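/- \textbf{Parameters.} Let $q,d\in\mathbb C^\times$, $q_1=q^{-1}d$, $q_2=q^2$, $q_3=q^{-1}d^{-1}$, and assume that $q_1^{n_1}q_2^{n_2}q_3^{n_3}=1$ with $n_i\in\mathbb Z$ only if $n_1=n_2=n_3$. Fix a branch of $\log q_1$ and put $q_1^r=e^{r\log q_1}$. Let $m\ge n+1$, $n\ge1$, $\mathsf q=q_1^{-1/(m-n+1)}$, $\bar q_1=q_1\mathsf q$, $\bar q_3=q_3\mathsf q^{-1}$ (so that $d$ is replaced by $\bar d=d\,\mathsf q$, with the same $q$). \textbf{Algebras.} For $m\neq n$, $m,n\ge1$, $Sh^0_{m|n}(q_1,q_2,q_3)=\bigoplus_{N\ge0}Sh^0_{m|n,N}$, where $Sh^0_{m|n,N}$ is the space of rational functions $F(x_1;\dots;x_{m+n})$, $x_i=(x_{i,1},\dots,x_{i,N})$, $i$ read modulo $m+n$, such that (i) $F=f/\prod_{i=1}^{m+n}\prod_{a,b}(x_{i,a}-x_{i+1,b})$ with a Laurent polynomial $f$; (ii) $F$ is skew-symmetric in $x_m$ and in $x_{m+n}$ and symmetric in every other $x_i$; (iii) $f$ vanishes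 (in the torus) if for some $a,b,c,e$ one of the following holds: $x_{i,b}=q_3x_{i-1,a}$, $x_{i,c}=q_2x_{i,b}$ ($1\le i\le m-1$); $x_{i,b}=q_2x_{i,a}$, $x_{i+1,c}=q_3x_{i,b}$ ($1\le i\le m-1$); $x_{m,b}=q_3x_{m-1,a}$, $x_{m+1,c}=q_3^{-1}x_{m,b}$, $x_{m,e}=q_1^{-1}x_{m+1,c}$; $x_{i,b}=q_3^{-1}x_{i-1,a}$, $x_{i,c}=q_2^{-1}x_{i,b}$ ($m+1\le i\le m+n-1$); $x_{i,b}=q_2^{-1}x_{i,a}$, $x_{i+1,c}=q_3^{-1}x_{i,b}$ ($m+1\le i\le m+n-1$); $x_{m+n,b}=q_3^{-1}x_{m+n-1,a}$, $x_{1,c}=q_3x_{m+n,b}$, $x_{m+n,e}=q_1x_{1,c}$. The product of $F$ of degree $M$ and $G$ of degree $N$ is $$F*G=\sum_{I_i\sqcup J_i}\operatorname{sgn}(I_m,J_m)\operatorname{sgn}(I_{m+n},J_{m+n})\,F(x_{1,I_1};\dots;x_{m+n,I_{m+n}})\,G(x_{1,J_1};\dots;x_{m+n,J_{m+n}})\prod_{i,j}\prod_{a\in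 I_i,\,b\in J_j}\omega_{i,j}(x_{i,a},x_{j,b}),$$ the sum being over all decompositions $I_i\sqcup J_i=\{1,\dots,M+N\}$, $|I_i|=M$, $|J_i|=N$, where $\operatorname{sgn}(I,J)$ is the sign of the permutation listing $I$ increasingly and then $J$ increasingly, and $\omega_{i,i}(x,y)=\frac{x-q_2y}{x-y}$ ($1\le i\le m-1$), $\frac{x-q_2^{-1}y}{x-y}$ ($m+1\le i\le m+n-1$); $\omega_{i-1,i}(x,y)=\frac{x-q_1y}{x-y}$ ($1\le i\le m$), $\frac{x-q_1^{-1}y}{x-y}$ ($m+1\le i\le m+n$); $\omega_{i,i-1}(x,y)=d\,\frac{x-q_3y}{x-y}$ ($1\le i\le m$), $d^{-1}\frac{x-q_3^{-1}y}{x-y}$ ($m+1\le i\le m+n$); all other $\omega_{i,j}=1$. $Sh^0_{m|0}=Sh^0_m$ ($m\ge2$) is defined in the same way with $m$ colours modulo $m$, all variables symmetric, no signs, the first two conditions of (iii) required for all $i$, and the structure functions $\omega_{i,i}=\frac{x-q_2y}{x-y}$, $\omega_{i-1,i}=\frac{x-q_1y}{x-y}$, $\omega_{i,i-1}=d\frac{x-q_3y}{x-y}$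 if $m\ge3$, and $\omega_{i,i}=\frac{x-q_2y}{x-y}$, $\omega_{i,i-1}=\frac{(x-q_1y)(x-q_3y)}{(x-y)^2}$ if $m=2$. For $p_1p_2p_3=1$, $Sh_1(p_1,p_2,p_3)=\bigoplus_N Sh_{1,N}$ is the space of symmetric functions $f(z)/\prod_{a<b}(z_a-z_b)^2$, $f$ a Laurent polynomial that vanishes if $z_b=p_3z_a$, $z_c=p_2z_b$ or $z_b=p_2z_a$, $z_c=p_3z_b$, with the product given by $\omega_{1,1}(x,y)=\frac{(x-p_1y)(x-p_2y)(x-p_3y)}{(x-y)^3}$. \textbf{The map.} Let $F\in Sh^0_{m|n,N}$ and $0\le L\le N$. Let $\rho_{N,L}(F)$ be obtained from $F$ by substituting, for $1\le a\le L$, $x_{i,a}=q_1\mathsf q^iy_{i,a}$ ($1\le i\le m$), $x_{i,a}=q_1\mathsf q^{2m-i}y_{i,a}$ ($m+1\le i\le m+n-1$), $x_{m+n,a}=q_1y_{m+n-1,a}$, and, for $L+1\le b\le N$, $x_{i,b}=q_3^{i-1}z_b$ ($0\le i\le m-1$), $x_{i,b}=q_3^{2m-i-1}z_b$ ($m\le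 i\le m+n-1$), where $x_{0,b}=x_{m+n,b}$. Define $\bar F_{N,L}(y_1;\dots;y_{m+n-1}|z)$ by $\rho_{N,L}(F)=\bar F_{N,L}\cdot A\,B\,C$, where $y_0=y_{m+n-1}$, $w_a=y_{m+n-1,a}$, $$A=\prod_{i=0}^{m-1}\prod_{a,b\le L}\frac{y_{i,a}-y_{i+1,b}}{y_{i,a}-\mathsf q\,y_{i+1,b}}\prod_{i=m}^{m+n-2}\prod_{a,b\le L}\frac{y_{i,a}-y_{i+1,b}}{y_{i,a}-\mathsf q^{-1}y_{i+1,b}}\prod_{1\le a<b\le L}\frac{\kappa\,\alpha(w_a,w_b)}{(w_a-q_1w_b)(w_a-q_1^{-1}w_b)},$$ with $\alpha(u,v)=(u-q_2v)(u-q_2^{-1}v)$, $\kappa=d^{-1}$ if $n>1$; $\alpha(u,v)=(u-v)^2$, $\kappa=d^{-1}$ if $n=1$, $m\geq 3$; and $\alpha(u,v)=(u-v)^2$, $\kappa=d^{-1}\bar d^{\,2}=q$ if $(m,n)=(2,1)$; $$B=\prod_{L<a<b\le N}d^{m-n}\Bigl(\frac{z_a-q_2z_b}{z_a-q_3z_b}\,\frac{z_a-q_2^{-1}z_b}{z_a-q_3^{-1}z_b}\Bigr)^{m+n-2}\frac{(z_a-z_b)^4}{(z_a-q_3z_b)(z_a-q_3^{-1}z_b)(z_a-q_3^{m-n+1}z_b)(z_a-q_3^{-m+n-1}z_b)};$$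 and $C$ is the product over $1\le a\le L<b\le N$ of $$\prod_{i=1}^{m-1}d\,\frac{(u_i-q_2q_3^{i-1}z_b)(u_i-q_2^{-1}q_3^{i-1}z_b)}{(u_i-q_3^iz_b)(u_i-q_3^{i-2}z_b)}\cdot D\cdot\frac{(w_a-q_2z_b)(w_a-z_b)}{(w_a-q_3^{-1}z_b)(w_a-q_1^{-1}z_b)},\qquad u_i=q_1\mathsf q^iy_{i,a},$$ where for $n=1$ $$D=\frac{(w_a-q_1^{-1}q_3^{m-2}z_b)(w_a-q_3^{m-1}z_b)}{(w_a-q_3^{m-2}z_b)(w_a-q_1^{-1}q_3^{m-1}z_b)}$$ and for $n>1$, with $v_i=q_1\mathsf q^{2m-i}y_{i,a}$, $t_i=q_3^{2m-i-1}z_b$, $$D=d^{-1}\frac{(u_m-q_3^{m-1}z_b)(u_m-q_2q_3^{m-1}z_b)}{(u_m-q_3^{m-2}z_b)^2}\prod_{i=m+1}^{m+n-2}d^{-1}\frac{(v_i-q_2t_i)(v_i-q_2^{-1}t_i)}{(v_i-q_3t_i)(v_i-q_3^{-1}t_i)}\cdot\frac{(w_a-q_2q_3^{m-n}z_b)(w_a-q_2^{-1}q_3^{m-n}z_b)}{(w_a-q_3q_3^{m-n}z_b)(w_a-q_1^{-1}q_3^{m-n}z_b)}.$$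 \textbf{Statement.} (1) For $F\in Sh^0_{m|n,N}$ the function $\bar F_{N,L}$ belongs to $Sh^0_{m|n-1,L}(\bar q_1,q_2,\bar q_3)\otimes Sh_{1,N-L}(q_1^{-1}q_3^{-m+n-1},q_2^{-1},q_3^{m-n})$ (identified with a space of functions of $y$ and $z$), and the linear map $$\pi_{m|n}^{m|n-1}:Sh^0_{m|n}(q_1,q_2,q_3)\longrightarrow Sh^0_{m|n-1}(\bar q_1,q_2,\bar q_3)\otimes Sh_1(q_1^{-1}q_3^{-m+n-1},q_2^{-1},q_3^{m-n}),\qquad F\mapsto\sum_{L=0}^N\bar F_{N,L}\quad(F\in Sh^0_{m|n,N}),$$ is a homomorphism of $\mathbb Z_{\ge0}$-graded unital algebras (in particular $Sh^0_{m|n}$ is closed under $*$). (2) Iterating, the composition of $\pi_{m|n}^{m|n-1}$, $\pi_{m|n-1}^{m|n-2}\otimes\mathrm{id}$, \dots, $\pi_{m|1}^{m|0}\otimes\mathrm{id}$ (with the parameters changed at each step as above) is a homomorphism of $\mathbb Z_{\ge0}$-graded unital algebras $$\pi_{m|n}:Sh^0_{m|n}(q_1,q_2,q_3)\longrightarrow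 Sh^0_m(q_1q_1^{-\frac nm},q_2,q_3q_1^{\frac nm})\otimes\bigotimes_{j=0}^{n-1}Sh_1(q_2^{j+1}q_3^{-m+n},q_2^{-1},q_2^{-j}q_3^{m-n}).$$ -/

import Mathlib

open scoped TensorProduct

noncomputable section

namespace Shuffle

/-! ## Rational functions in finitely many variables -/

/-- The field `ℂ(x_s : s ∈ σ)` of rational functions. -/
def RatField (σ : Type) : Type := FractionRing (MvPolynomial σ ℂ)

instance (σ : Type) : Field (RatField σ) := inferInstanceAs (Field (FractionRing (MvPolynomial σ ℂ)))

instance (σ : Type) : Algebra (MvPolynomial σ ℂ) (RatField σ) :=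
  inferInstanceAs (Algebra (MvPolynomial σ ℂ) (FractionRing (MvPolynomial σ ℂ)))

instance (σ : Type) : IsFractionRing (MvPolynomial σ ℂ) (RatField σ) :=
  inferInstanceAs (IsFractionRing (MvPolynomial σ ℂ) (FractionRing (MvPolynomial σ ℂ)))

instance (σ : Type) : Algebra ℂ (RatField σ) :=
  ((algebraMap (MvPolynomial σ ℂ) (RatField σ)).comp MvPolynomial.C).toAlgebra

instance (σ : Type) : IsScalarTower ℂ (MvPolynomial σ ℂ) (RatField σ) :=
  IsScalarTower.of_algebraMap_eq fun _ => rfl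

/-- The variable `x_s`, as a rational function. -/
def var {σ : Type} (s : σ) : RatField σ :=
  algebraMap (MvPolynomial σ ℂ) (RatField σ) (MvPolynomial.X s)

/-- Injective renaming of the variables of a rational function: `x_s ↦ x_{f s}`. -/
def ratRename {σ τ : Type} (f : σ → τ) (hf : Function.Injective f) :
    RatField σ →ₐ[ℂ] RatField τ :=
  IsFractionRing.liftAlgHom
    (g := (IsScalarTower.toAlgHom ℂ (MvPolynomial τ ℂ) (RatField τ)).comp (MvPolynomial.rename f))
    (by
      intro a b h
      exact MvPolynomial.rename_injective f hf
        (IsFractionRing.injective (MvPolynomial τ ℂ) (RatField τ) h))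

/-- Substitution `x_s ↦ φ s` in a rational function, evaluated on its reduced fraction. -/
def ratSubst {σ : Type} {K : Type} [Field K] [Algebra ℂ K] (φ : σ → K) (F : RatField σ) : K :=
  MvPolynomial.aeval φ (IsFractionRing.num (MvPolynomial σ ℂ) F) /
    MvPolynomial.aeval φ (IsFractionRing.den (MvPolynomial σ ℂ) F : MvPolynomial σ ℂ)

/-- The substitution may be computed on any fraction whose denominator does not become zero. -/
theorem ratSubst_eq {σ : Type} {K : Type} [Field K] [Algebra ℂ K] (φ : σ → K)
    (F : RatField σ) (f g : MvPolynomial σ ℂ)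
    (h : F * algebraMap _ (RatField σ) g = algebraMap _ (RatField σ) f)
    (hg : MvPolynomial.aeval φ g ≠ 0) :
    ratSubst φ F = MvPolynomial.aeval φ f / MvPolynomial.aeval φ g := by
  set a := IsFractionRing.num (MvPolynomial σ ℂ) F with ha
  set b : MvPolynomial σ ℂ := (IsFractionRing.den (MvPolynomial σ ℂ) F : MvPolynomial σ ℂ) with hb
  have hb0 : algebraMap _ (RatField σ) b ≠ 0 := by
    rw [Ne, map_eq_zero_iff _ (IsFractionRing.injective (MvPolynomial σ ℂ) (RatField σ))]
    exact nonZeroDivisors.ne_zero (IsFractionRing.den (MvPolynomial σ ℂ) F).2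
  have hF : F * algebraMap _ (RatField σ) b = algebraMap _ (RatField σ) a := by
    have h1 := IsFractionRing.mk'_num_den' (MvPolynomial σ ℂ) F
    rw [← h1, div_mul_cancel₀ _ hb0]
  have key : a * g = f * b := by
    apply IsFractionRing.injective (MvPolynomial σ ℂ) (RatField σ)
    rw [map_mul, map_mul, ← hF, ← h]; ring
  have hdvd : b ∣ g := by
    have hrel := IsFractionRing.num_den_reduced (MvPolynomial σ ℂ) F
    have : b ∣ a * g := ⟨f, by rw [key]; ring⟩
    exact hrel.symm.dvd_of_dvd_mul_left this
  have hbφ : MvPolynomial.aeval φ b ≠ 0 := by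
    obtain ⟨c, hc⟩ := hdvd
    intro h0
    apply hg
    rw [hc, map_mul, h0, zero_mul]
  unfold ratSubst
  rw [← ha, ← hb, div_eq_div_iff hbφ hg, ← map_mul, ← map_mul, key]

/-! ## Shuffle algebras in the degrees `(N, …, N)`

Colours are residues modulo the number `c` of colours, i.e. elements of `Fin c`; the colour `c` of
the usual labelling `1, …, c` is `0 : Fin c`. The variables of degree `(N, …, N)` are `x_{i,a}`
with `i : Fin c` and `a : Fin N`. -/

/-- The next colour `i + 1`, modulo `c`. -/
def next {c : ℕ} (i : Fin c) : Fin c := ⟨(i.val + 1) % c, Nat.mod_lt _ i.pos⟩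

/-- Rational functions in the variables `x_{i,a}`. -/
abbrev Rat (c N : ℕ) : Type := RatField (Fin c × Fin N)

/-- The data that distinguish the various shuffle algebras: the set of fermionic colours, the
structure functions `ω_{i,j}(x,y)`, the prescribed denominators, and the wheels (the points, with
coordinates `x_{i,a}`, at which the numerator has to vanish). -/
structure ShuffleType (c : ℕ) where
  odd : Finset (Fin c)
  ω : ∀ (K : Type) [Field K] [Algebra ℂ K], Fin c → Fin c → K → K → K
  pole : ∀ N : ℕ, MvPolynomial (Fin c × Fin N) ℂ
  wheel : ∀ N : ℕ, (Fin c → Fin N → ℂ) → Prop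

/-- The product of all variables; Laurent polynomials are the quotients `f / (∏ x)^k`. -/
def allVars (c N : ℕ) : MvPolynomial (Fin c × Fin N) ℂ := ∏ p, MvPolynomial.X p

/-- Permutation of the variables within each colour. -/
def permVars {c N : ℕ} (s : Fin c → Equiv.Perm (Fin N)) : Rat c N →ₐ[ℂ] Rat c N :=
  ratRename (fun p => (p.1, s p.1 p.2)) (by
    rintro ⟨i, a⟩ ⟨j, b⟩ h
    obtain ⟨rfl, h2⟩ := Prod.mk.inj h
    exact Prod.ext rfl ((s i).injective h2))

/-- The component of degree `(N, …, N)`: (i) `F` is a Laurent polynomial `f / (∏ x)^k` divided by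
the prescribed denominator, (iii) whose numerator `f` vanishes at the points of the torus that form a wheel (where the
denominator does not vanish this says that `F` vanishes), and
(ii) `F` is symmetric in bosonic and skew-symmetric in fermionic variables. -/
def ShuffleType.comp {c : ℕ} (T : ShuffleType c) (N : ℕ) : Submodule ℂ (Rat c N) where
  carrier := {F |
    (∃ (k : ℕ) (f : MvPolynomial (Fin c × Fin N) ℂ),
      F * algebraMap _ (Rat c N) (T.pole N * allVars c N ^ k) = algebraMap _ (Rat c N) f ∧
      ∀ x : Fin c → Fin N → ℂ, (∀ i a, x i a ≠ 0) → T.wheel N x →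
        MvPolynomial.eval (fun p => x p.1 p.2) f = 0) ∧
    ∀ s : Fin c → Equiv.Perm (Fin N),
      permVars s F = (∏ i ∈ T.odd, ((Equiv.Perm.sign (s i) : ℤ) : ℂ)) • F}
  zero_mem' := ⟨⟨0, 0, by simp, by simp⟩, by simp⟩
  add_mem' := by
    rintro F G ⟨⟨k, f, hf, hf'⟩, hF⟩ ⟨⟨l, g, hg, hg'⟩, hG⟩
    refine ⟨⟨k + l, f * allVars c N ^ l + g * allVars c N ^ k, ?_, ?_⟩, ?_⟩
    · simp only [map_add, map_mul, ← hf, ← hg, pow_add]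
      ring
    · intro x hx hw
      simp [hf' x hx hw, hg' x hx hw]
    · intro s
      rw [map_add, hF s, hG s, smul_add]
  smul_mem' := by
    rintro r F ⟨⟨k, f, hf, hf'⟩, hF⟩
    refine ⟨⟨k, r • f, ?_, ?_⟩, ?_⟩
    · rw [smul_mul_assoc, hf, ← IsScalarTower.coe_toAlgHom' ℂ (MvPolynomial (Fin c × Fin N) ℂ),
        map_smul]
    · intro x hx hw
      simp [hf' x hx hw]
    · intro s
      rw [map_smul, hF s, smul_comm]

/-- Subsets `I ⊆ {1, …, M + N}` with `|I| = M`. -/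
abbrev Sub (M N : ℕ) : Type := {I : Finset (Fin (M + N)) // I.card = M}

/-- The pair of increasing enumerations of `I` and of its complement `J`. -/
def Sub.enum {M N : ℕ} (I : Sub M N) : Fin M ⊕ Fin N ≃ Fin (M + N) :=
  finSumEquivOfFinset I.2 (by rw [Finset.card_compl, I.2, Fintype.card_fin]; omega)

/-- `sgn(I, J)`, the signature of the permutation `(a_1, …, a_M, b_1, …, b_N)`. -/
def Sub.sgn {M N : ℕ} (I : Sub M N) : ℂ :=
  ((Equiv.Perm.sign (finSumFinEquiv.symm.trans I.enum) : ℤ) : ℂ)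

/-- `F ↦ F(x_{1,I_1}; …; x_{c,I_c})`. -/
def onI {c M N : ℕ} (I : Fin c → Sub M N) : Rat c M →ₐ[ℂ] Rat c (M + N) :=
  ratRename (fun p => (p.1, (I p.1).enum (Sum.inl p.2))) (by
    rintro ⟨i, a⟩ ⟨j, b⟩ h
    obtain ⟨rfl, h2⟩ := Prod.mk.inj h
    exact Prod.ext rfl (Sum.inl_injective ((I i).enum.injective h2)))

/-- `G ↦ G(x_{1,J_1}; …; x_{c,J_c})`. -/
def onJ {c M N : ℕ} (I : Fin c → Sub M N) : Rat c N →ₐ[ℂ] Rat c (M + N) :=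
  ratRename (fun p => (p.1, (I p.1).enum (Sum.inr p.2))) (by
    rintro ⟨i, a⟩ ⟨j, b⟩ h
    obtain ⟨rfl, h2⟩ := Prod.mk.inj h
    exact Prod.ext rfl (Sum.inr_injective ((I i).enum.injective h2)))

/-- `∏_{i,j} ∏_{a ∈ I_i, b ∈ J_j} ω_{i,j}(x_{i,a}, x_{j,b})`. -/
def ShuffleType.omegaProd {c : ℕ} (T : ShuffleType c) {M N : ℕ} (I : Fin c → Sub M N) :
    Rat c (M + N) :=
  ∏ i, ∏ j, ∏ a : Fin M, ∏ b : Fin N,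
    T.ω (Rat c (M + N)) i j (var (i, (I i).enum (Sum.inl a))) (var (j, (I j).enum (Sum.inr b)))

/-- The shuffle product of rational functions of degrees `(M, …, M)` and `(N, …, N)`. -/
def ShuffleType.star {c : ℕ} (T : ShuffleType c) (M N : ℕ) :
    Rat c M →ₗ[ℂ] Rat c N →ₗ[ℂ] Rat c (M + N) :=
  ∑ I : Fin c → Sub M N, (∏ i ∈ T.odd, (I i).sgn) •
    LinearMap.mk₂ ℂ (fun F G => onI I F * onJ I G * T.omegaProd I)
      (fun F F' G => by rw [map_add, add_mul, add_mul])
      (fun r F G => by rw [map_smul, smul_mul_assoc, smul_mul_assoc])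
      (fun F G G' => by rw [map_add, mul_add, add_mul])
      (fun r F G => by rw [map_smul, mul_smul_comm, smul_mul_assoc])

/-! ## Graded algebras realised inside larger spaces -/

/-- A bilinear product on an ambient vector space `V`, a unit, and a sequence of subspaces: the
homogeneous components of a graded algebra contained in `V`. -/
structure GradedAlg (V : Type) [AddCommGroup V] [Module ℂ V] where
  mul : V →ₗ[ℂ] V →ₗ[ℂ] V
  one : V
  deg : ℕ → Submodule ℂ V

section GradedAlg

variable {V W : Type} [AddCommGroup V] [Module ℂ V] [AddCommGroup W] [Module ℂ W]

/-- The algebra itself: the sum of its homogeneous components. -/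
def GradedAlg.carrier (A : GradedAlg V) : Submodule ℂ V := ⨆ N, A.deg N

/-- The tensor product of graded algebras, `(a ⊗ b)(a' ⊗ b') = aa' ⊗ bb'`, with the total
degree. -/
def GradedAlg.tensor (A : GradedAlg V) (B : GradedAlg W) : GradedAlg (V ⊗[ℂ] W) where
  mul := TensorProduct.map₂ A.mul B.mul
  one := A.one ⊗ₜ[ℂ] B.one
  deg N := ⨆ p ∈ Finset.HasAntidiagonal.antidiagonal N,
    LinearMap.range (TensorProduct.mapIncl (A.deg p.1) (B.deg p.2))

/-- `φ` is a homomorphism of unital graded algebras from `A` to `B` (`A` being closed under the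
product and containing the unit is part of the assertion). -/
def IsGradedHom (A : GradedAlg V) (B : GradedAlg W) (φ : A.carrier →ₗ[ℂ] W) : Prop :=
  (∀ (N : ℕ) (F : A.carrier), (F : V) ∈ A.deg N → φ F ∈ B.deg N) ∧
  (∃ h : A.one ∈ A.carrier, φ ⟨A.one, h⟩ = B.one) ∧
  ∀ F G : A.carrier, ∃ h : A.mul F G ∈ A.carrier, φ ⟨A.mul F G, h⟩ = B.mul (φ F) (φ G)

end GradedAlg

/-- The space `⊕_N ℂ(x_{i,a} : i ∈ Fin c, a ∈ Fin N)`. -/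
abbrev Space (c : ℕ) : Type := DirectSum ℕ (fun N => Rat c N)

/-- The function `F` of degree `(N, …, N)` as an element of the direct sum. -/
abbrev single (c N : ℕ) : Rat c N →ₗ[ℂ] Space c := DirectSum.lof ℂ ℕ (fun N => Rat c N) N

/-- The graded algebra `Sh^0 = ⊕_N Sh_{(N, …, N)}` with the shuffle product. -/
def ShuffleType.alg {c : ℕ} (T : ShuffleType c) : GradedAlg (Space c) where
  mul := DirectSum.toModule ℂ ℕ _ fun M => LinearMap.flip <|
    DirectSum.toModule ℂ ℕ _ fun N => LinearMap.flip <|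
      (T.star M N).compr₂ (single c (M + N))
  one := single c 0 1
  deg N := (T.comp N).map (single c N)

/-! ## The parameters -/

/-- The parameters `q`, `d`, and a branch of `log q_1`, used to define fractional powers of
`q_1`. -/
structure Params where
  q : ℂ
  d : ℂ
  logq1 : ℂ

namespace Params

def q1 (P : Params) : ℂ := P.q⁻¹ * P.d
def q2 (P : Params) : ℂ := P.q ^ 2
def q3 (P : Params) : ℂ := P.q⁻¹ * P.d⁻¹

/-- `q_1^r = exp (r log q_1)`. -/
def q1pow (P : Params) (r : ℂ) : ℂ := Complex.exp (r * P.logq1)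

/-- The standing assumptions on the parameters. -/
structure Valid (P : Params) : Prop where
  q_ne : P.q ≠ 0
  d_ne : P.d ≠ 0
  exp_logq1 : Complex.exp P.logq1 = P.q1
  generic : ∀ n₁ n₂ n₃ : ℤ, P.q1 ^ n₁ * P.q2 ^ n₂ * P.q3 ^ n₃ = 1 → n₁ = n₂ ∧ n₂ = n₃

/-- Multiply `q_1` by `q_1^r` and `q_3` by `q_1^{-r}`, keeping `q_2` (and `q`). -/
def shift (P : Params) (r : ℂ) : Params where
  q := P.q
  d := P.d * P.q1pow r
  logq1 := P.logq1 + r * P.logq1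

/-- `(q̄_1, q_2, q̄_3) = (q_1 q_1^{-1/(m-n+1)}, q_2, q_3 q_1^{1/(m-n+1)})`. -/
def bar (P : Params) (m n : ℕ) : Params := P.shift (-1 / ((m : ℂ) - n + 1))

/-- The ratio `q̄_1 / q_1 = q_1^{-1/(m-n+1)}`. -/
def sfq (P : Params) (m n : ℕ) : ℂ := P.q1pow (-1 / ((m : ℂ) - n + 1))

end Params

/-! ## The shuffle algebras `Sh_1`, `Sh_m`, `Sh_{m|n}` -/

/-- `∏_i ∏_{a,b} (x_{i,a} - x_{i+1,b})`. -/
def cyclicPole (c N : ℕ) : MvPolynomial (Fin c × Fin N) ℂ :=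
  ∏ i : Fin c, ∏ a : Fin N, ∏ b : Fin N, (MvPolynomial.X (i, a) - MvPolynomial.X (next i, b))

/-- Cubic wheels of both kinds for the colours `i`, `j = i + 1`. Kind (a):
`x_{j,b} = p₃ x_{i,a}`, `x_{j,c} = p₂ x_{j,b}`. -/
def wheelA {c N : ℕ} (p₂ p₃ : ℂ) (x : Fin c → Fin N → ℂ) (i j : Fin c) : Prop :=
  ∃ a b e, x j b = p₃ * x i a ∧ x j e = p₂ * x j b

/-- Kind (b): `x_{i,b} = p₂ x_{i,a}`, `x_{j,c} = p₃ x_{i,b}`. -/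
def wheelB {c N : ℕ} (p₂ p₃ : ℂ) (x : Fin c → Fin N → ℂ) (i j : Fin c) : Prop :=
  ∃ a b e, x i b = p₂ * x i a ∧ x j e = p₃ * x i b

/-- Quartic wheels, for the colours `i`, `j = i + 1`, `k = i + 2`:
`x_{j,b} = p₃ x_{i,a}`, `x_{k,c} = p₃⁻¹ x_{j,b}`, `x_{j,d} = p₁⁻¹ x_{k,c}`. -/
def wheelC {c N : ℕ} (p₁ p₃ : ℂ) (x : Fin c → Fin N → ℂ) (i j k : Fin c) : Prop :=
  ∃ a b e f, x j b = p₃ * x i a ∧ x k e = p₃⁻¹ * x j b ∧ x j f = p₁⁻¹ * x k e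

/-- `Sh_1(p_1, p_2, p_3)`. -/
def oneType (p₁ p₂ p₃ : ℂ) : ShuffleType 1 where
  odd := ∅
  ω _ _ _ _ _ x y := (x - p₁ • y) * (x - p₂ • y) * (x - p₃ • y) / (x - y) ^ 3
  pole N := ∏ a : Fin N, ∏ b ∈ Finset.Ioi a, (MvPolynomial.X (0, a) - MvPolynomial.X (0, b)) ^ 2
  wheel _ x := wheelA p₂ p₃ x 0 0 ∨ wheelB p₂ p₃ x 0 0

/-- `Sh_m(q_1, q_2, q_3)` for `m ≥ 2`. -/
def evenType' (P : Params) (m : ℕ) : ShuffleType m where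
  odd := ∅
  ω _ _ _ i j x y :=
    if i = j then (x - P.q2 • y) / (x - y)
    else if m = 2 then (x - P.q1 • y) * (x - P.q3 • y) / (x - y) ^ 2
    else if j = next i then (x - P.q1 • y) / (x - y)
    else if i = next j then P.d • ((x - P.q3 • y) / (x - y))
    else 1
  pole N := cyclicPole m N
  wheel _ x := ∃ i, wheelA P.q2 P.q3 x i (next i) ∨ wheelB P.q2 P.q3 x i (next i)

/-- `Sh_m(q_1, q_2, q_3) = Sh_{m|0}(q_1, q_2, q_3)`. -/
def evenType (P : Params) : (m : ℕ) → ShuffleType m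
  | 1 => oneType P.q1 P.q2 P.q3
  | m => evenType' P m

/-- `Sh_{m|n}(q_1, q_2, q_3)` for `m, n ≥ 1`, `m ≠ n`. The fermionic colours are `m` and
`m + n ≡ 0`. -/
def superType (P : Params) (m n : ℕ) : ShuffleType (m + n) where
  odd := Finset.univ.filter fun i => i.val = 0 ∨ i.val = m
  ω _ _ _ i j x y :=
    if i = j then
      if 1 ≤ i.val ∧ i.val ≤ m - 1 then (x - P.q2 • y) / (x - y)
      else if m + 1 ≤ i.val then (x - P.q2⁻¹ • y) / (x - y)
      else 1
    else if j = next i then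
      if 1 ≤ j.val ∧ j.val ≤ m then (x - P.q1 • y) / (x - y)
      else (x - P.q1⁻¹ • y) / (x - y)
    else if i = next j then
      if 1 ≤ i.val ∧ i.val ≤ m then P.d • ((x - P.q3 • y) / (x - y))
      else P.d⁻¹ • ((x - P.q3⁻¹ • y) / (x - y))
    else 1
  pole N := cyclicPole (m + n) N
  wheel _ x := ∃ i : Fin (m + n),
    (1 ≤ (next i).val ∧ (next i).val ≤ m - 1 ∧ wheelA P.q2 P.q3 x i (next i)) ∨
    (1 ≤ i.val ∧ i.val ≤ m - 1 ∧ wheelB P.q2 P.q3 x i (next i)) ∨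
    ((next i).val = m ∧ wheelC P.q1 P.q3 x i (next i) (next (next i))) ∨
    (m + 1 ≤ (next i).val ∧ wheelA P.q2⁻¹ P.q3⁻¹ x i (next i)) ∨
    (m + 1 ≤ i.val ∧ wheelB P.q2⁻¹ P.q3⁻¹ x i (next i)) ∨
    ((next i).val = 0 ∧ wheelC P.q1⁻¹ P.q3⁻¹ x i (next i) (next (next i)))

/-- The data of `Sh_{m|n}`, with `Sh_{m|0} = Sh_m`. -/
def shType (P : Params) (m : ℕ) : (n : ℕ) → ShuffleType (m + n)
  | 0 => evenType P m
  | n + 1 => superType P m (n + 1)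

/-- `Sh^0_{m|n}(q_1, q_2, q_3)`. -/
def Sh0 (P : Params) (m n : ℕ) : GradedAlg (Space (m + n)) := (shType P m n).alg

/-- `Sh_1(p_1, p_2, p_3)`. -/
def Sh1 (p₁ p₂ p₃ : ℂ) : GradedAlg (Space 1) := (oneType p₁ p₂ p₃).alg

/-- `Sh_1(q_1^{-1} q_3^{-m+n-1}, q_2^{-1}, q_3^{m-n})`. -/
def fusionSh1 (P : Params) (m n : ℕ) : GradedAlg (Space 1) :=
  Sh1 (P.q1⁻¹ * P.q3 ^ (-(m : ℤ) + n - 1)) P.q2⁻¹ (P.q3 ^ ((m : ℤ) - n))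

/-! ## The fusion map -/

/-- The field `ℂ(y_1; …; y_{m+n-1}; z)` with `y_i = (y_{i,a})_{a ∈ Fin L}`,
`z = (z_b)_{b ∈ Fin K}`. -/
abbrev YZ (m n L K : ℕ) : Type := RatField ((Fin (m + (n - 1)) × Fin L) ⊕ (Fin 1 × Fin K))

/-- The variable `y_{i,a}`, the index `i` being read modulo `m + n - 1`. -/
def yvar {m n : ℕ} (hm : 0 < m) (L K : ℕ) (i : ℕ) (a : Fin L) : YZ m n L K :=
  var (Sum.inl (⟨i % (m + (n - 1)), Nat.mod_lt _ (by omega)⟩, a))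

/-- The variable `z_b`. -/
def zvar (m n L K : ℕ) (b : Fin K) : YZ m n L K := var (Sum.inr (0, b))

/-- The coefficient of `y_{i,a}` in the specialization of `x_{i,a}`, `i ∈ {0, …, m + n - 1}`
(`i = 0` stands for the colour `m + n`, specialized to `q_1 y_{m+n-1,a}`). -/
def ycoef (P : Params) (m n i : ℕ) : ℂ :=
  if i = 0 then P.q1
  else if i ≤ m then P.q1 * P.sfq m n ^ i
  else P.q1 * P.sfq m n ^ (2 * (m : ℤ) - i)

/-- The coefficient of `z_b` in the specialization of `x_{i,b}`. -/
def zcoef (P : Params) (m i : ℕ) : ℂ :=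
  if i ≤ m - 1 then P.q3 ^ ((i : ℤ) - 1) else P.q3 ^ (2 * (m : ℤ) - i - 1)

/-- The specialization `ρ_{N,L}` with `N = L + K`: the first `L` variables of each colour are
expressed by `y`, the other `K` by `z`. -/
def rho (P : Params) {m n : ℕ} (hm : 0 < m) (L K : ℕ) (F : Rat (m + n) (L + K)) : YZ m n L K :=
  ratSubst (fun p => Fin.addCases
    (fun a => ycoef P m n p.1 • yvar hm L K p.1 a)
    (fun b => zcoef P m p.1 • zvar m n L K b) p.2) F

section Factors

variable {E : Type} [Field E] [Algebra ℂ E] {L K : ℕ}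

/-- The factor `A`. The constant is `d⁻¹` for each pair `a < b`, except for `m | n = 2 | 1`: there
the target is `Sh_2`, whose structure functions `ω_{i,i-1}` carry no factor `d`, and the constant
compatible with this normalization is `d⁻¹ (d q_1^{-1/2})^2 = q`. -/
def factorA (P : Params) (m n : ℕ) (y : ℕ → Fin L → E) : E :=
  (∏ i ∈ Finset.range m, ∏ a, ∏ b,
    (y i a - y (i + 1) b) / (y i a - P.sfq m n • y (i + 1) b)) *
  (∏ i ∈ Finset.Ico m (m + n - 1), ∏ a, ∏ b,
    (y i a - y (i + 1) b) / (y i a - (P.sfq m n)⁻¹ • y (i + 1) b)) *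
  ∏ a, ∏ b ∈ Finset.Ioi a,
    let u := y (m + n - 1) a
    let v := y (m + n - 1) b
    if n = 1 then
      (if m = 2 then P.q else P.d⁻¹) • ((u - v) ^ 2 / ((u - P.q1 • v) * (u - P.q1⁻¹ • v)))
    else
      P.d⁻¹ • ((u - P.q2 • v) * (u - P.q2⁻¹ • v) / ((u - P.q1 • v) * (u - P.q1⁻¹ • v)))

/-- The factor `B`. -/
def factorB (P : Params) (m n : ℕ) (z : Fin K → E) : E :=
  ∏ a, ∏ b ∈ Finset.Ioi a,
    let u := z a
    let v := z b
    P.d ^ (m - n) •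
      (((u - P.q2 • v) / (u - P.q3 • v) * ((u - P.q2⁻¹ • v) / (u - P.q3⁻¹ • v))) ^ (m + n - 2) *
      ((u - v) ^ 2 / ((u - P.q3 • v) * (u - P.q3⁻¹ • v))) *
      ((u - v) ^ 2 /
        ((u - P.q3 ^ ((m : ℤ) - n + 1) • v) * (u - P.q3 ^ (-(m : ℤ) + n - 1) • v))))

/-- The factor `C`. -/
def factorC (P : Params) (m n : ℕ) (y : ℕ → Fin L → E) (z : Fin K → E) : E :=
  ∏ a, ∏ b,
    let w := y (m + n - 1) a
    (∏ i ∈ Finset.Ico 1 m,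
      let u := (P.q1 * P.sfq m n ^ i) • y i a
      P.d • ((u - (P.q2 * P.q3 ^ ((i : ℤ) - 1)) • z b) *
          (u - (P.q2⁻¹ * P.q3 ^ ((i : ℤ) - 1)) • z b) /
        ((u - P.q3 ^ (i : ℤ) • z b) * (u - P.q3 ^ ((i : ℤ) - 2) • z b)))) *
    (if n = 1 then
      (w - (P.q1⁻¹ * P.q3 ^ ((m : ℤ) - 2)) • z b) * (w - P.q3 ^ ((m : ℤ) - 1) • z b) /
        ((w - P.q3 ^ ((m : ℤ) - 2) • z b) * (w - (P.q1⁻¹ * P.q3 ^ ((m : ℤ) - 1)) • z b))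
    else
      (let u := (P.q1 * P.sfq m n ^ m) • y m a
      P.d⁻¹ • ((u - P.q3 ^ ((m : ℤ) - 1) • z b) * (u - (P.q2 * P.q3 ^ ((m : ℤ) - 1)) • z b) /
        (u - P.q3 ^ ((m : ℤ) - 2) • z b) ^ 2)) *
      (∏ i ∈ Finset.Ico (m + 1) (m + n - 1),
        let u := (P.q1 * P.sfq m n ^ (2 * (m : ℤ) - i)) • y i a
        let v := P.q3 ^ (2 * (m : ℤ) - i - 1) • z b
        P.d⁻¹ • ((u - P.q2 • v) * (u - P.q2⁻¹ • v) / ((u - P.q3 • v) * (u - P.q3⁻¹ • v)))) *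
      (let v := P.q3 ^ ((m : ℤ) - n) • z b
      (w - P.q2 • v) * (w - P.q2⁻¹ • v) / ((w - P.q3 • v) * (w - P.q1⁻¹ • v)))) *
    ((w - P.q2 • z b) * (w - z b) / ((w - P.q3⁻¹ • z b) * (w - P.q1⁻¹ • z b)))

end Factors

/-- The component of bidegree `(L, K)` of an element of the tensor product, viewed as a rational
function of `y` and `z`: `f ⊗ g ↦ f_L(y) g_K(z)`. -/
def toFun (c L K : ℕ) :
    Space c ⊗[ℂ] Space 1 →ₗ[ℂ] RatField ((Fin c × Fin L) ⊕ (Fin 1 × Fin K)) :=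
  TensorProduct.lift <|
    ((LinearMap.mul ℂ (RatField ((Fin c × Fin L) ⊕ (Fin 1 × Fin K)))).compl₁₂
      ((ratRename Sum.inl Sum.inl_injective).toLinearMap ∘ₗ
        DirectSum.component ℂ ℕ (fun N => Rat c N) L)
      ((ratRename Sum.inr Sum.inr_injective).toLinearMap ∘ₗ
        DirectSum.component ℂ ℕ (fun N => Rat 1 N) K))

/-- `Sh^0_{m|n-1}(q̄_1, q_2, q̄_3) ⊗ Sh_1(q_1^{-1} q_3^{-m+n-1}, q_2^{-1}, q_3^{m-n})`, as a vector
space. -/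
abbrev FusionTarget (P : Params) (m n : ℕ) : Type :=
  (Sh0 (P.bar m n) m (n - 1)).carrier ⊗[ℂ] (fusionSh1 P m n).carrier

/-- The same tensor product, as a graded algebra in its ambient space. -/
def fusionTarget (P : Params) (m n : ℕ) :
    GradedAlg (Space (m + (n - 1)) ⊗[ℂ] Space 1) :=
  (Sh0 (P.bar m n) m (n - 1)).tensor (fusionSh1 P m n)

/-- The inclusion of the tensor product into its ambient space. -/
def fusionIncl (P : Params) (m n : ℕ) :
    FusionTarget P m n →ₗ[ℂ] Space (m + (n - 1)) ⊗[ℂ] Space 1 :=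
  TensorProduct.mapIncl (Sh0 (P.bar m n) m (n - 1)).carrier (fusionSh1 P m n).carrier

/-- `π = π_{m|n}^{m|n-1} = ∑_L π_{N,L}`: on elements `F` of degree `N = L + K`, the component
`F̄_{N,L}` of bidegree `(L, K)` of `π F` is given by `ρ_{N,L}(F) = F̄_{N,L} · A B C`, and the
components of total degree different from `N` vanish. -/
def IsFusionMap (P : Params) (m n : ℕ) (hm : 0 < m)
    (π : (Sh0 P m n).carrier →ₗ[ℂ] FusionTarget P m n) : Prop :=
  (∀ (L K : ℕ) (F : Rat (m + n) (L + K)) (hF : single (m + n) (L + K) F ∈ (Sh0 P m n).carrier),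
    rho P hm L K F =
      toFun (m + (n - 1)) L K (fusionIncl P m n (π ⟨single (m + n) (L + K) F, hF⟩)) *
      (factorA P m n (yvar hm L K) * factorB P m n (zvar m n L K) *
        factorC P m n (yvar hm L K) (zvar m n L K))) ∧
  (∀ (N : ℕ) (F : Rat (m + n) N) (hF : single (m + n) N F ∈ (Sh0 P m n).carrier) (L K : ℕ),
    L + K ≠ N →
      toFun (m + (n - 1)) L K (fusionIncl P m n (π ⟨single (m + n) N F, hF⟩)) = 0)

/-! ## The iterated fusion map -/

/-- The vector space `((Space m ⊗ Space 1) ⊗ ⋯) ⊗ Space 1` with `n` factors `Space 1`. -/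
def iterSpace (m : ℕ) : ℕ → ModuleCat.{0} ℂ
  | 0 => ModuleCat.of ℂ (Space m)
  | n + 1 => ModuleCat.of ℂ (iterSpace m n ⊗[ℂ] Space 1)

/-- `A ⊗ Sh_1(p 0) ⊗ ⋯ ⊗ Sh_1(p (n-1))`, bracketed as
`((A ⊗ Sh_1(p (n-1))) ⊗ ⋯) ⊗ Sh_1(p 0)`. -/
def iterTarget {m : ℕ} (A : GradedAlg (Space m)) :
    (n : ℕ) → (p : ℕ → ℂ × ℂ × ℂ) → GradedAlg (iterSpace m n)
  | 0, _ => A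
  | n + 1, p =>
    (iterTarget A n fun j => p (j + 1)).tensor (Sh1 (p 0).1 (p 0).2.1 (p 0).2.2)

/-- The map `(Φ' ⊗ id) ∘ π`. -/
def fusionStep (P : Params) (m n : ℕ)
    (π : (Sh0 P m (n + 1)).carrier →ₗ[ℂ] FusionTarget P m (n + 1))
    (Φ' : (Sh0 (P.bar m (n + 1)) m n).carrier →ₗ[ℂ] iterSpace m n) :
    (Sh0 P m (n + 1)).carrier →ₗ[ℂ] iterSpace m (n + 1) :=
  TensorProduct.map Φ' (fusionSh1 P m (n + 1)).carrier.subtype ∘ₗ π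

/-- `Φ` is obtained from `Sh^0_{m|n}(P)` by `n` fusion steps
`m|n → m|n-1 → ⋯ → m|0`, i.e. `Φ = (Φ' ⊗ id) ∘ π_{m|n}^{m|n-1}` with `Φ'` obtained from
`Sh^0_{m|n-1}(P̄)` by `n - 1` fusion steps, and `Φ` is the inclusion of `Sh^0_m(P)` if `n = 0`. -/
def IsIteratedFusion (m : ℕ) (hm : 0 < m) : (n : ℕ) → (P : Params) →
    ((Sh0 P m n).carrier →ₗ[ℂ] iterSpace m n) → Prop
  | 0, P, Φ => Φ = (Sh0 P m 0).carrier.subtype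
  | n + 1, P, Φ =>
    ∃ (π : (Sh0 P m (n + 1)).carrier →ₗ[ℂ] FusionTarget P m (n + 1))
      (Φ' : (Sh0 (P.bar m (n + 1)) m n).carrier →ₗ[ℂ] iterSpace m n),
      IsFusionMap P m (n + 1) hm π ∧
      IsIteratedFusion m hm n (P.bar m (n + 1)) Φ' ∧
      Φ = fusionStep P m n π Φ'

/-- `Sh^0_m(q_1 q_1^{-n/m}, q_2, q_3 q_1^{n/m}) ⊗
⊗_{j=0}^{n-1} Sh_1(q_2^{j+1} q_3^{-m+n}, q_2^{-1}, q_2^{-j} q_3^{m-n})`. -/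
def fullTarget (P : Params) (m n : ℕ) : GradedAlg (iterSpace m n) :=
  iterTarget (Sh0 (P.shift (-(n : ℂ) / m)) m 0) n fun j =>
    (P.q2 ^ (j + 1) * P.q3 ^ (-(m : ℤ) + n), P.q2⁻¹, P.q2 ^ (-(j : ℤ)) * P.q3 ^ ((m : ℤ) - n))

end Shuffle

end

set_option linter.unusedSectionVars false

open scoped TensorProduct

noncomputable section

namespace Shuffle

open Finset (card_compl card_disjSum card_le_card card_le_univ card_pair card_range card_singleton
  card_toLeft_add_card_toRight mem_Ico mem_Ioi mem_compl mem_erase mem_filter mem_insert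
  mem_insert_of_mem mem_insert_self mem_map_equiv mem_range mem_singleton mem_toLeft mem_toRight
  mem_univ mul_prod_erase mul_sum prod_Ico_consecutive prod_Ico_eq_prod_range prod_bij' prod_comm
  prod_comm' prod_congr prod_const prod_const_one prod_div_distrib prod_dvd_of_isRelPrime
  prod_eq_one prod_eq_prod_Ico_succ_bot prod_eq_single_of_mem prod_eq_zero prod_filter prod_insert
  prod_ite_eq prod_ite_eq' prod_mul_distrib prod_ne_zero_iff prod_pair prod_product prod_range_add
  prod_range_eq_mul_Ico prod_range_mul_prod_Ico prod_range_succ prod_range_succ' prod_subset range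
  smul_sum sum_add_distrib sum_coe_sort sum_comm sum_congr sum_const_zero sum_eq_single
  sum_eq_zero sum_insert sum_mul sum_sub_distrib)
open Sum (inl inr)
open Equiv (Perm)
open TensorProduct (mapIncl)
open Function (Injective)
open MvPolynomial

section

variable (P : Params) (m k : ℕ)

set_option hygiene false

/-- The shuffle type of the second factor. -/
notation "𝕆" => oneType (P.q1⁻¹ * P.q3 ^ (-(m : ℤ) + (k + 1 : ℕ) - 1)) P.q2⁻¹ (P.q3 ^ ((m : ℤ) - (k + 1 : ℕ)))

/-- The shuffle type of the first factor. -/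
notation "𝕋" => shType (P.bar m (k + 1)) m k

/-- The shuffle type of the source. -/
notation "𝕊" => superType P m (k + 1)

/-- The coefficients of the variables `y`. -/
notation "η" => ycoef P m (k + 1)

/-- The coefficients of the variables `z`. -/
notation "ζ" => zcoef P m

/-- The parameter of the specialization. -/
notation "𝔮" => P.sfq m (k + 1)

/-- The new parameters. -/
notation "𝔓" => P.bar m (k + 1)

/-- The colours. -/
notation "𝕀" => Fin (m + (k + 1))

end

/-! ## Substitution in rational functions -/

section RatSubst

variable {σ τ : Type} {K : Type} [Field K] [Algebra ℂ K]

theorem algebraMap_rat_injective : Injective (algebraMap (MvPolynomial σ ℂ) (RatField σ)) :=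
  IsFractionRing.injective _ _

theorem algebraMap_rat_ne_zero {f : MvPolynomial σ ℂ} (hf : f ≠ 0) :
    algebraMap (MvPolynomial σ ℂ) (RatField σ) f ≠ 0 :=
  (map_ne_zero_iff _ algebraMap_rat_injective).2 hf

/-- The rational functions that can be evaluated at `φ`. -/
def regSub (φ : σ → K) : Subalgebra ℂ (RatField σ) where
  carrier := {F | ∃ f g : MvPolynomial σ ℂ,
    F * algebraMap _ (RatField σ) g = algebraMap _ (RatField σ) f ∧ aeval φ g ≠ 0}
  mul_mem' := by
    rintro F G ⟨f, g, h, hg⟩ ⟨f', g', h', hg'⟩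
    refine ⟨f * f', g * g', ?_, by grind⟩
    grind
  add_mem' := by
    rintro F G ⟨f, g, h, hg⟩ ⟨f', g', h', hg'⟩
    refine ⟨f * g' + f' * g, g * g', ?_, by grind⟩
    rw [map_mul, map_add, map_mul, map_mul, ← h, ← h']; ring
  algebraMap_mem' r := ⟨C r, 1, by rw [map_one, mul_one]; rfl, by simp⟩

theorem ratSubst_algebraMap (φ : σ → K) (f : MvPolynomial σ ℂ) :
    ratSubst φ (algebraMap _ (RatField σ) f) = aeval φ f := by
  rw [ratSubst_eq φ _ f 1 (by simp) (by simp)]; simp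

theorem algebraMap_mem_regSub (φ : σ → K) (f : MvPolynomial σ ℂ) :
    algebraMap _ (RatField σ) f ∈ regSub φ := ⟨f, 1, by simp, by simp⟩

theorem ratSubst_var (φ : σ → K) (s : σ) : ratSubst φ (var s) = φ s := by
  rw [var, ratSubst_algebraMap, aeval_X]

theorem var_mem_regSub (φ : σ → K) (s : σ) : var s ∈ regSub φ := algebraMap_mem_regSub φ _

theorem ratSubst_mul {φ : σ → K} {F G : RatField σ} (hF : F ∈ regSub φ) (hG : G ∈ regSub φ) :
    ratSubst φ (F * G) = ratSubst φ F * ratSubst φ G := by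
  obtain ⟨f, g, h, hg⟩ := hF
  obtain ⟨f', g', h', hg'⟩ := hG
  rw [ratSubst_eq φ F f g h hg, ratSubst_eq φ G f' g' h' hg',
    ratSubst_eq φ (F * G) (f * f') (g * g') (by grind)
      (by grind), map_mul, map_mul, div_mul_div_comm]

theorem ratSubst_add {φ : σ → K} {F G : RatField σ} (hF : F ∈ regSub φ) (hG : G ∈ regSub φ) :
    ratSubst φ (F + G) = ratSubst φ F + ratSubst φ G := by
  obtain ⟨f, g, h, hg⟩ := hF
  obtain ⟨f', g', h', hg'⟩ := hG
  rw [ratSubst_eq φ F f g h hg, ratSubst_eq φ G f' g' h' hg',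
    ratSubst_eq φ (F + G) (f * g' + f' * g) (g * g')
      (by rw [map_mul, map_add, map_mul, map_mul, ← h, ← h']; ring)
      (by grind)]
  simp only [map_add, map_mul]
  field_simp

theorem algebraMap_complex_eq (r : ℂ) :
    algebraMap ℂ (RatField σ) r = algebraMap (MvPolynomial σ ℂ) (RatField σ) (C r) := rfl

theorem ratSubst_const (φ : σ → K) (r : ℂ) :
    ratSubst φ (algebraMap ℂ (RatField σ) r) = algebraMap ℂ K r := by
  rw [algebraMap_complex_eq, ratSubst_algebraMap, aeval_C]

theorem ratSubst_zero (φ : σ → K) : ratSubst φ (0 : RatField σ) = 0 := by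
  simpa using ratSubst_const φ 0

theorem ratSubst_one (φ : σ → K) : ratSubst φ (1 : RatField σ) = 1 := by
  simpa using ratSubst_const φ 1

theorem ratSubst_smul {φ : σ → K} {F : RatField σ} (hF : F ∈ regSub φ) (r : ℂ) :
    ratSubst φ (r • F) = r • ratSubst φ F := by
  rw [Algebra.smul_def, ratSubst_mul ((regSub φ).algebraMap_mem r) hF, ratSubst_const,
    Algebra.smul_def]

theorem ratSubst_sub {φ : σ → K} {F G : RatField σ} (hF : F ∈ regSub φ) (hG : G ∈ regSub φ) :
    ratSubst φ (F - G) = ratSubst φ F - ratSubst φ G := by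
  rw [eq_sub_iff_add_eq, ← ratSubst_add (sub_mem hF hG) hG, sub_add_cancel]

theorem ratSubst_sum {φ : σ → K} {ι : Type*} (s : Finset ι) (F : ι → RatField σ)
    (hF : ∀ i ∈ s, F i ∈ regSub φ) : ratSubst φ (∑ i ∈ s, F i) = ∑ i ∈ s, ratSubst φ (F i) := by
  classical
  induction s using Finset.induction_on with
  | empty => exact ratSubst_zero φ
  | insert a s ha ih =>
    rw [sum_insert ha, sum_insert ha, ratSubst_add (hF a (by simp))
      (sum_mem fun i hi => hF i (by simp [hi])), ih fun i hi => hF i (by simp [hi])]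

theorem ratSubst_prod {φ : σ → K} {ι : Type*} (s : Finset ι) (F : ι → RatField σ)
    (hF : ∀ i ∈ s, F i ∈ regSub φ) : ratSubst φ (∏ i ∈ s, F i) = ∏ i ∈ s, ratSubst φ (F i) := by
  classical
  induction s using Finset.induction_on with
  | empty => exact ratSubst_one φ
  | insert a s ha ih =>
    rw [prod_insert ha, prod_insert ha, ratSubst_mul (hF a (by simp))
      (prod_mem fun i hi => hF i (by simp [hi])), ih fun i hi => hF i (by simp [hi])]

theorem div_mem_regSub {φ : σ → K} {F G : RatField σ} (hF : F ∈ regSub φ) (hG : G ∈ regSub φ)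
    (h0 : ratSubst φ G ≠ 0) : F / G ∈ regSub φ := by
  obtain ⟨f, g, h, hg⟩ := hF
  obtain ⟨f', g', h', hg'⟩ := hG
  rw [ratSubst_eq φ G f' g' h' hg'] at h0
  have hf' : aeval φ f' ≠ 0 := (div_ne_zero_iff.1 h0).1
  have hG0 : G ≠ 0 := by
    rintro rfl
    rw [zero_mul] at h'
    have := algebraMap_rat_injective (h'.symm.trans (map_zero _).symm)
    grind
  refine ⟨f * g', g * f', ?_, by grind⟩
  grind

theorem ratSubst_div {φ : σ → K} {F G : RatField σ} (hF : F ∈ regSub φ) (hG : G ∈ regSub φ)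
    (h0 : ratSubst φ G ≠ 0) : ratSubst φ (F / G) = ratSubst φ F / ratSubst φ G := by
  rw [eq_div_iff h0, ← ratSubst_mul (div_mem_regSub hF hG h0) hG, div_mul_cancel₀]
  rintro rfl
  exact h0 (ratSubst_zero φ)

theorem ratRename_algebraMap (f : σ → τ) (hf : Injective f) (p : MvPolynomial σ ℂ) :
    ratRename f hf (algebraMap _ (RatField σ) p) = algebraMap _ (RatField τ) (rename f p) := by
  unfold ratRename
  simp [IsFractionRing.liftAlgHom]

theorem ratRename_var (f : σ → τ) (hf : Injective f) (s : σ) :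
    ratRename f hf (var s) = var (f s) := by
  rw [var, ratRename_algebraMap, rename_X, var]

theorem ratRename_mem_regSub {f : σ → τ} (hf : Injective f) {φ : τ → K}
    {F : RatField σ} (hF : F ∈ regSub (φ ∘ f)) : ratRename f hf F ∈ regSub φ := by
  obtain ⟨p, g, h, hg⟩ := hF
  refine ⟨rename f p, rename f g, ?_, by rwa [aeval_rename]⟩
  rw [← ratRename_algebraMap f hf, ← ratRename_algebraMap f hf, ← map_mul, h]

theorem ratSubst_ratRename {f : σ → τ} (hf : Injective f) {φ : τ → K}
    {F : RatField σ} (hF : F ∈ regSub (φ ∘ f)) :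
    ratSubst φ (ratRename f hf F) = ratSubst (φ ∘ f) F := by
  obtain ⟨p, g, h, hg⟩ := hF
  rw [ratSubst_eq _ F p g h hg, ratSubst_eq φ _ (rename f p) (rename f g) _ (by rwa [aeval_rename]),
    aeval_rename, aeval_rename]
  rw [← ratRename_algebraMap f hf, ← ratRename_algebraMap f hf, ← map_mul, h]

theorem map_aeval_comp {K' : Type} [Field K'] [Algebra ℂ K'] (θ : K →ₐ[ℂ] K') (φ : σ → K)
    (f : MvPolynomial σ ℂ) : θ (aeval φ f) = aeval (fun s => θ (φ s)) f := by
  have : θ.comp (aeval φ) = aeval (fun s => θ (φ s)) := by ext s; simp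
  exact DFunLike.congr_fun this f

theorem map_ratSubst {K' : Type} [Field K'] [Algebra ℂ K'] (θ : K →ₐ[ℂ] K') (φ : σ → K)
    (F : RatField σ) : θ (ratSubst φ F) = ratSubst (fun s => θ (φ s)) F := by
  unfold ratSubst
  rw [map_div₀, map_aeval_comp, map_aeval_comp]

theorem aeval_var_eq (f : σ → τ) (p : MvPolynomial σ ℂ) :
    aeval (fun s => (var (f s) : RatField τ)) p = algebraMap _ (RatField τ) (rename f p) := by
  have : aeval (fun s => (var (f s) : RatField τ)) =
      (IsScalarTower.toAlgHom ℂ (MvPolynomial τ ℂ) (RatField τ)).comp (rename f) := by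
    ext s; simp [var]
  rw [this]; rfl

theorem mem_regSub_var {f : σ → τ} (hf : Injective f) (F : RatField σ) :
    F ∈ regSub (fun s => (var (f s) : RatField τ)) := by
  obtain ⟨a, b, hb, rfl⟩ := IsFractionRing.div_surjective (A := MvPolynomial σ ℂ) F
  have hb0 : b ≠ 0 := nonZeroDivisors.ne_zero hb
  refine ⟨a, b, div_mul_cancel₀ _ (algebraMap_rat_ne_zero hb0), ?_⟩
  rw [aeval_var_eq]
  exact algebraMap_rat_ne_zero ((map_ne_zero_iff _ (rename_injective f hf)).2 hb0)

theorem ratSubst_var_eq {f : σ → τ} (hf : Injective f) (F : RatField σ) :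
    ratSubst (fun s => (var (f s) : RatField τ)) F = ratRename f hf F := by
  obtain ⟨a, b, hb, rfl⟩ := IsFractionRing.div_surjective (A := MvPolynomial σ ℂ) F
  have hb0 : b ≠ 0 := nonZeroDivisors.ne_zero hb
  rw [ratSubst_eq _ _ a b (div_mul_cancel₀ _ (algebraMap_rat_ne_zero hb0)), aeval_var_eq,
    aeval_var_eq, map_div₀, ratRename_algebraMap, ratRename_algebraMap]
  rw [aeval_var_eq]
  exact algebraMap_rat_ne_zero ((map_ne_zero_iff _ (rename_injective f hf)).2 hb0)

end RatSubst

/-! ## Monomial points and linear forms -/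

section Linear

variable {σ τ υ : Type}

/-- The point with coordinates `c_s X_{r s}`. -/
def mpt (c : σ → ℂ) (r : σ → τ) : σ → MvPolynomial τ ℂ := fun s => C (c s) * X (r s)

theorem eval_mpt (c : σ → ℂ) (r : σ → τ) (p : τ → ℂ) (f : MvPolynomial σ ℂ) :
    eval p (aeval (mpt c r) f) = eval (fun s => c s * p (r s)) f := by
  have : (aeval p).comp (aeval (mpt c r)) =
      (aeval (fun s => c s * p (r s)) : MvPolynomial σ ℂ →ₐ[ℂ] ℂ) := by
    ext s; simp [mpt]
  have h := DFunLike.congr_fun this f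
  simpa [coe_aeval_eq_eval] using h

theorem mpt_comp (c : σ → ℂ) (r : σ → τ) (c' : τ → ℂ) (r' : τ → υ) (f : MvPolynomial σ ℂ) :
    aeval (mpt c' r') (aeval (mpt c r) f) =
    aeval (mpt (fun s => c s * c' (r s)) (fun s => r' (r s))) f := by
  have : (aeval (mpt c' r')).comp (aeval (mpt c r)) =
      aeval (mpt (fun s => c s * c' (r s)) (fun s => r' (r s))) := by
    ext s; simp [mpt, mul_assoc]
  exact DFunLike.congr_fun this f

theorem eq_zero_of_torus (f : MvPolynomial τ ℂ)
    (h : ∀ p : τ → ℂ, (∀ t, p t ≠ 0) → eval p f = 0) : f = 0 := by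
  classical
  have hfin : ∀ (s : Finset τ), (∏ t ∈ s, (X t : MvPolynomial τ ℂ)) ≠ 0 := fun s =>
    prod_ne_zero_iff.2 fun t _ => X_ne_zero t
  have key : f * ∏ t ∈ f.vars, X t = 0 := by
    apply MvPolynomial.funext
    intro p
    rw [map_mul, map_zero, map_prod]
    by_cases hp : ∀ t ∈ f.vars, p t ≠ 0
    · have h1 : eval p f = eval (fun t => if p t = 0 then 1 else p t) f := by
        apply eval₂Hom_congr' rfl _ rfl
        grind
      grind
    · push Not at hp
      obtain ⟨t, ht, ht0⟩ := hp
      rw [prod_eq_zero ht (by simpa using ht0), mul_zero]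
  exact (mul_eq_zero.1 key).resolve_right (hfin _)

/-- The linear form `α X_u - β X_v`. -/
def lin (α : ℂ) (u : τ) (β : ℂ) (v : τ) : MvPolynomial τ ℂ := C α * X u - C β * X v

theorem aeval_lin (α : ℂ) (u : τ) (β : ℂ) (v : τ) (c : τ → ℂ) (r : τ → υ) :
    aeval (mpt c r) (lin α u β v) = lin (α * c u) (r u) (β * c v) (r v) := by
  simp [lin, mpt, mul_assoc]

theorem eval_lin (α : ℂ) (u : τ) (β : ℂ) (v : τ) (p : τ → ℂ) :
    eval p (lin α u β v) = α * p u - β * p v := by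
  simp [lin]

open Classical in
theorem lin_ne_zero {α : ℂ} {u : τ} {β : ℂ} {v : τ} (h : u ≠ v ∨ α ≠ β) (hα : α ≠ 0) :
    lin α u β v ≠ 0 := by
  intro h0
  by_cases huv : u = v
  · subst huv
    have := congrArg (eval fun _ => (1 : ℂ)) h0
    rw [eval_lin] at this
    grind
  · have := congrArg (eval fun t => if t = u then (1 : ℂ) else 0) h0
    rw [eval_lin] at this
    grind

open Classical in
/-- The substitution `X_u ↦ t X_v`. -/
def subl (u : τ) (t : ℂ) (v : τ) : MvPolynomial τ ℂ →ₐ[ℂ] MvPolynomial τ ℂ :=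
  aeval (mpt (Function.update (fun _ => 1) u t) (Function.update id u v))

open Classical in
theorem subl_X (u : τ) (t : ℂ) (v : τ) (w : τ) :
    subl u t v (X w) = if w = u then C t * X v else X w := by
  unfold subl
  rw [aeval_X, mpt]
  grind

theorem subl_lin_self {α : ℂ} (hα : α ≠ 0) {u v : τ} (huv : u ≠ v) (β : ℂ) :
    subl u (β / α) v (lin α u β v) = 0 := by
  unfold lin
  rw [map_sub, map_mul, map_mul, subl_X, subl_X, if_pos rfl, if_neg huv.symm, ← algebraMap_eq,
    AlgHom.commutes, AlgHom.commutes, algebraMap_eq, ← mul_assoc, ← C_mul, mul_div_cancel₀ _ hα,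
    sub_self]

theorem lin_dvd_iff {α : ℂ} (hα : α ≠ 0) {u v : τ} (huv : u ≠ v) (β : ℂ) (g : MvPolynomial τ ℂ) :
    lin α u β v ∣ g ↔ subl u (β / α) v g = 0 := by
  constructor
  · rintro ⟨h, rfl⟩
    rw [map_mul, subl_lin_self hα huv, zero_mul]
  · intro h
    have hmk : ((Ideal.Quotient.mkₐ ℂ (Ideal.span {lin α u β v})).comp (subl u (β / α) v)) =
        Ideal.Quotient.mkₐ ℂ (Ideal.span {lin α u β v}) := by
      ext w
      rw [AlgHom.comp_apply, subl_X]
      split_ifs with hw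
      · subst hw
        rw [eq_comm, Ideal.Quotient.mkₐ_eq_mk, Ideal.Quotient.eq, Ideal.mem_span_singleton]
        refine ⟨C (1 / α), ?_⟩
        have h2 : C α * C (1 / α) = (1 : MvPolynomial τ ℂ) := by
          rw [← C_mul, mul_one_div_cancel hα, C_1]
        have h3 : C (β / α) = C β * (C (1 / α) : MvPolynomial τ ℂ) := by grind
        rw [lin, h3]
        grind
      · rfl
    have h2 := DFunLike.congr_fun hmk g
    rw [AlgHom.comp_apply, h, map_zero, eq_comm, Ideal.Quotient.mkₐ_eq_mk,
      Ideal.Quotient.eq_zero_iff_mem, Ideal.mem_span_singleton] at h2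
    exact h2

theorem lin_prime {α : ℂ} (hα : α ≠ 0) {u v : τ} (huv : u ≠ v) (β : ℂ) : Prime (lin α u β v) := by
  refine ⟨lin_ne_zero (Or.inl huv) hα, ?_, ?_⟩
  · intro hu
    have := hu.map (eval fun _ => (0 : ℂ))
    rw [eval_lin] at this
    simp at this
  · intro a b h
    rw [lin_dvd_iff hα huv] at h ⊢
    rw [lin_dvd_iff hα huv]
    rw [map_mul] at h
    exact mul_eq_zero.1 h

/-- Vanishing of `f` on the part of the torus cut out by `α p_u = β p_v` gives divisibility of its
pullback. -/
theorem lin_dvd_of_torus {α β : ℂ} (hα : α ≠ 0) (hβ : β ≠ 0) {u v : τ} (huv : u ≠ v)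
    {g : MvPolynomial τ ℂ} (h : ∀ p : τ → ℂ, (∀ t, p t ≠ 0) → α * p u = β * p v → eval p g = 0) :
    lin α u β v ∣ g := by
  classical
  rw [lin_dvd_iff hα huv]
  apply eq_zero_of_torus
  intro p hp
  unfold subl
  rw [eval_mpt]
  grind

/-- Products of linear forms in pairs of variables from `S`. -/
def Forms (S : Set (τ × τ)) : Submonoid (MvPolynomial τ ℂ) :=
  Submonoid.closure {d | ∃ α u β v, α ≠ 0 ∧ β ≠ 0 ∧ u ≠ v ∧ (u, v) ∈ S ∧ d = lin α u β v}

theorem lin_mem_Forms {S : Set (τ × τ)} {α β : ℂ} {u v : τ} (hα : α ≠ 0) (hβ : β ≠ 0)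
    (huv : u ≠ v) (h : (u, v) ∈ S) : lin α u β v ∈ Forms S :=
  Submonoid.subset_closure ⟨α, u, β, v, hα, hβ, huv, h, rfl⟩

theorem Forms_mono {S S' : Set (τ × τ)} (h : S ⊆ S') : Forms S ≤ Forms S' :=
  Submonoid.closure_mono (by grind)

theorem subl_lin_ne_zero {α β α' β' : ℂ} {u v u' v' : τ} (hα : α ≠ 0) (hβ : β ≠ 0)
    (hα' : α' ≠ 0) (huv' : u' ≠ v') (hpair : ¬ (u = u' ∧ v = v') ∧ ¬ (u = v' ∧ v = u')) :
    subl u (β / α) v (lin α' u' β' v') ≠ 0 := by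
  classical
  unfold subl
  rw [aeval_lin]
  apply lin_ne_zero
  · grind
  · grind

theorem isRelPrime_lin {α β α' β' : ℂ} {u v u' v' : τ} (hα : α ≠ 0) (hβ : β ≠ 0) (huv : u ≠ v)
    (hα' : α' ≠ 0) (huv' : u' ≠ v') (hpair : ¬ (u = u' ∧ v = v') ∧ ¬ (u = v' ∧ v = u')) :
    IsRelPrime (lin α u β v) (lin α' u' β' v') := by
  rw [(lin_prime hα huv β).irreducible.isRelPrime_iff_not_dvd, lin_dvd_iff hα huv]
  exact subl_lin_ne_zero hα hβ hα' huv' hpair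

/-- Distinct forms in the same two variables. -/
theorem isRelPrime_lin' {α β α' β' : ℂ} {u v : τ} (hα : α ≠ 0) (huv : u ≠ v)
    (h : α * β' ≠ α' * β) : IsRelPrime (lin α u β v) (lin α' u β' v) := by
  classical
  rw [(lin_prime hα huv β).irreducible.isRelPrime_iff_not_dvd, lin_dvd_iff hα huv]
  intro h0
  have := congrArg (eval fun _ => (1 : ℂ)) h0
  unfold subl at this
  rw [eval_mpt, eval_lin] at this
  grind

theorem isRelPrime_of_Forms {S S' : Set (τ × τ)}
    (h : ∀ u v, (u, v) ∈ S → (u, v) ∉ S' ∧ (v, u) ∉ S') {d d' : MvPolynomial τ ℂ}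
    (hd : d ∈ Forms S) (hd' : d' ∈ Forms S') : IsRelPrime d d' := by
  induction hd using Submonoid.closure_induction with
  | mem d hd =>
    obtain ⟨α, u, β, v, hα, hβ, huv, hS, rfl⟩ := hd
    induction hd' using Submonoid.closure_induction with
    | mem d hd =>
      obtain ⟨α', u', β', v', hα', hβ', huv', hS', rfl⟩ := hd
      apply isRelPrime_lin hα hβ huv hα' huv'
      grind
    | one => exact isRelPrime_one_right
    | mul a b _ _ ha hb => exact ha.mul_right hb
  | one => exact isRelPrime_one_left
  | mul a b _ _ ha hb => exact ha.mul_left hb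

/-- Pairwise coprime factors, given by forms in disjoint sets of pairs of variables. -/
theorem prod_dvd_of_Forms {ι : Type*} (s : Finset ι) (d : ι → MvPolynomial τ ℂ)
    (S : ι → Set (τ × τ)) (hd : ∀ i ∈ s, d i ∈ Forms (S i))
    (hS : ∀ i ∈ s, ∀ j ∈ s, i ≠ j → ∀ u v, (u, v) ∈ S i → (u, v) ∉ S j ∧ (v, u) ∉ S j)
    {g : MvPolynomial τ ℂ} (h : ∀ i ∈ s, d i ∣ g) : ∏ i ∈ s, d i ∣ g := by
  apply prod_dvd_of_isRelPrime
  · intro i hi j hj hij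
    exact isRelPrime_of_Forms (hS i hi j hj hij) (hd i hi) (hd j hj)
  · exact h

end Linear

section ColumnDvd

variable {ι κ τ : Type} [DecidableEq κ]

/-- A column `e` of coordinates is left free: vanishing of `f` whenever the coordinate `(i, e)`
equals `t_i p (v i)`, for `i ∈ S`, gives the product of the corresponding linear forms as a
divisor, even if these forms coincide. -/
theorem column_dvd (f : MvPolynomial (ι × κ) ℂ) (c : ι × κ → ℂ) (hc : ∀ s, c s ≠ 0)
    (r : ι × κ → τ) (e : κ) (S : Finset ι) (t : ι → ℂ) (ht : ∀ i, t i ≠ 0) (v : ι → τ)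
    (h : ∀ i ∈ S, ∀ p : τ → ℂ, (∀ s, p s ≠ 0) → ∀ x : ι × κ → ℂ, (∀ s, x s ≠ 0) →
    (∀ j a, a ≠ e → x (j, a) = c (j, a) * p (r (j, a))) → x (i, e) = t i * p (v i) → eval x f = 0) :
    ∏ i ∈ S, lin (c (i, e)) (r (i, e)) (t i) (v i) ∣ aeval (mpt c r) f := by
  classical
  let c1 : ι × κ → ℂ := fun s => if s.2 = e then 1 else c s
  let r1 : ι × κ → τ ⊕ ι := fun s => if s.2 = e then inr s.1 else inl (r s)
  let c2 : τ ⊕ ι → ℂ := Sum.elim (fun _ => 1) (fun i => c (i, e))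
  let r2 : τ ⊕ ι → τ := Sum.elim id (fun i => r (i, e))
  have hdvd : ∏ i ∈ S, lin 1 (inr i) (t i) (inl (v i)) ∣ aeval (mpt c1 r1) f := by
    apply prod_dvd_of_Forms S _ (fun i => {(inr i, inl (v i))})
    · intro i _
      exact lin_mem_Forms one_ne_zero (ht i) (by simp) rfl
    · grind
    · intro i hi
      apply lin_dvd_of_torus one_ne_zero (ht i) (by simp)
      intro p hp hpi
      rw [eval_mpt]
      refine h i hi (fun s => p (inl s)) (fun s => hp _) _ ?_ ?_ ?_
      · grind
      · grind
      · grind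
  have h2 := map_dvd (aeval (mpt c2 r2)) hdvd
  rw [mpt_comp, map_prod] at h2
  have e1 : mpt (fun s => c1 s * c2 (r1 s)) (fun s => r2 (r1 s)) = mpt c r := by
    funext s
    obtain ⟨j, a⟩ := s
    by_cases ha : a = e
    · subst ha; simp [mpt, c1, c2, r1, r2]
    · simp [mpt, c1, c2, r1, r2, ha]
  rw [e1] at h2
  convert h2 using 2 with i hi
  rw [aeval_lin]
  simp [c2, r2]

end ColumnDvd

/-! ## Tensor products of spaces of functions -/

section Rank

variable {V W X : Type*} [AddCommGroup V] [Module ℂ V] [AddCommGroup W] [Module ℂ W]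
    [AddCommGroup X] [Module ℂ X]

theorem exists_shorter_sum (B : V →ₗ[ℂ] W →ₗ[ℂ] X) {n : ℕ} (v : Fin (n + 1) → V)
    (w : Fin (n + 1) → W) (hv : ¬ LinearIndependent ℂ v) :
    ∃ (v' : Fin n → V) (w' : Fin n → W), ∑ i, B (v i) (w i) = ∑ i, B (v' i) (w' i) := by
  rw [Fintype.not_linearIndependent_iff] at hv
  obtain ⟨g, hg, k, hk⟩ := hv
  refine ⟨fun j => v (k.succAbove j),
    fun j => w (k.succAbove j) - (g (k.succAbove j) / g k) • w k, ?_⟩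
  rw [Fin.sum_univ_succAbove _ k] at hg ⊢
  have hvk : v k = -∑ j, (g (k.succAbove j) / g k) • v (k.succAbove j) := by
    have h1 : g k • v k = -∑ j, g (k.succAbove j) • v (k.succAbove j) :=
      eq_neg_of_add_eq_zero_left hg
    have h2 : v k = (g k)⁻¹ • g k • v k := by rw [smul_smul, inv_mul_cancel₀ hk, one_smul]
    rw [h2, h1, smul_neg, smul_sum]
    simp only [smul_smul, div_eq_inv_mul]
  have h3 : B (v k) (w k) =
      -∑ j, (g (k.succAbove j) / g k) • B (v (k.succAbove j)) (w k) := by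
    rw [hvk]
    simp [LinearMap.sum_apply]
  rw [h3]
  simp only [map_sub, map_smul, sum_sub_distrib]
  abel

/-- A sum of values of a bilinear map may be written with independent entries on both sides. -/
theorem exists_linearIndependent_sum (B : V →ₗ[ℂ] W →ₗ[ℂ] X) {n : ℕ} (v : Fin n → V)
    (w : Fin n → W) : ∃ (k : ℕ) (v' : Fin k → V) (w' : Fin k → W), LinearIndependent ℂ v' ∧
    LinearIndependent ℂ w' ∧ ∑ i, B (v i) (w i) = ∑ i, B (v' i) (w' i) := by
  induction n with
  | zero => exact ⟨0, v, w, linearIndependent_empty_type, linearIndependent_empty_type, rfl⟩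
  | succ n ih =>
    by_cases hv : LinearIndependent ℂ v
    · by_cases hw : LinearIndependent ℂ w
      · grind
      · obtain ⟨w', v', h⟩ := exists_shorter_sum B.flip w v hw
        obtain ⟨k, v2, w2, h1, h2, h3⟩ := ih v' w'
        refine ⟨k, v2, w2, h1, h2, ?_⟩
        rw [← h3]
        simpa using h
    · obtain ⟨v', w', h⟩ := exists_shorter_sum B v w hv
      obtain ⟨k, v2, w2, h1, h2, h3⟩ := ih v' w'
      grind

end Rank

section Functions

variable {α β : Type}

/-- `(P, Q) ↦ P(y) Q(z)`, for polynomials. -/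
def polyMul : MvPolynomial α ℂ →ₗ[ℂ] MvPolynomial β ℂ →ₗ[ℂ] MvPolynomial (α ⊕ β) ℂ :=
  (LinearMap.mul ℂ (MvPolynomial (α ⊕ β) ℂ)).compl₁₂
    (rename (R := ℂ) inl).toLinearMap (rename (R := ℂ) inr).toLinearMap

theorem polyMul_apply (P : MvPolynomial α ℂ) (Q : MvPolynomial β ℂ) :
    polyMul P Q = rename inl P * rename inr Q := rfl

theorem exists_sum_polyMul (f : MvPolynomial (α ⊕ β) ℂ) :
    ∃ (n : ℕ) (P : Fin n → MvPolynomial α ℂ) (Q : Fin n → MvPolynomial β ℂ),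
    f = ∑ i, polyMul (P i) (Q i) := by
  induction f using MvPolynomial.induction_on with
  | C a => exact ⟨1, fun _ => C a, fun _ => 1, by simp [polyMul_apply]⟩
  | add p q hp hq =>
    obtain ⟨n, P, Q, rfl⟩ := hp
    obtain ⟨n', P', Q', rfl⟩ := hq
    refine ⟨n + n', Fin.append P P', Fin.append Q Q', ?_⟩
    rw [Fin.sum_univ_add]
    simp
  | mul_X p s hp =>
    obtain ⟨n, P, Q, rfl⟩ := hp
    cases s with
    | inl s =>
      refine ⟨n, fun i => P i * X s, Q, ?_⟩
      rw [sum_mul]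
      refine sum_congr rfl fun i _ => ?_
      simp only [polyMul_apply, map_mul, rename_X]
      ring
    | inr s =>
      refine ⟨n, P, fun i => Q i * X s, ?_⟩
      rw [sum_mul]
      refine sum_congr rfl fun i _ => ?_
      simp only [polyMul_apply, map_mul, rename_X]
      ring

theorem exists_independent_polyMul (f : MvPolynomial (α ⊕ β) ℂ) :
    ∃ (n : ℕ) (P : Fin n → MvPolynomial α ℂ) (Q : Fin n → MvPolynomial β ℂ),
    LinearIndependent ℂ P ∧ LinearIndependent ℂ Q ∧ f = ∑ i, polyMul (P i) (Q i) := by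
  obtain ⟨n, P, Q, rfl⟩ := exists_sum_polyMul f
  obtain ⟨k, v, w, h1, h2, h3⟩ := exists_linearIndependent_sum polyMul P Q
  grind

theorem eval_polyMul (y : α → ℂ) (z : β → ℂ) (P : MvPolynomial α ℂ) (Q : MvPolynomial β ℂ) :
    eval (Sum.elim y z) (polyMul P Q) = eval y P * eval z Q := by
  rw [polyMul_apply, map_mul, eval_rename, eval_rename]
  simp

theorem eval_left_eq_zero {n : ℕ} {P : Fin n → MvPolynomial α ℂ} {Q : Fin n → MvPolynomial β ℂ}
    (hQ : LinearIndependent ℂ Q) (y : α → ℂ)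
    (h : ∀ z : β → ℂ, (∀ s, z s ≠ 0) → eval (Sum.elim y z) (∑ i, polyMul (P i) (Q i)) = 0)
    (i : Fin n) : eval y (P i) = 0 := by
  rw [Fintype.linearIndependent_iff] at hQ
  refine hQ (fun i => eval y (P i)) ?_ i
  apply eq_zero_of_torus
  intro z hz
  have := h z hz
  rw [map_sum] at this ⊢
  simpa [eval_polyMul, smul_eval] using this

theorem eval_right_eq_zero {n : ℕ} {P : Fin n → MvPolynomial α ℂ} {Q : Fin n → MvPolynomial β ℂ}
    (hP : LinearIndependent ℂ P) (z : β → ℂ)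
    (h : ∀ y : α → ℂ, (∀ s, y s ≠ 0) → eval (Sum.elim y z) (∑ i, polyMul (P i) (Q i)) = 0)
    (i : Fin n) : eval z (Q i) = 0 := by
  rw [Fintype.linearIndependent_iff] at hP
  refine hP (fun i => eval z (Q i)) ?_ i
  apply eq_zero_of_torus
  intro y hy
  have := h y hy
  rw [map_sum] at this ⊢
  simpa [eval_polyMul, smul_eval, mul_comm] using this

/-- `(F, G) ↦ F(y) G(z)`, for rational functions. -/
def ratMul : RatField α →ₗ[ℂ] RatField β →ₗ[ℂ] RatField (α ⊕ β) :=
  (LinearMap.mul ℂ (RatField (α ⊕ β))).compl₁₂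
    (ratRename inl Sum.inl_injective).toLinearMap
    (ratRename inr Sum.inr_injective).toLinearMap

theorem ratMul_apply (F : RatField α) (G : RatField β) :
    ratMul F G = ratRename inl Sum.inl_injective F * ratRename inr Sum.inr_injective G :=
  rfl

theorem algebraMap_polyMul (P : MvPolynomial α ℂ) (Q : MvPolynomial β ℂ) :
    algebraMap _ (RatField (α ⊕ β)) (polyMul P Q) =
    ratMul (algebraMap _ (RatField α) P) (algebraMap _ (RatField β) Q) := by
  rw [polyMul_apply, ratMul_apply, map_mul, ratRename_algebraMap, ratRename_algebraMap]

theorem exists_common_denominator {n : ℕ} (F : Fin n → RatField α) :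
    ∃ (b : MvPolynomial α ℂ) (P : Fin n → MvPolynomial α ℂ), b ≠ 0 ∧
    ∀ i, F i * algebraMap _ (RatField α) b = algebraMap _ (RatField α) (P i) := by
  obtain ⟨b, hb⟩ := IsLocalization.exist_integer_multiples_of_finite
    (nonZeroDivisors (MvPolynomial α ℂ)) F
  choose P hP using hb
  refine ⟨b, P, nonZeroDivisors.ne_zero b.2, fun i => ?_⟩
  rw [hP i, mul_comm, Algebra.smul_def]

theorem linearIndependent_of_algebraMap {n : ℕ} {G : Fin n → RatField β}
    (hG : LinearIndependent ℂ G) {b : MvPolynomial β ℂ} (hb : b ≠ 0) {Q : Fin n → MvPolynomial β ℂ}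
    (h : ∀ i, G i * algebraMap _ (RatField β) b = algebraMap _ (RatField β) (Q i)) :
    LinearIndependent ℂ Q := by
  rw [Fintype.linearIndependent_iff] at hG ⊢
  intro g hg i
  refine hG g ?_ i
  have h1 := congrArg (algebraMap _ (RatField β)) hg
  rw [map_sum, map_zero] at h1
  have h2 : (∑ i, g i • G i) * algebraMap _ (RatField β) b = 0 := by
    rw [← h1, sum_mul]
    refine sum_congr rfl fun j _ => ?_
    rw [smul_mul_assoc, h j, ← IsScalarTower.coe_toAlgHom' ℂ (MvPolynomial β ℂ) (RatField β),
      map_smul]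
  exact (mul_eq_zero.1 h2).resolve_right (algebraMap_rat_ne_zero hb)

theorem ratMul_left_eq_zero {n : ℕ} {F : Fin n → RatField α} {G : Fin n → RatField β}
    (hG : LinearIndependent ℂ G) (h : ∑ i, ratMul (F i) (G i) = 0) (i : Fin n) : F i = 0 := by
  obtain ⟨a, P, ha, hP⟩ := exists_common_denominator F
  obtain ⟨b, Q, hb, hQ⟩ := exists_common_denominator G
  have hQi := linearIndependent_of_algebraMap hG hb hQ
  have h1 : ∑ i, polyMul (P i) (Q i) = 0 := by
    apply algebraMap_rat_injective
    rw [map_sum, map_zero]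
    have : ∀ i, algebraMap _ (RatField (α ⊕ β)) (polyMul (P i) (Q i)) =
        ratMul (F i) (G i) * algebraMap _ (RatField (α ⊕ β)) (polyMul a b) := by
      intro i
      rw [algebraMap_polyMul, algebraMap_polyMul, ← hP, ← hQ]
      simp only [ratMul_apply, map_mul]
      ring
    rw [sum_congr rfl fun i _ => this i, ← sum_mul, h, zero_mul]
  have h2 : P i = 0 := by
    apply eq_zero_of_torus
    intro y _
    exact eval_left_eq_zero hQi y (fun z _ => by rw [h1, map_zero]) i
  have h3 := hP i
  rw [h2, map_zero] at h3
  exact (mul_eq_zero.1 h3).resolve_right (algebraMap_rat_ne_zero ha)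

theorem sum_swap_ratMul {n : ℕ} (F : Fin n → RatField α) (G : Fin n → RatField β) :
    ratRename Sum.swap Sum.swap_leftInverse.injective (∑ i, ratMul (F i) (G i)) =
    ∑ i, ratMul (G i) (F i) := by
  have hcomp : ∀ (γ : Type) (f : γ → α ⊕ β) (hf : Injective f) (H : RatField γ),
      ratRename Sum.swap Sum.swap_leftInverse.injective (ratRename f hf H) =
        ratRename (fun s => Sum.swap (f s)) (Sum.swap_leftInverse.injective.comp hf) H := by
    intro γ f hf H
    rw [← ratSubst_var_eq hf, map_ratSubst, ← ratSubst_var_eq]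
    simp only [ratRename_var]
  rw [map_sum]
  refine sum_congr rfl fun i _ => ?_
  rw [ratMul_apply, ratMul_apply, map_mul, hcomp, hcomp, mul_comm]
  rfl

theorem ratMul_right_eq_zero {n : ℕ} {F : Fin n → RatField α} {G : Fin n → RatField β}
    (hF : LinearIndependent ℂ F) (h : ∑ i, ratMul (F i) (G i) = 0) (i : Fin n) : G i = 0 := by
  apply ratMul_left_eq_zero hF (F := G)
  rw [← sum_swap_ratMul, h, map_zero]

theorem lift_ratMul_injective : Injective (TensorProduct.lift (ratMul (α := α) (β := β))) := by
  rw [injective_iff_map_eq_zero]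
  intro t ht
  obtain ⟨S, rfl⟩ := TensorProduct.exists_finset t
  have e := S.equivFin
  have h0 : ∑ i ∈ S, i.1 ⊗ₜ[ℂ] i.2 = ∑ j, TensorProduct.mk ℂ (RatField α) (RatField β)
      (e.symm j).1.1 (e.symm j).1.2 := by
    rw [← sum_coe_sort S (fun i => i.1 ⊗ₜ[ℂ] i.2), ← e.symm.sum_comp]
    rfl
  obtain ⟨k, v, w, _, hw, h3⟩ := exists_linearIndependent_sum
    (TensorProduct.mk ℂ (RatField α) (RatField β))
    (fun j => (e.symm j).1.1) (fun j => (e.symm j).1.2)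
  rw [h0, h3] at ht ⊢
  rw [map_sum] at ht
  simp only [TensorProduct.mk_apply, TensorProduct.lift.tmul] at ht ⊢
  have := ratMul_left_eq_zero hw ht
  simp [this]

end Functions

section Joint

theorem toFun_tmul (c L K : ℕ) (x : Space c) (y : Space 1) :
    toFun c L K (x ⊗ₜ[ℂ] y) = ratMul (x L) (y K) := rfl

theorem toFun_eq (c L K : ℕ) (t : Space c ⊗[ℂ] Space 1) :
    toFun c L K t = TensorProduct.lift ratMul (TensorProduct.map
    (DirectSum.component ℂ ℕ (fun N => Rat c N) L)
    (DirectSum.component ℂ ℕ (fun N => Rat 1 N) K) t) := by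
  induction t with
  | zero => simp
  | add x y hx hy => simp only [map_add, hx, hy]
  | tmul x y => rfl

theorem directSum_apply_eq (c L K : ℕ) (t : Space c ⊗[ℂ] Space 1) :
    TensorProduct.directSum ℂ ℂ (fun N => Rat c N) (fun N => Rat 1 N) t (L, K) =
    TensorProduct.map (DirectSum.component ℂ ℕ (fun N => Rat c N) L)
    (DirectSum.component ℂ ℕ (fun N => Rat 1 N) K) t := by
  have : (DirectSum.component ℂ (ℕ × ℕ) (fun p => Rat c p.1 ⊗[ℂ] Rat 1 p.2) (L, K)) ∘ₗ
      (TensorProduct.directSum ℂ ℂ (fun N => Rat c N) (fun N => Rat 1 N)).toLinearMap =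
      TensorProduct.map (DirectSum.component ℂ ℕ (fun N => Rat c N) L)
      (DirectSum.component ℂ ℕ (fun N => Rat 1 N) K) := by
    apply TensorProduct.ext
    apply DirectSum.linearMap_ext
    intro i
    apply LinearMap.ext
    intro x
    apply DirectSum.linearMap_ext
    intro j
    apply LinearMap.ext
    intro y
    simp only [LinearMap.comp_apply, TensorProduct.mk_apply,
      LinearEquiv.coe_coe, TensorProduct.directSum_lof_tmul_lof, TensorProduct.map_tmul,
      LinearMap.compr₂ₛₗ_apply]
    by_cases hL : i = L
    · subst hL
      by_cases hK : j = K
      · subst hK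
        rw [DirectSum.component.lof_self, DirectSum.component.lof_self,
          DirectSum.component.lof_self]
      · rw [DirectSum.component.of, DirectSum.component.of, dif_neg (by simpa using hK),
          DirectSum.component.of, dif_neg hK, TensorProduct.tmul_zero]
    · rw [DirectSum.component.of, DirectSum.component.of, dif_neg (by simp [hL]), dif_neg hL,
        TensorProduct.zero_tmul]
  exact LinearMap.congr_fun this t

theorem eq_of_toFun (c : ℕ) {t t' : Space c ⊗[ℂ] Space 1}
    (h : ∀ L K, toFun c L K t = toFun c L K t') : t = t' := by
  apply (TensorProduct.directSum ℂ ℂ (fun N => Rat c N) (fun N => Rat 1 N)).injective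
  apply DFinsupp.ext
  rintro ⟨L, K⟩
  apply lift_ratMul_injective
  have := h L K
  rw [toFun_eq, toFun_eq] at this
  erw [directSum_apply_eq, directSum_apply_eq]
  exact this

end Joint

section Membership

/-- The action of permutations of the variables `y`. -/
def permL {c L K : ℕ} (s : Fin c → Perm (Fin L)) :
    RatField ((Fin c × Fin L) ⊕ (Fin 1 × Fin K)) →ₐ[ℂ]
    RatField ((Fin c × Fin L) ⊕ (Fin 1 × Fin K)) :=
  ratRename (Sum.map (fun p => (p.1, s p.1 p.2)) id) (by
    apply Injective.sumMap _ Function.injective_id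
    rintro ⟨i, a⟩ ⟨j, b⟩ h
    obtain ⟨rfl, h2⟩ := Prod.mk.inj h
    exact Prod.ext rfl ((s i).injective h2))

/-- The action of permutations of the variables `z`. -/
def permR {c L K : ℕ} (s : Perm (Fin K)) : RatField ((Fin c × Fin L) ⊕ (Fin 1 × Fin K)) →ₐ[ℂ]
    RatField ((Fin c × Fin L) ⊕ (Fin 1 × Fin K)) :=
  ratRename (Sum.map id (fun p => (p.1, s p.2))) (by
    apply Injective.sumMap Function.injective_id
    rintro ⟨i, a⟩ ⟨j, b⟩ h
    obtain ⟨rfl, h2⟩ := Prod.mk.inj h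
    exact Prod.ext rfl (s.injective h2))

theorem ratRename_ratRename {α β γ : Type} (f : α → β) (hf : Injective f) (g : β → γ)
    (hg : Injective g) (H : RatField α) :
    ratRename g hg (ratRename f hf H) = ratRename (fun s => g (f s)) (hg.comp hf) H := by
  rw [← ratSubst_var_eq hf, map_ratSubst, ← ratSubst_var_eq]
  simp only [ratRename_var]

theorem permFun_injective {c N : ℕ} (s : Fin c → Perm (Fin N)) :
    Injective (fun p : Fin c × Fin N => (p.1, s p.1 p.2)) := by
  rintro ⟨i, a⟩ ⟨j, b⟩ h
  obtain ⟨rfl, h2⟩ := Prod.mk.inj h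
  exact Prod.ext rfl ((s i).injective h2)

theorem permVars_eq {c N : ℕ} (s : Fin c → Perm (Fin N)) :
    permVars s = ratRename (fun p => (p.1, s p.1 p.2)) (permFun_injective s) := rfl

theorem permL_ratMul {c L K : ℕ} (s : Fin c → Perm (Fin L)) (F : Rat c L) (G : Rat 1 K) :
    permL s (ratMul F G) = ratMul (permVars s F) G := by
  rw [ratMul_apply, ratMul_apply, map_mul, permL, permVars_eq, ratRename_ratRename,
    ratRename_ratRename, ratRename_ratRename]
  rfl

theorem permR_ratMul {c L K : ℕ} (s : Fin 1 → Perm (Fin K)) (F : Rat c L) (G : Rat 1 K) :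
    permR (s 0) (ratMul F G) = ratMul F (permVars s G) := by
  rw [ratMul_apply, ratMul_apply, map_mul, permR, permVars_eq, ratRename_ratRename,
    ratRename_ratRename, ratRename_ratRename]
  have : (fun p : Fin 1 × Fin K => (Sum.map id (fun p : Fin 1 × Fin K => (p.1, s 0 p.2))
      (inr p) : (Fin c × Fin L) ⊕ (Fin 1 × Fin K))) = fun p => inr (p.1, s p.1 p.2) := by
    funext p
    obtain ⟨i, a⟩ := p
    fin_cases i
    rfl
  simp only [this]
  rfl

/-- A criterion for a function of `y` and `z` to belong to the tensor product of two shuffle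
algebras. -/
theorem exists_sum_ratMul {c L K : ℕ} (T : ShuffleType c) (T₁ : ShuffleType 1)
    (H : RatField ((Fin c × Fin L) ⊕ (Fin 1 × Fin K))) (hT : T.pole L ≠ 0) (hT₁ : T₁.pole K ≠ 0)
    (k : ℕ) (f : MvPolynomial ((Fin c × Fin L) ⊕ (Fin 1 × Fin K)) ℂ)
    (hf : H * algebraMap _ (RatField ((Fin c × Fin L) ⊕ (Fin 1 × Fin K)))
    (polyMul (T.pole L * allVars c L ^ k) (T₁.pole K * allVars 1 K ^ k)) = algebraMap _ _ f)
    (hy : ∀ y : Fin c → Fin L → ℂ, (∀ i a, y i a ≠ 0) → T.wheel L y →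
    ∀ z : Fin 1 × Fin K → ℂ, (∀ s, z s ≠ 0) → eval (Sum.elim (fun p => y p.1 p.2) z) f = 0)
    (hz : ∀ z : Fin 1 → Fin K → ℂ, (∀ i a, z i a ≠ 0) → T₁.wheel K z →
    ∀ y : Fin c × Fin L → ℂ, (∀ s, y s ≠ 0) → eval (Sum.elim y (fun p => z p.1 p.2)) f = 0)
    (hL : ∀ s : Fin c → Perm (Fin L), permL s H = (∏ i ∈ T.odd, ((Perm.sign (s i) : ℤ) : ℂ)) • H)
    (hR : ∀ s : Fin 1 → Perm (Fin K),
    permR (s 0) H = (∏ i ∈ T₁.odd, ((Perm.sign (s i) : ℤ) : ℂ)) • H) :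
    ∃ t : T.comp L ⊗[ℂ] T₁.comp K,
    TensorProduct.lift ratMul (mapIncl (T.comp L) (T₁.comp K) t) = H := by
  obtain ⟨n, P, Q, hP, hQ, rfl⟩ := exists_independent_polyMul f
  have hvar : ∀ (c' N : ℕ), allVars c' N ^ k ≠ 0 := fun c' N =>
    pow_ne_zero _ (prod_ne_zero_iff.2 fun t _ => X_ne_zero t)
  set A := T.pole L * allVars c L ^ k with hA
  set B := T₁.pole K * allVars 1 K ^ k with hB
  have hA0 : A ≠ 0 := mul_ne_zero hT (hvar _ _)
  have hB0 : B ≠ 0 := mul_ne_zero hT₁ (hvar _ _)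
  have hA1 := algebraMap_rat_ne_zero hA0
  have hB1 := algebraMap_rat_ne_zero hB0
  let v : Fin n → Rat c L := fun i => algebraMap _ _ (P i) / algebraMap _ _ A
  let w : Fin n → Rat 1 K := fun i => algebraMap _ _ (Q i) / algebraMap _ _ B
  have hlin : ∀ {σ : Type} (R : Fin n → MvPolynomial σ ℂ) (D : MvPolynomial σ ℂ),
      LinearIndependent ℂ R → D ≠ 0 → LinearIndependent ℂ
        (fun i => algebraMap _ (RatField σ) (R i) / algebraMap _ (RatField σ) D) := by
    intro σ R D hR hD
    rw [Fintype.linearIndependent_iff] at hR ⊢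
    intro g hg i
    refine hR g ?_ i
    apply algebraMap_rat_injective
    have h1 : (∑ i, g i • (algebraMap _ (RatField σ) (R i) / algebraMap _ (RatField σ) D)) *
        algebraMap _ (RatField σ) D = 0 := by rw [hg, zero_mul]
    rw [sum_mul] at h1
    rw [map_sum, map_zero, ← h1]
    refine sum_congr rfl fun j _ => ?_
    rw [smul_mul_assoc, div_mul_cancel₀ _ (algebraMap_rat_ne_zero hD),
      ← IsScalarTower.coe_toAlgHom' ℂ (MvPolynomial σ ℂ) (RatField σ), map_smul]
  have hv : LinearIndependent ℂ v := hlin P A hP hA0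
  have hw : LinearIndependent ℂ w := hlin Q B hQ hB0
  have hH : H = ∑ i, ratMul (v i) (w i) := by
    have h0 : algebraMap _ (RatField ((Fin c × Fin L) ⊕ (Fin 1 × Fin K))) (polyMul A B) ≠ 0 := by
      rw [algebraMap_polyMul, ratMul_apply]
      exact mul_ne_zero ((map_ne_zero _).2 hA1) ((map_ne_zero _).2 hB1)
    rw [← mul_left_inj' h0, hf, map_sum, sum_mul]
    refine sum_congr rfl fun i _ => ?_
    rw [algebraMap_polyMul, algebraMap_polyMul]
    have e1 : algebraMap _ (RatField (Fin c × Fin L)) (P i) = v i * algebraMap _ _ A :=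
      (div_mul_cancel₀ _ hA1).symm
    have e2 : algebraMap _ (RatField (Fin 1 × Fin K)) (Q i) = w i * algebraMap _ _ B :=
      (div_mul_cancel₀ _ hB1).symm
    rw [e1, e2]
    simp only [ratMul_apply, map_mul]
    ring
  have hvmem : ∀ i, v i ∈ T.comp L := by
    intro i
    refine ⟨⟨k, P i, div_mul_cancel₀ _ hA1, ?_⟩, ?_⟩
    · intro y hy0 hyw
      exact eval_left_eq_zero hQ _ (hy y hy0 hyw) i
    · intro s
      have h1 := hL s
      rw [hH, map_sum, smul_sum, ← sub_eq_zero, ← sum_sub_distrib] at h1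
      refine sub_eq_zero.1 (ratMul_left_eq_zero (F := fun i => permVars s (v i) -
        (∏ i ∈ T.odd, ((Perm.sign (s i) : ℤ) : ℂ)) • v i) hw ?_ i)
      rw [← h1]
      refine sum_congr rfl fun j _ => ?_
      rw [permL_ratMul, map_sub, LinearMap.sub_apply, map_smul, LinearMap.smul_apply]
  have hwmem : ∀ i, w i ∈ T₁.comp K := by
    intro i
    refine ⟨⟨k, Q i, div_mul_cancel₀ _ hB1, ?_⟩, ?_⟩
    · intro z hz0 hzw
      exact eval_right_eq_zero hP _ (hz z hz0 hzw) i
    · intro s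
      have h1 := hR s
      rw [hH, map_sum, smul_sum, ← sub_eq_zero, ← sum_sub_distrib] at h1
      refine sub_eq_zero.1 (ratMul_right_eq_zero (G := fun i => permVars s (w i) -
        (∏ i ∈ T₁.odd, ((Perm.sign (s i) : ℤ) : ℂ)) • w i) hv ?_ i)
      rw [← h1]
      refine sum_congr rfl fun j _ => ?_
      rw [permR_ratMul, map_sub, map_smul]
  refine ⟨∑ i, (⟨v i, hvmem i⟩ : T.comp L) ⊗ₜ[ℂ] (⟨w i, hwmem i⟩ : T₁.comp K), ?_⟩
  rw [map_sum, map_sum, hH]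
  rfl

end Membership

/-! ## Sums over families of subsets -/

section SetSum

variable {ι α β : Type} [Fintype ι] [DecidableEq ι] [Fintype α] [DecidableEq α]
    [Fintype β] [DecidableEq β] {M N : ℕ} {K : Type} [Field K]

/-- The subset enumerated by the first block of `e`. -/
def leftSet (e : Fin M ⊕ Fin N ≃ α) : Finset α := Finset.univ.map (Function.Embedding.inl.trans e.toEmbedding)

theorem mem_leftSet (e : Fin M ⊕ Fin N ≃ α) (x : α) : x ∈ leftSet e ↔ ∃ a, e (inl a) = x := by
  simp [leftSet]

theorem card_leftSet (e : Fin M ⊕ Fin N ≃ α) : (leftSet e).card = M := by simp [leftSet]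

theorem leftSet_enum (I : Sub M N) : leftSet I.enum = I.1 := by
  ext x
  rw [mem_leftSet]
  constructor
  · rintro ⟨a, rfl⟩
    unfold Sub.enum
    rw [finSumEquivOfFinset_inl]
    exact Finset.orderEmbOfFin_mem _ _ _
  · intro hx
    obtain ⟨y, rfl⟩ := I.enum.surjective x
    cases y with
    | inl a => exact ⟨a, rfl⟩
    | inr b =>
      unfold Sub.enum at hx
      rw [finSumEquivOfFinset_inr] at hx
      have := Finset.orderEmbOfFin_mem (I.1)ᶜ (by grind) b
      exact absurd hx (mem_compl.1 this)

theorem exists_perm_of_leftSet_eq {e e' : Fin M ⊕ Fin N ≃ α} (h : leftSet e = leftSet e') :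
    ∃ (p : Perm (Fin M)) (p' : Perm (Fin N)), e' = (Equiv.sumCongr p p').trans e := by
  have hm : Set.MapsTo (e'.trans e.symm) (Set.range inl) (Set.range inl) := by
    rintro _ ⟨a, rfl⟩
    have : e' (inl a) ∈ leftSet e := by rw [h, mem_leftSet]; exact ⟨a, rfl⟩
    obtain ⟨b, hb⟩ := (mem_leftSet _ _).1 this
    grind
  obtain ⟨⟨p, p'⟩, hp⟩ := Perm.mem_sumCongrHom_range_of_perm_mapsTo_inl hm
  refine ⟨p, p', ?_⟩
  have h2 : Equiv.sumCongr p p' = e'.trans e.symm := hp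
  grind

open Classical in
/-- The value of `Φ` on any enumeration of the family of subsets `S`. -/
def setTerm (Φ : (ι → (Fin M ⊕ Fin N ≃ α)) → K) (S : ι → Finset α) : K :=
  if h : ∀ i, ∃ e : Fin M ⊕ Fin N ≃ α, leftSet e = S i then Φ (fun i => (h i).choose) else 0

/-- `∑ Φ` over all families of subsets with `M` elements, given by enumerations. -/
def setSum (Φ : (ι → (Fin M ⊕ Fin N ≃ α)) → K) : K := ∑ S : ι → Finset α, setTerm Φ S

/-- `Φ` depends on the subsets only. -/
def SetInv (Φ : (ι → (Fin M ⊕ Fin N ≃ α)) → K) : Prop :=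
  ∀ e e', (∀ i, leftSet (e i) = leftSet (e' i)) → Φ e = Φ e'

theorem setTerm_leftSet {Φ : (ι → (Fin M ⊕ Fin N ≃ α)) → K} (h : SetInv Φ)
    (e : ι → (Fin M ⊕ Fin N ≃ α)) : setTerm Φ (fun i => leftSet (e i)) = Φ e := by
  unfold setTerm
  have h1 : ∀ i, ∃ e' : Fin M ⊕ Fin N ≃ α, leftSet e' = leftSet (e i) := fun i => ⟨e i, rfl⟩
  rw [dif_pos h1]
  exact h _ _ fun i => (h1 i).choose_spec

theorem setTerm_eq_of {Φ : (ι → (Fin M ⊕ Fin N ≃ α)) → K} {S : ι → Finset α}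
    (hS : setTerm Φ S ≠ 0) : ∃ e : ι → (Fin M ⊕ Fin N ≃ α), (∀ i, leftSet (e i) = S i) ∧
    setTerm Φ S = Φ e := by
  unfold setTerm at hS ⊢
  grind

theorem sum_Sub_eq_setSum {Φ : (ι → (Fin M ⊕ Fin N ≃ Fin (M + N))) → K} (h : SetInv Φ) :
    ∑ I : ι → Sub M N, Φ (fun i => (I i).enum) = setSum Φ := by
  apply Fintype.sum_of_injective (fun I : ι → Sub M N => fun i => (I i).1)
  · intro I I' hI
    funext i
    exact Subtype.ext (congrFun hI i)
  · intro S hS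
    by_contra h0
    obtain ⟨e, he, -⟩ := setTerm_eq_of h0
    apply hS
    refine ⟨fun i => ⟨S i, ?_⟩, rfl⟩
    rw [← he i, card_leftSet]
  · intro I
    rw [← setTerm_leftSet h]
    congr 1
    funext i
    exact leftSet_enum _

theorem leftSet_trans (e : Fin M ⊕ Fin N ≃ α) (σ : α ≃ β) :
    leftSet (e.trans σ) = (leftSet e).map σ.toEmbedding := by
  ext x
  simp only [mem_leftSet, mem_map_equiv, Equiv.trans_apply, Equiv.eq_symm_apply]

theorem SetInv.trans {Φ : (ι → (Fin M ⊕ Fin N ≃ β)) → K} (h : SetInv Φ) (σ : ι → (α ≃ β)) :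
    SetInv (fun e : ι → (Fin M ⊕ Fin N ≃ α) => Φ (fun i => (e i).trans (σ i))) := by
  intro e e' he
  apply h
  intro i
  rw [leftSet_trans, leftSet_trans, he]

theorem setSum_trans {Φ : (ι → (Fin M ⊕ Fin N ≃ β)) → K} (h : SetInv Φ) (σ : ι → (α ≃ β)) :
    setSum (fun e : ι → (Fin M ⊕ Fin N ≃ α) => Φ (fun i => (e i).trans (σ i))) = setSum Φ := by
  unfold setSum
  apply Fintype.sum_equiv (Equiv.piCongrRight fun i => (σ i).finsetCongr)
  intro S
  have hE : (Equiv.piCongrRight fun i => (σ i).finsetCongr) S =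
      fun i => (S i).map (σ i).toEmbedding := rfl
  rw [hE]
  by_cases h0 : ∀ i, ∃ e : Fin M ⊕ Fin N ≃ α, leftSet e = S i
  · choose e he using h0
    have h1 : S = fun i => leftSet (e i) := funext fun i => (he i).symm
    rw [h1, setTerm_leftSet (h.trans σ) e]
    simp only [← leftSet_trans]
    rw [setTerm_leftSet h]
  · unfold setTerm
    rw [dif_neg h0, dif_neg]
    intro h1
    apply h0
    intro i
    obtain ⟨e, he⟩ := h1 i
    refine ⟨e.trans (σ i).symm, ?_⟩
    rw [leftSet_trans, he, Finset.map_map]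
    convert Finset.map_refl
    ext x
    simp

end SetSum

/-! ## The shuffle product at a point -/

section StarEval

variable {c M N : ℕ} {α β : Type} [Fintype α] [DecidableEq α] [Fintype β] [DecidableEq β]
    {K K' : Type} [Field K] [Algebra ℂ K] [Field K'] [Algebra ℂ K']

/-- The first block of coordinates. -/
def ptL (x : Fin c → α → K) (e : Fin c → (Fin M ⊕ Fin N ≃ α)) : Fin c × Fin M → K :=
  fun p => x p.1 (e p.1 (inl p.2))

/-- The second block of coordinates. -/
def ptR (x : Fin c → α → K) (e : Fin c → (Fin M ⊕ Fin N ≃ α)) : Fin c × Fin N → K :=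
  fun p => x p.1 (e p.1 (inr p.2))

/-- The product of structure functions between two sets of variables. -/
def ShuffleType.omegaAt (T : ShuffleType c) (x : Fin c × Fin M → K) (y : Fin c × Fin N → K) : K :=
  ∏ i, ∏ j, ∏ a : Fin M, ∏ b : Fin N, T.ω K i j (x (i, a)) (y (j, b))

/-- The product of the signatures of the enumerations in fermionic colours, relative to `b`. -/
def ShuffleType.signAt (T : ShuffleType c) (b : Fin M ⊕ Fin N ≃ α)
    (e : Fin c → (Fin M ⊕ Fin N ≃ α)) : ℂ :=
  ∏ i ∈ T.odd, ((Perm.sign (b.symm.trans (e i)) : ℤ) : ℂ)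

/-- A summand of the shuffle product, evaluated at a point. -/
def ShuffleType.termAt (T : ShuffleType c) (b : Fin M ⊕ Fin N ≃ α) (F : Rat c M) (G : Rat c N)
    (x : Fin c → α → K) (e : Fin c → (Fin M ⊕ Fin N ≃ α)) : K :=
  T.signAt b e • (ratSubst (ptL x e) F * ratSubst (ptR x e) G * T.omegaAt (ptL x e) (ptR x e))

/-- Symmetry in bosonic and skew symmetry in fermionic variables. -/
def ShuffleType.Sym (T : ShuffleType c) {N : ℕ} (F : Rat c N) : Prop :=
  ∀ s : Fin c → Perm (Fin N),
      permVars s F = (∏ i ∈ T.odd, ((Perm.sign (s i) : ℤ) : ℂ)) • F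

theorem permVars_regSub {F : Rat c N} {φ : Fin c × Fin N → K} (hF : F ∈ regSub φ)
    (s : Fin c → Perm (Fin N)) {T : ShuffleType c} (h : T.Sym F) :
    F ∈ regSub (fun p => φ (p.1, s p.1 p.2)) := by
  have hφ : (fun p : Fin c × Fin N => φ (p.1, s p.1 p.2)) ∘
      (fun p : Fin c × Fin N => (p.1, (s p.1).symm p.2)) = φ := by
    funext p
    simp
  have h2 : permVars (fun i => (s i).symm) F ∈ regSub (fun p => φ (p.1, s p.1 p.2)) := by
    rw [permVars_eq]
    exact ratRename_mem_regSub (permFun_injective fun i => (s i).symm) (by rw [hφ]; exact hF)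
  rw [h] at h2
  have h3 : (∏ i ∈ T.odd, ((Perm.sign ((s i).symm) : ℤ) : ℂ)) ≠ 0 :=
    prod_ne_zero_iff.2 fun i _ => by simp
  have h4 := Subalgebra.smul_mem _ h2
    (∏ i ∈ T.odd, ((Perm.sign ((s i).symm) : ℤ) : ℂ))⁻¹
  rwa [smul_smul, inv_mul_cancel₀ h3, one_smul] at h4

theorem ratSubst_perm {T : ShuffleType c} {F : Rat c N} (h : T.Sym F) {φ : Fin c × Fin N → K}
    (hF : F ∈ regSub φ) (s : Fin c → Perm (Fin N)) : ratSubst (fun p => φ (p.1, s p.1 p.2)) F =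
    (∏ i ∈ T.odd, ((Perm.sign (s i) : ℤ) : ℂ)) • ratSubst φ F := by
  have h2 := permVars_regSub hF s h
  rw [← ratSubst_smul hF, ← h s, permVars_eq, ratSubst_ratRename]
  · rfl
  · exact h2

theorem ShuffleType.omegaAt_perm (T : ShuffleType c) (x : Fin c × Fin M → K)
    (y : Fin c × Fin N → K) (p : Fin c → Perm (Fin M)) (p' : Fin c → Perm (Fin N)) :
    T.omegaAt (fun s => x (s.1, p s.1 s.2)) (fun s => y (s.1, p' s.1 s.2)) = T.omegaAt x y := by
  unfold ShuffleType.omegaAt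
  refine prod_congr rfl fun i _ => prod_congr rfl fun j _ => ?_
  rw [← Equiv.prod_comp (p i) (fun a => ∏ b, T.ω K i j (x (i, a)) (y (j, b)))]
  refine prod_congr rfl fun a _ => ?_
  rw [← Equiv.prod_comp (p' j) (fun b => T.ω K i j (x (i, p i a)) (y (j, b)))]

theorem ShuffleType.setInv_termAt (T : ShuffleType c) (b : Fin M ⊕ Fin N ≃ α) {F : Rat c M}
    {G : Rat c N} (x : Fin c → α → K) (hF : T.Sym F) (hG : T.Sym G)
    (hxF : ∀ e : Fin c → (Fin M ⊕ Fin N ≃ α), F ∈ regSub (ptL x e))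
    (hxG : ∀ e : Fin c → (Fin M ⊕ Fin N ≃ α), G ∈ regSub (ptR x e)) :
    SetInv (T.termAt b F G x) := by
  intro e e' he
  choose p p' hp using fun i => exists_perm_of_leftSet_eq (he i)
  have hL : ptL x e' = fun s => ptL x e (s.1, p s.1 s.2) := by funext s; simp [ptL, hp]
  have hR : ptR x e' = fun s => ptR x e (s.1, p' s.1 s.2) := by funext s; simp [ptR, hp]
  have hs : T.signAt b e' = (∏ i ∈ T.odd, ((Perm.sign (p i) : ℤ) : ℂ)) *
      (∏ i ∈ T.odd, ((Perm.sign (p' i) : ℤ) : ℂ)) * T.signAt b e := by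
    unfold ShuffleType.signAt
    rw [← prod_mul_distrib, ← prod_mul_distrib]
    refine prod_congr rfl fun i _ => ?_
    have : b.symm.trans (e' i) =
        ((b.symm.trans ((Equiv.sumCongr (p i) (p' i)).trans b)).trans (b.symm.trans (e i))) := by grind
    rw [this, Perm.sign_trans, ← Equiv.trans_assoc, Perm.sign_symm_trans_trans,
      Perm.sign_sumCongr]
    push_cast
    ring
  unfold ShuffleType.termAt
  rw [hL, hR, hs, ratSubst_perm hF (hxF e), ratSubst_perm hG (hxG e), T.omegaAt_perm]
  rw [smul_mul_smul_comm, smul_mul_assoc, smul_smul]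
  congr 1
  have hsq : ∀ (M : ℕ) (p : Fin c → Perm (Fin M)),
      (∏ i ∈ T.odd, ((Perm.sign (p i) : ℤ) : ℂ)) *
      (∏ i ∈ T.odd, ((Perm.sign (p i) : ℤ) : ℂ)) = 1 := by
    intro M p
    rw [← prod_mul_distrib]
    refine prod_eq_one fun i _ => ?_
    rw [← Int.cast_mul, ← Units.val_mul, Int.units_mul_self]
    simp
  linear_combination -T.signAt b e * (∏ i ∈ T.odd, ((Perm.sign (p' i) : ℤ) : ℂ)) ^ 2 *
    hsq _ p - T.signAt b e * hsq _ p'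

theorem ShuffleType.termAt_trans (T : ShuffleType c) (b : Fin M ⊕ Fin N ≃ α) (F : Rat c M)
    (G : Rat c N) (x : Fin c → β → K) (σ : α ≃ β) (e : Fin c → (Fin M ⊕ Fin N ≃ α)) :
    T.termAt (b.trans σ) F G x (fun i => (e i).trans σ) =
    T.termAt b F G (fun i a => x i (σ a)) e := by
  have hs : T.signAt (b.trans σ) (fun i => (e i).trans σ) = T.signAt b e := by
    unfold ShuffleType.signAt
    refine prod_congr rfl fun i _ => ?_
    have : (b.trans σ).symm.trans ((e i).trans σ) =
        (σ.symm.trans (b.symm.trans (e i))).trans σ := by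
      ext z; simp
    rw [this, Perm.sign_symm_trans_trans]
  unfold ShuffleType.termAt
  rw [hs]
  rfl

/-- The structure functions are compatible with homomorphisms of fields. -/
def ShuffleType.Natural (T : ShuffleType c) : Prop :=
  ∀ (K K' : Type) [Field K] [Algebra ℂ K] [Field K'] [Algebra ℂ K'] (θ : K →ₐ[ℂ] K')
    (i j : Fin c) (x y : K), θ (T.ω K i j x y) = T.ω K' i j (θ x) (θ y)

theorem ShuffleType.star_apply (T : ShuffleType c) (F : Rat c M) (G : Rat c N) :
    T.star M N F G = ∑ I : Fin c → Sub M N, T.termAt finSumFinEquiv F G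
    (fun i a => (var (i, a) : Rat c (M + N))) (fun i => (I i).enum) := by
  unfold ShuffleType.star
  simp only [LinearMap.sum_apply, LinearMap.smul_apply, LinearMap.mk₂_apply]
  refine sum_congr rfl fun I _ => ?_
  unfold ShuffleType.termAt ShuffleType.signAt ptL ptR
  congr 1
  have h1 : onI I F = ratSubst (fun p : Fin c × Fin M =>
      (var (p.1, (I p.1).enum (inl p.2)) : Rat c (M + N))) F := by
    rw [ratSubst_var_eq (f := fun p : Fin c × Fin M => (p.1, (I p.1).enum (inl p.2)))]
    rfl
  have h2 : onJ I G = ratSubst (fun p : Fin c × Fin N =>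
      (var (p.1, (I p.1).enum (inr p.2)) : Rat c (M + N))) G := by
    rw [ratSubst_var_eq (f := fun p : Fin c × Fin N => (p.1, (I p.1).enum (inr p.2)))]
    rfl
  rw [h1, h2]
  rfl

theorem ptL_var_regSub (e : Fin c → (Fin M ⊕ Fin N ≃ α)) (F : Rat c M) :
    F ∈ regSub (ptL (fun i a => (var (i, a) : RatField (Fin c × α))) e) := by
  apply mem_regSub_var (f := fun p : Fin c × Fin M => (p.1, e p.1 (inl p.2)))
  rintro ⟨i, a⟩ ⟨j, b⟩ h
  obtain ⟨rfl, h2⟩ := Prod.mk.inj h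
  exact Prod.ext rfl (Sum.inl_injective ((e i).injective h2))

theorem ptR_var_regSub (e : Fin c → (Fin M ⊕ Fin N ≃ α)) (G : Rat c N) :
    G ∈ regSub (ptR (fun i a => (var (i, a) : RatField (Fin c × α))) e) := by
  apply mem_regSub_var (f := fun p : Fin c × Fin N => (p.1, e p.1 (inr p.2)))
  rintro ⟨i, a⟩ ⟨j, b⟩ h
  obtain ⟨rfl, h2⟩ := Prod.mk.inj h
  exact Prod.ext rfl (Sum.inr_injective ((e i).injective h2))

theorem ShuffleType.star_eq_setSum (T : ShuffleType c) {F : Rat c M} {G : Rat c N}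
    (hF : T.Sym F) (hG : T.Sym G) : T.star M N F G = setSum (T.termAt finSumFinEquiv F G
    (fun i a => (var (i, a) : Rat c (M + N)))) := by
  rw [T.star_apply, sum_Sub_eq_setSum]
  exact T.setInv_termAt _ _ hF hG (fun e => ptL_var_regSub e F) (fun e => ptR_var_regSub e G)

/-- Evaluation of the shuffle product at a point of any field, indexed by any set of indices. -/
theorem ShuffleType.ratSubst_star (T : ShuffleType c) {F : Rat c M} {G : Rat c N}
    (hF : T.Sym F) (hG : T.Sym G) (σ : Fin (M + N) ≃ α) (x : Fin c → α → K)
    (hxF : ∀ e : Fin c → (Fin M ⊕ Fin N ≃ α), F ∈ regSub (ptL x e))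
    (hxG : ∀ e : Fin c → (Fin M ⊕ Fin N ≃ α), G ∈ regSub (ptR x e))
    (hω : ∀ i j a b, (i, a) ≠ (j, b) →
    T.ω (Rat c (M + N)) i j (var (i, a)) (var (j, b)) ∈ regSub (fun p => x p.1 (σ p.2)) ∧
    ratSubst (fun p => x p.1 (σ p.2)) (T.ω (Rat c (M + N)) i j (var (i, a)) (var (j, b))) =
    T.ω K i j (x i (σ a)) (x j (σ b))) : ratSubst (fun p => x p.1 (σ p.2)) (T.star M N F G) =
    setSum (T.termAt (finSumFinEquiv.trans σ) F G x) := by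
  have hinv := T.setInv_termAt (finSumFinEquiv.trans σ) x hF hG hxF hxG
  rw [← setSum_trans hinv (fun _ => σ), T.star_apply, ← sum_Sub_eq_setSum (hinv.trans fun _ => σ)]
  simp only [T.termAt_trans]
  have key : ∀ e : Fin c → (Fin M ⊕ Fin N ≃ Fin (M + N)),
      T.termAt finSumFinEquiv F G (fun i a => (var (i, a) : Rat c (M + N))) e ∈
        regSub (fun p => x p.1 (σ p.2)) ∧
      ratSubst (fun p => x p.1 (σ p.2))
        (T.termAt finSumFinEquiv F G (fun i a => (var (i, a) : Rat c (M + N))) e) =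
        T.termAt finSumFinEquiv F G (fun i a => x i (σ a)) e := by
    intro e
    have injL : Injective (fun p : Fin c × Fin M => (p.1, e p.1 (inl p.2))) := by
      rintro ⟨i, a⟩ ⟨j, b⟩ h
      obtain ⟨rfl, h2⟩ := Prod.mk.inj h
      exact Prod.ext rfl (Sum.inl_injective ((e i).injective h2))
    have injR : Injective (fun p : Fin c × Fin N => (p.1, e p.1 (inr p.2))) := by
      rintro ⟨i, a⟩ ⟨j, b⟩ h
      obtain ⟨rfl, h2⟩ := Prod.mk.inj h
      exact Prod.ext rfl (Sum.inr_injective ((e i).injective h2))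
    have eL : ratSubst (ptL (fun i a => (var (i, a) : Rat c (M + N))) e) F =
        ratRename _ injL F := ratSubst_var_eq injL F
    have eR : ratSubst (ptR (fun i a => (var (i, a) : Rat c (M + N))) e) G =
        ratRename _ injR G := ratSubst_var_eq injR G
    have rL : ratRename _ injL F ∈ regSub (fun p => x p.1 (σ p.2)) :=
      ratRename_mem_regSub injL (hxF (fun i => (e i).trans σ))
    have rR : ratRename _ injR G ∈ regSub (fun p => x p.1 (σ p.2)) :=
      ratRename_mem_regSub injR (hxG (fun i => (e i).trans σ))
    have hne : ∀ i j a b, ((i, e i (inl a)) : Fin c × Fin (M + N)) ≠ (j, e j (inr b)) := by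
      intro i j a b h
      obtain ⟨rfl, h2⟩ := Prod.mk.inj h
      simpa using (e i).injective h2
    have rO : T.omegaAt (ptL (fun i a => (var (i, a) : Rat c (M + N))) e)
        (ptR (fun i a => (var (i, a) : Rat c (M + N))) e) ∈ regSub (fun p => x p.1 (σ p.2)) :=
      prod_mem fun i _ => prod_mem fun j _ => prod_mem fun a _ => prod_mem fun b _ =>
        (hω i j _ _ (hne i j a b)).1
    have eO : ratSubst (fun p => x p.1 (σ p.2))
        (T.omegaAt (ptL (fun i a => (var (i, a) : Rat c (M + N))) e)
          (ptR (fun i a => (var (i, a) : Rat c (M + N))) e)) =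
        T.omegaAt (ptL (fun i a => x i (σ a)) e) (ptR (fun i a => x i (σ a)) e) := by
      unfold ShuffleType.omegaAt
      simp only [ptL, ptR]
      rw [ratSubst_prod _ _ fun i _ => prod_mem fun j _ => prod_mem fun a _ => prod_mem fun b _ =>
        (hω i j _ _ (hne i j a b)).1]
      refine prod_congr rfl fun i _ => ?_
      rw [ratSubst_prod _ _ fun j _ => prod_mem fun a _ => prod_mem fun b _ =>
        (hω i j _ _ (hne i j a b)).1]
      refine prod_congr rfl fun j _ => ?_
      rw [ratSubst_prod _ _ fun a _ => prod_mem fun b _ => (hω i j _ _ (hne i j a b)).1]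
      refine prod_congr rfl fun a _ => ?_
      rw [ratSubst_prod _ _ fun b _ => (hω i j _ _ (hne i j a b)).1]
      grind
    unfold ShuffleType.termAt
    rw [eL, eR]
    refine ⟨Subalgebra.smul_mem _ (mul_mem (mul_mem rL rR) rO) _, ?_⟩
    rw [ratSubst_smul (mul_mem (mul_mem rL rR) rO), ratSubst_mul (mul_mem rL rR) rO,
      ratSubst_mul rL rR, eO, ratSubst_ratRename injL, ratSubst_ratRename injR]
    · rfl
    · exact hxG (fun i => (e i).trans σ)
    · exact hxF (fun i => (e i).trans σ)
  rw [ratSubst_sum _ _ fun I _ => (key _).1]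
  grind

/-- The image of a shuffle product under a homomorphism of fields. -/
theorem ShuffleType.map_star (T : ShuffleType c) (hT : T.Natural) (F : Rat c M) (G : Rat c N)
    (θ : Rat c (M + N) →ₐ[ℂ] K) :
    θ (T.star M N F G) = ∑ I : Fin c → Sub M N, T.termAt finSumFinEquiv F G
    (fun i a => θ (var (i, a))) (fun i => (I i).enum) := by
  rw [T.star_apply, map_sum]
  refine sum_congr rfl fun I _ => ?_
  unfold ShuffleType.termAt ShuffleType.omegaAt
  rw [map_smul, map_mul, map_mul, map_ratSubst, map_ratSubst]
  simp only [map_prod, hT _ _ θ]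
  rfl

end StarEval

/-! ## Symmetry of the shuffle product -/

section StarSym

variable {c M N : ℕ}

theorem ShuffleType.star_sym (T : ShuffleType c) (hT : T.Natural) {F : Rat c M} {G : Rat c N}
    (hF : T.Sym F) (hG : T.Sym G) : T.Sym (T.star M N F G) := by
  intro s
  have hinv := T.setInv_termAt finSumFinEquiv (fun i a => (var (i, a) : Rat c (M + N))) hF hG
    (fun e => ptL_var_regSub e F) (fun e => ptR_var_regSub e G)
  rw [T.map_star hT, T.star_eq_setSum hF hG, ← setSum_trans hinv s,
    ← sum_Sub_eq_setSum (hinv.trans s), smul_sum]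
  refine sum_congr rfl fun I _ => ?_
  have hvar : (fun i a => permVars s (var (i, a) : Rat c (M + N))) =
      fun i a => (var (i, s i a) : Rat c (M + N)) := by
    funext i a
    rw [permVars_eq, ratRename_var]
  rw [hvar]
  have hs : T.signAt finSumFinEquiv (fun i => (I i).enum.trans (s i)) =
      (∏ i ∈ T.odd, ((Perm.sign (s i) : ℤ) : ℂ)) *
        T.signAt finSumFinEquiv (fun i => (I i).enum) := by
    unfold ShuffleType.signAt
    rw [← prod_mul_distrib]
    refine prod_congr rfl fun i _ => ?_
    rw [← Equiv.trans_assoc, Perm.sign_trans]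
    push_cast
    rfl
  have hsq : (∏ i ∈ T.odd, ((Perm.sign (s i) : ℤ) : ℂ)) *
      (∏ i ∈ T.odd, ((Perm.sign (s i) : ℤ) : ℂ)) = 1 := by
    rw [← prod_mul_distrib]
    refine prod_eq_one fun i _ => ?_
    rw [← Int.cast_mul, ← Units.val_mul, Int.units_mul_self]
    simp
  unfold ShuffleType.termAt
  rw [hs, smul_smul, ← mul_assoc, hsq, one_mul]
  rfl

end StarSym

/-! ## Splitting products -/

section Split

variable {R : Type*} [CommRing R] {M N : ℕ} {α β : Type} [Fintype α] [Fintype β]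

theorem prod_split (e : Fin M ⊕ Fin N ≃ α) (f : α → R) :
    ∏ a, f a = (∏ a : Fin M, f (e (inl a))) * ∏ b : Fin N, f (e (inr b)) := by
  rw [← Equiv.prod_comp e, Fintype.prod_sum_type]

theorem prod_prod_split (e : Fin M ⊕ Fin N ≃ α) (e' : Fin M ⊕ Fin N ≃ β) (f : α → β → R) :
    ∏ a, ∏ b, f a b = ((∏ a : Fin M, ∏ b : Fin M, f (e (inl a)) (e' (inl b))) *
    (∏ a : Fin N, ∏ b : Fin N, f (e (inr a)) (e' (inr b)))) *
    ((∏ a : Fin M, ∏ b : Fin N, f (e (inl a)) (e' (inr b))) *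
    ∏ a : Fin N, ∏ b : Fin M, f (e (inr a)) (e' (inl b))) := by
  rw [prod_split e]
  simp only [prod_split e', prod_mul_distrib]
  ring

/-- `∏_{a < b} f a b`. -/
def pairProd {N : ℕ} (f : Fin N → Fin N → R) : R := ∏ a, ∏ b ∈ Finset.Ioi a, f a b

theorem pairProd_mul {N : ℕ} (f g : Fin N → Fin N → R) :
    pairProd (fun a b => f a b * g a b) = pairProd f * pairProd g := by
  simp [pairProd, prod_mul_distrib]

theorem pairProd_eq_filter {N : ℕ} (f : Fin N → Fin N → R) :
    pairProd f = ∏ p ∈ Finset.univ.filter (fun p : Fin N × Fin N => p.1 < p.2), f p.1 p.2 := by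
  unfold pairProd
  rw [prod_filter, ← Finset.univ_product_univ, prod_product]
  refine prod_congr rfl fun a _ => ?_
  rw [← prod_filter]
  refine prod_congr ?_ fun _ _ => rfl
  ext b
  simp

theorem pairProd_add (f : Fin (M + N) → Fin (M + N) → R) :
    pairProd f = (pairProd fun a b => f (Fin.castAdd N a) (Fin.castAdd N b)) *
    (pairProd fun a b => f (Fin.natAdd M a) (Fin.natAdd M b)) *
    ∏ a : Fin M, ∏ b : Fin N, f (Fin.castAdd N a) (Fin.natAdd M b) := by
  have key : ∀ {L : ℕ} (g : Fin L → Fin L → R), pairProd g =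
      ∏ a, ∏ b, if a < b then g a b else 1 := by
    intro L g
    unfold pairProd
    refine prod_congr rfl fun a _ => ?_
    rw [← prod_filter]
    refine prod_congr ?_ fun _ _ => rfl
    ext b
    simp
  rw [key, key, key]
  simp only [Fin.prod_univ_add, prod_mul_distrib]
  have h1 : ∀ (a : Fin M) (b : Fin N), Fin.castAdd N a < Fin.natAdd M b := by grind
  have h2 : ∀ (a : Fin M) (b : Fin N), ¬ Fin.natAdd M b < Fin.castAdd N a := fun a b =>
    not_lt.2 (h1 a b).le
  simp only [h1, h2, if_true, if_false, prod_const_one]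
  simp only [Fin.lt_def, Fin.val_castAdd, Fin.val_natAdd, Nat.add_lt_add_iff_left]
  ring

theorem pairProd_sub_perm {N : ℕ} (v : Fin N → R) (s : Perm (Fin N)) :
    (pairProd fun a b => v (s a) - v (s b)) =
    ((Perm.sign s : ℤ) : R) * pairProd fun a b => v a - v b := by
  have h : ∀ w : Fin N → R, (pairProd fun a b => w a - w b) =
      (Matrix.vandermonde fun a => -w a).det := by
    intro w
    rw [Matrix.det_vandermonde]
    unfold pairProd
    grind
  have h2 : (Matrix.vandermonde fun a => -v (s a)) =
      (Matrix.vandermonde fun a => -v a).submatrix s id := by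
    ext a b
    simp [Matrix.vandermonde_apply]
  rw [h (fun a => v (s a)), h v, h2, Matrix.det_permute]

/-- The Vandermonde product, split according to an enumeration of a subset. -/
theorem pairProd_sub_split (v : Fin (M + N) → R) (e : Fin M ⊕ Fin N ≃ Fin (M + N)) :
    (pairProd fun a b => v a - v b) = ((Perm.sign (finSumFinEquiv.symm.trans e) : ℤ) : R) *
    ((pairProd fun a b => v (e (inl a)) - v (e (inl b))) *
    (pairProd fun a b => v (e (inr a)) - v (e (inr b))) *
    ∏ a : Fin M, ∏ b : Fin N, (v (e (inl a)) - v (e (inr b)))) := by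
  have h := pairProd_sub_perm v (finSumFinEquiv.symm.trans e)
  rw [pairProd_add] at h
  simp only [Equiv.trans_apply, finSumFinEquiv_symm_apply_castAdd,
    finSumFinEquiv_symm_apply_natAdd] at h
  rw [h, ← mul_assoc, ← Int.cast_mul, ← Units.val_mul, Int.units_mul_self]
  simp

/-- Symmetric products over pairs do not depend on the ordering. -/
theorem pairProd_perm {N : ℕ} {f : Fin N → Fin N → R} (hf : ∀ a b, f a b = f b a)
    (s : Perm (Fin N)) : (pairProd fun a b => f (s a) (s b)) = pairProd f := by
  rw [pairProd_eq_filter, pairProd_eq_filter]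
  refine prod_bij' (fun p _ => if s p.1 < s p.2 then (s p.1, s p.2) else (s p.2, s p.1))
    (fun p _ => if s.symm p.1 < s.symm p.2 then (s.symm p.1, s.symm p.2)
      else (s.symm p.2, s.symm p.1)) ?_ ?_ ?_ ?_ ?_
  · rintro ⟨a, b⟩ h
    simp only [mem_filter, mem_univ, true_and] at h ⊢
    split_ifs with h1
    · exact h1
    · exact lt_of_le_of_ne (not_lt.1 h1) fun h2 => h.ne' (s.injective h2)
  · rintro ⟨a, b⟩ h
    simp only [mem_filter, mem_univ, true_and] at h ⊢
    split_ifs with h1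
    · exact h1
    · exact lt_of_le_of_ne (not_lt.1 h1) fun h2 => h.ne' (s.symm.injective h2)
  · grind
  · grind
  · grind

theorem pairProd_split {f : Fin (M + N) → Fin (M + N) → R} (hf : ∀ a b, f a b = f b a)
    (e : Fin M ⊕ Fin N ≃ Fin (M + N)) :
    pairProd f = (pairProd fun a b => f (e (inl a)) (e (inl b))) *
    (pairProd fun a b => f (e (inr a)) (e (inr b))) *
    ∏ a : Fin M, ∏ b : Fin N, f (e (inl a)) (e (inr b)) := by
  have h := pairProd_perm hf (finSumFinEquiv.symm.trans e)
  rw [pairProd_add] at h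
  simp only [Equiv.trans_apply, finSumFinEquiv_symm_apply_castAdd,
    finSumFinEquiv_symm_apply_natAdd] at h
  exact h.symm

theorem next_ne {c : ℕ} (hc : 2 ≤ c) (i : Fin c) : next i ≠ i := by
  intro h
  have := congrArg Fin.val h
  simp only [next] at this
  by_cases h1 : i.val + 1 < c
  · rw [Nat.mod_eq_of_lt h1] at this; omega
  · have h2 : i.val + 1 = c := by omega
    rw [h2, Nat.mod_self] at this
    omega

theorem next_next_ne {c : ℕ} (hc : 3 ≤ c) (i : Fin c) : next (next i) ≠ i := by
  intro h
  have := congrArg Fin.val h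
  simp only [next] at this
  rw [Nat.mod_add_mod] at this
  by_cases h1 : i.val + 1 + 1 < c
  · rw [Nat.mod_eq_of_lt h1] at this; omega
  · rw [Nat.mod_eq_sub_mod (by omega), Nat.mod_eq_of_lt (by omega)] at this
    omega

/-- A product over pairs of colours reduces to the colours and the edges of the cycle. -/
theorem prod_edges {c : ℕ} (hc : 3 ≤ c) (h : Fin c → Fin c → R)
    (h1 : ∀ i j, i ≠ j → j ≠ next i → i ≠ next j → h i j = 1) :
    ∏ i, ∏ j, h i j = ∏ i, (h i i * (h i (next i) * h (next i) i)) := by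
  have key : ∀ i j, h i j = (if i = j then h i j else 1) *
      ((if j = next i then h i j else 1) * (if i = next j then h i j else 1)) := by
    intro i j
    by_cases e1 : i = j
    · subst e1
      simp [(next_ne (by omega) i).symm]
    · by_cases e2 : j = next i
      · subst e2
        simp [(next_next_ne hc i).symm, e1]
      · grind
  have e3 : ∏ i, ∏ j, (if i = next j then h i j else 1) = ∏ j, h (next j) j := by
    rw [prod_comm]
    exact prod_congr rfl fun j _ => by rw [prod_ite_eq']; simp
  calc ∏ i, ∏ j, h i j = ∏ i, ∏ j, (if i = j then h i j else 1) *
      ((if j = next i then h i j else 1) * (if i = next j then h i j else 1)) :=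
        prod_congr rfl fun i _ => prod_congr rfl fun j _ => key i j
    _ = (∏ i, ∏ j, if i = j then h i j else 1) * ((∏ i, ∏ j, if j = next i then h i j else 1) *
        ∏ i, ∏ j, if i = next j then h i j else 1) := by
        simp only [prod_mul_distrib]
    _ = _ := by
        rw [e3]
        simp only [prod_ite_eq, prod_ite_eq', mem_univ, if_true,
          prod_mul_distrib]

end Split

/-! ## The structure functions of `Sh_{m|n}` -/

section Super

variable (P : Params) (m n : ℕ)

/-- Numerators of the structure functions. -/
def snum {R : Type} [CommRing R] [Algebra ℂ R] (i j : Fin (m + n)) (x y : R) : R :=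
  if i = j then
    if 1 ≤ i.val ∧ i.val ≤ m - 1 then x - P.q2 • y
    else if m + 1 ≤ i.val then x - P.q2⁻¹ • y
    else 1
  else if j = next i then
    if 1 ≤ j.val ∧ j.val ≤ m then x - P.q1 • y
    else x - P.q1⁻¹ • y
  else if i = next j then
    if 1 ≤ i.val ∧ i.val ≤ m then P.d • (P.q3 • y - x)
    else P.d⁻¹ • (P.q3⁻¹ • y - x)
  else 1

/-- Denominators of the structure functions. -/
def sden {R : Type} [CommRing R] (i j : Fin (m + n)) (x y : R) : R :=
  if i = j then
    if i ∈ Finset.univ.filter (fun i : Fin (m + n) => i.val = 0 ∨ i.val = m) then 1 else x - y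
  else if j = next i then x - y
  else if i = next j then y - x
  else 1

theorem super_omega (K : Type) [Field K] [Algebra ℂ K] (i j : Fin (m + n)) (x y : K) :
    (superType P m n).ω K i j x y = snum P m n i j x y / sden m n i j x y := by
  unfold superType snum sden
  dsimp only
  split_ifs with h1 h2 h3 h4 h5 h6 h7 h8 h9 <;> try rfl
  all_goals first
    | (exfalso; simp at *; omega)
    | simp
    | (rw [← neg_sub x y, div_neg, smul_div_assoc, ← smul_neg, ← neg_div, neg_sub])

theorem super_natural : (superType P m n).Natural := by
  intro K K' _ _ _ _ θ i j x y
  rw [super_omega, super_omega, map_div₀]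
  congr 1
  · unfold snum
    split_ifs <;> simp
  · unfold sden
    split_ifs <;> simp

theorem super_omega_regular {σ : Type} {K : Type} [Field K] [Algebra ℂ K] (φ : σ → K)
    (i j : Fin (m + n)) (s t : σ) (h : sden m n i j (φ s) (φ t) ≠ 0) :
    (superType P m n).ω (RatField σ) i j (var s) (var t) ∈ regSub φ ∧
    ratSubst φ ((superType P m n).ω (RatField σ) i j (var s) (var t)) =
    (superType P m n).ω K i j (φ s) (φ t) := by
  have hs := var_mem_regSub φ s
  have ht := var_mem_regSub φ t
  have h1 : snum P m n i j (var s : RatField σ) (var t) ∈ regSub φ ∧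
      ratSubst φ (snum P m n i j (var s : RatField σ) (var t)) = snum P m n i j (φ s) (φ t) := by
    have key : ∀ r : ℂ, (var s : RatField σ) - r • var t ∈ regSub φ ∧
        ratSubst φ ((var s : RatField σ) - r • var t) = φ s - r • φ t := fun r =>
      ⟨sub_mem hs (Subalgebra.smul_mem _ ht r), by
        rw [ratSubst_sub hs (Subalgebra.smul_mem _ ht r), ratSubst_smul ht, ratSubst_var,
          ratSubst_var]⟩
    have key' : ∀ r d : ℂ, d • (r • (var t : RatField σ) - var s) ∈ regSub φ ∧
        ratSubst φ (d • (r • (var t : RatField σ) - var s)) = d • (r • φ t - φ s) := fun r d =>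
      ⟨Subalgebra.smul_mem _ (sub_mem (Subalgebra.smul_mem _ ht r) hs) _, by
        rw [ratSubst_smul (sub_mem (Subalgebra.smul_mem _ ht r) hs),
          ratSubst_sub (Subalgebra.smul_mem _ ht r) hs, ratSubst_smul ht, ratSubst_var,
          ratSubst_var]⟩
    unfold snum
    split_ifs
    all_goals first
      | exact key _
      | exact key' _ _
      | exact ⟨one_mem _, ratSubst_one φ⟩
  have h2 : sden m n i j (var s : RatField σ) (var t) ∈ regSub φ ∧
      ratSubst φ (sden m n i j (var s : RatField σ) (var t)) = sden m n i j (φ s) (φ t) := by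
    unfold sden
    split_ifs
    · exact ⟨one_mem _, ratSubst_one φ⟩
    · exact ⟨sub_mem hs ht, by rw [ratSubst_sub hs ht, ratSubst_var, ratSubst_var]⟩
    · exact ⟨sub_mem hs ht, by rw [ratSubst_sub hs ht, ratSubst_var, ratSubst_var]⟩
    · exact ⟨sub_mem ht hs, by rw [ratSubst_sub ht hs, ratSubst_var, ratSubst_var]⟩
    · exact ⟨one_mem _, ratSubst_one φ⟩
  rw [super_omega, super_omega]
  exact ⟨div_mem_regSub h1.1 h2.1 (by rw [h2.2]; exact h), by
    rw [ratSubst_div h1.1 h2.1 (by rw [h2.2]; exact h), h1.2, h2.2]⟩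

end Super

/-! ## `Sh_{m|n}` is closed under the shuffle product -/

section Points

variable {c M N : ℕ} {R : Type} [CommRing R]

/-- The product of differences of variables of equal colour, for colours in `S`. -/
def vdmAt (S : Finset (Fin c)) (x : Fin c × Fin N → R) : R :=
  ∏ i ∈ S, pairProd fun a b => x (i, a) - x (i, b)

/-- The polynomial `vdmAt`. -/
def vdm (S : Finset (Fin c)) (N : ℕ) : MvPolynomial (Fin c × Fin N) ℂ := vdmAt S X

/-- The value of `cyclicPole`. -/
def poleAt (x : Fin c × Fin N → R) : R :=
  ∏ i : Fin c, ∏ a : Fin N, ∏ b : Fin N, (x (i, a) - x (next i, b))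

theorem aeval_vdm [Algebra ℂ R] (S : Finset (Fin c)) (x : Fin c × Fin N → R) :
    aeval x (vdm S N) = vdmAt S x := by
  simp [vdm, vdmAt, pairProd]

theorem aeval_cyclicPole [Algebra ℂ R] (x : Fin c × Fin N → R) :
    aeval x (cyclicPole c N) = poleAt x := by
  simp [cyclicPole, poleAt]

theorem cyclicPole_eq : cyclicPole c N = poleAt X := rfl

theorem rename_eq_aeval {σ τ : Type} (f : σ → τ) (p : MvPolynomial σ ℂ) :
    rename f p = aeval (fun s => (X (f s) : MvPolynomial τ ℂ)) p := by
  have : rename f = aeval (fun s => (X (f s) : MvPolynomial τ ℂ)) := by ext s; simp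
  grind

theorem rename_perm_cyclicPole (s : Fin c → Perm (Fin N)) :
    rename (fun p : Fin c × Fin N => (p.1, s p.1 p.2)) (cyclicPole c N) = cyclicPole c N := by
  rw [rename_eq_aeval, aeval_cyclicPole, cyclicPole_eq]
  unfold poleAt
  refine prod_congr rfl fun i _ => ?_
  rw [← Equiv.prod_comp (s i) (fun a => ∏ b, (X (i, a) - X (next i, b) :
    MvPolynomial (Fin c × Fin N) ℂ))]
  refine prod_congr rfl fun a _ => ?_
  rw [← Equiv.prod_comp (s (next i)) (fun b => (X (i, s i a) - X (next i, b) :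
    MvPolynomial (Fin c × Fin N) ℂ))]

theorem allVars_eq : allVars c N = ∏ i : Fin c, ∏ a : Fin N, X (i, a) := by
  rw [allVars, ← Finset.univ_product_univ, prod_product]

theorem rename_perm_allVars (s : Fin c → Perm (Fin N)) :
    rename (fun p : Fin c × Fin N => (p.1, s p.1 p.2)) (allVars c N) = allVars c N := by
  rw [allVars_eq]
  simp only [map_prod, rename_X]
  refine prod_congr rfl fun i _ => ?_
  rw [← Equiv.prod_comp (s i) (fun a => (X (i, a) : MvPolynomial (Fin c × Fin N) ℂ))]

theorem rename_perm_vdm (S : Finset (Fin c)) (s : Fin c → Perm (Fin N)) :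
    rename (fun p : Fin c × Fin N => (p.1, s p.1 p.2)) (vdm S N) =
    C (∏ i ∈ S, ((Perm.sign (s i) : ℤ) : ℂ)) * vdm S N := by
  rw [rename_eq_aeval, aeval_vdm, vdm, map_prod]
  unfold vdmAt
  rw [← prod_mul_distrib]
  refine prod_congr rfl fun i _ => ?_
  rw [pairProd_sub_perm (fun a => (X (i, a) : MvPolynomial (Fin c × Fin N) ℂ)) (s i)]
  simp

theorem allVars_split (e : Fin c → (Fin M ⊕ Fin N ≃ Fin (M + N))) :
    allVars c (M + N) = rename (fun p : Fin c × Fin M => (p.1, e p.1 (inl p.2))) (allVars c M) *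
    rename (fun p : Fin c × Fin N => (p.1, e p.1 (inr p.2))) (allVars c N) := by
  rw [allVars_eq, allVars_eq, allVars_eq]
  simp only [map_prod, rename_X]
  rw [← prod_mul_distrib]
  exact prod_congr rfl fun i _ => prod_split (e i) _

theorem sub_lin {σ : Type} (s t : σ) : (X s - X t : MvPolynomial σ ℂ) = lin 1 s 1 t := by simp [lin]

theorem vdm_dvd (S : Finset (Fin c)) {g : MvPolynomial (Fin c × Fin N) ℂ}
    (h : ∀ i ∈ S, ∀ a b, a ≠ b → ∀ p : Fin c × Fin N → ℂ, p (i, a) = p (i, b) → eval p g = 0) :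
    vdm S N ∣ g := by
  have hform : ∀ (i : Fin c) (a b : Fin N), a < b →
      (X (i, a) - X (i, b) : MvPolynomial (Fin c × Fin N) ℂ) ∈ Forms {((i, a), (i, b))} := by
    intro i a b hab
    rw [sub_lin]
    exact lin_mem_Forms one_ne_zero one_ne_zero (by simp [hab.ne]) rfl
  unfold vdm vdmAt pairProd
  apply prod_dvd_of_Forms S _ (fun i => {q | ∃ a b, a < b ∧ q = ((i, a), (i, b))})
  · intro i _
    refine prod_mem fun a _ => prod_mem fun b hb => ?_
    exact Forms_mono (by grind)
      (hform i a b (by simpa using hb))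
  · grind
  intro i hi
  apply prod_dvd_of_Forms Finset.univ _ (fun a => {q | ∃ b, a < b ∧ q = ((i, a), (i, b))})
  · intro a _
    refine prod_mem fun b hb => ?_
    exact Forms_mono (by grind)
      (hform i a b (by simpa using hb))
  · grind
  intro a _
  apply prod_dvd_of_Forms _ _ (fun b => {((i, a), (i, b))})
  · grind
  · grind
  intro b hb
  have hb2 : a < b := by simpa using hb
  show (X (i, a) - X (i, b) : MvPolynomial (Fin c × Fin N) ℂ) ∣ g
  rw [sub_lin]
  apply lin_dvd_of_torus one_ne_zero one_ne_zero (by simp [hb2.ne])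
  grind

end Points

section SuperSplit

variable (P : Params) (m n : ℕ) {M N : ℕ} {R : Type} [CommRing R]

/-- The bosonic colours. -/
def evens : Finset (Fin (m + n)) := Finset.univ.filter fun i => ¬ (i.val = 0 ∨ i.val = m)

theorem sden_self_of_even {i : Fin (m + n)} (hi : i ∈ evens m n) (x y : R) :
    sden m n i i x y = x - y := by
  unfold evens at hi
  unfold sden
  grind

theorem sden_self_of_odd {i : Fin (m + n)} (hi : i ∉ evens m n) (x y : R) :
    sden m n i i x y = 1 := by
  unfold evens at hi
  unfold sden
  grind

theorem sden_next (hc : 3 ≤ m + n) (i : Fin (m + n)) (x y : R) :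
    sden m n i (next i) x y = x - y := by
  unfold sden
  rw [if_neg (next_ne (by omega) i).symm, if_pos rfl]

theorem sden_prev (hc : 3 ≤ m + n) (i : Fin (m + n)) (x y : R) :
    sden m n (next i) i x y = y - x := by
  unfold sden
  rw [if_neg (next_ne (by omega) i), if_neg (next_next_ne hc i).symm, if_pos rfl]

theorem prod_sden (hc : 3 ≤ m + n) (x : Fin (m + n) × Fin M → R) (y : Fin (m + n) × Fin N → R) :
    ∏ i, ∏ j, ∏ a, ∏ b, sden m n i j (x (i, a)) (y (j, b)) =
    (∏ i ∈ evens m n, ∏ a, ∏ b, (x (i, a) - y (i, b))) *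
    ((∏ i, ∏ a, ∏ b, (x (i, a) - y (next i, b))) * ∏ i, ∏ b, ∏ a, (y (i, b) - x (next i, a))) := by
  rw [prod_edges hc]
  · rw [prod_mul_distrib, prod_mul_distrib]
    congr 1
    · rw [← prod_subset (Finset.subset_univ (evens m n))]
      · refine prod_congr rfl fun i hi => ?_
        simp only [sden_self_of_even m n hi]
      · intro i _ hi
        simp only [sden_self_of_odd m n hi, prod_const_one]
    · congr 1
      · simp only [sden_next m n hc]
      · simp only [sden_prev m n hc]
        exact prod_congr rfl fun i _ => prod_comm
  · intro i j h1 h2 h3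
    simp only [sden, if_neg h1, if_neg h2, if_neg h3, prod_const_one]

/-- The sign of a family of enumerations, in a set of colours. -/
def signOn {c : ℕ} (S : Finset (Fin c)) (e : Fin c → (Fin M ⊕ Fin N ≃ Fin (M + N))) : ℤ :=
  ∏ i ∈ S, (Perm.sign (finSumFinEquiv.symm.trans (e i)) : ℤ)

theorem vdm_pole_split (hc : 3 ≤ m + n) (x : Fin (m + n) × Fin (M + N) → R)
    (e : Fin (m + n) → (Fin M ⊕ Fin N ≃ Fin (M + N))) :
    vdmAt (evens m n) x * poleAt x = (signOn (evens m n) e : R) *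
    ((vdmAt (evens m n) (fun p => x (p.1, e p.1 (inl p.2))) *
    poleAt (fun p => x (p.1, e p.1 (inl p.2)))) *
    (vdmAt (evens m n) (fun p => x (p.1, e p.1 (inr p.2))) *
    poleAt (fun p => x (p.1, e p.1 (inr p.2)))) *
    ∏ i, ∏ j, ∏ a, ∏ b, sden m n i j (x (i, e i (inl a))) (x (j, e j (inr b)))) := by
  have h1 : vdmAt (evens m n) x = (signOn (evens m n) e : R) *
      (vdmAt (evens m n) (fun p => x (p.1, e p.1 (inl p.2))) *
      vdmAt (evens m n) (fun p => x (p.1, e p.1 (inr p.2))) *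
      ∏ i ∈ evens m n, ∏ a, ∏ b, (x (i, e i (inl a)) - x (i, e i (inr b)))) := by
    unfold vdmAt signOn
    rw [Int.cast_prod, ← prod_mul_distrib, ← prod_mul_distrib,
      ← prod_mul_distrib]
    exact prod_congr rfl fun i _ => pairProd_sub_split (fun a => x (i, a)) (e i)
  have h2 : poleAt x = poleAt (fun p => x (p.1, e p.1 (inl p.2))) *
      poleAt (fun p => x (p.1, e p.1 (inr p.2))) *
      ((∏ i, ∏ a, ∏ b, (x (i, e i (inl a)) - x (next i, e (next i) (inr b)))) *
        ∏ i, ∏ b, ∏ a, (x (i, e i (inr b)) - x (next i, e (next i) (inl a)))) := by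
    unfold poleAt
    rw [← prod_mul_distrib, ← prod_mul_distrib, ← prod_mul_distrib]
    exact prod_congr rfl fun i _ => prod_prod_split (e i) (e (next i)) _
  rw [h1, h2, prod_sden m n hc (fun p => x (p.1, e p.1 (inl p.2)))
    (fun p => x (p.1, e p.1 (inr p.2)))]
  ring

end SuperSplit

section Summand

variable (P : Params) (m n : ℕ) {M N : ℕ}

/-- The numerator of a summand of the shuffle product. -/
def psum (f : MvPolynomial (Fin (m + n) × Fin M) ℂ) (g : MvPolynomial (Fin (m + n) × Fin N) ℂ)
    (e : Fin (m + n) → (Fin M ⊕ Fin N ≃ Fin (M + N))) :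
    MvPolynomial (Fin (m + n) × Fin (M + N)) ℂ :=
  C ((superType P m n).signAt finSumFinEquiv e * (signOn (evens m n) e : ℂ)) *
    (rename (fun p => (p.1, e p.1 (inl p.2))) (f * vdm (evens m n) M) *
      rename (fun p => (p.1, e p.1 (inr p.2))) (g * vdm (evens m n) N) *
      ∏ i, ∏ j, ∏ a, ∏ b, snum P m n i j (X (i, e i (inl a))) (X (j, e j (inr b))))

theorem algebraMap_rat_smul {σ : Type} (r : ℂ) (p : MvPolynomial σ ℂ) :
    algebraMap _ (RatField σ) (r • p) = r • algebraMap _ (RatField σ) p := by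
  rw [← IsScalarTower.coe_toAlgHom' ℂ (MvPolynomial σ ℂ) (RatField σ), map_smul]

theorem algebraMap_snum {σ : Type} (i j : Fin (m + n)) (s t : σ) :
    algebraMap _ (RatField σ) (snum P m n i j (X s : MvPolynomial σ ℂ) (X t)) =
    snum P m n i j (var s) (var t) := by
  unfold snum var
  split_ifs <;> simp [algebraMap_rat_smul]

theorem sden_var_ne_zero {σ : Type} (i j : Fin (m + n)) {s t : σ} (h : s ≠ t) :
    sden m n i j (var s : RatField σ) (var t) ≠ 0 := by
  have h1 : (var s : RatField σ) - var t ≠ 0 := by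
    rw [var, var, ← map_sub, sub_lin]
    exact algebraMap_rat_ne_zero (lin_ne_zero (Or.inl h) one_ne_zero)
  have h2 : (var t : RatField σ) - var s ≠ 0 := by grind
  unfold sden
  grind

theorem summand_identity {K : Type} [Field K] {s t A B S D v p v' p' a a' : K} {k : ℕ}
    (hD : D ≠ 0) : s * (A * B * (S / D)) * (t * (v * p * (v' * p') * D) * (a * a') ^ k) =
    s * t * (A * (p * a ^ k) * v * (B * (p' * a' ^ k) * v') * S) := by
  rw [mul_pow]
  field_simp

theorem termAt_mul_eq (hc : 3 ≤ m + n) {F : Rat (m + n) M} {G : Rat (m + n) N} {k : ℕ}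
    {f : MvPolynomial (Fin (m + n) × Fin M) ℂ} {g : MvPolynomial (Fin (m + n) × Fin N) ℂ}
    (hf : F * algebraMap _ (Rat (m + n) M) (cyclicPole (m + n) M * allVars (m + n) M ^ k) =
    algebraMap _ _ f)
    (hg : G * algebraMap _ (Rat (m + n) N) (cyclicPole (m + n) N * allVars (m + n) N ^ k) =
    algebraMap _ _ g) (e : Fin (m + n) → (Fin M ⊕ Fin N ≃ Fin (M + N))) :
    (superType P m n).termAt finSumFinEquiv F G (fun i a => (var (i, a) : Rat (m + n) (M + N))) e *
    algebraMap _ _ (vdm (evens m n) (M + N) * (cyclicPole (m + n) (M + N) *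
    allVars (m + n) (M + N) ^ k)) = algebraMap _ _ (psum P m n f g e) := by
  have injL : Injective (fun p : Fin (m + n) × Fin M => (p.1, e p.1 (inl p.2))) := by
    rintro ⟨i, a⟩ ⟨j, b⟩ h
    obtain ⟨rfl, h2⟩ := Prod.mk.inj h
    exact Prod.ext rfl (Sum.inl_injective ((e i).injective h2))
  have injR : Injective (fun p : Fin (m + n) × Fin N => (p.1, e p.1 (inr p.2))) := by
    rintro ⟨i, a⟩ ⟨j, b⟩ h
    obtain ⟨rfl, h2⟩ := Prod.mk.inj h
    exact Prod.ext rfl (Sum.inr_injective ((e i).injective h2))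
  have eL : ratSubst (ptL (fun i a => (var (i, a) : Rat (m + n) (M + N))) e) F =
      ratRename _ injL F := ratSubst_var_eq injL F
  have eR : ratSubst (ptR (fun i a => (var (i, a) : Rat (m + n) (M + N))) e) G =
      ratRename _ injR G := ratSubst_var_eq injR G
  have hf' := congrArg (ratRename _ injL) hf
  have hg' := congrArg (ratRename _ injR) hg
  rw [map_mul, ratRename_algebraMap, ratRename_algebraMap, map_mul, map_pow, map_mul, map_pow,
    rename_eq_aeval _ (cyclicPole _ _), aeval_cyclicPole] at hf' hg'
  have hΩ : (superType P m n).omegaAt (ptL (fun i a => (var (i, a) : Rat (m + n) (M + N))) e)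
      (ptR (fun i a => (var (i, a) : Rat (m + n) (M + N))) e) =
      algebraMap (MvPolynomial _ ℂ) (Rat (m + n) (M + N)) (∏ i, ∏ j, ∏ a, ∏ b, snum P m n i j
        (X (i, e i (inl a)) : MvPolynomial (Fin (m + n) × Fin (M + N)) ℂ)
        (X (j, e j (inr b)))) /
      algebraMap (MvPolynomial _ ℂ) (Rat (m + n) (M + N)) (∏ i, ∏ j, ∏ a, ∏ b, sden m n i j
        (X (i, e i (inl a)) : MvPolynomial (Fin (m + n) × Fin (M + N)) ℂ)
        (X (j, e j (inr b)))) := by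
    unfold ShuffleType.omegaAt ptL ptR
    simp only [super_omega, prod_div_distrib, map_prod, algebraMap_snum]
    congr 1
    refine prod_congr rfl fun i _ => prod_congr rfl fun j _ =>
      prod_congr rfl fun a _ => prod_congr rfl fun b _ => ?_
    unfold sden var
    split_ifs <;> simp
  have hD : algebraMap _ (Rat (m + n) (M + N)) (∏ i, ∏ j, ∏ a, ∏ b, sden m n i j
        (X (i, e i (inl a)) : MvPolynomial (Fin (m + n) × Fin (M + N)) ℂ)
        (X (j, e j (inr b)))) ≠ 0 := by
    simp only [map_prod]
    refine prod_ne_zero_iff.2 fun i _ => prod_ne_zero_iff.2 fun j _ =>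
      prod_ne_zero_iff.2 fun a _ => prod_ne_zero_iff.2 fun b _ => ?_
    have := sden_var_ne_zero m n i j (s := ((i, e i (inl a)) : Fin (m + n) × Fin (M + N)))
      (t := (j, e j (inr b))) (by
        intro h
        obtain ⟨rfl, h2⟩ := Prod.mk.inj h
        simpa using (e i).injective h2)
    convert this using 1
    unfold sden var
    split_ifs <;> simp
  have hsplit := vdm_pole_split m n hc (X : _ → MvPolynomial (Fin (m + n) × Fin (M + N)) ℂ) e
  unfold ShuffleType.termAt psum
  rw [eL, eR, hΩ, allVars_split e, ← mul_assoc (vdm _ _), cyclicPole_eq, vdm, hsplit]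
  simp only [map_mul, map_pow, rename_eq_aeval _ (vdm _ _), aeval_vdm] at hf' hg' ⊢
  rw [← hf', ← hg', Algebra.smul_def, algebraMap_complex_eq]
  simp only [map_intCast]
  exact summand_identity hD

end Summand

section Closure

variable {P : Params} {m n : ℕ} {M N : ℕ}

open Fin.NatCast Fin.CommRing in
/-- The summands of the product vanish along the family of points through a cycle of zeros of
structure functions whose vertices form a wheel. -/
theorem aeval_psum_eq_zero {x₀ : Fin (m + n) → Fin (M + N) → ℂ} (hx₀ : ∀ i a, x₀ i a ≠ 0)
    {l : ℕ} (v : Fin (l + 1) → Fin (m + n) × Fin (M + N))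
    (hcyc : ∀ t, snum P m n (v (t + 1)).1 (v t).1 (x₀ (v (t + 1)).1 (v (t + 1)).2)
    (x₀ (v t).1 (v t).2) = 0)
    (hw : ∀ (N' : ℕ) (y : Fin (m + n) → Fin N' → ℂ) (u : Fin (l + 1) → Fin N') (r : ℂ),
    (∀ t, y (v t).1 (u t) = r * x₀ (v t).1 (v t).2) → (superType P m n).wheel N' y)
    {f : MvPolynomial (Fin (m + n) × Fin M) ℂ} {g : MvPolynomial (Fin (m + n) × Fin N) ℂ}
    (hf : ∀ y : Fin (m + n) → Fin M → ℂ, (∀ i a, y i a ≠ 0) → (superType P m n).wheel M y →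
    eval (fun p => y p.1 p.2) f = 0)
    (hg : ∀ y : Fin (m + n) → Fin N → ℂ, (∀ i a, y i a ≠ 0) → (superType P m n).wheel N y →
    eval (fun p => y p.1 p.2) g = 0)
    {τ : Type} (o : τ) (r : Fin (m + n) × Fin (M + N) → τ) (hr : ∀ t, r (v t) = o)
    (e : Fin (m + n) → (Fin M ⊕ Fin N ≃ Fin (M + N))) :
    aeval (mpt (fun s => x₀ s.1 s.2) r) (psum P m n f g e) = 0 := by
  apply eq_zero_of_torus
  intro p hp
  rw [eval_mpt]
  unfold psum
  simp only [map_mul]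
  by_cases hI : ∀ t, ((e (v t).1).symm (v t).2).isLeft
  · have : eval (fun s => x₀ s.1 s.2 * p (r s))
        (rename (fun p : Fin (m + n) × Fin M => (p.1, e p.1 (inl p.2))) f) = 0 := by
      rw [eval_rename]
      choose u hu using fun t => Sum.isLeft_iff.1 (hI t)
      refine hf (fun i a => x₀ i (e i (inl a)) * p (r (i, e i (inl a))))
        (fun i a => mul_ne_zero (hx₀ _ _) (hp _)) (hw _ _ u (p o) fun t => ?_)
      grind
    rw [this]; ring
  by_cases hJ : ∀ t, ((e (v t).1).symm (v t).2).isRight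
  · have : eval (fun s => x₀ s.1 s.2 * p (r s))
        (rename (fun p : Fin (m + n) × Fin N => (p.1, e p.1 (inr p.2))) g) = 0 := by
      rw [eval_rename]
      choose u hu using fun t => Sum.isRight_iff.1 (hJ t)
      refine hg (fun i a => x₀ i (e i (inr a)) * p (r (i, e i (inr a))))
        (fun i a => mul_ne_zero (hx₀ _ _) (hp _)) (hw _ _ u (p o) fun t => ?_)
      grind
    rw [this]; ring
  have hstep : ∃ t, ((e (v (t + 1)).1).symm (v (t + 1)).2).isLeft ∧
      ((e (v t).1).symm (v t).2).isRight := by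
    by_contra! hno
    apply hJ
    obtain ⟨t₀, ht₀⟩ := not_forall.1 hI
    have key : ∀ k : ℕ, ((e (v (t₀ + (k : Fin (l + 1)))).1).symm
        (v (t₀ + (k : Fin (l + 1)))).2).isRight := by
      intro k
      induction k with
      | zero => simpa using ht₀
      | succ k ih =>
        by_contra h
        refine hno (t₀ + k) ?_ ih
        rw [Nat.cast_succ, ← add_assoc] at h
        simpa using h
    intro t
    have := key (t - t₀).val
    rwa [Fin.cast_val_eq_self, add_sub_cancel] at this
  obtain ⟨t, h1, h2⟩ := hstep
  obtain ⟨a, ha⟩ := Sum.isLeft_iff.1 h1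
  obtain ⟨b, hb⟩ := Sum.isRight_iff.1 h2
  have ha' : e (v (t + 1)).1 (inl a) = (v (t + 1)).2 := by grind
  have hb' : e (v t).1 (inr b) = (v t).2 := by grind
  have hsn : eval (fun s => x₀ s.1 s.2 * p (r s)) (snum P m n (v (t + 1)).1 (v t).1
      (X ((v (t + 1)).1, e (v (t + 1)).1 (inl a)) :
        MvPolynomial (Fin (m + n) × Fin (M + N)) ℂ)
      (X ((v t).1, e (v t).1 (inr b)))) = 0 := by
    have h3 := hcyc t
    rw [ha', hb']
    unfold snum at h3 ⊢
    have hp1 : r ((v (t + 1)).1, (v (t + 1)).2) = o := hr _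
    have hp2 : r ((v t).1, (v t).2) = o := hr _
    split_ifs at h3 ⊢ <;> simp only [smul_eq_mul, one_ne_zero] at h3
    all_goals
      simp only [map_sub, smul_eval, eval_X, hp1, hp2]
      grind
  have : eval (fun s => x₀ s.1 s.2 * p (r s)) (∏ i, ∏ j, ∏ a, ∏ b, snum P m n i j
      (X (i, e i (inl a)) : MvPolynomial (Fin (m + n) × Fin (M + N)) ℂ)
      (X (j, e j (inr b)))) = 0 := by
    simp only [map_prod]
    rw [prod_eq_zero (mem_univ (v (t + 1)).1)]
    rw [prod_eq_zero (mem_univ (v t).1)]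
    rw [prod_eq_zero (mem_univ a)]
    rw [prod_eq_zero (mem_univ b)]
    exact hsn
  grind

theorem aeval_vdm_ne_zero {c N : ℕ} {x₀ : Fin c × Fin N → ℂ} (hx₀ : ∀ s, x₀ s ≠ 0)
    {τ : Type} {r : Fin c × Fin N → τ} (S : Finset (Fin c))
    (h : ∀ i a b, a ≠ b → r (i, a) = r (i, b) → x₀ (i, a) ≠ x₀ (i, b)) :
    aeval (mpt x₀ r) (vdm S N) ≠ 0 := by
  rw [aeval_vdm]
  unfold vdmAt pairProd
  refine prod_ne_zero_iff.2 fun i _ => prod_ne_zero_iff.2 fun a _ =>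
    prod_ne_zero_iff.2 fun b hb => ?_
  have hab : a ≠ b := (mem_Ioi.1 hb).ne
  exact lin_ne_zero (not_and_or.1 fun h' => h i a b hab h'.1 h'.2) (hx₀ _)

/-- A polynomial `h` such that `vdm * h` is a combination of the `psum`s vanishes at the wheel. -/
theorem eval_eq_zero_of_cycle {x₀ : Fin (m + n) → Fin (M + N) → ℂ} (hx₀ : ∀ i a, x₀ i a ≠ 0)
    {l : ℕ} (v : Fin (l + 1) → Fin (m + n) × Fin (M + N))
    (hcyc : ∀ t, snum P m n (v (t + 1)).1 (v t).1 (x₀ (v (t + 1)).1 (v (t + 1)).2)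
    (x₀ (v t).1 (v t).2) = 0)
    (hdist : ∀ t t', (v t).1 = (v t').1 → t ≠ t' → x₀ (v t).1 (v t).2 ≠ x₀ (v t').1 (v t').2)
    (hw : ∀ (N' : ℕ) (y : Fin (m + n) → Fin N' → ℂ) (u : Fin (l + 1) → Fin N') (r : ℂ),
    (∀ t, y (v t).1 (u t) = r * x₀ (v t).1 (v t).2) → (superType P m n).wheel N' y)
    {f : MvPolynomial (Fin (m + n) × Fin M) ℂ} {g : MvPolynomial (Fin (m + n) × Fin N) ℂ}
    (hf : ∀ y : Fin (m + n) → Fin M → ℂ, (∀ i a, y i a ≠ 0) → (superType P m n).wheel M y →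
    eval (fun p => y p.1 p.2) f = 0)
    (hg : ∀ y : Fin (m + n) → Fin N → ℂ, (∀ i a, y i a ≠ 0) → (superType P m n).wheel N y →
    eval (fun p => y p.1 p.2) g = 0) {h : MvPolynomial (Fin (m + n) × Fin (M + N)) ℂ}
    (hh : ∑ I : Fin (m + n) → Sub M N, psum P m n f g (fun i => (I i).enum) =
    vdm (evens m n) (M + N) * h) : eval (fun p => x₀ p.1 p.2) h = 0 := by
  classical
  set r : Fin (m + n) × Fin (M + N) → Option (Fin (m + n) × Fin (M + N)) :=
    fun s => if s ∈ Set.range v then none else some s with hrdef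
  have h1 := congrArg (aeval (mpt (fun s => x₀ s.1 s.2) r)) hh
  rw [map_mul, map_sum, sum_eq_zero fun I _ => aeval_psum_eq_zero hx₀ v hcyc hw hf hg none r
    (fun t => if_pos ⟨t, rfl⟩) _] at h1
  have h2 := (mul_eq_zero.1 h1.symm).resolve_left (aeval_vdm_ne_zero (fun s => hx₀ _ _) _ (by grind))
  have h3 := congrArg (eval fun _ => (1 : ℂ)) h2
  rw [eval_mpt, map_zero] at h3
  simpa using h3

end Closure

section Snum

variable (P : Params) (m n : ℕ) {R : Type} [CommRing R] [Algebra ℂ R]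

theorem snum_self_pos {i : Fin (m + n)} (h : 1 ≤ i.val ∧ i.val ≤ m - 1) (x y : R) :
    snum P m n i i x y = x - P.q2 • y := by
  unfold snum
  grind

theorem snum_self_neg {i : Fin (m + n)} (h : m + 1 ≤ i.val) (x y : R) :
    snum P m n i i x y = x - P.q2⁻¹ • y := by
  unfold snum
  grind

theorem snum_fwd_pos (hc : 3 ≤ m + n) {i : Fin (m + n)}
    (h : 1 ≤ (next i).val ∧ (next i).val ≤ m) (x y : R) :
    snum P m n i (next i) x y = x - P.q1 • y := by
  unfold snum
  rw [if_neg (next_ne (by omega) i).symm, if_pos rfl, if_pos h]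

theorem snum_fwd_neg (hc : 3 ≤ m + n) {i : Fin (m + n)}
    (h : ¬ (1 ≤ (next i).val ∧ (next i).val ≤ m)) (x y : R) :
    snum P m n i (next i) x y = x - P.q1⁻¹ • y := by
  unfold snum
  rw [if_neg (next_ne (by omega) i).symm, if_pos rfl, if_neg h]

theorem snum_bwd_pos (hc : 3 ≤ m + n) {i : Fin (m + n)}
    (h : 1 ≤ (next i).val ∧ (next i).val ≤ m) (x y : R) :
    snum P m n (next i) i x y = P.d • (P.q3 • y - x) := by
  unfold snum
  rw [if_neg (next_ne (by omega) i), if_neg (next_next_ne hc i).symm, if_pos rfl, if_pos h]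

theorem snum_bwd_neg (hc : 3 ≤ m + n) {i : Fin (m + n)}
    (h : ¬ (1 ≤ (next i).val ∧ (next i).val ≤ m)) (x y : R) :
    snum P m n (next i) i x y = P.d⁻¹ • (P.q3⁻¹ • y - x) := by
  unfold snum
  rw [if_neg (next_ne (by omega) i), if_neg (next_next_ne hc i).symm, if_pos rfl, if_neg h]

end Snum

theorem next_val_of_lt {c : ℕ} {i : Fin c} (h : i.val + 1 < c) : (next i).val = i.val + 1 :=
  Nat.mod_eq_of_lt h

theorem next_val_of_eq {c : ℕ} {i : Fin c} (h : i.val + 1 = c) : (next i).val = 0 := by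
  simp [next, h]

theorem next_val_cases {c : ℕ} (i : Fin c) :
    (i.val + 1 < c ∧ (next i).val = i.val + 1) ∨ (i.val + 1 = c ∧ (next i).val = 0) := by
  rcases Nat.lt_or_ge (i.val + 1) c with h | h
  · exact Or.inl ⟨h, next_val_of_lt h⟩
  · have h2 : i.val + 1 = c := le_antisymm i.2 h
    exact Or.inr ⟨h2, next_val_of_eq h2⟩

section Closure

variable {P : Params} {m n : ℕ} {M N : ℕ}

/-- The combinations `h` of numerators, and the vanishing of the numerators of both factors. -/
structure SumNum (P : Params) (m n M N : ℕ) (f : MvPolynomial (Fin (m + n) × Fin M) ℂ)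
    (g : MvPolynomial (Fin (m + n) × Fin N) ℂ)
    (h : MvPolynomial (Fin (m + n) × Fin (M + N)) ℂ) : Prop where
  hf : ∀ y : Fin (m + n) → Fin M → ℂ, (∀ i a, y i a ≠ 0) → (superType P m n).wheel M y →
      eval (fun p => y p.1 p.2) f = 0
  hg : ∀ y : Fin (m + n) → Fin N → ℂ, (∀ i a, y i a ≠ 0) → (superType P m n).wheel N y →
      eval (fun p => y p.1 p.2) g = 0
  hh : ∑ I : Fin (m + n) → Sub M N, psum P m n f g (fun i => (I i).enum) =
      vdm (evens m n) (M + N) * h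

variable {f : MvPolynomial (Fin (m + n) × Fin M) ℂ} {g : MvPolynomial (Fin (m + n) × Fin N) ℂ}
    {h : MvPolynomial (Fin (m + n) × Fin (M + N)) ℂ}

theorem SumNum.eval_cubic (H : SumNum P m n M N f g h) {x : Fin (m + n) → Fin (M + N) → ℂ}
    (hx : ∀ i a, x i a ≠ 0) {i j k : Fin (m + n)} {a b e : Fin (M + N)}
    (h1 : snum P m n j i (x j b) (x i a) = 0) (h2 : snum P m n k j (x k e) (x j b) = 0)
    (h3 : snum P m n i k (x i a) (x k e) = 0)
    (d1 : i = j → x i a ≠ x j b) (d2 : j = k → x j b ≠ x k e) (d3 : i = k → x i a ≠ x k e)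
    (hw : ∀ (N' : ℕ) (y : Fin (m + n) → Fin N' → ℂ) (r : ℂ) (a' b' e' : Fin N'),
    y i a' = r * x i a → y j b' = r * x j b → y k e' = r * x k e → (superType P m n).wheel N' y) :
    eval (fun p => x p.1 p.2) h = 0 := by
  refine eval_eq_zero_of_cycle hx ![(i, a), (j, b), (k, e)] ?_ ?_ ?_ H.hf H.hg H.hh
  · intro t
    fin_cases t
    · exact h1
    · exact h2
    · exact h3
  · intro t t'
    fin_cases t <;> fin_cases t' <;> intro hc ht
    all_goals first | exact absurd rfl ht | skip
    · exact d1 hc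
    · exact d3 hc
    · exact (d1 hc.symm).symm
    · exact d2 hc
    · exact (d3 hc.symm).symm
    · exact (d2 hc.symm).symm
  · intro N' y u r hu
    exact hw N' y r _ _ _ (hu 0) (hu 1) (hu 2)

theorem SumNum.eval_quartic (H : SumNum P m n M N f g h) {x : Fin (m + n) → Fin (M + N) → ℂ}
    (hx : ∀ i a, x i a ≠ 0) {i j k : Fin (m + n)} {a b e o : Fin (M + N)}
    (h1 : snum P m n j i (x j b) (x i a) = 0) (h2 : snum P m n k j (x k e) (x j b) = 0)
    (h3 : snum P m n j k (x j o) (x k e) = 0) (h4 : snum P m n i j (x i a) (x j o) = 0)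
    (d1 : i ≠ j) (d2 : j ≠ k) (d3 : i ≠ k) (d4 : x j b ≠ x j o)
    (hw : ∀ (N' : ℕ) (y : Fin (m + n) → Fin N' → ℂ) (r : ℂ) (a' b' e' o' : Fin N'),
    y i a' = r * x i a → y j b' = r * x j b → y k e' = r * x k e → y j o' = r * x j o →
    (superType P m n).wheel N' y) : eval (fun p => x p.1 p.2) h = 0 := by
  refine eval_eq_zero_of_cycle hx ![(i, a), (j, b), (k, e), (j, o)] ?_ ?_ ?_ H.hf H.hg H.hh
  · intro t
    fin_cases t
    · exact h1
    · exact h2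
    · exact h3
    · exact h4
  · intro t t'
    fin_cases t <;> fin_cases t' <;> intro hc ht
    all_goals first
      | exact absurd rfl ht
      | exact absurd hc d1
      | exact absurd hc d1.symm
      | exact absurd hc d2
      | exact absurd hc d2.symm
      | exact absurd hc d3
      | exact absurd hc d3.symm
      | exact d4
      | exact d4.symm
  · intro N' y u r hu
    exact hw N' y r _ _ _ _ (hu 0) (hu 1) (hu 2) (hu 3)

theorem Params.q1_mul (hq : P.q ≠ 0) (hd : P.d ≠ 0) : P.q1 * P.q2 * P.q3 = 1 := by
  unfold Params.q1 Params.q2 Params.q3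
  field_simp

theorem Params.q1_ne (hq : P.q ≠ 0) (hd : P.d ≠ 0) : P.q1 ≠ 0 := mul_ne_zero (inv_ne_zero hq) hd

theorem Params.q2_ne (hq : P.q ≠ 0) : P.q2 ≠ 0 := pow_ne_zero _ hq

theorem Params.q3_ne (hq : P.q ≠ 0) (hd : P.d ≠ 0) : P.q3 ≠ 0 :=
  mul_ne_zero (inv_ne_zero hq) (inv_ne_zero hd)

theorem SumNum.eval_wheel (H : SumNum P m n M N f g h) (hm : 2 ≤ m) (hn : 1 ≤ n) (hq : P.q ≠ 0)
    (hd : P.d ≠ 0) (hq2 : P.q2 ≠ 1) {x : Fin (m + n) → Fin (M + N) → ℂ} (hx : ∀ i a, x i a ≠ 0)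
    (hw : (superType P m n).wheel (M + N) x) : eval (fun p => x p.1 p.2) h = 0 := by
  have hc : 3 ≤ m + n := by omega
  have h123 := Params.q1_mul hq hd
  have n1 := Params.q1_ne hq hd
  have n2 := Params.q2_ne (P := P) hq
  have n3 := Params.q3_ne hq hd
  have e2 : P.q2 = P.q1⁻¹ * P.q3⁻¹ := by grind
  have hne : ∀ {u v : ℂ}, v ≠ 0 → u = P.q2 * v → v ≠ u := by grind
  have hne' : ∀ {u v : ℂ}, v ≠ 0 → u = P.q2⁻¹ * v → v ≠ u := by grind
  obtain ⟨i, hi⟩ := hw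
  have c1 := next_val_cases i
  have c2 := next_val_cases (next i)
  have di := next_ne (by omega) i
  have di' := next_ne (by omega) (next i)
  have di'' := next_next_ne hc i
  rcases hi with ⟨l1, l2, a, b, e, w1, w2⟩ | ⟨l1, l2, a, b, e, w1, w2⟩ |
    ⟨l1, a, b, e, o, w1, w2, w3⟩ | ⟨l1, a, b, e, w1, w2⟩ | ⟨l1, a, b, e, w1, w2⟩ |
    ⟨l1, a, b, e, o, w1, w2, w3⟩
  · apply H.eval_cubic hx (i := i) (j := next i) (k := next i) (a := a) (b := b) (e := e)
    · rw [snum_bwd_pos P m n hc (by omega), w1]; simp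
    · rw [snum_self_pos P m n (by omega), w2]; simp
    · rw [snum_fwd_pos P m n hc (by omega), w2, w1]
      simp only [smul_eq_mul]
      grind
    · grind
    · grind
    · grind
    · intro N' y r a' b' e' h1 h2 h3
      exact ⟨i, Or.inl ⟨l1, l2, a', b', e', by grind, by grind⟩⟩
  · apply H.eval_cubic hx (i := i) (j := i) (k := next i) (a := a) (b := b) (e := e)
    · rw [snum_self_pos P m n (by omega), w1]; simp
    · rw [snum_bwd_pos P m n hc (by omega), w2]; simp
    · rw [snum_fwd_pos P m n hc (by omega), w2, w1]
      simp only [smul_eq_mul]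
      grind
    · grind
    · grind
    · grind
    · intro N' y r a' b' e' h1 h2 h3
      exact ⟨i, Or.inr (Or.inl ⟨l1, l2, a', b', e', by grind,
        by grind⟩)⟩
  · apply H.eval_quartic hx (i := i) (j := next i) (k := next (next i)) (a := a) (b := b) (e := e)
      (o := o)
    · rw [snum_bwd_pos P m n hc (by omega), w1]; simp
    · rw [snum_bwd_neg P m n hc (by omega), w2]; simp
    · rw [snum_fwd_neg P m n hc (by omega), w3]; simp
    · rw [snum_fwd_pos P m n hc (by omega), w3, w2, w1]
      simp only [smul_eq_mul]
      grind
    · exact di.symm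
    · exact di'.symm
    · exact di''.symm
    · grind
    · intro N' y r a' b' e' o' h1 h2 h3 h4
      exact ⟨i, Or.inr (Or.inr (Or.inl ⟨l1, a', b', e', o', by grind,
        by grind, by grind⟩))⟩
  · apply H.eval_cubic hx (i := i) (j := next i) (k := next i) (a := a) (b := b) (e := e)
    · rw [snum_bwd_neg P m n hc (by omega), w1]; simp
    · rw [snum_self_neg P m n (by omega), w2]; simp
    · rw [snum_fwd_neg P m n hc (by omega), w2, w1]
      simp only [smul_eq_mul]
      grind
    · grind
    · grind
    · grind
    · intro N' y r a' b' e' h1 h2 h3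
      exact ⟨i, Or.inr (Or.inr (Or.inr (Or.inl ⟨l1, a', b', e', by grind,
        by grind⟩)))⟩
  · apply H.eval_cubic hx (i := i) (j := i) (k := next i) (a := a) (b := b) (e := e)
    · rw [snum_self_neg P m n (by omega), w1]; simp
    · rw [snum_bwd_neg P m n hc (by omega), w2]; simp
    · rw [snum_fwd_neg P m n hc (by omega), w2, w1]
      simp only [smul_eq_mul]
      grind
    · grind
    · grind
    · grind
    · intro N' y r a' b' e' h1 h2 h3
      exact ⟨i, Or.inr (Or.inr (Or.inr (Or.inr (Or.inl ⟨l1, a', b', e',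
        by grind, by grind⟩))))⟩
  · rw [inv_inv] at w2 w3
    apply H.eval_quartic hx (i := i) (j := next i) (k := next (next i)) (a := a) (b := b) (e := e)
      (o := o)
    · rw [snum_bwd_neg P m n hc (by omega), w1]; simp
    · rw [snum_bwd_pos P m n hc (by omega), w2]; simp
    · rw [snum_fwd_pos P m n hc (by omega), w3]; simp
    · rw [snum_fwd_neg P m n hc (by omega), w3, w2, w1]
      simp only [smul_eq_mul]
      grind
    · exact di.symm
    · exact di'.symm
    · exact di''.symm
    · grind
    · intro N' y r a' b' e' o' h1 h2 h3 h4
      exact ⟨i, Or.inr (Or.inr (Or.inr (Or.inr (Or.inr ⟨l1, a', b', e', o',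
        by grind, by grind,
        by grind⟩))))⟩

end Closure

section StarMem

variable {P : Params} {m n : ℕ} {M N : ℕ}

theorem comp_sym {c N : ℕ} {T : ShuffleType c} {F : Rat c N} (hF : F ∈ T.comp N) : T.Sym F := hF.2

theorem not_odd_of_even {i : Fin (m + n)} (hi : i ∈ evens m n) : i ∉ (superType P m n).odd := by
  unfold evens at hi
  unfold superType
  simpa using hi

theorem comp_exists_le {c N : ℕ} {T : ShuffleType c} {F : Rat c N} (hF : F ∈ T.comp N) :
    ∃ k₀, ∀ k, k₀ ≤ k → ∃ f : MvPolynomial (Fin c × Fin N) ℂ,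
    F * algebraMap _ (Rat c N) (T.pole N * allVars c N ^ k) = algebraMap _ (Rat c N) f ∧
    ∀ x : Fin c → Fin N → ℂ, (∀ i a, x i a ≠ 0) → T.wheel N x →
    eval (fun p => x p.1 p.2) f = 0 := by
  obtain ⟨⟨k₀, f, hf, hf'⟩, -⟩ := hF
  refine ⟨k₀, fun k hk => ⟨f * allVars c N ^ (k - k₀), ?_, fun x hx hw => ?_⟩⟩
  · rw [map_mul _ f, ← hf, mul_assoc, ← map_mul, mul_assoc, ← pow_add, Nat.add_sub_cancel' hk]
  · grind

theorem super_star_mem (hm : 2 ≤ m) (hn : 1 ≤ n) (hq : P.q ≠ 0) (hd : P.d ≠ 0) (hq2 : P.q2 ≠ 1)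
    {F : Rat (m + n) M} {G : Rat (m + n) N} (hF : F ∈ (superType P m n).comp M)
    (hG : G ∈ (superType P m n).comp N) :
    (superType P m n).star M N F G ∈ (superType P m n).comp (M + N) := by
  have hc : 3 ≤ m + n := by omega
  have hsym := (superType P m n).star_sym (super_natural P m n) (comp_sym hF) (comp_sym hG)
  refine ⟨?_, hsym⟩
  obtain ⟨k₁, hk₁⟩ := comp_exists_le hF
  obtain ⟨k₂, hk₂⟩ := comp_exists_le hG
  obtain ⟨f, hf, hf'⟩ := hk₁ (k₁ + k₂) (by omega)
  obtain ⟨g, hg, hg'⟩ := hk₂ (k₁ + k₂) (by omega)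
  set k := k₁ + k₂
  set Q := ∑ I : Fin (m + n) → Sub M N, psum P m n f g (fun i => (I i).enum) with hQ
  have hsum : (superType P m n).star M N F G * algebraMap _ _ (vdm (evens m n) (M + N) *
      (cyclicPole (m + n) (M + N) * allVars (m + n) (M + N) ^ k)) = algebraMap _ _ Q := by
    rw [ShuffleType.star_apply, sum_mul, hQ, map_sum]
    exact sum_congr rfl fun I _ => termAt_mul_eq P m n hc hf hg _
  have hskew : ∀ i ∈ evens m n, ∀ a b, a ≠ b →
      rename (fun p : Fin (m + n) × Fin (M + N) =>
        (p.1, (Function.update (fun _ => 1) i (Equiv.swap a b) :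
          Fin (m + n) → Perm (Fin (M + N)))
          p.1 p.2)) Q = -Q := by
    intro i hi a b hab
    set s : Fin (m + n) → Perm (Fin (M + N)) :=
      Function.update (fun _ => 1) i (Equiv.swap a b) with hs
    have h1 := congrArg (permVars s) hsum
    have hodd : ∏ j ∈ (superType P m n).odd, ((Perm.sign (s j) : ℤ) : ℂ) = 1 := by
      refine prod_eq_one fun j hj => ?_
      have : j ≠ i := by rintro rfl; exact not_odd_of_even hi hj
      simp [hs, this]
    have heven : ∏ j ∈ evens m n, ((Perm.sign (s j) : ℤ) : ℂ) = -1 := by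
      rw [prod_eq_single_of_mem i hi]
      · simp [hs, Perm.sign_swap hab]
      · intro j _ hj
        simp [hs, hj]
    rw [map_mul, hsym s, hodd, one_smul, permVars_eq, ratRename_algebraMap, map_mul, map_mul,
      map_mul _ (cyclicPole _ _), map_pow, ratRename_algebraMap, rename_perm_vdm, rename_perm_cyclicPole, rename_perm_allVars,
      heven] at h1
    apply algebraMap_rat_injective
    rw [← h1]
    refine Eq.trans ?_ ((congrArg Neg.neg hsum).trans (map_neg _ _).symm)
    simp
  obtain ⟨h, hh⟩ : vdm (evens m n) (M + N) ∣ Q := by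
    apply vdm_dvd
    intro i hi a b hab p hp
    have h1 := congrArg (eval p) (hskew i hi a b hab)
    rw [eval_rename, map_neg] at h1
    have h2 : (p ∘ fun q : Fin (m + n) × Fin (M + N) =>
        (q.1, (Function.update (fun _ => 1) i (Equiv.swap a b) :
          Fin (m + n) → Perm (Fin (M + N)))
          q.1 q.2)) = p := by
      funext ⟨j, e⟩
      by_cases hj : j = i
      · subst hj
        simp only [Function.comp_apply, Function.update_self]
        by_cases ha : e = a
        · rw [ha, Equiv.swap_apply_left, hp]
        · by_cases hb : e = b
          · rw [hb, Equiv.swap_apply_right, hp]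
          · rw [Equiv.swap_apply_of_ne_of_ne ha hb]
      · simp [hj]
    grind
  have H : SumNum P m n M N f g h := ⟨hf', hg', hh⟩
  refine ⟨k, h, ?_, fun x hx hw => H.eval_wheel hm hn hq hd hq2 hx hw⟩
  have hV : algebraMap _ (Rat (m + n) (M + N)) (vdm (evens m n) (M + N)) ≠ 0 := by
    apply algebraMap_rat_ne_zero
    unfold vdm vdmAt pairProd
    refine prod_ne_zero_iff.2 fun i _ => prod_ne_zero_iff.2 fun a _ =>
      prod_ne_zero_iff.2 fun b hb => ?_
    show (X (i, a) - X (i, b) : MvPolynomial (Fin (m + n) × Fin (M + N)) ℂ) ≠ 0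
    rw [sub_lin]
    exact lin_ne_zero (Or.inl (by simpa using (mem_Ioi.1 hb).ne)) one_ne_zero
  apply mul_left_cancel₀ hV
  rw [← map_mul, ← hh, ← hsum, map_mul _ (vdm _ _)]
  show _ * (_ * algebraMap _ _ (cyclicPole (m + n) (M + N) * _)) = _
  ring

end StarMem

/-! ## The parameters -/

namespace Params

variable {P : Params}

theorem Valid.n1 (h : P.Valid) : P.q1 ≠ 0 := q1_ne h.q_ne h.d_ne
theorem Valid.n2 (h : P.Valid) : P.q2 ≠ 0 := q2_ne h.q_ne
theorem Valid.n3 (h : P.Valid) : P.q3 ≠ 0 := q3_ne h.q_ne h.d_ne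
theorem Valid.mul (h : P.Valid) : P.q1 * P.q2 * P.q3 = 1 := q1_mul h.q_ne h.d_ne

theorem Valid.q1_eq (h : P.Valid) : P.q1 = P.q2⁻¹ * P.q3⁻¹ := by
  have := h.mul
  grind

theorem Valid.zpow_inj (h : P.Valid) {a b a' b' : ℤ}
    (h2 : P.q2 ^ a * P.q3 ^ b = P.q2 ^ a' * P.q3 ^ b') : a = a' ∧ b = b' := by
  have n2 := h.n2
  have n3 := h.n3
  have key : P.q1 ^ (0 : ℤ) * P.q2 ^ (a - a') * P.q3 ^ (b - b') = 1 := by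
    rw [zpow_zero, one_mul, zpow_sub₀ n2, zpow_sub₀ n3, div_mul_div_comm, h2]
    exact div_self (mul_ne_zero (zpow_ne_zero _ n2) (zpow_ne_zero _ n3))
  obtain ⟨h3, h4⟩ := h.generic _ _ _ key
  omega

theorem Valid.q2_ne_one (h : P.Valid) : P.q2 ≠ 1 := by
  intro h1
  have := h.zpow_inj (a := 1) (b := 0) (a' := 0) (b' := 0) (by simp [h1])
  omega

theorem Valid.sfq_ne (P : Params) (m n : ℕ) : P.sfq m n ≠ 0 := Complex.exp_ne_zero _

end Params

section Coefficients

variable {P : Params} {m k : ℕ}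

/-- The specializations are powers of `𝗊` and `q_3`, with exponents increasing by one along the
edges between the colours `0, …, m`, and decreasing along the others. -/
def expo (m i : ℕ) : ℤ := if i ≤ m then i else 2 * (m : ℤ) - i

theorem ycoef_eq (n i : ℕ) : ycoef P m n i = P.q1 * P.sfq m n ^ expo m i := by
  unfold ycoef expo
  split_ifs with h1 h2 h3
  · simp [h1]
  · omega
  · simp
  · rfl

theorem zcoef_eq (i : ℕ) : ζ i = P.q3 ^ (expo m i - 1) := by
  unfold zcoef expo
  grind

theorem expo_succ_of_lt {i : ℕ} (h : i < m) : expo m (i + 1) = expo m i + 1 := by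
  unfold expo
  grind

theorem expo_succ_of_le {i : ℕ} (h : m ≤ i) : expo m (i + 1) = expo m i - 1 := by
  unfold expo
  grind

theorem ycoef_ne (hP : P.Valid) (n i : ℕ) : ycoef P m n i ≠ 0 := by
  rw [ycoef_eq]
  exact mul_ne_zero hP.n1 (zpow_ne_zero _ (Params.Valid.sfq_ne _ _ _))

theorem zcoef_ne (hP : P.Valid) (i : ℕ) : ζ i ≠ 0 := by
  rw [zcoef_eq]
  exact zpow_ne_zero _ hP.n3

theorem zcoef_succ_of_lt (hP : P.Valid) {i : ℕ} (h : i < m) : ζ (i + 1) = P.q3 * ζ i := by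
  rw [zcoef_eq, zcoef_eq, expo_succ_of_lt h, add_sub_right_comm, zpow_add_one₀ hP.n3, mul_comm]

theorem zcoef_succ_of_le (hP : P.Valid) {i : ℕ} (h : m ≤ i) : ζ (i + 1) = P.q3⁻¹ * ζ i := by
  rw [zcoef_eq, zcoef_eq, expo_succ_of_le h, sub_right_comm, zpow_sub_one₀ hP.n3, mul_comm]

theorem ycoef_succ_of_lt {n i : ℕ} (h : i < m) :
    ycoef P m n (i + 1) = P.sfq m n * ycoef P m n i := by
  rw [ycoef_eq, ycoef_eq, expo_succ_of_lt h, zpow_add_one₀ (Params.Valid.sfq_ne _ _ _)]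
  ring

theorem ycoef_succ_of_le {n i : ℕ} (h : m ≤ i) :
    ycoef P m n (i + 1) = (P.sfq m n)⁻¹ * ycoef P m n i := by
  rw [ycoef_eq, ycoef_eq, expo_succ_of_le h, zpow_sub_one₀ (Params.Valid.sfq_ne _ _ _)]
  ring

theorem sfq_zpow (hP : P.Valid) (h : k < m) : 𝔮 ^ ((m : ℤ) - k) = P.q1⁻¹ := by
  unfold Params.sfq Params.q1pow
  rw [← Complex.exp_int_mul, ← hP.exp_logq1, ← Complex.exp_neg]
  congr 1
  have : (m : ℂ) - k ≠ 0 := sub_ne_zero.2 (by exact_mod_cast h.ne')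
  push_cast
  grind

theorem ycoef_zero (n : ℕ) : ycoef P m n 0 = P.q1 := by simp [ycoef]

theorem ycoef_last (hP : P.Valid) (h : k < m) : η (m + k) = 1 := by
  rw [ycoef_eq]
  have : expo m (m + k) = (m : ℤ) - k := by
    unfold expo
    grind
  rw [this, sfq_zpow hP h, mul_inv_cancel₀ hP.n1]

theorem zcoef_zero : ζ 0 = P.q3⁻¹ := by
  rw [zcoef_eq]
  simp [expo]

theorem zcoef_last : ζ (m + k) = P.q3 ^ ((m : ℤ) - k - 1) := by
  rw [zcoef_eq]
  congr 1
  unfold expo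
  grind

end Coefficients

/-! ## Vanishing of the numerators -/

/-- The zeros of numerators of elements of `Sh_{m|n}` that are forced by the wheel conditions and
the skew symmetry, for variables indexed by any set: the colour `i` contains a variable which is
proportional to another one. -/
structure RatioVanish (P : Params) (m n : ℕ) {α : Type} (f : MvPolynomial (Fin (m + n) × α) ℂ) :
    Prop where
  skew : ∀ i : Fin (m + n), (i.val = 0 ∨ i.val = m) → ∀ x : Fin (m + n) × α → ℂ, (∀ s, x s ≠ 0) →
    ∀ a b, a ≠ b → x (i, a) = x (i, b) → eval x f = 0
  pos : ∀ i : Fin (m + n), i.val ≠ 0 → ∀ x : Fin (m + n) × α → ℂ, (∀ s, x s ≠ 0) →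
    ∀ e b, x (i, e) = P.q2 * x (i, b) →
    (i.val ≤ m → ∃ j a, next j = i ∧ x (i, b) = P.q3 * x (j, a)) →
    (m ≤ i.val → ∃ a, x (next i, a) = P.q3⁻¹ * x (i, b)) → eval x f = 0
  neg : ∀ i : Fin (m + n), i.val ≠ m → ∀ x : Fin (m + n) × α → ℂ, (∀ s, x s ≠ 0) →
    ∀ e b, x (i, e) = P.q2⁻¹ * x (i, b) →
    (i.val = 0 ∨ m < i.val → ∃ j a, next j = i ∧ x (i, b) = P.q3⁻¹ * x (j, a)) →
    (i.val < m → ∃ a, x (next i, a) = P.q3 * x (i, b)) → eval x f = 0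

theorem RatioVanish.rename {P : Params} {m n : ℕ} {α β : Type}
    {f : MvPolynomial (Fin (m + n) × α) ℂ} (h : RatioVanish P m n f) (σ : α ≃ β) :
    RatioVanish P m n (rename (fun p => (p.1, σ p.2)) f) where
  skew i hi x hx a b hab hxab := by
    rw [eval_rename]
    exact h.skew i hi _ (fun s => hx _) (σ.symm a) (σ.symm b) (by simpa using hab) (by simpa)
  pos i hi x hx e b heb ha hb := by
    rw [eval_rename]
    refine h.pos i hi _ (fun s => hx _) (σ.symm e) (σ.symm b) (by simpa) ?_ ?_
    · intro h1
      obtain ⟨j, a, h2, h3⟩ := ha h1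
      exact ⟨j, σ.symm a, h2, by simpa⟩
    · intro h1
      obtain ⟨a, h3⟩ := hb h1
      exact ⟨σ.symm a, by simpa⟩
  neg i hi x hx e b heb ha hb := by
    rw [eval_rename]
    refine h.neg i hi _ (fun s => hx _) (σ.symm e) (σ.symm b) (by simpa) ?_ ?_
    · intro h1
      obtain ⟨j, a, h2, h3⟩ := ha h1
      exact ⟨j, σ.symm a, h2, by simpa⟩
    · intro h1
      obtain ⟨a, h3⟩ := hb h1
      exact ⟨σ.symm a, by simpa⟩

theorem exists_ratioVanish {P : Params} {m n N : ℕ} (hm : 0 < m) (hP : P.Valid)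
    {F : Rat (m + n) N} (hF : F ∈ (superType P m n).comp N) :
    ∃ (k : ℕ) (f : MvPolynomial (Fin (m + n) × Fin N) ℂ),
    F * algebraMap _ (Rat (m + n) N) (cyclicPole (m + n) N * allVars (m + n) N ^ k) =
    algebraMap _ _ f ∧ RatioVanish P m n f := by
  obtain ⟨⟨k, f, hf, hw⟩, hsym⟩ := hF
  have e2 := hP.q1_eq
  have n2 := hP.n2
  have n3 := hP.n3
  refine ⟨k, f, hf, ⟨?_, ?_, ?_⟩⟩
  · intro i hi x hx a b hab hxab
    set s : Fin (m + n) → Perm (Fin N) := Function.update (fun _ => 1) i (Equiv.swap a b) with hs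
    have hodd : ∏ j ∈ (superType P m n).odd, ((Perm.sign (s j) : ℤ) : ℂ) = -1 := by
      rw [prod_eq_single_of_mem i (by simpa [superType] using hi)]
      · simp [hs, Perm.sign_swap hab]
      · intro j _ hj
        simp [hs, hj]
    have h1 := congrArg (permVars s) hf
    rw [map_mul, hsym s, hodd, permVars_eq, ratRename_algebraMap, ratRename_algebraMap, map_mul,
      map_pow, rename_perm_allVars] at h1
    have h0 : MvPolynomial.rename (fun p : Fin (m + n) × Fin N => (p.1, s p.1 p.2))
      ((superType P m n).pole N) = (superType P m n).pole N := rename_perm_cyclicPole s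
    rw [h0] at h1
    have h2 : MvPolynomial.rename (fun p : Fin (m + n) × Fin N => (p.1, s p.1 p.2)) f = -f := by
      apply algebraMap_rat_injective
      rw [← h1]
      refine Eq.trans ?_ ((congrArg Neg.neg hf).trans (map_neg _ _).symm)
      simp
    have h3 := congrArg (eval x) h2
    rw [eval_rename, map_neg] at h3
    have h4 : (x ∘ fun q : Fin (m + n) × Fin N => (q.1, s q.1 q.2)) = x := by
      funext ⟨j, e⟩
      by_cases hj : j = i
      · grind
      · simp [hs, hj]
    grind
  · intro i hi x hx e b heb ha hb
    refine hw (fun i a => x (i, a)) (fun _ _ => hx _) ?_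
    rcases lt_trichotomy i.val m with h | h | h
    · obtain ⟨j, a, rfl, h2⟩ := ha h.le
      exact ⟨j, Or.inl ⟨Nat.one_le_iff_ne_zero.2 hi, Nat.le_sub_one_of_lt h, a, b, e, h2, heb⟩⟩
    · obtain ⟨j, a, rfl, h2⟩ := ha h.le
      obtain ⟨a', h3⟩ := hb h.ge
      refine ⟨j, Or.inr (Or.inr (Or.inl ⟨h, a, b, a', e, h2, h3, ?_⟩))⟩
      grind
    · obtain ⟨a', h3⟩ := hb h.le
      refine ⟨i, Or.inr (Or.inr (Or.inr (Or.inr (Or.inl ⟨h, e, b, a', ?_, h3⟩))))⟩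
      grind
  · intro i hi x hx e b heb ha hb
    refine hw (fun i a => x (i, a)) (fun _ _ => hx _) ?_
    by_cases h0 : i.val = 0
    · obtain ⟨j, a, rfl, h2⟩ := ha (Or.inl h0)
      obtain ⟨a', h3⟩ := hb (by omega)
      refine ⟨j, Or.inr (Or.inr (Or.inr (Or.inr (Or.inr ⟨h0, a, b, a', e, h2, ?_, ?_⟩))))⟩
      · simpa using h3
      · grind
    rcases lt_trichotomy i.val m with h | h | h
    · obtain ⟨a', h3⟩ := hb h
      refine ⟨i, Or.inr (Or.inl ⟨by omega, by omega, e, b, a', ?_, h3⟩)⟩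
      grind
    · exact absurd h hi
    · obtain ⟨j, a, rfl, h2⟩ := ha (Or.inr h)
      exact ⟨j, Or.inr (Or.inr (Or.inr (Or.inl ⟨h, a, b, e, h2, heb⟩)))⟩

theorem pairProd_dvd {τ : Type} {N : ℕ} (ι : Fin N → τ) (hι : Injective ι)
    (d : Fin N → Fin N → MvPolynomial τ ℂ) (hd : ∀ a b, a < b → d a b ∈ Forms {(ι a, ι b)})
    {g : MvPolynomial τ ℂ} (h : ∀ a b, a < b → d a b ∣ g) : pairProd d ∣ g := by
  unfold pairProd
  apply prod_dvd_of_Forms Finset.univ _ (fun a => {q | ∃ b, a < b ∧ q = (ι a, ι b)})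
  · intro a _
    refine prod_mem fun b hb => ?_
    have hb' : a < b := by simpa using hb
    exact Forms_mono (by grind) (hd a b hb')
  · grind
  intro a _
  apply prod_dvd_of_Forms _ _ (fun b => {(ι a, ι b)})
  · grind
  · grind
  grind

/-! ## The specialization and the numerators of `A`, `B`, `C` -/

/-- The indices of the variables `y` and `z`. -/
abbrev YZIdx (m k L K : ℕ) : Type := (Fin (m + k) × Fin L) ⊕ (Fin 1 × Fin K)

section

variable (m k L K : ℕ)

set_option hygiene false

/-- The variables `y` and `z`. -/
notation "𝕍" => YZIdx m k L K

end

section Spec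

variable (P : Params) {m k : ℕ} (hm : 0 < m) (L K : ℕ)

/-- Residues modulo `m + k`. -/
def col (i : ℕ) : Fin (m + k) := ⟨i % (m + k), Nat.mod_lt _ (by omega)⟩

/-- The coefficients of the specialization. -/
def sc (m k : ℕ) (s : 𝕀 × (Fin L ⊕ Fin K)) : ℂ := Sum.elim (fun _ => η s.1) (fun _ => ζ s.1) s.2

/-- The variables of the specialization. -/
def sv (s : 𝕀 × (Fin L ⊕ Fin K)) : 𝕍 :=
  Sum.elim (fun a => inl (col hm s.1, a)) (fun b => inr (0, b)) s.2

/-- The variable `w_a`. -/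
def wv {L : ℕ} (K : ℕ) (a : Fin L) : 𝕍 := inl (col hm 0, a)

/-- The variable `z_b`. -/
def zv (m k : ℕ) (L : ℕ) {K : ℕ} (b : Fin K) : 𝕍 := inr (0, b)

/-- The larger ratio for the colour `i`. -/
def ratA (i : ℕ) : ℂ := if i = 0 then 1 else P.q2

/-- The smaller ratio for the colour `i`. -/
def ratB (m : ℕ) (i : ℕ) : ℂ := if i = m then 1 else P.q2⁻¹

/-- The numerator of the fermionic part of `A` for a pair of variables. -/
def pairWW (a b : Fin L) : MvPolynomial 𝕍 ℂ :=
  if k = 0 then ∏ i ∈ {0, Fin.last (m + k)}, lin (η (i : 𝕀))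
    (wv hm K a) (η i) (wv hm K b)
  else lin 1 (wv hm K a) P.q2 (wv hm K b) * lin 1 (wv hm K a) P.q2⁻¹ (wv hm K b)

/-- The numerator of the fermionic part of `A`. -/
def numWW : MvPolynomial 𝕍 ℂ := pairProd (pairWW P hm L K)

/-- The part of the numerator of `B` that does not belong to the poles of the target, for a pair
of variables. -/
def pairZZ (m k : ℕ) (a b : Fin K) : MvPolynomial 𝕍 ℂ :=
  (∏ i : 𝕀 with i.val ≠ 0 ∧ i.val ≠ m + k,
    lin (ζ i) (zv m k L a) (P.q2 * ζ i) (zv m k L b)) *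
  (∏ i : 𝕀 with i.val ≠ 0 ∧ i.val ≠ m,
    lin (ζ i) (zv m k L a) (P.q2⁻¹ * ζ i) (zv m k L b)) *
  ∏ i : 𝕀 with i.val = 0 ∨ i.val = m,
    lin (ζ i) (zv m k L a) (ζ i) (zv m k L b)

/-- The part of the numerator of `B` that does not belong to the poles of the target. -/
def numZZ (m k : ℕ) : MvPolynomial 𝕍 ℂ := pairProd (pairZZ P L K m k)

/-- The numerator of `C`. -/
def numYZ : MvPolynomial 𝕍 ℂ :=
  ∏ q : 𝕀 × Fin L × Fin K × Bool,
    lin (η q.1) (inl (col hm q.1, q.2.1))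
      ((if q.2.2.2 then ratA P q.1 else ratB P m q.1) * ζ q.1) (zv m k L q.2.2.1)

end Spec

section Vanish

variable {P : Params} {m k : ℕ} {hm : 0 < m} {α : Type}

theorem col_eq_col {i j : ℕ} (hi : i ≤ m + k) (hj : j ≤ m + k)
    (h : (col hm i : Fin (m + k)) = col hm j) :
    i = j ∨ (i = 0 ∧ j = m + k) ∨ (i = m + k ∧ j = 0) := by
  have h1 := congrArg Fin.val h
  simp only [col] at h1
  rcases Nat.lt_or_ge i (m + k) with hi' | hi'
  · rw [Nat.mod_eq_of_lt hi'] at h1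
    rcases Nat.lt_or_ge j (m + k) with hj' | hj'
    · rw [Nat.mod_eq_of_lt hj'] at h1
      exact Or.inl h1
    · have : j = m + k := by omega
      subst this
      rw [Nat.mod_self] at h1
      grind
  · have : i = m + k := by omega
    subst this
    rw [Nat.mod_self] at h1
    rcases Nat.lt_or_ge j (m + k) with hj' | hj'
    · rw [Nat.mod_eq_of_lt hj'] at h1
      grind
    · grind

theorem col_last : (col hm (m + k) : Fin (m + k)) = col hm 0 := by
  unfold col
  simp

theorem exists_prev {c : ℕ} {i : Fin c} (h : i.val ≠ 0) : ∃ j : Fin c, next j = i ∧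
    i.val = j.val + 1 := by
  have hi := i.2
  refine ⟨⟨i.val - 1, by omega⟩, ?_, by simp; omega⟩
  ext
  rw [next_val_of_lt (by simp; omega)]
  simp
  omega

theorem RatioVanish.chain_pos (hP : P.Valid) {f : MvPolynomial (𝕀 × α) ℂ}
    (hf : RatioVanish P m (k + 1) f) {x : 𝕀 × α → ℂ} (hx : ∀ s, x s ≠ 0)
    {i : 𝕀} {e b : α} {z : ℂ} (hi : i.val ≠ 0) (hprev : ∀ j : 𝕀, next j = i → x (j, b) = ζ j * z)
    (hb : x (i, b) = ζ i * z) (he : x (i, e) = P.q2 * (ζ i * z))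
    (hnext : i.val ≠ m + k → x (next i, b) = ζ (i + 1) * z)
    (hlast : i.val = m + k → ∃ a, x (next i, a) = P.q3⁻¹ * (ζ i * z)) : eval x f = 0 := by
  refine hf.pos i hi x hx e b (by rw [he, hb]) ?_ ?_
  · intro h
    obtain ⟨j, hj, hj'⟩ := exists_prev hi
    refine ⟨j, b, hj, ?_⟩
    rw [hb, hprev j hj, hj', zcoef_succ_of_lt hP (by omega)]
    ring
  · intro h
    by_cases hl : i.val = m + k
    · grind
    · refine ⟨b, ?_⟩
      rw [hb, hnext hl, zcoef_succ_of_le hP h]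
      ring

theorem RatioVanish.chain_neg (hP : P.Valid) {f : MvPolynomial (𝕀 × α) ℂ}
    (hf : RatioVanish P m (k + 1) f) {x : 𝕀 × α → ℂ} (hx : ∀ s, x s ≠ 0)
    {i : 𝕀} {e b : α} {z : ℂ} (hi : i.val ≠ m)
    (hprev : i.val ≠ 0 → ∀ j : 𝕀, next j = i → x (j, b) = ζ j * z)
    (hb : x (i, b) = ζ i * z) (he : x (i, e) = P.q2⁻¹ * (ζ i * z))
    (hnext : i.val ≠ m + k → x (next i, b) = ζ (i + 1) * z)
    (hzero : i.val = 0 → ∃ j a, next j = i ∧ ζ i * z = P.q3⁻¹ * x (j, a)) : eval x f = 0 := by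
  refine hf.neg i hi x hx e b (by rw [he, hb]) ?_ ?_
  · intro h
    by_cases h0 : i.val = 0
    · grind
    · obtain ⟨j, hj, hj'⟩ := exists_prev h0
      refine ⟨j, b, hj, ?_⟩
      rw [hb, hprev h0 j hj, hj', zcoef_succ_of_le hP (by omega)]
      ring
  · intro h
    refine ⟨b, ?_⟩
    rw [hb, hnext (by omega), zcoef_succ_of_lt hP h]
    ring

end Vanish

section Divisibility

variable {P : Params} {m k : ℕ} {hm : 0 < m} {L K : ℕ} {f : MvPolynomial (𝕀 × (Fin L ⊕ Fin K)) ℂ}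

theorem sc_ne (hP : P.Valid) (s : 𝕀 × (Fin L ⊕ Fin K)) : sc P L K m k s ≠ 0 := by
  rcases s with ⟨i, a | b⟩
  · exact ycoef_ne hP _ _
  · exact zcoef_ne hP _

theorem ratA_ne (hP : P.Valid) (i : ℕ) : ratA P i ≠ 0 := by
  unfold ratA
  split_ifs
  · exact one_ne_zero
  · exact hP.n2

theorem ratB_ne (hP : P.Valid) (i : ℕ) : ratB P m i ≠ 0 := by
  unfold ratB
  split_ifs
  · exact one_ne_zero
  · exact inv_ne_zero hP.n2

theorem next_last_val {i : 𝕀} (h : i.val = m + k) : (next i).val = 0 := next_val_of_eq (by omega)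

theorem next_val_of_ne {i : 𝕀} (h : i.val ≠ m + k) : (next i).val = i.val + 1 :=
  next_val_of_lt (by have := i.2; omega)

theorem exists_prev_zero {i : 𝕀} (h : i.val = 0) : ∃ j : 𝕀, next j = i ∧ j.val = m + k :=
  ⟨Fin.last (m + k), Fin.ext ((next_last_val rfl).trans h.symm), rfl⟩

theorem yz_dvd (hP : P.Valid) (hkm : k + 2 ≤ m) (hf : RatioVanish P m (k + 1) f)
    (i : 𝕀) (a : Fin L) (b : Fin K) (t : Bool) : lin (η i) (inl (col hm i, a) : 𝕍)
    ((if t then ratA P i else ratB P m i) * ζ i) (zv m k L b) ∣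
    aeval (mpt (sc P L K m k) (sv hm L K)) f := by
  have hr : (if t then ratA P i else ratB P m i) ≠ 0 := by
    split_ifs
    · exact ratA_ne hP _
    · exact ratB_ne hP _
  apply lin_dvd_of_torus (ycoef_ne hP _ _) (mul_ne_zero hr (zcoef_ne hP _))
    (by simp [zv])
  intro p hp hpe
  rw [eval_mpt]
  have hx : ∀ s, sc P L K m k s * p (sv hm L K s) ≠ 0 := fun s => mul_ne_zero (sc_ne hP s) (hp _)
  have e1 := hP.q1_eq
  have n2 := hP.n2
  have n3 := hP.n3
  rw [mul_assoc] at hpe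
  by_cases hskew : (i.val = 0 ∧ t = true) ∨ (i.val = m ∧ t = false)
  · refine hf.skew i (by tauto) _ hx (inl a) (inr b) (by simp) ?_
    have : (if t then ratA P i else ratB P m i) = 1 := by
      rcases hskew with ⟨h1, rfl⟩ | ⟨h1, rfl⟩ <;> simp [ratA, ratB, h1]
    rw [this, one_mul] at hpe
    exact hpe
  cases t with
  | true =>
    have hi : i.val ≠ 0 := by tauto
    simp only [if_true, ratA, if_neg hi] at hpe
    refine hf.chain_pos hP hx (e := inl a) (b := inr b) (z := p (zv m k L b)) hi
      (fun j _ => rfl) rfl hpe (fun h => ?_) (fun h => ⟨inl a, ?_⟩)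
    · rw [← next_val_of_ne h]; rfl
    · show η (next i) * p (inl (col hm (next i), a)) = _
      rw [next_last_val h, ycoef_zero]
      have hkm' : k < m := by omega
      rw [h, ycoef_last hP hkm', col_last, one_mul] at hpe
      grind
  | false =>
    have hi : i.val ≠ m := by tauto
    simp only [Bool.false_eq_true, if_false, ratB, if_neg hi] at hpe
    refine hf.chain_neg hP hx (e := inl a) (b := inr b) (z := p (zv m k L b)) hi
      (fun _ j _ => rfl) rfl hpe (fun h => ?_) (fun h => ?_)
    · rw [← next_val_of_ne h]; rfl
    · obtain ⟨j, hj, hj'⟩ := exists_prev_zero h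
      refine ⟨j, inl a, hj, ?_⟩
      show _ = P.q3⁻¹ * (η j * p (inl (col hm j, a)))
      rw [hj', ycoef_last hP (by omega), col_last, one_mul, h, zcoef_zero]
      rw [h, ycoef_zero, zcoef_zero, e1] at hpe
      grind

theorem numYZ_dvd (hP : P.Valid) (hkm : k + 2 ≤ m) (hf : RatioVanish P m (k + 1) f) :
    numYZ P hm L K ∣ aeval (mpt (sc P L K m k) (sv hm L K)) f := by
  unfold numYZ
  apply prod_dvd_of_isRelPrime
  · rintro ⟨i, a, b, t⟩ _ ⟨i', a', b', t'⟩ _ hne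
    show IsRelPrime (lin _ _ _ _) (lin _ _ _ _)
    dsimp only
    by_cases hpair : (inl (col hm i, a) : 𝕍) = inl (col hm i', a') ∧ b = b'
    · obtain ⟨h1, rfl⟩ := hpair
      rw [h1]
      apply isRelPrime_lin' (ycoef_ne hP _ _) (by simp [zv])
      obtain ⟨h2, rfl⟩ := Prod.mk.inj (Sum.inl_injective h1)
      have n2 := hP.n2
      have hr : ratA P i ≠ ratB P m i := by
        unfold ratA ratB
        intro h
        split_ifs at h with h3 h4 h4
        · omega
        · exact hP.q2_ne_one (by grind)
        · exact hP.q2_ne_one h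
        · have := hP.zpow_inj (a := 1) (b := 0) (a' := -1) (b' := 0) (by simpa using h)
          omega
      have hkm' : k < m := by omega
      have main : ∀ (r r' : ℂ) (u v : ℤ), r = P.q2 ^ u → r' = P.q2 ^ v →
          (u = 0 ∨ u = -1) → (1 : ℂ) * (r * ζ 0) ≠ P.q1 * (r' * ζ (m + k)) := by
        rintro _ _ u v rfl rfl hu h
        rw [zcoef_zero, zcoef_last, hP.q1_eq] at h
        have h5 : P.q2 ^ u * P.q3 ^ (-1 : ℤ) =
            P.q2 ^ (v - 1) * P.q3 ^ ((m : ℤ) - k - 1 - 1) := by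
          rw [zpow_sub_one₀ n2, zpow_sub_one₀ hP.n3, zpow_neg_one]
          grind
        have := hP.zpow_inj h5
        omega
      have hA0 : ∀ (t : Bool), ∃ u : ℤ, (u = 0 ∨ u = -1) ∧
          (if t then ratA P 0 else ratB P m 0) = P.q2 ^ u := by
        rintro (_ | _)
        · exact ⟨-1, Or.inr rfl, by simp [ratB, hm.ne]⟩
        · exact ⟨0, Or.inl rfl, by simp [ratA]⟩
      have hB0 : ∀ (t : Bool), ∃ u : ℤ,
          (if t then ratA P (m + k) else ratB P m (m + k)) = P.q2 ^ u := by
        rintro (_ | _)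
        · by_cases hk : k = 0
          · exact ⟨0, by simp [ratB, hk]⟩
          · exact ⟨-1, by simp [ratB, hk]⟩
        · exact ⟨1, by simp [ratA, hm.ne']⟩
      rcases col_eq_col (by have := i.2; omega) (by grind) h2 with h | ⟨h, h'⟩ | ⟨h, h'⟩
      · obtain rfl := Fin.ext h
        intro h3
        have h4 := mul_right_cancel₀ (zcoef_ne hP _) (mul_left_cancel₀ (ycoef_ne hP _ _) h3)
        grind
      · rw [h, h', ycoef_zero, ycoef_last hP hkm']
        obtain ⟨u, hu, h4⟩ := hA0 t
        obtain ⟨v, h5⟩ := hB0 t'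
        grind
      · rw [h, h', ycoef_zero, ycoef_last hP hkm']
        obtain ⟨u, hu, h4⟩ := hA0 t'
        obtain ⟨v, h5⟩ := hB0 t
        grind
    · apply isRelPrime_lin (ycoef_ne hP _ _) _ (by simp [zv]) (ycoef_ne hP _ _) (by simp [zv])
      · refine ⟨?_, by simp [zv]⟩
        rintro ⟨h1, h2⟩
        exact hpair ⟨h1, by simpa [zv] using h2⟩
      · refine mul_ne_zero ?_ (zcoef_ne hP _)
        split_ifs
        · exact ratA_ne hP _
        · exact ratB_ne hP _
  · rintro ⟨i, a, b, t⟩ _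
    exact yz_dvd hP hkm hf i a b t

end Divisibility

section Divisibility

variable {P : Params} {m k : ℕ} {hm : 0 < m} {L K : ℕ} {f : MvPolynomial (𝕀 × (Fin L ⊕ Fin K)) ℂ}

theorem Params.Valid.q2_ne_inv (hP : P.Valid) : P.q2 ≠ P.q2⁻¹ := by
  intro h
  have := hP.zpow_inj (a := 1) (b := 0) (a' := -1) (b' := 0) (by simpa using h)
  omega

theorem Params.Valid.q2_inv_ne_one (hP : P.Valid) : P.q2⁻¹ ≠ 1 := by
  intro h
  exact hP.q2_ne_one (by grind)

theorem lin_mul_dvd {τ : Type} {α β α' β' : ℂ} {u v : τ} (hα : α ≠ 0) (huv : u ≠ v)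
    (h : α * β' ≠ α' * β) {g : MvPolynomial τ ℂ} (h1 : lin α u β v ∣ g)
    (h2 : lin α' u β' v ∣ g) : lin α u β v * lin α' u β' v ∣ g :=
  (isRelPrime_lin' hα huv h).mul_dvd h1 h2

theorem isRelPrime_prod_lin {τ ι : Type} {S S' : Finset ι} {α : ι → ℂ} {t t' : ℂ} {u v : τ}
    (hα : ∀ i, α i ≠ 0) (huv : u ≠ v) (ht : t ≠ t') :
    IsRelPrime (∏ i ∈ S, lin (α i) u (t * α i) v) (∏ i ∈ S', lin (α i) u (t' * α i) v) := by
  refine IsRelPrime.prod_left fun i _ => IsRelPrime.prod_right fun j _ => ?_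
  apply isRelPrime_lin' (hα i) huv
  grind

theorem wv_ne {a b : Fin L} (hab : a ≠ b) : (wv hm K a : 𝕍) ≠ wv hm K b := by simpa [wv] using hab

theorem zv_ne {a b : Fin K} (hab : a ≠ b) : zv m k L a ≠ zv m k L b := by simpa [zv] using hab

theorem prod_lin_mem_Forms {τ ι : Type} {S : Finset ι} {α β : ι → ℂ} {u v : τ}
    (hα : ∀ i, α i ≠ 0) (hβ : ∀ i, β i ≠ 0) (huv : u ≠ v) {A : Set (τ × τ)} (hA : (u, v) ∈ A) :
    ∏ i ∈ S, lin (α i) u (β i) v ∈ Forms A :=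
  prod_mem fun i _ => lin_mem_Forms (hα i) (hβ i) huv hA

theorem ww_mem_Forms (hP : P.Valid) {a b : Fin L} (hab : a < b) {A : Set (𝕍 × 𝕍)}
    (hA : (wv hm K a, wv hm K b) ∈ A) : pairWW P hm L K a b ∈ Forms A := by
  unfold pairWW
  split_ifs
  · exact prod_lin_mem_Forms (fun _ => ycoef_ne hP _ _) (fun _ => ycoef_ne hP _ _)
      (wv_ne hab.ne) hA
  · exact mul_mem (lin_mem_Forms one_ne_zero hP.n2 (wv_ne hab.ne) hA)
      (lin_mem_Forms one_ne_zero (inv_ne_zero hP.n2) (wv_ne hab.ne) hA)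

theorem ww_pos_dvd (hP : P.Valid) (hkm : k + 2 ≤ m) (hk : k ≠ 0) (hf : RatioVanish P m (k + 1) f)
    {a b : Fin L} {p : 𝕍 → ℂ} (hp : ∀ s, p s ≠ 0) (h : p (wv hm K a) = P.q2 * p (wv hm K b)) :
    eval (fun s => sc P L K m k s * p (sv hm L K s)) f = 0 := by
  have hx : ∀ s, sc P L K m k s * p (sv hm L K s) ≠ 0 := fun s => mul_ne_zero (sc_ne hP s) (hp _)
  have hkm' : k < m := by omega
  have hw : ∀ a, sc P L K m k (Fin.last (m + k), inl a) *
      p (sv hm L K (Fin.last (m + k), inl a)) = p (wv hm K a) := by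
    intro a
    show η (m + k) * p (inl (col hm (m + k), a)) = _
    rw [ycoef_last hP hkm', one_mul, col_last]
    rfl
  refine hf.pos (Fin.last (m + k)) (by simp; omega) _ hx (inl a) (inl b) ?_ ?_ ?_
  · rw [hw, hw, h]
  · grind
  · intro _
    refine ⟨inl a, ?_⟩
    rw [hw]
    show η (next (Fin.last (m + k))) *
      p (inl (col hm (next (Fin.last (m + k))), a)) = _
    rw [next_last_val rfl, ycoef_zero]
    have h' : p (inl (col hm 0, a)) = P.q2 * p (wv hm K b) := h
    have n2 := hP.n2
    rw [h', hP.q1_eq]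
    field_simp

theorem numWW_dvd (hP : P.Valid) (hkm : k + 2 ≤ m) (hf : RatioVanish P m (k + 1) f) :
    numWW P hm L K ∣ aeval (mpt (sc P L K m k) (sv hm L K)) f := by
  unfold numWW
  apply pairProd_dvd (wv hm K) (fun a b h => by simpa [wv] using h)
  · intro a b hab
    exact ww_mem_Forms hP hab rfl
  · intro a b hab
    unfold pairWW
    split_ifs with hk
    · have h2 : ∀ i, i ∈ ({0, Fin.last (m + k)} : Finset 𝕀) →
          ((i.val = 0 ∨ i.val = m) ∧ sv hm L K (i, inl a) = wv hm K a) ∧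
          sv hm L K (i, inl b) = wv hm K b := by
        intro i hi
        rcases mem_insert.1 hi with rfl | hi
        · exact ⟨⟨Or.inl rfl, rfl⟩, rfl⟩
        · rw [mem_singleton.1 hi]
          refine ⟨⟨Or.inr (by simp [hk]), ?_⟩, ?_⟩
          · show inl (col hm (m + k), a) = _
            rw [col_last]; rfl
          · show inl (col hm (m + k), b) = _
            rw [col_last]; rfl
      have h3 := column_dvd f (sc P L K m k) (sc_ne hP) (sv hm L K) (inl a)
        {0, Fin.last (m + k)} (fun i => sc P L K m k (i, inl b)) (fun i => sc_ne hP _)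
        (fun _ => wv hm K b) ?_
      · convert h3 using 1
        refine prod_congr rfl fun i hi => ?_
        rw [(h2 i hi).1.2]
        rfl
      · intro i hi p hp x hx hxj hxe
        refine hf.skew i (h2 i hi).1.1 x hx (inl a) (inl b) (by simpa using hab.ne) ?_
        grind
    · apply lin_mul_dvd one_ne_zero (wv_ne hab.ne)
      · rw [one_mul, one_mul]; exact hP.q2_ne_inv.symm
      · apply lin_dvd_of_torus one_ne_zero hP.n2 (wv_ne hab.ne)
        intro p hp h
        rw [eval_mpt]
        exact ww_pos_dvd hP hkm hk hf hp (by rw [← h, one_mul])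
      · apply lin_dvd_of_torus one_ne_zero (inv_ne_zero hP.n2) (wv_ne hab.ne)
        intro p hp h
        rw [eval_mpt]
        have n2 := hP.n2
        exact ww_pos_dvd hP hkm hk hf hp (a := b) (b := a) (by grind)

theorem zz_dvd (hP : P.Valid) (hf : RatioVanish P m (k + 1) f) {a b : Fin K} (hab : a < b) :
    pairZZ P L K m k a b ∣ aeval (mpt (sc P L K m k) (sv hm L K)) f := by
  have hζ : ∀ i : 𝕀, ζ i ≠ 0 := fun i => zcoef_ne hP _
  have hba : (inr b : Fin L ⊕ Fin K) ≠ inr a := by grind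
  have h1 := isRelPrime_prod_lin (S := Finset.univ.filter fun i : 𝕀 =>
    i.val ≠ 0 ∧ i.val ≠ m + k) (S' := Finset.univ.filter fun i : 𝕀 =>
    i.val ≠ 0 ∧ i.val ≠ m) hζ (zv_ne (m := m) (k := k) (L := L) hab.ne) hP.q2_ne_inv
  have h2 := isRelPrime_prod_lin (S := Finset.univ.filter fun i : 𝕀 =>
    i.val ≠ 0 ∧ i.val ≠ m + k) (S' := Finset.univ.filter fun i : 𝕀 =>
    i.val = 0 ∨ i.val = m) hζ (zv_ne (m := m) (k := k) (L := L) hab.ne) hP.q2_ne_one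
  have h3 := isRelPrime_prod_lin (S := Finset.univ.filter fun i : 𝕀 =>
    i.val ≠ 0 ∧ i.val ≠ m) (S' := Finset.univ.filter fun i : 𝕀 =>
    i.val = 0 ∨ i.val = m) hζ (zv_ne (m := m) (k := k) (L := L) hab.ne) hP.q2_inv_ne_one
  simp only [one_mul] at h2 h3
  refine (h2.mul_left h3).mul_dvd (h1.mul_dvd ?_ ?_) ?_
  · refine column_dvd f (sc P L K m k) (sc_ne hP) (sv hm L K) (inr a) _
      (fun i => P.q2 * ζ i) (fun i => mul_ne_zero hP.n2 (hζ i)) (fun _ => zv m k L b) ?_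
    intro i hi p hp x hx hxj hxe
    have hi' := (mem_filter.1 hi).2
    refine hf.chain_pos hP hx (e := inr a) (b := inr b) (z := p (zv m k L b)) hi'.1
      (fun j _ => hxj j _ hba) (hxj i _ hba) (by grind)
      (fun h => ?_) (fun h => absurd h hi'.2)
    rw [hxj _ _ hba, ← next_val_of_ne h]; rfl
  · refine column_dvd f (sc P L K m k) (sc_ne hP) (sv hm L K) (inr a) _
      (fun i => P.q2⁻¹ * ζ i) (fun i => mul_ne_zero (inv_ne_zero hP.n2) (hζ i))
      (fun _ => zv m k L b) ?_
    intro i hi p hp x hx hxj hxe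
    have hi' := (mem_filter.1 hi).2
    refine hf.chain_neg hP hx (e := inr a) (b := inr b) (z := p (zv m k L b)) hi'.2
      (fun _ j _ => hxj j _ hba) (hxj i _ hba) (by grind)
      (fun h => ?_) (fun h => absurd h hi'.1)
    rw [hxj _ _ hba, ← next_val_of_ne h]; rfl
  · refine column_dvd f (sc P L K m k) (sc_ne hP) (sv hm L K) (inr a) _
      (fun i => ζ i) hζ (fun _ => zv m k L b) ?_
    intro i hi p hp x hx hxj hxe
    have hi' := (mem_filter.1 hi).2
    refine hf.skew i hi' x hx (inr a) (inr b) hba.symm ?_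
    rw [hxe, hxj _ _ hba]
    rfl

theorem zz_mem_Forms (hP : P.Valid) {a b : Fin K} (hab : a ≠ b)
    {A : Set (𝕍 × 𝕍)} (hA : (zv m k L a, zv m k L b) ∈ A) : pairZZ P L K m k a b ∈ Forms A := by
  have hζ : ∀ i : 𝕀, ζ i ≠ 0 := fun i => zcoef_ne hP _
  exact mul_mem (mul_mem
    (prod_lin_mem_Forms hζ (fun i => mul_ne_zero hP.n2 (hζ i)) (zv_ne hab) hA)
    (prod_lin_mem_Forms hζ (fun i => mul_ne_zero (inv_ne_zero hP.n2) (hζ i)) (zv_ne hab) hA))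
    (prod_lin_mem_Forms hζ hζ (zv_ne hab) hA)

theorem numZZ_dvd (hP : P.Valid) (hf : RatioVanish P m (k + 1) f) :
    numZZ P L K m k ∣ aeval (mpt (sc P L K m k) (sv hm L K)) f :=
  pairProd_dvd (zv m k L) (fun a b h => by simpa [zv] using h) _
    (fun _ _ hab => zz_mem_Forms hP hab.ne rfl) fun _ _ hab => zz_dvd hP hf hab

theorem num_dvd (hP : P.Valid) (hkm : k + 2 ≤ m) (hf : RatioVanish P m (k + 1) f) :
    numWW P hm L K * numZZ P L K m k * numYZ P hm L K ∣
    aeval (mpt (sc P L K m k) (sv hm L K)) f := by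
  have hW : numWW P hm L K ∈ Forms {q : 𝕍 × 𝕍 |
      q.1.isLeft ∧ q.2.isLeft} := by
    unfold numWW pairProd
    exact prod_mem fun a _ => prod_mem fun b hb => ww_mem_Forms hP (mem_Ioi.1 hb) ⟨rfl, rfl⟩
  have hZ : numZZ P L K m k ∈ Forms {q : 𝕍 × 𝕍 |
      q.1.isRight ∧ q.2.isRight} := by
    unfold numZZ pairProd
    exact prod_mem fun a _ => prod_mem fun b hb => zz_mem_Forms hP (mem_Ioi.1 hb).ne ⟨rfl, rfl⟩
  have hY : numYZ P hm L K ∈ Forms {q : 𝕍 × 𝕍 |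
      q.1.isLeft ∧ q.2.isRight} := by
    unfold numYZ
    refine prod_mem fun q _ => lin_mem_Forms (ycoef_ne hP _ _) (mul_ne_zero ?_ (zcoef_ne hP _))
      (by simp [zv]) ⟨rfl, rfl⟩
    split_ifs
    · exact ratA_ne hP _
    · exact ratB_ne hP _
  refine IsRelPrime.mul_dvd (IsRelPrime.mul_left ?_ ?_) (IsRelPrime.mul_dvd ?_
    (numWW_dvd hP hkm hf) (numZZ_dvd hP hf)) (numYZ_dvd hP hkm hf)
  · refine isRelPrime_of_Forms ?_ hW hY
    grind
  · refine isRelPrime_of_Forms ?_ hZ hY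
    grind
  · refine isRelPrime_of_Forms ?_ hW hZ
    grind

end Divisibility

/-! ## Families of points through a given point -/

section Family

variable {σ : Type}

open Classical in
/-- The coordinates in `W` are scaled simultaneously, the other coordinates are independent. -/
def fam (W : Set σ) (s : σ) : Option σ := if s ∈ W then none else some s

theorem fam_of_mem {W : Set σ} {s : σ} (h : s ∈ W) : fam W s = none := if_pos h

theorem fam_of_notMem {W : Set σ} {s : σ} (h : s ∉ W) : fam W s = some s := if_neg h

theorem mem_of_fam_eq {W : Set σ} {s t : σ} (hst : s ≠ t) (h : fam W s = fam W t) :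
    s ∈ W ∧ t ∈ W := by
  by_cases hs : s ∈ W
  · by_cases ht : t ∈ W
    · exact ⟨hs, ht⟩
    · rw [fam_of_mem hs, fam_of_notMem ht] at h; simp at h
  · by_cases ht : t ∈ W
    · rw [fam_of_mem ht, fam_of_notMem hs] at h; simp at h
    · rw [fam_of_notMem hs, fam_of_notMem ht] at h; simp [hst] at h

theorem fam_lin_ne {p₀ : σ → ℂ} (hp₀ : ∀ s, p₀ s ≠ 0) {W : Set σ} {α β : ℂ} {u v : σ}
    (hα : α ≠ 0) (huv : u ≠ v) (h : u ∈ W → v ∈ W → α * p₀ u ≠ β * p₀ v) :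
    aeval (mpt p₀ (fam W)) (lin α u β v) ≠ 0 := by
  rw [aeval_lin]
  refine lin_ne_zero ?_ (mul_ne_zero hα (hp₀ _))
  by_cases hf : fam W u = fam W v
  · exact Or.inr (h (mem_of_fam_eq huv hf).1 (mem_of_fam_eq huv hf).2)
  · exact Or.inl hf

theorem eval_of_fam_eq_zero {p₀ : σ → ℂ} {W : Set σ} {h : MvPolynomial σ ℂ}
    (h0 : aeval (mpt p₀ (fam W)) h = 0) : eval p₀ h = 0 := by
  have := congrArg (eval fun _ => (1 : ℂ)) h0
  rw [eval_mpt] at this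
  simpa using this

/-- A quotient of a function that vanishes along the family vanishes if the divisor does not vanish
identically along the family. -/
theorem eval_eq_zero_of_fam {p₀ : σ → ℂ} (hp₀ : ∀ s, p₀ s ≠ 0) (W : Set σ)
    {g D h : MvPolynomial σ ℂ} (hg : g = D * h) (hD : aeval (mpt p₀ (fam W)) D ≠ 0)
    (hv : ∀ (q : σ → ℂ) (r : ℂ), (∀ s, q s ≠ 0) → (∀ s ∈ W, q s = p₀ s * r) → eval q g = 0) :
    eval p₀ h = 0 := by
  apply eval_of_fam_eq_zero (W := W)
  have h1 : aeval (mpt p₀ (fam W)) g = 0 := by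
    apply eq_zero_of_torus
    intro p hp
    rw [eval_mpt]
    refine hv _ (p none) (fun s => mul_ne_zero (hp₀ s) (hp _)) fun s hs => ?_
    rw [fam_of_mem hs]
  rw [hg, map_mul] at h1
  exact (mul_eq_zero.1 h1).resolve_left hD

/-- The same for divisors that vanish to order `N` along a divisor of the family. -/
theorem eval_eq_zero_of_fam_pow {p₀ : σ → ℂ} (hp₀ : ∀ s, p₀ s ≠ 0) (W : Set σ) {u v : σ} {t : ℂ}
    (hu : u ∉ W) (hv : v ∈ W) (huv : p₀ u = t * p₀ v) {g D B h : MvPolynomial σ ℂ}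
    (hg : g = D * h) (N : ℕ) (hD : Associated D (B * lin 1 u t v ^ N))
    (hB : aeval (mpt p₀ (fam (insert u W))) B ≠ 0)
    (hdvd : lin (p₀ u) (some u) (t * p₀ v) none ^ (N + 1) ∣ aeval (mpt p₀ (fam W)) g) :
    eval p₀ h = 0 := by
  classical
  set ℓ : MvPolynomial (Option σ) ℂ := lin (p₀ u) (some u) (t * p₀ v) none with hℓ
  have hprime : Prime ℓ := lin_prime (hp₀ u) (by simp) _
  have hℓ1 : aeval (mpt p₀ (fam W)) (lin 1 u t v) = ℓ := by
    rw [aeval_lin, fam_of_mem hv, fam_of_notMem hu, one_mul]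
  obtain ⟨e, he⟩ := hD
  have hBℓ : ¬ ℓ ∣ aeval (mpt p₀ (fam W)) B := by
    rintro ⟨b, hb⟩
    apply hB
    apply eq_zero_of_torus
    intro p hp
    rw [eval_mpt]
    have h1 := congrArg (eval fun s => Option.elim s (p none)
      (fun s => if s = u then p none else p (some s))) hb
    rw [eval_mpt, map_mul, hℓ, eval_lin] at h1
    simp only [Option.elim_some, if_true, Option.elim_none] at h1
    rw [huv, sub_self, zero_mul] at h1
    rw [← h1]
    congr 2
    funext s
    by_cases hs : s = u
    · subst hs
      rw [fam_of_mem (Set.mem_insert _ _), fam_of_notMem hu]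
      simp [huv]
    · by_cases hsW : s ∈ W
      · rw [fam_of_mem (Set.mem_insert_of_mem _ hsW), fam_of_mem hsW]
        simp
      · rw [fam_of_notMem (by simp [hs, hsW]), fam_of_notMem hsW]
        simp [hs]
  have h2 : ℓ ^ (N + 1) ∣ aeval (mpt p₀ (fam W)) (B * h) * ℓ ^ N := by
    have h3 : aeval (mpt p₀ (fam W)) (B * h) * ℓ ^ N =
        aeval (mpt p₀ (fam W)) g * aeval (mpt p₀ (fam W)) (e : MvPolynomial σ ℂ) := by
      rw [hg, ← hℓ1, ← map_pow, ← map_mul, ← map_mul]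
      grind
    rw [h3]
    exact Dvd.dvd.mul_right hdvd _
  rw [pow_succ', mul_dvd_mul_iff_right (pow_ne_zero _ hprime.ne_zero), map_mul] at h2
  obtain ⟨b, hb⟩ := (hprime.dvd_mul.1 h2).resolve_left hBℓ
  have := congrArg (eval fun _ => (1 : ℂ)) hb
  rw [eval_mpt, map_mul, hℓ, eval_lin, huv] at this
  grind

theorem pairProd_assoc {N : ℕ} (d : Fin N → Fin N → MvPolynomial σ ℂ)
    (hd : ∀ a b, a ≠ b → Associated (d a b) (d b a)) {a b : Fin N} (hab : a ≠ b) :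
    Associated (pairProd d) (d a b * ∏ p : Fin N × Fin N with
    p.1 < p.2 ∧ ¬ (p.1 = a ∧ p.2 = b) ∧ ¬ (p.1 = b ∧ p.2 = a), d p.1 p.2) := by
  classical
  wlog h : a < b generalizing a b with H
  · refine (H hab.symm (lt_of_le_of_ne (not_lt.1 h) hab.symm)).trans ?_
    refine (hd _ _ hab.symm).mul_mul (Associated.of_eq ?_)
    refine prod_congr ?_ fun _ _ => rfl
    grind
  apply Associated.of_eq
  rw [pairProd_eq_filter, ← mul_prod_erase _ _
    (show (a, b) ∈ Finset.univ.filter fun p : Fin N × Fin N => p.1 < p.2 by simpa using h)]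
  congr 1
  refine prod_congr ?_ fun _ _ => rfl
  grind

theorem associated_lin_swap {α β t : ℂ} (hα : α ≠ 0) (hβ : β ≠ 0) (ht : t ≠ 0) (u v : σ) :
    Associated (lin α u (t * α) v) (lin β v (t⁻¹ * β) u) := by
  have h : IsUnit (C (-(β / (t * α))) : MvPolynomial σ ℂ) :=
    (isUnit_iff_ne_zero.2 (neg_ne_zero.2 (div_ne_zero hβ (mul_ne_zero ht hα)))).map C
  obtain ⟨e, he⟩ := h
  refine ⟨e, ?_⟩
  rw [he]
  unfold lin
  have h1 : C α * C (-(β / (t * α))) = (C (-(t⁻¹ * β)) : MvPolynomial σ ℂ) := by rw [← C_mul]; grind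
  have h2 : C (t * α) * C (-(β / (t * α))) = (C (-β) : MvPolynomial σ ℂ) := by rw [← C_mul]; grind
  grind

theorem associated_prod_lin {ι : Type} (S : Finset ι) {α : ι → ℂ} (hα : ∀ i, α i ≠ 0) (t : ℂ)
    (u v : σ) : Associated (∏ i ∈ S, lin (α i) u (t * α i) v) (lin 1 u t v ^ S.card) := by
  rw [← prod_const]
  refine Associated.prod _ _ _ fun i _ => ?_
  have h : IsUnit (C (α i)⁻¹ : MvPolynomial σ ℂ) :=
    (isUnit_iff_ne_zero.2 (inv_ne_zero (hα i))).map C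
  obtain ⟨e, he⟩ := h
  refine ⟨e, ?_⟩
  rw [he]
  unfold lin
  grind

end Family

section Numerators

variable {P : Params} {m k : ℕ} {hm : 0 < m} {L K : ℕ}

theorem fam_numYZ_ne (hP : P.Valid) {p₀ : 𝕍 → ℂ} (hp₀ : ∀ s, p₀ s ≠ 0)
    {W : Set 𝕍} (hW : (∀ s ∈ W, s.isLeft) ∨ ∀ s ∈ W, s.isRight) :
    aeval (mpt p₀ (fam W)) (numYZ P hm L K) ≠ 0 := by
  unfold numYZ
  rw [map_prod]
  refine prod_ne_zero_iff.2 fun q _ => fam_lin_ne hp₀ (ycoef_ne hP _ _) (by simp [zv]) ?_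
  intro h1 h2
  rcases hW with hW | hW
  · have := hW _ h2
    simp [zv] at this
  · grind

theorem fam_pairZZ_ne (hP : P.Valid) {p₀ : 𝕍 → ℂ} (hp₀ : ∀ s, p₀ s ≠ 0)
    {W : Set 𝕍} {a b : Fin K} (hab : a ≠ b)
    (hW : zv m k L a ∈ W → zv m k L b ∈ W → p₀ (zv m k L a) ≠ P.q2 * p₀ (zv m k L b) ∧
    p₀ (zv m k L a) ≠ P.q2⁻¹ * p₀ (zv m k L b) ∧ p₀ (zv m k L a) ≠ p₀ (zv m k L b)) :
    aeval (mpt p₀ (fam W)) (pairZZ P L K m k a b) ≠ 0 := by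
  have hζ : ∀ i : 𝕀, ζ i ≠ 0 := fun i => zcoef_ne hP _
  unfold pairZZ
  simp only [map_mul, map_prod]
  refine mul_ne_zero (mul_ne_zero ?_ ?_) ?_
  · refine prod_ne_zero_iff.2 fun i _ => fam_lin_ne hp₀ (hζ i) (zv_ne hab) fun h1 h2 h => ?_
    grind
  · refine prod_ne_zero_iff.2 fun i _ => fam_lin_ne hp₀ (hζ i) (zv_ne hab) fun h1 h2 h => ?_
    grind
  · refine prod_ne_zero_iff.2 fun i _ => fam_lin_ne hp₀ (hζ i) (zv_ne hab) fun h1 h2 h => ?_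
    grind

theorem fam_numZZ_ne (hP : P.Valid) {p₀ : 𝕍 → ℂ} (hp₀ : ∀ s, p₀ s ≠ 0)
    {W : Set 𝕍} (hW : ∀ s ∈ W, s.isLeft) : aeval (mpt p₀ (fam W)) (numZZ P L K m k) ≠ 0 := by
  unfold numZZ pairProd
  simp only [map_prod]
  refine prod_ne_zero_iff.2 fun a _ => prod_ne_zero_iff.2 fun b hb =>
    fam_pairZZ_ne hP hp₀ (mem_Ioi.1 hb).ne fun h => ?_
  have := hW _ h
  simp [zv] at this

theorem fam_pairWW_ne (hP : P.Valid) {p₀ : 𝕍 → ℂ} (hp₀ : ∀ s, p₀ s ≠ 0)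
    {W : Set 𝕍} {a b : Fin L} (hab : a ≠ b)
    (hW : wv hm K a ∈ W → wv hm K b ∈ W → (k = 0 → p₀ (wv hm K a) ≠ p₀ (wv hm K b)) ∧
    (k ≠ 0 → p₀ (wv hm K a) ≠ P.q2 * p₀ (wv hm K b) ∧ p₀ (wv hm K a) ≠ P.q2⁻¹ * p₀ (wv hm K b))) :
    aeval (mpt p₀ (fam W)) (pairWW P hm L K a b) ≠ 0 := by
  unfold pairWW
  split_ifs with hk
  · rw [map_prod]
    refine prod_ne_zero_iff.2 fun i _ => fam_lin_ne hp₀ (ycoef_ne hP _ _) (wv_ne hab)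
      fun h1 h2 h => ?_
    exact (hW h1 h2).1 hk (mul_left_cancel₀ (ycoef_ne hP _ _) h)
  · rw [map_mul]
    refine mul_ne_zero (fam_lin_ne hp₀ one_ne_zero (wv_ne hab) fun h1 h2 h => ?_)
      (fam_lin_ne hp₀ one_ne_zero (wv_ne hab) fun h1 h2 h => ?_)
    · grind
    · grind

theorem fam_numWW_ne (hP : P.Valid) {p₀ : 𝕍 → ℂ} (hp₀ : ∀ s, p₀ s ≠ 0) {W : Set 𝕍}
    (hW : ∀ a b, a ≠ b → wv hm K a ∈ W → wv hm K b ∈ W → k = 0 ∧ p₀ (wv hm K a) ≠ p₀ (wv hm K b)) :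
    aeval (mpt p₀ (fam W)) (numWW P hm L K) ≠ 0 := by
  unfold numWW pairProd
  simp only [map_prod]
  refine prod_ne_zero_iff.2 fun a _ => prod_ne_zero_iff.2 fun b hb =>
    fam_pairWW_ne hP hp₀ (mem_Ioi.1 hb).ne fun h1 h2 => ?_
  grind

theorem pairWW_swap (hP : P.Valid) (a b : Fin L) :
    Associated (pairWW (k := k) P hm L K a b) (pairWW P hm L K b a) := by
  unfold pairWW
  split_ifs
  · refine Associated.prod _ _ _ fun i _ => ?_
    have := associated_lin_swap (ycoef_ne (m := m) hP (k + 1) i)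
      (ycoef_ne (m := m) hP (k + 1) i) one_ne_zero (wv (k := k) hm K a) (wv hm K b)
    simpa using this
  · rw [mul_comm (lin 1 (wv hm K b) _ _)]
    have h1 := associated_lin_swap one_ne_zero one_ne_zero hP.n2 (wv (k := k) hm K a) (wv hm K b)
    have h2 := associated_lin_swap one_ne_zero one_ne_zero (inv_ne_zero hP.n2) (wv (k := k) hm K a)
      (wv hm K b)
    simp only [mul_one, inv_inv] at h1 h2
    exact h1.mul_mul h2

theorem card_filter_ne {j : ℕ} (hj : 0 < j) (hj' : j ≤ m + k) :
    (Finset.univ.filter fun l : 𝕀 => l.val ≠ 0 ∧ l.val ≠ j).card = m + k - 1 := by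
  have : (Finset.univ.filter fun l : 𝕀 => l.val ≠ 0 ∧ l.val ≠ j) =
      ({0, ⟨j, by omega⟩} : Finset _)ᶜ := by
    ext l
    simp only [mem_filter, mem_univ, true_and, mem_compl, mem_insert,
      mem_singleton, not_or, Fin.ext_iff]
    exact Iff.rfl
  rw [this, card_compl, Fintype.card_fin, card_pair]
  · omega
  · grind

theorem pairZZ_assoc (hm : 0 < m) (hP : P.Valid) (a b : Fin K) :
    Associated (pairZZ P L K m k a b) ((lin 1 (zv m k L a) P.q2 (zv m k L b) *
    lin 1 (zv m k L a) P.q2⁻¹ (zv m k L b)) ^ (m + k - 1) * ∏ i : 𝕀 with i.val = 0 ∨ i.val = m,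
    lin (ζ i) (zv m k L a) (ζ i) (zv m k L b)) := by
  have hζ : ∀ i : 𝕀, ζ i ≠ 0 := fun i => zcoef_ne hP _
  unfold pairZZ
  rw [mul_pow]
  refine (Associated.mul_mul ?_ ?_).mul_mul (Associated.refl _)
  · have := associated_prod_lin (Finset.univ.filter fun i : 𝕀 => i.val ≠ 0 ∧
      i.val ≠ m + k) hζ P.q2 (zv m k L a) (zv m k L b)
    rw [card_filter_ne (by omega) le_rfl] at this
    exact this
  · have := associated_prod_lin (Finset.univ.filter fun i : 𝕀 => i.val ≠ 0 ∧
      i.val ≠ m) hζ P.q2⁻¹ (zv m k L a) (zv m k L b)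
    rw [card_filter_ne hm (by omega)] at this
    exact this

theorem pairZZ_swap (hm : 0 < m) (hP : P.Valid) (a b : Fin K) :
    Associated (pairZZ P L K m k a b) (pairZZ P L K m k b a) := by
  have hζ : ∀ i : 𝕀, ζ i ≠ 0 := fun i => zcoef_ne hP _
  refine (pairZZ_assoc hm hP a b).trans (Associated.trans ?_ (pairZZ_assoc hm hP b a).symm)
  refine Associated.mul_mul (Associated.pow_pow ?_) (Associated.prod _ _ _ fun i _ => ?_)
  · rw [mul_comm (lin 1 (zv m k L b) _ _)]
    have h1 := associated_lin_swap one_ne_zero one_ne_zero hP.n2 (zv m k L a) (zv m k L b)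
    have h2 := associated_lin_swap one_ne_zero one_ne_zero (inv_ne_zero hP.n2) (zv m k L a)
      (zv m k L b)
    simp only [mul_one, inv_inv] at h1 h2
    exact h1.mul_mul h2
  · have := associated_lin_swap (hζ i) (hζ i) one_ne_zero (zv m k L a) (zv m k L b)
    simpa using this

end Numerators

/-! ## Wheels of the image: the variables `z` -/

section

variable (P : Params) {m k : ℕ} (hm : 0 < m) (L K : ℕ) (f : MvPolynomial (Fin (m + (k + 1)) × (Fin L ⊕ Fin K)) ℂ)
    (h : MvPolynomial 𝕍 ℂ)

set_option hygiene false

/-- The image of `f` is divisible by the numerators, with quotient `h`. -/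
notation "𝔈" => aeval (mpt (sc P L K m k) (sv hm L K)) f = (numWW P hm L K * numZZ P L K m k * numYZ P hm L K) * h

/-- The specialization of polynomials. -/
notation "𝔐" => aeval (mpt (sc P L K m k) (sv hm L K))

/-- The product of the numerators. -/
notation "𝔑" => numWW P hm L K * numZZ P L K m k * numYZ P hm L K

end

section ZWheels

variable {P : Params} {m k : ℕ} {hm : 0 < m} {L K : ℕ}
    {f : MvPolynomial (𝕀 × (Fin L ⊕ Fin K)) ℂ} {h : MvPolynomial 𝕍 ℂ}

theorem Params.Valid.ratio_ne (hP : P.Valid) {x y : ℂ} (hy : y ≠ 0) {i j : ℤ} (hj : j ≠ 0)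
    (hxy : x = P.q2 ^ i * P.q3 ^ j * y) : x ≠ P.q2 * y ∧ x ≠ P.q2⁻¹ * y ∧ x ≠ y := by
  have key : ∀ i' : ℤ, x ≠ P.q2 ^ i' * y := by
    intro i' h
    rw [hxy] at h
    have := hP.zpow_inj (a := i) (b := j) (a' := i') (b' := 0)
      (by rw [zpow_zero, mul_one]; grind)
    exact hj this.2
  refine ⟨?_, ?_, ?_⟩
  · simpa using key 1
  · simpa using key (-1)
  · simpa using key 0

theorem Params.Valid.ratio_ne' (hP : P.Valid) {x y : ℂ} (hx : x ≠ 0) {i j : ℤ} (hj : j ≠ 0)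
    (hxy : x = P.q2 ^ i * P.q3 ^ j * y) : y ≠ P.q2 * x ∧ y ≠ P.q2⁻¹ * x ∧ y ≠ x := by
  refine hP.ratio_ne hx (i := -i) (j := -j) (neg_ne_zero.2 hj) ?_
  have n2 := zpow_ne_zero i hP.n2
  have n3 := zpow_ne_zero j hP.n3
  rw [hxy, zpow_neg, zpow_neg]
  field_simp

theorem eval_eq_zero_of_z_column (hP : P.Valid) (hg : 𝔈)
    {p₀ : 𝕍 → ℂ} (hp₀ : ∀ s, p₀ s ≠ 0) {u v o : Fin K} {ε j : ℤ} (hε : ε = 1 ∨ ε = -1)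
    (hj : j ≠ 0) (hv : p₀ (zv m k L v) = P.q3 ^ j * p₀ (zv m k L o))
    (hu : p₀ (zv m k L u) = P.q2 ^ ε * p₀ (zv m k L v))
    (hdvd : lin (p₀ (zv m k L u)) (some (zv m k L u)) (P.q2 ^ ε * p₀ (zv m k L v)) none ^ (m + k) ∣
    aeval (mpt p₀ (fam {zv m k L o, zv m k L v})) (𝔐 f)) : eval p₀ h = 0 := by
  classical
  have hζ : ∀ i : 𝕀, ζ i ≠ 0 := fun i => zcoef_ne hP _
  have huv1 : p₀ (zv m k L u) ≠ p₀ (zv m k L v) := by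
    intro h1
    rw [hu] at h1
    have := mul_right_cancel₀ (hp₀ _) (h1.trans (one_mul _).symm)
    have := hP.zpow_inj (a := ε) (b := 0) (a' := 0) (b' := 0) (by simpa using this)
    omega
  have huv : u ≠ v := fun h1 => huv1 (by rw [h1])
  have huv2 : p₀ (zv m k L u) ≠ P.q2 ^ (-ε) * p₀ (zv m k L v) := by
    intro h1
    rw [hu] at h1
    have := mul_right_cancel₀ (hp₀ _) h1
    have := hP.zpow_inj (a := ε) (b := 0) (a' := -ε) (b' := 0) (by simpa using this)
    omega
  have hv' : p₀ (zv m k L v) = P.q2 ^ (0 : ℤ) * P.q3 ^ j * p₀ (zv m k L o) := by simpa using hv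
  have hu' : p₀ (zv m k L u) = P.q2 ^ ε * P.q3 ^ j * p₀ (zv m k L o) := by rw [hu, hv]; ring
  have hvo : v ≠ o := by
    rintro rfl
    exact (hP.ratio_ne (hp₀ _) hj hv').2.2 rfl
  have huo : u ≠ o := by
    rintro rfl
    exact (hP.ratio_ne (hp₀ _) hj hu').2.2 rfl
  set G : MvPolynomial 𝕍 ℂ := ∏ i : 𝕀 with i.val = 0 ∨ i.val = m,
        lin (ζ i) (zv m k L u) (ζ i) (zv m k L v) with hG
  set R : MvPolynomial 𝕍 ℂ := ∏ p : Fin K × Fin K with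
      p.1 < p.2 ∧ ¬ (p.1 = u ∧ p.2 = v) ∧ ¬ (p.1 = v ∧ p.2 = u), pairZZ P L K m k p.1 p.2 with hR
  refine eval_eq_zero_of_fam_pow hp₀ {zv m k L o, zv m k L v} (u := zv m k L u)
    (v := zv m k L v) (t := P.q2 ^ ε) (B := numWW P hm L K * numYZ P hm L K *
      (lin 1 (zv m k L u) (P.q2 ^ (-ε)) (zv m k L v) ^ (m + k - 1) * G * R)) ?_ ?_ hu hg (m + k - 1)
      ?_ ?_ ?_
  · simp [zv, huv, huo]
  · simp
  · have h1 : Associated (numZZ P L K m k) _ :=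
      pairProd_assoc (pairZZ P L K m k) (fun a b _ => pairZZ_swap hm hP a b) huv
    have h2 := (h1.trans ((pairZZ_assoc hm hP u v).mul_right _)).mul_left (numWW P hm L K)
    have h3 := h2.mul_right (numYZ P hm L K)
    refine h3.trans (Associated.of_eq ?_)
    have h4 : lin 1 (zv m k L u) P.q2 (zv m k L v) * lin 1 (zv m k L u) P.q2⁻¹ (zv m k L v) =
        lin 1 (zv m k L u) (P.q2 ^ (-ε)) (zv m k L v) * lin 1 (zv m k L u) (P.q2 ^ ε) (zv m k L v) := by
      rcases hε with rfl | rfl <;> simp [mul_comm]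
    rw [h4, mul_pow]
    ring
  · have hright : ∀ s ∈ insert (zv m k L u) ({zv m k L o, zv m k L v} : Set 𝕍),
        s.isRight := by
      rintro s (rfl | rfl | rfl) <;> rfl
    simp only [map_mul, map_pow]
    refine mul_ne_zero (mul_ne_zero ?_ ?_) (mul_ne_zero (mul_ne_zero (pow_ne_zero _ ?_) ?_) ?_)
    · refine fam_numWW_ne hP hp₀ fun a b _ h1 => ?_
      have := hright _ h1
      simp [wv] at this
    · exact fam_numYZ_ne hP hp₀ (Or.inr hright)
    · refine fam_lin_ne hp₀ one_ne_zero (zv_ne huv) fun _ _ => ?_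
      grind
    · rw [hG, map_prod]
      refine prod_ne_zero_iff.2 fun i _ => fam_lin_ne hp₀ (hζ i) (zv_ne huv) fun _ _ h1 => ?_
      exact huv1 (mul_left_cancel₀ (hζ i) h1)
    · rw [hR, map_prod]
      refine prod_ne_zero_iff.2 fun p hp => ?_
      obtain ⟨x, y⟩ := p
      obtain ⟨h1, h2, h3⟩ := (mem_filter.1 hp).2
      refine fam_pairZZ_ne hP hp₀ h1.ne fun h4 h5 => ?_
      have hmem : ∀ x : Fin K, zv m k L x ∈ insert (zv m k L u)
          ({zv m k L o, zv m k L v} : Set 𝕍) → x = u ∨ x = o ∨ x = v := by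
        intro x hx
        simpa [zv] using hx
      dsimp only at h1 h2 h3 h4 h5 ⊢
      rcases hmem x h4 with rfl | rfl | rfl <;> rcases hmem y h5 with rfl | rfl | rfl
      · grind
      · exact hP.ratio_ne (hp₀ _) hj hu'
      · grind
      · exact hP.ratio_ne' (hp₀ _) hj hu'
      · grind
      · exact hP.ratio_ne' (hp₀ _) hj hv'
      · grind
      · exact hP.ratio_ne (hp₀ _) hj hv'
      · grind
  · grind

theorem aeval_mpt_mpt {σ τ ρ : Type} (c : σ → ℂ) (r : σ → τ) (c' : τ → ℂ) (r' : τ → ρ)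
    (f : MvPolynomial σ ℂ) : aeval (mpt c' r') (aeval (mpt c r) f) =
    aeval (mpt (fun s => c s * c' (r s)) (fun s => r' (r s))) f := by
  rw [← AlgHom.comp_apply]
  congr 1
  ext s
  simp [mpt, mul_assoc]

/-- The colours different from a given one contribute equal factors. -/
theorem pow_lin_dvd {τ : Type} {S : Finset 𝕀} {j : ℕ} (hj : j ≤ m + k)
    (hS : S = Finset.univ.filter fun i => i.val ≠ j) {α : 𝕀 → ℂ}
    {β γ : ℂ} {u v : τ} {g : MvPolynomial τ ℂ}
    (hd : ∏ i ∈ S, lin (α i * β) u (γ * α i) v ∣ g) : lin β u γ v ^ (m + k) ∣ g := by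
  have hcard : S.card = m + k := by
    have : S = ({⟨j, by omega⟩} : Finset _)ᶜ := by
      rw [hS]
      ext l
      simp [Fin.ext_iff]
    rw [this, card_compl, Fintype.card_fin, card_singleton]
    omega
  have h1 : ∀ i, lin (α i * β) u (γ * α i) v = C (α i) * lin β u γ v := by
    intro i
    unfold lin
    grind
  simp only [h1, prod_mul_distrib, prod_const, hcard] at hd
  exact dvd_of_mul_left_dvd hd

theorem eval_eq_zero_of_z_wheelA (hP : P.Valid) (hkm : k + 2 ≤ m)
    (hf : RatioVanish P m (k + 1) f) (hg : 𝔈) {p₀ : 𝕍 → ℂ} (hp₀ : ∀ s, p₀ s ≠ 0) {a b e : Fin K}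
    (hb : p₀ (zv m k L b) = P.q3 ^ ((m : ℤ) - k - 1) * p₀ (zv m k L a))
    (he : p₀ (zv m k L e) = P.q2⁻¹ * p₀ (zv m k L b)) : eval p₀ h = 0 := by
  have he' : p₀ (zv m k L e) = P.q2 ^ (-1 : ℤ) * p₀ (zv m k L b) := by simpa using he
  have hζ : ∀ i : 𝕀, ζ i ≠ 0 := fun i => zcoef_ne hP _
  have hj : (m : ℤ) - k - 1 ≠ 0 := by omega
  have hbe : (inr b : Fin L ⊕ Fin K) ≠ inr e := by
    rintro h1
    obtain rfl := Sum.inr_injective h1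
    have := mul_right_cancel₀ (hp₀ _) (he.symm.trans (one_mul _).symm)
    exact hP.q2_inv_ne_one this
  have hae : (inr a : Fin L ⊕ Fin K) ≠ inr e := by
    rintro h1
    obtain rfl := Sum.inr_injective h1
    exact (hP.ratio_ne (hp₀ _) hj (i := -1) (by rw [mul_assoc, ← hb]; exact he')).2.2 rfl
  refine eval_eq_zero_of_z_column hP hg hp₀ (u := e) (v := b) (o := a) (ε := -1) (Or.inr rfl) hj
    hb he' ?_
  rw [zpow_neg_one, aeval_mpt_mpt]
  have heW : zv m k L e ∉ ({zv m k L a, zv m k L b} : Set 𝕍) := by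
    have h1 : e ≠ a := fun h => hae (by rw [h])
    have h2 : e ≠ b := fun h => hbe (by rw [h])
    simp [zv, h1, h2]
  have hbW : zv m k L b ∈ ({zv m k L a, zv m k L b} : Set 𝕍) := by simp
  have haW : zv m k L a ∈ ({zv m k L a, zv m k L b} : Set 𝕍) := by simp
  have hd := column_dvd f (fun s => sc P L K m k s * p₀ (sv hm L K s))
    (fun s => mul_ne_zero (sc_ne hP s) (hp₀ _))
    (fun s => fam {zv m k L a, zv m k L b} (sv hm L K s)) (inr e)
    (Finset.univ.filter fun i : 𝕀 => i.val ≠ m)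
    (fun i => P.q2⁻¹ * p₀ (zv m k L b) * ζ i)
    (fun i => mul_ne_zero (mul_ne_zero (inv_ne_zero hP.n2) (hp₀ _)) (hζ i)) (fun _ => none) ?_
  · refine pow_lin_dvd (j := m) (by omega) rfl (α := fun i => ζ i) (u := some (zv m k L e)) ?_
    convert hd using 1
    refine prod_congr rfl fun i _ => ?_
    rw [← fam_of_notMem heW]
    rfl
  · intro i hi p hp x hx hxj hxe
    have hxz : ∀ (j : 𝕀) (a' : Fin K), (inr a' : Fin L ⊕ Fin K) ≠ inr e →
        zv m k L a' ∈ ({zv m k L a, zv m k L b} : Set 𝕍) →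
        x (j, inr a') = ζ j * (p₀ (zv m k L a') * p none) := by
      intro j a' ha' hW
      rw [hxj j _ ha']
      show ζ j * p₀ (zv m k L a') * p (fam _ (zv m k L a')) = _
      rw [fam_of_mem hW, mul_assoc]
    refine hf.chain_neg hP hx (e := inr e) (b := inr b) (z := p₀ (zv m k L b) * p none)
      (mem_filter.1 hi).2 (fun _ j _ => hxz j b hbe hbW) (hxz i b hbe hbW)
      (by rw [hxe]; ring) (fun h1 => ?_) (fun h1 => ?_)
    · rw [hxz _ b hbe hbW, next_val_of_ne h1]
    · obtain ⟨j, hj1, hj2⟩ := exists_prev_zero h1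
      refine ⟨j, inr a, hj1, ?_⟩
      rw [hxz _ a hae haW, hj2, h1, zcoef_zero, zcoef_last, hb]
      ring

theorem eval_eq_zero_of_z_wheelB (hP : P.Valid) (hkm : k + 2 ≤ m)
    (hf : RatioVanish P m (k + 1) f) (hg : 𝔈) {p₀ : 𝕍 → ℂ} (hp₀ : ∀ s, p₀ s ≠ 0) {a b e : Fin K}
    (hb : p₀ (zv m k L b) = P.q2⁻¹ * p₀ (zv m k L a))
    (he : p₀ (zv m k L e) = P.q3 ^ ((m : ℤ) - k - 1) * p₀ (zv m k L b)) : eval p₀ h = 0 := by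
  have n2 := hP.n2
  have hζ : ∀ i : 𝕀, ζ i ≠ 0 := fun i => zcoef_ne hP _
  have ha : p₀ (zv m k L a) = P.q2 * p₀ (zv m k L b) := by grind
  have ha' : p₀ (zv m k L a) = P.q2 ^ (1 : ℤ) * p₀ (zv m k L b) := by simpa using ha
  have hj : -((m : ℤ) - k - 1) ≠ 0 := by omega
  have hb' : p₀ (zv m k L b) = P.q3 ^ (-((m : ℤ) - k - 1)) * p₀ (zv m k L e) := by
    have := zpow_ne_zero ((m : ℤ) - k - 1) hP.n3
    rw [he, zpow_neg]
    field_simp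
  have hba : (inr b : Fin L ⊕ Fin K) ≠ inr a := by
    rintro h1
    obtain rfl := Sum.inr_injective h1
    have := mul_right_cancel₀ (hp₀ _) (ha.symm.trans (one_mul _).symm)
    exact hP.q2_ne_one this
  have hea : (inr e : Fin L ⊕ Fin K) ≠ inr a := by
    rintro h1
    obtain rfl := Sum.inr_injective h1
    exact (hP.ratio_ne (hp₀ _) hj (i := 1) (by rw [mul_assoc, ← hb']; exact ha')).2.2 rfl
  refine eval_eq_zero_of_z_column hP hg hp₀ (u := a) (v := b) (o := e) (ε := 1) (Or.inl rfl) hj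
    hb' ha' ?_
  rw [zpow_one, aeval_mpt_mpt]
  have haW : zv m k L a ∉ ({zv m k L e, zv m k L b} : Set 𝕍) := by
    have h1 : a ≠ e := fun h => hea (by rw [h])
    have h2 : a ≠ b := fun h => hba (by rw [h])
    simp [zv, h1, h2]
  have hbW : zv m k L b ∈ ({zv m k L e, zv m k L b} : Set 𝕍) := by simp
  have heW : zv m k L e ∈ ({zv m k L e, zv m k L b} : Set 𝕍) := by simp
  have hd := column_dvd f (fun s => sc P L K m k s * p₀ (sv hm L K s))
    (fun s => mul_ne_zero (sc_ne hP s) (hp₀ _))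
    (fun s => fam {zv m k L e, zv m k L b} (sv hm L K s)) (inr a)
    (Finset.univ.filter fun i : 𝕀 => i.val ≠ 0)
    (fun i => P.q2 * p₀ (zv m k L b) * ζ i)
    (fun i => mul_ne_zero (mul_ne_zero hP.n2 (hp₀ _)) (hζ i)) (fun _ => none) ?_
  · refine pow_lin_dvd (j := 0) (by omega) rfl (α := fun i => ζ i) (u := some (zv m k L a)) ?_
    convert hd using 1
    refine prod_congr rfl fun i _ => ?_
    rw [← fam_of_notMem haW]
    rfl
  · intro i hi p hp x hx hxj hxe
    have hxz : ∀ (j : 𝕀) (a' : Fin K), (inr a' : Fin L ⊕ Fin K) ≠ inr a →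
        zv m k L a' ∈ ({zv m k L e, zv m k L b} : Set 𝕍) →
        x (j, inr a') = ζ j * (p₀ (zv m k L a') * p none) := by
      intro j a' ha' hW
      rw [hxj j _ ha']
      show ζ j * p₀ (zv m k L a') * p (fam _ (zv m k L a')) = _
      rw [fam_of_mem hW, mul_assoc]
    refine hf.chain_pos hP hx (e := inr a) (b := inr b) (z := p₀ (zv m k L b) * p none)
      (mem_filter.1 hi).2 (fun j _ => hxz j b hba hbW) (hxz i b hba hbW)
      (by rw [hxe]; ring) (fun h1 => ?_) (fun h1 => ⟨inr e, ?_⟩)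
    · rw [hxz _ b hba hbW, next_val_of_ne h1]
    · rw [hxz _ e hea heW, next_last_val h1, h1, zcoef_zero, zcoef_last, he]
      ring

end ZWheels

/-! ## Wheels of the image: the variables `y` -/

section Bar

variable (P : Params) (m n : ℕ)

theorem Params.bar_q1 : (P.bar m n).q1 = P.q1 * P.sfq m n := by
  unfold Params.bar Params.shift Params.q1 Params.sfq
  ring

theorem Params.bar_q2 : (P.bar m n).q2 = P.q2 := rfl

theorem Params.bar_q3 : (P.bar m n).q3 = P.q3 * (P.sfq m n)⁻¹ := by
  unfold Params.bar Params.shift Params.q3 Params.sfq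
  grind

end Bar

section YWheels

variable {P : Params} {m k : ℕ} {hm : 0 < m} {L K : ℕ}
    {f : MvPolynomial (𝕀 × (Fin L ⊕ Fin K)) ℂ} {h : MvPolynomial 𝕍 ℂ}

theorem col_ne {i j : ℕ} (hi : i < m + k) (hj : j < m + k) (hij : i ≠ j) :
    (col hm i : Fin (m + k)) ≠ col hm j := by
  intro h
  have := col_eq_col (hm := hm) hi.le hj.le h
  omega

theorem mem_of_wv {W : Set 𝕍} {x : Fin L} {S : ℕ → Fin L → Prop}
    (hW : W = {s | ∃ j a, S j a ∧ s = inl (col hm j, a)}) (hS : ∀ j a, S j a → j ≤ m + k)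
    (h : wv hm K x ∈ W) : S 0 x ∨ S (m + k) x := by
  rw [hW] at h
  obtain ⟨i, a, hc, h1⟩ := h
  obtain ⟨h2, rfl⟩ := Prod.mk.inj (Sum.inl_injective h1)
  rcases col_eq_col (hm := hm) (Nat.zero_le _) (hS _ _ hc) h2 with h3 | h3 | h3
  · grind
  · grind
  · omega

/-- The vertices of a wheel are given by colours in `{0, …, m + k}`, both ends of which are
fused. -/
theorem eval_eq_zero_of_vertices (hP : P.Valid) (hg : 𝔈)
    {p₀ : 𝕍 → ℂ} (hp₀ : ∀ s, p₀ s ≠ 0) (S : ℕ → Fin L → Prop) (hS : ∀ j a, S j a → j ≤ m + k)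
    (hWW : ∀ a b, a ≠ b → (S 0 a ∨ S (m + k) a) → (S 0 b ∨ S (m + k) b) →
    k = 0 ∧ p₀ (wv hm K a) ≠ p₀ (wv hm K b))
    (hv : ∀ x : 𝕀 × (Fin L ⊕ Fin K) → ℂ, ∀ r : ℂ, (∀ s, x s ≠ 0) →
    (∀ (i : 𝕀) (j : ℕ) (a : Fin L), S j a → (col hm i : Fin (m + k)) = col hm j →
    x (i, inl a) = η i * p₀ (inl (col hm i, a)) * r) → eval x f = 0) : eval p₀ h = 0 := by
  set W : Set 𝕍 := {s | ∃ j a, S j a ∧ s = inl (col hm j, a)} with hW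
  have hleft : ∀ s ∈ W, s.isLeft := by grind
  refine eval_eq_zero_of_fam hp₀ W hg ?_ ?_
  · rw [map_mul, map_mul]
    refine mul_ne_zero (mul_ne_zero ?_ (fam_numZZ_ne hP hp₀ hleft))
      (fam_numYZ_ne hP hp₀ (Or.inl hleft))
    exact fam_numWW_ne hP hp₀ fun a b hab h1 h2 =>
      hWW a b hab (mem_of_wv hW hS h1) (mem_of_wv hW hS h2)
  · intro q r hq hqW
    rw [eval_mpt]
    refine hv _ r (fun s => mul_ne_zero (sc_ne hP s) (hq _)) fun i j a hja hij => ?_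
    show η i * q (inl (col hm i, a)) = _
    rw [hqW _ ⟨j, a, hja, by rw [hij]⟩, mul_assoc]

theorem eval_eq_zero_of_y_pos (hP : P.Valid) (hkm : k + 2 ≤ m)
    (hf : RatioVanish P m (k + 1) f) (hg : 𝔈)
    {p₀ : 𝕍 → ℂ} (hp₀ : ∀ s, p₀ s ≠ 0) (i : 𝕀) (hi : i.val ≠ 0)
    (hlast : i.val = m + k → k = 0) {e b : Fin L}
    (he : p₀ (inl (col hm i, e)) = P.q2 * p₀ (inl (col hm i, b)))
    (hprev : ∀ j, i.val = j + 1 → i.val ≤ m → ∃ a, p₀ (inl (col hm i, b)) =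
    P.q3 * 𝔮⁻¹ * p₀ (inl (col hm j, a)))
    (hnext : m ≤ i.val → i.val ≠ m + k → ∃ a, p₀ (inl (col hm (i + 1), a)) =
    (P.q3 * 𝔮⁻¹)⁻¹ * p₀ (inl (col hm i, b))) : eval p₀ h = 0 := by
  have n2 := hP.n2
  have n3 := hP.n3
  have ns := Params.Valid.sfq_ne P m (k + 1)
  have hi2 := i.2
  obtain ⟨j, hj⟩ : ∃ j, i.val = j + 1 := ⟨i.val - 1, by omega⟩
  obtain ⟨a, ha⟩ : ∃ a, i.val ≤ m → p₀ (inl (col hm i, b)) =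
      P.q3 * 𝔮⁻¹ * p₀ (inl (col hm j, a)) := by
    by_cases h1 : i.val ≤ m
    · obtain ⟨a, ha⟩ := hprev j hj h1
      grind
    · exact ⟨b, fun h2 => absurd h2 h1⟩
  obtain ⟨a', ha'⟩ : ∃ a', m ≤ i.val → i.val ≠ m + k → p₀ (inl (col hm (i + 1), a')) =
      (P.q3 * 𝔮⁻¹)⁻¹ * p₀ (inl (col hm i, b)) := by
    by_cases h1 : m ≤ i.val ∧ i.val ≠ m + k
    · grind
    · exact ⟨b, fun h2 h3 => absurd ⟨h2, h3⟩ h1⟩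
  refine eval_eq_zero_of_vertices hP hg hp₀ (fun c x => (c = i.val ∧ (x = e ∨ x = b)) ∨
    (i.val ≤ m ∧ c = j ∧ x = a) ∨ (m ≤ i.val ∧ i.val ≠ m + k ∧ c = i.val + 1 ∧ x = a')) ?_ ?_ ?_
  · grind
  · intro x y hxy hx hy
    by_cases hl : i.val = m + k
    · have hk := hlast hl
      have key : ∀ x, (wv hm K x : 𝕍) = inl (col hm i, x) := by
        intro x
        rw [hl, col_last]
        rfl
      have hne : p₀ (inl (col hm i, e)) ≠ p₀ (inl (col hm i, b)) := by
        rw [he]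
        intro h1
        exact hP.q2_ne_one (mul_right_cancel₀ (hp₀ _) (h1.trans (one_mul _).symm))
      grind
    · grind
  · intro x r hx hxS
    have hx1 : ∀ c, c = e ∨ c = b →
        x (i, inl c) = η i * p₀ (inl (col hm i, c)) * r := by grind
    have hb := hx1 b (Or.inr rfl)
    refine hf.pos i hi x hx (inl e) (inl b) ?_ ?_ ?_
    · grind
    · intro h1
      obtain ⟨j', hj', hj''⟩ := exists_prev hi
      obtain rfl : j = j'.val := by omega
      refine ⟨j', inl a, hj', ?_⟩
      rw [hb, hxS j' j' a (Or.inr (Or.inl ⟨h1, rfl, rfl⟩)) rfl, ha h1, hj'', ycoef_succ_of_lt (by omega)]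
      field_simp
    · intro h1
      by_cases h2 : i.val = m + k
      · refine ⟨inl e, ?_⟩
        have h3 : (col hm (next i) : Fin (m + k)) = col hm i := by
          rw [next_last_val h2, h2, col_last]
        rw [hb, hxS (next i) i e (Or.inl ⟨rfl, Or.inl rfl⟩) h3, h3, he, next_last_val h2, ycoef_zero, h2,
          ycoef_last hP (by omega), hP.q1_eq]
        field_simp
      · refine ⟨inl a', ?_⟩
        have h3 := next_val_of_ne h2
        rw [hb, hxS (next i) (i.val + 1) a' (Or.inr (Or.inr ⟨h1, h2, rfl, rfl⟩)) (by rw [h3]), h3, ha' h1 h2, ycoef_succ_of_le h1]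
        field_simp

theorem eval_eq_zero_of_y_neg (hP : P.Valid) (hkm : k + 2 ≤ m)
    (hf : RatioVanish P m (k + 1) f) (hg : 𝔈)
    {p₀ : 𝕍 → ℂ} (hp₀ : ∀ s, p₀ s ≠ 0) (i : 𝕀) (hi : i.val ≠ m)
    (hzero : i.val = 0 → k = 0) (hlast : i.val ≠ m + k) {e b : Fin L}
    (he : p₀ (inl (col hm i, e)) = P.q2⁻¹ * p₀ (inl (col hm i, b)))
    (hprev : ∀ j, i.val = j + 1 → m < i.val → ∃ a, p₀ (inl (col hm i, b)) =
    (P.q3 * 𝔮⁻¹)⁻¹ * p₀ (inl (col hm j, a)))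
    (hnext : i.val < m → ∃ a, p₀ (inl (col hm (i + 1), a)) =
    P.q3 * 𝔮⁻¹ * p₀ (inl (col hm i, b))) : eval p₀ h = 0 := by
  have n2 := hP.n2
  have n3 := hP.n3
  have ns := Params.Valid.sfq_ne P m (k + 1)
  have hi2 := i.2
  obtain ⟨j, hj⟩ : ∃ j, m < i.val → i.val = j + 1 := ⟨i.val - 1, by omega⟩
  obtain ⟨a, ha⟩ : ∃ a, m < i.val → p₀ (inl (col hm i, b)) =
      (P.q3 * 𝔮⁻¹)⁻¹ * p₀ (inl (col hm j, a)) := by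
    by_cases h1 : m < i.val
    · obtain ⟨a, ha⟩ := hprev j (hj h1) h1
      grind
    · grind
  obtain ⟨a', ha'⟩ : ∃ a', i.val < m → p₀ (inl (col hm (i + 1), a')) =
      P.q3 * 𝔮⁻¹ * p₀ (inl (col hm i, b)) := by
    by_cases h1 : i.val < m
    · grind
    · exact ⟨b, fun h2 => absurd h2 h1⟩
  refine eval_eq_zero_of_vertices hP hg hp₀ (fun c x => (c = i.val ∧ (x = e ∨ x = b)) ∨
    (m < i.val ∧ c = j ∧ x = a) ∨ (i.val < m ∧ c = i.val + 1 ∧ x = a')) ?_ ?_ ?_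
  · grind
  · intro x y hxy hx hy
    by_cases hl : i.val = 0
    · have hk := hzero hl
      have key : ∀ x, (wv hm K x : 𝕍) = inl (col hm i, x) := by
        intro x
        rw [hl]
        rfl
      have hne : p₀ (inl (col hm i, e)) ≠ p₀ (inl (col hm i, b)) := by
        rw [he]
        intro h1
        exact hP.q2_inv_ne_one (mul_right_cancel₀ (hp₀ _) (h1.trans (one_mul _).symm))
      grind
    · grind
  · intro x r hx hxS
    have hx1 : ∀ c, c = e ∨ c = b →
        x (i, inl c) = η i * p₀ (inl (col hm i, c)) * r := by grind
    have hb := hx1 b (Or.inr rfl)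
    refine hf.neg i hi x hx (inl e) (inl b) ?_ ?_ ?_
    · grind
    · intro h1
      by_cases h0 : i.val = 0
      · obtain ⟨j', hj', hj''⟩ := exists_prev_zero h0
        refine ⟨j', inl e, hj', ?_⟩
        have h3 : (col hm j' : Fin (m + k)) = col hm i := by rw [hj'', h0, col_last]
        rw [hb, hxS j' i e (Or.inl ⟨rfl, Or.inl rfl⟩) h3, h3, he, hj'', h0, ycoef_zero,
          ycoef_last hP (by omega), hP.q1_eq]
        field_simp
      · have h1' : m < i.val := by omega
        obtain ⟨j', hj', hj''⟩ := exists_prev h0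
        obtain rfl : j = j'.val := by grind
        refine ⟨j', inl a, hj', ?_⟩
        rw [hb, hxS j' j' a (Or.inr (Or.inl ⟨h1', rfl, rfl⟩)) rfl, ha h1', hj'', ycoef_succ_of_le (by omega)]
        field_simp
    · intro h1
      refine ⟨inl a', ?_⟩
      have h3 := next_val_of_ne hlast
      rw [hb, hxS (next i) (i.val + 1) a' (Or.inr (Or.inr ⟨h1, rfl, rfl⟩)) (by rw [h3]), h3, ha' h1,
        ycoef_succ_of_lt h1]
      field_simp

end YWheels

/-! ## Wheels of the image: the quartic wheels around the fused colour -/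

theorem sq_lin_dvd {σ τ υ : Type} {f : MvPolynomial σ ℂ} {c₁ : σ → ℂ} {r₁ : σ → τ}
    {c₂ c₃ : τ → ℂ} {r₂ r₃ : τ → υ} {α β : ℂ} {u v : τ} {u' v' : υ} (hα : α ≠ 0) (hβ : β ≠ 0)
    (huv : u ≠ v) (huv' : u' ≠ v') (h2u : c₂ u = 1 ∧ r₂ u = u') (h2v : c₂ v = 1 ∧ r₂ v = v')
    (h3u : c₃ u = 1 ∧ r₃ u = u') (h3v : c₃ v = 1 ∧ r₃ v = v')
    (h₁ : ∀ p : τ → ℂ, (∀ t, p t ≠ 0) → α * p u = β * p v → eval (fun s => c₁ s * p (r₁ s)) f = 0)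
    (h₃ : ∀ p : υ → ℂ, (∀ t, p t ≠ 0) → eval (fun s => c₁ s * (c₃ (r₁ s) * p (r₃ (r₁ s)))) f = 0)
    (hp : ∀ p : υ → ℂ, (∀ t, p t ≠ 0) → α * p u' = β * p v' →
    ∀ t, c₂ t * p (r₂ t) = c₃ t * p (r₃ t)) :
    lin α u' β v' ^ 2 ∣ aeval (mpt (fun s => c₁ s * c₂ (r₁ s)) (fun s => r₂ (r₁ s))) f := by
  obtain ⟨h0, hh0⟩ : lin α u β v ∣ aeval (mpt c₁ r₁) f := by
    apply lin_dvd_of_torus hα hβ huv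
    intro p hp h
    rw [eval_mpt]
    exact h₁ p hp h
  have e2 : aeval (mpt c₂ r₂) (lin α u β v) = lin α u' β v' := by
    rw [aeval_lin, h2u.1, h2u.2, h2v.1, h2v.2, mul_one, mul_one]
  have e3 : aeval (mpt c₃ r₃) (lin α u β v) = lin α u' β v' := by
    rw [aeval_lin, h3u.1, h3u.2, h3v.1, h3v.2, mul_one, mul_one]
  have h30 : aeval (mpt c₃ r₃) h0 = 0 := by
    have : aeval (mpt c₃ r₃) (aeval (mpt c₁ r₁) f) = 0 := by
      apply eq_zero_of_torus
      intro p hp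
      rw [eval_mpt, eval_mpt]
      exact h₃ p hp
    rw [hh0, map_mul, e3] at this
    exact (mul_eq_zero.1 this).resolve_left (lin_ne_zero (Or.inl huv') hα)
  rw [← aeval_mpt_mpt, hh0, map_mul, e2, pow_two]
  refine mul_dvd_mul_left _ (lin_dvd_of_torus hα hβ huv' fun p hp' h => ?_)
  rw [eval_mpt]
  have := congrArg (eval p) h30
  rw [eval_mpt, map_zero] at this
  rw [← this]
  congr 2
  funext t
  exact hp p hp' h t

section YWheels

variable {P : Params} {m k : ℕ} {hm : 0 < m} {L K : ℕ}
    {f : MvPolynomial (𝕀 × (Fin L ⊕ Fin K)) ℂ} {h : MvPolynomial 𝕍 ℂ}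

theorem sq_lin_dvd_of_fused (hP : P.Valid) (hkm : k + 2 ≤ m) (hk : k ≠ 0)
    (hf : RatioVanish P m (k + 1) f) {p₀ : 𝕍 → ℂ} (hp₀ : ∀ s, p₀ s ≠ 0) {a b e o : Fin L}
    (hb : p₀ (wv hm K b) = (P.q3 * 𝔮⁻¹)⁻¹ * p₀ (inl (col hm (m + k - 1), a)))
    (he : p₀ (inl (col hm 1, e)) = P.q3 * 𝔮⁻¹ * p₀ (wv hm K b)) (hbo : b ≠ o) :
    lin (p₀ (wv hm K o)) (some (wv hm K o)) (P.q2⁻¹ * p₀ (wv hm K b)) none ^ 2 ∣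
    aeval (mpt p₀ (fam {wv hm K b, inl (col hm 1, e), inl (col hm (m + k - 1), a)})) (𝔐 f) := by
  classical
  have n2 := hP.n2
  have n3 := hP.n3
  have ns := Params.Valid.sfq_ne P m (k + 1)
  have n1 : P.q1 = P.q2⁻¹ * P.q3⁻¹ := hP.q1_eq
  set W : Set 𝕍 := {wv hm K b, inl (col hm 1, e), inl (col hm (m + k - 1), a)} with hW
  have c01 := col_ne (hm := hm) (show 0 < m + k by omega) (show 1 < m + k by omega) zero_ne_one
  have c0l := col_ne (hm := hm) (show 0 < m + k by omega) (show m + k - 1 < m + k by omega)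
    (by omega)
  have hoW : wv hm K o ∉ W := by simp [hW, wv, c01, c0l, hbo.symm]
  have hbW : wv hm K b ∈ W := by simp [hW]
  set i0 : 𝕀 := ⟨0, by omega⟩ with hi0
  set i1 : 𝕀 := ⟨1, by omega⟩ with hi1
  set il : 𝕀 := ⟨m + k, by omega⟩ with hil
  set ip : 𝕀 := ⟨m + k - 1, by omega⟩ with hip
  have nl : next il = i0 := Fin.ext (next_last_val rfl)
  have n0 : next i0 = i1 := Fin.ext (next_val_of_ne (show (0 : ℕ) ≠ m + k by omega))
  have np : next ip = il := Fin.ext ((next_val_of_ne (show m + k - 1 ≠ m + k by omega)).trans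
    (show m + k - 1 + 1 = m + k by omega))
  have hsl : ∀ x : Fin L, sv hm L K (il, inl x) = (wv hm K x : 𝕍) := fun x => by
    show inl (col hm (m + k), x) = _
    rw [col_last]
    rfl
  have yl : η (m + k) = 1 := ycoef_last hP (by omega)
  have yp : η (m + k - 1) = 𝔮 := by
    have := ycoef_succ_of_le (P := P) (n := k + 1) (show m ≤ m + k - 1 by omega)
    grind
  have y1 : η 1 = 𝔮 * P.q1 := by
    have := ycoef_succ_of_lt (P := P) (n := k + 1) (show 0 < m by omega)
    rw [ycoef_zero] at this
    exact this
  set r₁ : 𝕀 × (Fin L ⊕ Fin K) → Option 𝕍 ⊕ Fin 3 := fun s =>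
    if s = (i0, inl b) then inr 0 else if s = (i0, inl o) then inr 1 else
      if s = (i1, inl e) then inr 2 else inl (fam W (sv hm L K s)) with hr₁
  set c₁ : 𝕀 × (Fin L ⊕ Fin K) → ℂ := fun s =>
    if s = (i0, inl b) then 1 else if s = (i0, inl o) then 1 else
      if s = (i1, inl e) then 1 else sc P L K m k s * p₀ (sv hm L K s) with hc₁
  have i01 : i0 ≠ i1 := fun h => absurd (congrArg Fin.val h) zero_ne_one
  have i0l : il ≠ i0 := fun h => absurd (congrArg Fin.val h) (show m + k ≠ 0 by omega)
  have i1l : il ≠ i1 := fun h => absurd (congrArg Fin.val h) (show m + k ≠ 1 by omega)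
  have i0p : ip ≠ i0 := fun h => absurd (congrArg Fin.val h) (show m + k - 1 ≠ 0 by omega)
  have i1p : ip ≠ i1 := fun h => absurd (congrArg Fin.val h) (show m + k - 1 ≠ 1 by omega)
  have s1 : c₁ (i0, inl b) = 1 ∧ r₁ (i0, inl b) = inr 0 := by grind
  have s2 : c₁ (i0, inl o) = 1 ∧ r₁ (i0, inl o) = inr 1 := by grind
  have s3 : c₁ (i1, inl e) = 1 ∧ r₁ (i1, inl e) = inr 2 := by grind
  have sl : ∀ x : Fin L, c₁ (il, inl x) = p₀ (wv hm K x) ∧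
      r₁ (il, inl x) = inl (fam W (wv hm K x)) := by
    intro x
    have : sc P L K m k (il, inl x) = 1 := yl
    grind
  have sp : c₁ (ip, inl a) = 𝔮 * p₀ (inl (col hm (m + k - 1), a)) ∧
      r₁ (ip, inl a) = inl none := by
    have h1 : sc P L K m k (ip, inl a) = 𝔮 := yp
    have h2 : sv hm L K (ip, inl a) = inl (col hm (m + k - 1), a) := rfl
    simp only [hr₁, hc₁, Prod.mk.injEq, i0p, i1p, false_and, if_false, h1, h2]
    rw [fam_of_mem (by simp [hW])]
    simp
  set v₂ : Fin 3 → ℂ := ![P.q1 * p₀ (wv hm K b), P.q1 * p₀ (wv hm K o),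
    𝔮 * P.q1 * p₀ (inl (col hm 1, e))] with hv₂
  set v₃ : Fin 3 → ℂ := ![P.q3⁻¹ * p₀ (wv hm K o), P.q1 * p₀ (wv hm K o),
    p₀ (wv hm K o)] with hv₃
  have key := sq_lin_dvd (f := f) (c₁ := c₁) (r₁ := r₁)
    (c₂ := Sum.elim (fun _ => 1) v₂) (r₂ := Sum.elim id ![none, some (wv hm K o), none])
    (c₃ := Sum.elim (fun _ => 1) v₃)
    (r₃ := Sum.elim id ![some (wv hm K o), some (wv hm K o), some (wv hm K o)])
    (α := p₀ (wv hm K o)) (β := P.q2⁻¹ * p₀ (wv hm K b)) (u := inl (some (wv hm K o)))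
    (v := inl none) (u' := some (wv hm K o)) (v' := none)
    (hp₀ _) (mul_ne_zero (inv_ne_zero n2) (hp₀ _)) (by simp) (by simp) ⟨rfl, rfl⟩ ⟨rfl, rfl⟩
    ⟨rfl, rfl⟩ ⟨rfl, rfl⟩ ?_ ?_ ?_
  · rw [aeval_mpt_mpt]
    have e1 : (fun s => sc P L K m k s * p₀ (sv hm L K s)) =
        fun s => c₁ s * Sum.elim (fun _ => 1) v₂ (r₁ s) := by
      funext s
      simp only [hr₁, hc₁]
      split_ifs with h1 h2 h3
      · subst h1
        simp only [Sum.elim_inr, hv₂, Matrix.cons_val_zero, one_mul]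
        rw [← ycoef_zero (P := P) (m := m) (n := k + 1)]
        rfl
      · subst h2
        simp only [Sum.elim_inr, hv₂, Matrix.cons_val_one, Matrix.cons_val_zero, one_mul]
        rw [← ycoef_zero (P := P) (m := m) (n := k + 1)]
        rfl
      · subst h3
        simp only [Sum.elim_inr, hv₂, one_mul]
        rw [← y1]
        rfl
      · simp
    have e2 : (fun s => fam W (sv hm L K s)) =
        fun s => Sum.elim id ![none, some (wv hm K o), none] (r₁ s) := by
      funext s
      simp only [hr₁]
      split_ifs with h1 h2 h3
      · subst h1
        exact fam_of_mem hbW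
      · subst h2
        exact fam_of_notMem hoW
      · subst h3
        exact fam_of_mem (by simp [hW, sv, hi1])
      · rfl
    grind
  · intro p hp h1
    have hne : ∀ s, c₁ s ≠ 0 := by
      intro s
      simp only [hc₁]
      split_ifs
      · exact one_ne_zero
      · exact one_ne_zero
      · exact one_ne_zero
      · exact mul_ne_zero (sc_ne hP s) (hp₀ _)
    refine hf.neg il (show m + k ≠ m by omega) _ (fun s => mul_ne_zero (hne s) (hp _))
      (inl o) (inl b) ?_ (fun _ => ⟨ip, inl a, np, ?_⟩) (fun h2 => ?_)
    · rw [(sl o).1, (sl o).2, (sl b).1, (sl b).2, fam_of_mem hbW, fam_of_notMem hoW, h1]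
      ring
    · rw [(sl b).1, (sl b).2, sp.1, sp.2, fam_of_mem hbW, hb]
      field_simp
    · grind
  · intro p hp
    have hne : ∀ t, (Sum.elim (fun _ => 1) v₃ : Option 𝕍 ⊕ Fin 3 → ℂ) t ≠ 0 := by
      rintro (t | t)
      · exact one_ne_zero
      · fin_cases t
        · exact mul_ne_zero (inv_ne_zero n3) (hp₀ _)
        · exact mul_ne_zero hP.n1 (hp₀ _)
        · exact hp₀ _
    have hne₁ : ∀ s, c₁ s ≠ 0 := by
      intro s
      simp only [hc₁]
      split_ifs
      · exact one_ne_zero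
      · exact one_ne_zero
      · exact one_ne_zero
      · exact mul_ne_zero (sc_ne hP s) (hp₀ _)
    refine hf.neg i0 (show 0 ≠ m by omega) _
      (fun s => mul_ne_zero (hne₁ s) (mul_ne_zero (hne _) (hp _)))
      (inl o) (inl b) ?_ (fun _ => ⟨il, inl o, nl, ?_⟩) (fun _ => ⟨inl e, ?_⟩)
    · rw [s1.1, s1.2, s2.1, s2.2]
      simp only [Sum.elim_inr, hv₃, Matrix.cons_val_one, Matrix.cons_val_zero, one_mul, n1]
      ring
    · rw [s1.1, s1.2, (sl o).1, (sl o).2, fam_of_notMem hoW]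
      simp only [Sum.elim_inr, Sum.elim_inl, hv₃, Matrix.cons_val_zero, one_mul, id]
      ring
    · rw [n0, s1.1, s1.2, s3.1, s3.2]
      simp only [Sum.elim_inr, hv₃, Matrix.cons_val_zero, one_mul]
      show p₀ (wv hm K o) * p (some (wv hm K o)) = _
      field_simp
  · intro p hp h1 t
    have hpb : p₀ (wv hm K b) * p none = P.q2 * (p₀ (wv hm K o) * p (some (wv hm K o))) := by
      rw [h1]
      field_simp
    rcases t with t | t
    · rfl
    · fin_cases t
      · show P.q1 * p₀ (wv hm K b) * p none = P.q3⁻¹ * p₀ (wv hm K o) * p (some (wv hm K o))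
        rw [mul_assoc, hpb, n1]
        field_simp
      · rfl
      · show 𝔮 * P.q1 * p₀ (inl (col hm 1, e)) * p none =
          p₀ (wv hm K o) * p (some (wv hm K o))
        have : 𝔮 * P.q1 * p₀ (inl (col hm 1, e)) * p none =
            P.q1 * P.q3 * (p₀ (wv hm K b) * p none) := by
          rw [he]
          field_simp
        rw [this, hpb, n1]
        field_simp

theorem eval_eq_zero_of_fused (hP : P.Valid) (hkm : k + 2 ≤ m) (hk : k ≠ 0)
    (hf : RatioVanish P m (k + 1) f) (hg : 𝔈) {p₀ : 𝕍 → ℂ} (hp₀ : ∀ s, p₀ s ≠ 0) {a b e o : Fin L}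
    (hb : p₀ (wv hm K b) = (P.q3 * 𝔮⁻¹)⁻¹ * p₀ (inl (col hm (m + k - 1), a)))
    (he : p₀ (inl (col hm 1, e)) = P.q3 * 𝔮⁻¹ * p₀ (wv hm K b))
    (ho : p₀ (wv hm K o) = P.q2⁻¹ * p₀ (wv hm K b)) : eval p₀ h = 0 := by
  have hbo : b ≠ o := by
    rintro rfl
    exact hP.q2_inv_ne_one (mul_right_cancel₀ (hp₀ _) (ho.symm.trans (one_mul _).symm))
  have c01 := col_ne (hm := hm) (show 0 < m + k by omega) (show 1 < m + k by omega) zero_ne_one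
  have c0l := col_ne (hm := hm) (show 0 < m + k by omega) (show m + k - 1 < m + k by omega)
    (by omega)
  set R : MvPolynomial 𝕍 ℂ := ∏ p : Fin L × Fin L with
      p.1 < p.2 ∧ ¬ (p.1 = o ∧ p.2 = b) ∧ ¬ (p.1 = b ∧ p.2 = o), pairWW P hm L K p.1 p.2 with hR
  have hmem : ∀ x : Fin L, wv hm K x ∈ insert (wv hm K o) ({wv hm K b, inl (col hm 1, e),
      inl (col hm (m + k - 1), a)} : Set 𝕍) → x = o ∨ x = b := by
    intro x hx
    simpa [wv, c01, c0l] using hx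
  have hleft : ∀ s ∈ insert (wv hm K o) ({wv hm K b, inl (col hm 1, e),
      inl (col hm (m + k - 1), a)} : Set 𝕍), s.isLeft := by
    rintro s (rfl | rfl | rfl | rfl) <;> rfl
  refine eval_eq_zero_of_fam_pow hp₀ {wv hm K b, inl (col hm 1, e),
    inl (col hm (m + k - 1), a)} (u := wv hm K o) (v := wv hm K b) (t := P.q2⁻¹)
    (B := lin 1 (wv hm K o) P.q2 (wv hm K b) * R * numZZ P L K m k * numYZ P hm L K)
    ?_ (by simp) ho hg 1 ?_ ?_ (sq_lin_dvd_of_fused hP hkm hk hf hp₀ hb he hbo)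
  · simp [wv, c01, c0l, hbo.symm]
  · have h1 : Associated (numWW P hm L K) _ :=
      pairProd_assoc (pairWW (k := k) P hm L K) (fun a b _ => pairWW_swap hP a b) hbo.symm
    refine ((h1.mul_right _).mul_right _).trans (Associated.of_eq ?_)
    have h2 : pairWW P hm L K o b = lin 1 (wv (k := k) hm K o) P.q2 (wv hm K b) *
        lin 1 (wv hm K o) P.q2⁻¹ (wv hm K b) := if_neg hk
    grind
  · simp only [map_mul]
    refine mul_ne_zero (mul_ne_zero (mul_ne_zero ?_ ?_) (fam_numZZ_ne hP hp₀ hleft))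
      (fam_numYZ_ne hP hp₀ (Or.inl hleft))
    · refine fam_lin_ne hp₀ one_ne_zero (wv_ne hbo.symm) fun _ _ => ?_
      rw [one_mul, ho]
      intro h1
      exact hP.q2_ne_inv (mul_right_cancel₀ (hp₀ _) h1).symm
    · rw [hR, map_prod]
      refine prod_ne_zero_iff.2 fun p hp => ?_
      obtain ⟨x, y⟩ := p
      obtain ⟨h1, h2, h3⟩ := (mem_filter.1 hp).2
      refine fam_pairWW_ne hP hp₀ h1.ne fun h4 h5 => ?_
      grind

theorem next_eq_col (i : Fin (m + k)) : next i = col hm (i.val + 1) := rfl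

theorem eq_col (i : Fin (m + k)) : i = col hm i.val := Fin.ext (Nat.mod_eq_of_lt i.2).symm

theorem eval_eq_zero_of_super_wheel (hP : P.Valid) (hkm : k + 2 ≤ m) (hk : k ≠ 0)
    (hf : RatioVanish P m (k + 1) f) (hg : 𝔈) {p₀ : 𝕍 → ℂ} (hp₀ : ∀ s, p₀ s ≠ 0)
    (hw : (superType 𝔓 m k).wheel L fun i a => p₀ (inl (i, a))) : eval p₀ h = 0 := by
  have n2 := hP.n2
  have n3 := hP.n3
  have ns := Params.Valid.sfq_ne P m (k + 1)
  have n1 : P.q1 = P.q2⁻¹ * P.q3⁻¹ := hP.q1_eq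
  obtain ⟨i, hi⟩ := hw
  have hi2 := i.2
  simp only [wheelA, wheelB, wheelC, Params.bar_q1, Params.bar_q2, Params.bar_q3] at hi
  have hnext := next_val_cases i
  rcases hi with ⟨h1, h2, a, b, e, h3, h4⟩ | ⟨h1, h2, a, b, e, h3, h4⟩ | ⟨h1, a, b, e, o, h3, h4, h5⟩ |
    ⟨h1, a, b, e, h3, h4⟩ | ⟨h1, a, b, e, h3, h4⟩ | ⟨h1, a, b, e, o, h3, h4, h5⟩
  · refine eval_eq_zero_of_y_pos hP hkm hf hg hp₀ ⟨i.val + 1, by omega⟩ (by simp)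
      (fun h => by grind) (e := e) (b := b) h4 (fun j hj _ => ⟨a, ?_⟩)
      (fun h => by grind)
    obtain rfl : i.val = j := by simpa using hj
    rw [← eq_col]
    exact h3
  · refine eval_eq_zero_of_y_neg hP hkm hf hg hp₀ ⟨i.val, by omega⟩ (by dsimp only; omega)
      (fun h => by grind) (by dsimp only; omega) (e := a) (b := b) ?_
      (fun j hj h => by grind) (fun h => ⟨e, ?_⟩)
    · dsimp only
      rw [← eq_col, h3]
      field_simp
    · dsimp only
      rw [← eq_col]
      exact h4
  · refine eval_eq_zero_of_y_pos hP hkm hf hg hp₀ ⟨i.val + 1, by omega⟩ (by simp)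
      (fun h => by grind) (e := o) (b := b) ?_ (fun j hj _ => ⟨a, ?_⟩)
      (fun _ _ => ⟨e, ?_⟩)
    · dsimp only
      rw [← next_eq_col, h5, h4, n1]
      field_simp
    · obtain rfl : i.val = j := by simpa using hj
      rw [← eq_col]
      exact h3
    · dsimp only
      rw [← next_eq_col, ← h4, next_eq_col (hm := hm) (next i),
        show (next i).val = i.val + 1 by omega]
  · refine eval_eq_zero_of_y_neg hP hkm hf hg hp₀ ⟨i.val + 1, by omega⟩ (by dsimp only; omega)
      (fun h => by grind) (by dsimp only; omega) (e := e) (b := b) h4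
      (fun j hj _ => ⟨a, ?_⟩) (fun h => by grind)
    obtain rfl : i.val = j := by simpa using hj
    dsimp only
    rw [← eq_col, ← next_eq_col, h3, mul_inv]
  · refine eval_eq_zero_of_y_pos hP hkm hf hg hp₀ ⟨i.val, by omega⟩ (by dsimp only; omega)
      (fun h => by grind) (e := a) (b := b) ?_
      (fun j hj h => by grind) (fun _ _ => ⟨e, ?_⟩)
    · dsimp only
      rw [← eq_col, h3]
      field_simp
    · dsimp only
      rw [← eq_col]
      exact h4
  · have hl : i = col hm (m + k - 1) := by
      rw [eq_col (hm := hm) i]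
      grind
    have h0 : next i = col hm 0 := Fin.ext (by rw [h1]; simp [col])
    have h00 : next (next i) = col hm 1 := by
      rw [h0]
      ext
      simp [next, col]
    rw [h00, h0] at h4
    rw [h00, h0] at h5
    rw [h0, hl] at h3
    rw [inv_inv] at h4 h5
    refine eval_eq_zero_of_fused hP hkm hk hf hg hp₀ (a := a) (b := b) (e := e) (o := o) h3 h4 ?_
    show p₀ (inl (col hm 0, o)) = P.q2⁻¹ * p₀ (inl (col hm 0, b))
    grind

end YWheels

section YWheels

variable {P : Params} {m : ℕ} {hm : 0 < m} {L K : ℕ}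
    {f : MvPolynomial (Fin (m + (0 + 1)) × (Fin L ⊕ Fin K)) ℂ} {h : MvPolynomial (YZIdx m 0 L K) ℂ}

theorem eval_eq_zero_of_even_wheel (hP : P.Valid) (hkm : 0 + 2 ≤ m)
    (hf : RatioVanish P m (0 + 1) f) (hg : aeval (mpt (sc P L K m 0) (sv hm L K)) f =
    (numWW P hm L K * numZZ P L K m 0 * numYZ P hm L K) * h)
    {p₀ : YZIdx m 0 L K → ℂ} (hp₀ : ∀ s, p₀ s ≠ 0)
    (hw : (evenType' (P.bar m (0 + 1)) (m + 0)).wheel L fun i a => p₀ (inl (i, a))) :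
    eval p₀ h = 0 := by
  have n2 := hP.n2
  have n3 := hP.n3
  obtain ⟨i, hi⟩ := hw
  have hi2 : i.val < m := i.2
  simp only [wheelA, wheelB, Params.bar_q2, Params.bar_q3] at hi
  rcases hi with ⟨a, b, e, h3, h4⟩ | ⟨a, b, e, h3, h4⟩
  · refine eval_eq_zero_of_y_pos hP hkm hf hg hp₀ ⟨i.val + 1, by omega⟩ (by simp)
      (fun h => rfl) (e := e) (b := b) h4 (fun j hj _ => ⟨a, ?_⟩)
      (fun h h' => by grind)
    obtain rfl : i.val = j := by simpa using hj
    rw [← eq_col]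
    exact h3
  · refine eval_eq_zero_of_y_neg hP hkm hf hg hp₀ ⟨i.val, by omega⟩ (by dsimp only; omega)
      (fun h => rfl) (by dsimp only; omega) (e := a) (b := b) ?_
      (fun j hj h => by grind) (fun h => ⟨e, ?_⟩)
    · dsimp only
      rw [← eq_col, h3]
      field_simp
    · dsimp only
      rw [← eq_col]
      exact h4

end YWheels

section Wheels

variable {P : Params} {m k : ℕ} {hm : 0 < m} {L K : ℕ}
    {f : MvPolynomial (𝕀 × (Fin L ⊕ Fin K)) ℂ} {h : MvPolynomial 𝕍 ℂ}

theorem evenType_eq (P : Params) {m : ℕ} (hm : 2 ≤ m) : evenType P m = evenType' P m := by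
  match m, hm with
  | m + 2, _ => rfl

theorem eval_eq_zero_of_y_wheel (hP : P.Valid) (hkm : k + 2 ≤ m)
    (hf : RatioVanish P m (k + 1) f) (hg : 𝔈) {p₀ : 𝕍 → ℂ} (hp₀ : ∀ s, p₀ s ≠ 0)
    (hw : (𝕋).wheel L fun i a => p₀ (inl (i, a))) : eval p₀ h = 0 := by
  cases k with
  | zero =>
    have h1 : shType (P.bar m (0 + 1)) m 0 = evenType' (P.bar m (0 + 1)) (m + 0) :=
      evenType_eq _ (by omega)
    rw [h1] at hw
    exact eval_eq_zero_of_even_wheel hP hkm hf hg hp₀ hw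
  | succ k => exact eval_eq_zero_of_super_wheel hP hkm (by omega) hf hg hp₀ hw

theorem eval_eq_zero_of_z_wheel (hP : P.Valid) (hkm : k + 2 ≤ m)
    (hf : RatioVanish P m (k + 1) f) (hg : 𝔈) {p₀ : 𝕍 → ℂ} (hp₀ : ∀ s, p₀ s ≠ 0) {p₁ : ℂ}
    (hw : (oneType p₁ P.q2⁻¹ (P.q3 ^ ((m : ℤ) - (k + 1 : ℕ)))).wheel K
    fun i a => p₀ (inr (i, a))) : eval p₀ h = 0 := by
  have h1 : (m : ℤ) - (k + 1 : ℕ) = (m : ℤ) - k - 1 := by push_cast; ring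
  rw [h1] at hw
  simp only [oneType, wheelA, wheelB] at hw
  rcases hw with ⟨a, b, e, h3, h4⟩ | ⟨a, b, e, h3, h4⟩
  · exact eval_eq_zero_of_z_wheelA hP hkm hf hg hp₀ h3 h4
  · exact eval_eq_zero_of_z_wheelB hP hkm hf hg hp₀ h3 h4

end Wheels

/-! ## Structure functions along the edges of the cycle of colours -/

section Fractions

variable {E : Type} [Field E] [Algebra ℂ E]

/-- The quotient `(u - α v) / (u - β v)`. -/
def fr (α β : ℂ) (u v : E) : E := (u - α • v) / (u - β • v)

theorem fr_smul {α β a b : ℂ} (ha : a ≠ 0) (u v : E) :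
    fr α β (a • u) (b • v) = fr (α * b / a) (β * b / a) u v := by
  have h : ∀ γ : ℂ, a • u - γ • b • v = algebraMap ℂ E a * (u - (γ * b / a) • v) := by
    intro γ
    rw [← Algebra.smul_def, smul_sub, smul_smul, smul_smul, mul_div_cancel₀ _ ha]
  unfold fr
  rw [h, h, mul_div_mul_left]
  exact (map_ne_zero _).2 ha

theorem fr_swap {α β : ℂ} (hα : α ≠ 0) (hβ : β ≠ 0) (u v : E) :
    fr α β v u = (α / β) • fr α⁻¹ β⁻¹ u v := by
  have h : ∀ γ : ℂ, γ ≠ 0 → v - γ • u = algebraMap ℂ E (-γ) * (u - γ⁻¹ • v) := by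
    intro γ hγ
    rw [← Algebra.smul_def, smul_sub, smul_smul, neg_mul, mul_inv_cancel₀ hγ]
    simp [sub_eq_add_neg, add_comm]
  unfold fr
  rw [h α hα, h β hβ, mul_div_mul_comm, ← map_div₀, neg_div_neg_eq, ← Algebra.smul_def]

theorem fr_mul_fr {β : ℂ} {u v : E} (h : u ≠ β • v) (α γ : ℂ) :
    fr α β u v * fr β γ u v = fr α γ u v :=
  div_mul_div_cancel₀ (sub_ne_zero.2 h)

end Fractions

/-- The parameter attached to the edge between the colours `i` and `i + 1`. -/
def eps (m i : ℕ) (r : ℂ) : ℂ := if i < m then r else r⁻¹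

theorem eps_of_lt {m i : ℕ} (h : i < m) (r : ℂ) : eps m i r = r := if_pos h

theorem eps_of_le {m i : ℕ} (h : m ≤ i) (r : ℂ) : eps m i r = r⁻¹ := if_neg (not_lt.2 h)

theorem eps_ne {m i : ℕ} {r : ℂ} (h : r ≠ 0) : eps m i r ≠ 0 := by
  unfold eps
  grind

theorem eps_mul (m i : ℕ) (r s : ℂ) : eps m i (r * s) = eps m i r * eps m i s := by
  unfold eps
  grind

theorem eps_inv (m i : ℕ) (r : ℂ) : eps m i r⁻¹ = (eps m i r)⁻¹ := by
  unfold eps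
  split_ifs <;> rfl

section Edges

variable (P : Params) (m : ℕ) {E : Type} [Field E] [Algebra ℂ E]

/-- The structure function `ω_{i,i}` of `Sh_{m|n}`. -/
def selfFn (i : ℕ) (u v : E) : E := if i = 0 ∨ i = m then 1 else fr (eps m i P.q2) 1 u v

/-- The structure function `ω_{i,i+1}`. -/
def fwdFn (i : ℕ) (u v : E) : E := fr (eps m i P.q1) 1 u v

/-- The structure function `ω_{i+1,i}`. -/
def bwdFn (i : ℕ) (u v : E) : E := eps m i P.d • fr (eps m i P.q3) 1 u v

/-- The structure function `ω_{i,i}` of `Sh_{m|k}`, where `Sh_{m|0} = Sh_m`. -/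
def selfFn' (k i : ℕ) (u v : E) : E :=
  if (i = 0 ∧ k ≠ 0) ∨ i = m then 1 else fr (eps m i P.q2) 1 u v

/-- The product of the structure functions between two sets of variables with one element in each
colour. -/
def ShuffleType.pair {c : ℕ} (T : ShuffleType c) (u v : Fin c → E) : E :=
  ∏ i, ∏ j, T.ω E i j (u i) (v j)

theorem ShuffleType.omegaAt_eq_pair {c M N : ℕ} (T : ShuffleType c) (x : Fin c × Fin M → E)
    (y : Fin c × Fin N → E) :
    T.omegaAt x y = ∏ a, ∏ b, T.pair (fun i => x (i, a)) (fun j => y (j, b)) := by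
  have h1 : ∀ i : Fin c, ∏ j : Fin c, ∏ a : Fin M, ∏ b : Fin N, T.ω E i j (x (i, a)) (y (j, b)) =
      ∏ a : Fin M, ∏ b : Fin N, ∏ j : Fin c, T.ω E i j (x (i, a)) (y (j, b)) := by
    intro i
    rw [prod_comm]
    exact prod_congr rfl fun a _ => prod_comm
  unfold ShuffleType.omegaAt ShuffleType.pair
  simp only [h1]
  rw [prod_comm]
  exact prod_congr rfl fun a _ => prod_comm

variable {m}

theorem super_pair {n : ℕ} (hn : 1 ≤ n) (hc : 3 ≤ m + n) (u v : Fin (m + n) → E) :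
    (superType P m n).pair u v = ∏ i : Fin (m + n), (selfFn P m i (u i) (v i) *
    (fwdFn P m i (u i) (v (next i)) * bwdFn P m i (u (next i)) (v i))) := by
  unfold ShuffleType.pair
  rw [prod_edges hc (fun i j => (superType P m n).ω E i j (u i) (v j))]
  · refine prod_congr rfl fun i _ => ?_
    have hnext := next_val_cases i
    have h1 : (1 ≤ (next i).val ∧ (next i).val ≤ m) ↔ i.val < m := by omega
    have h2 : next i ≠ i := next_ne (by omega) i
    have h3 : next (next i) ≠ i := next_next_ne hc i
    congr 1
    · simp only [superType, if_true, selfFn, fr, eps, one_smul]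
      grind
    · simp only [superType, if_true, fwdFn, bwdFn, fr, eps, one_smul, h1, h2, h2.symm, h3.symm,
        if_false]
      split_ifs <;> rfl
  · intro i j h1 h2 h3
    simp only [superType, h1, h2, h3, if_false]

theorem even_pair (hm : 2 ≤ m) (u v : Fin m → E) :
    (if m = 2 then P.d ^ 2 else 1) • (evenType' P m).pair u v =
    ∏ i : Fin m, (fr P.q2 1 (u i) (v i) *
    (fr P.q1 1 (u i) (v (next i)) * P.d • fr P.q3 1 (u (next i)) (v i))) := by
  rcases hm.eq_or_lt with rfl | hm
  · have e0 : (next 0 : Fin 2) = 1 := rfl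
    have e1 : (next 1 : Fin 2) = 0 := rfl
    have e2 : (0 : Fin 2) ≠ 1 := by decide
    unfold ShuffleType.pair
    simp only [Fin.prod_univ_two, evenType', if_true, e0, e1, e2, e2.symm, if_false, fr, one_smul]
    generalize u 0 - P.q1 • v 1 = a₁, u 0 - P.q3 • v 1 = a₂, u 0 - v 1 = a₃,
      u 1 - P.q1 • v 0 = b₁, u 1 - P.q3 • v 0 = b₂, u 1 - v 0 = b₃,
      (u 0 - P.q2 • v 0) / (u 0 - v 0) = c₁, (u 1 - P.q2 • v 1) / (u 1 - v 1) = c₂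
    simp only [Algebra.smul_def, map_pow, div_eq_mul_inv]
    ring
  · rw [if_neg hm.ne', one_smul]
    unfold ShuffleType.pair
    rw [prod_edges hm (fun i j => (evenType' P m).ω E i j (u i) (v j))]
    · refine prod_congr rfl fun i _ => ?_
      have h2 : next i ≠ i := next_ne (by omega) i
      have h3 : next (next i) ≠ i := next_next_ne hm i
      simp only [evenType', if_true, h2, h2.symm, h3.symm, if_false, hm.ne', fr, one_smul]
    · intro i j h1 h2 h3
      simp only [evenType', h1, h2, h3, hm.ne', if_false]

/-- The structure functions of the target of the fusion map. -/
theorem sh_pair {k : ℕ} (hm : k + 2 ≤ m) (u v : Fin (m + k) → E) :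
    (if m = 2 then P.d ^ 2 else 1) • (shType P m k).pair u v =
    ∏ i : Fin (m + k), (selfFn' P m k i (u i) (v i) *
    (fwdFn P m i (u i) (v (next i)) * bwdFn P m i (u (next i)) (v i))) := by
  cases k with
  | zero =>
    have h1 : shType P m 0 = evenType' P (m + 0) := evenType_eq _ (by omega)
    rw [h1]
    refine (even_pair P (m := m + 0) (by omega) u v).trans ?_
    refine prod_congr rfl fun i _ => ?_
    have hi : i.val < m := i.2
    have h2 : ¬ ((i.val = 0 ∧ (0 : ℕ) ≠ 0) ∨ i.val = m) := by omega
    simp only [selfFn', fwdFn, bwdFn, if_neg h2, eps_of_lt hi]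
  | succ k =>
    rw [if_neg (by omega), one_smul]
    refine (super_pair P (by omega) (by omega) u v).trans ?_
    refine prod_congr rfl fun i _ => ?_
    simp only [selfFn, selfFn', ne_eq, Nat.succ_ne_zero, not_false_eq_true, and_true]

/-- Products around the cycle of colours `0, …, N`. -/
theorem prod_cycle {R : Type} [CommMonoid R] {N : ℕ} (g : ℕ → E → E → E → E → R) (u v : ℕ → E) :
    ∏ i : Fin (N + 1), g i (u i) (v i) (u (next i)) (v (next i)) =
    (∏ i ∈ range N, g i (u i) (v i) (u (i + 1)) (v (i + 1))) * g N (u N) (v N) (u 0) (v 0) := by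
  rw [Fin.prod_univ_castSucc, ← Fin.prod_univ_eq_prod_range
    (fun i => g i (u i) (v i) (u (i + 1)) (v (i + 1)))]
  congr 1
  · refine prod_congr rfl fun i _ => ?_
    rw [next_val_of_lt (by simp)]
    rfl
  · rw [next_val_of_eq (by simp)]
    rfl

/-- Products around the cycle of colours `0, …, N - 1`, if `N` is identified with `0`. -/
theorem prod_cycle' {R : Type} [CommMonoid R] {N : ℕ} (g : ℕ → E → E → E → E → R) {u v : ℕ → E}
    (hu : u N = u 0) (hv : v N = v 0) : ∏ i : Fin N, g i (u i) (v i) (u (next i)) (v (next i)) =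
    ∏ i ∈ range N, g i (u i) (v i) (u (i + 1)) (v (i + 1)) := by
  rw [← Fin.prod_univ_eq_prod_range (fun i => g i (u i) (v i) (u (i + 1)) (v (i + 1)))]
  refine prod_congr rfl fun i _ => ?_
  rcases next_val_cases i with ⟨-, h⟩ | ⟨h1, h⟩
  · rw [h]
  · rw [h, h1, hu, hv]

end Edges

/-! ## The factors `A`, `B`, `C` and the structure functions: the variables `y` -/

section Factors

variable (P : Params) (m k : ℕ) {E : Type} [Field E] [Algebra ℂ E]

/-- The factor of `A` for an edge between the colours `i` and `i + 1`. -/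
def edgeF (i : ℕ) (u v : E) : E := fr 1 (eps m i 𝔮) u v

/-- The factor of `A` for a pair of variables of the fused colours. -/
def fusedF (u v : E) : E :=
  if k = 0 then
    (if m = 2 then P.q else P.d⁻¹) • ((u - v) ^ 2 / ((u - P.q1 • v) * (u - P.q1⁻¹ • v)))
  else
    P.d⁻¹ • ((u - P.q2 • v) * (u - P.q2⁻¹ • v) / ((u - P.q1 • v) * (u - P.q1⁻¹ • v)))

/-- The factor of `B` for a pair of variables. -/
def zzF (u v : E) : E :=
  P.d ^ (m - (k + 1)) •
      (((u - P.q2 • v) / (u - P.q3 • v) * ((u - P.q2⁻¹ • v) / (u - P.q3⁻¹ • v))) ^ (m + (k + 1) - 2) *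
      ((u - v) ^ 2 / ((u - P.q3 • v) * (u - P.q3⁻¹ • v))) *
      ((u - v) ^ 2 /
        ((u - P.q3 ^ ((m : ℤ) - (k + 1 : ℕ) + 1) • v) *
          (u - P.q3 ^ (-(m : ℤ) + (k + 1 : ℕ) - 1) • v))))

/-- The factor of `C` for a variable `z` and a system of variables `y`. -/
def yzF (y : ℕ → E) (z : E) : E :=
  (∏ i ∈ Finset.Ico 1 m,
      let u := (P.q1 * 𝔮 ^ i) • y i
      P.d • ((u - (P.q2 * P.q3 ^ ((i : ℤ) - 1)) • z) *
          (u - (P.q2⁻¹ * P.q3 ^ ((i : ℤ) - 1)) • z) /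
        ((u - P.q3 ^ (i : ℤ) • z) * (u - P.q3 ^ ((i : ℤ) - 2) • z)))) *
    (if k + 1 = 1 then
      (y (m + k) - (P.q1⁻¹ * P.q3 ^ ((m : ℤ) - 2)) • z) * (y (m + k) - P.q3 ^ ((m : ℤ) - 1) • z) /
        ((y (m + k) - P.q3 ^ ((m : ℤ) - 2) • z) * (y (m + k) - (P.q1⁻¹ * P.q3 ^ ((m : ℤ) - 1)) • z))
    else
      (let u := (P.q1 * 𝔮 ^ m) • y m
      P.d⁻¹ • ((u - P.q3 ^ ((m : ℤ) - 1) • z) * (u - (P.q2 * P.q3 ^ ((m : ℤ) - 1)) • z) /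
        (u - P.q3 ^ ((m : ℤ) - 2) • z) ^ 2)) *
      (∏ i ∈ Finset.Ico (m + 1) (m + k),
        let u := (P.q1 * 𝔮 ^ (2 * (m : ℤ) - i)) • y i
        let v := P.q3 ^ (2 * (m : ℤ) - i - 1) • z
        P.d⁻¹ • ((u - P.q2 • v) * (u - P.q2⁻¹ • v) / ((u - P.q3 • v) * (u - P.q3⁻¹ • v)))) *
      (let v := P.q3 ^ ((m : ℤ) - (k + 1 : ℕ)) • z
      (y (m + k) - P.q2 • v) * (y (m + k) - P.q2⁻¹ • v) /
        ((y (m + k) - P.q3 • v) * (y (m + k) - P.q1⁻¹ • v)))) *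
    ((y (m + k) - P.q2 • z) * (y (m + k) - z) /
      ((y (m + k) - P.q3⁻¹ • z) * (y (m + k) - P.q1⁻¹ • z)))

variable {L K : ℕ}

theorem factorA_eq (y : ℕ → Fin L → E) : factorA P m (k + 1) y =
    (∏ i ∈ range (m + k), ∏ a, ∏ b, edgeF P m k i (y i a) (y (i + 1) b)) *
    pairProd fun a b => fusedF P m k (y (m + k) a) (y (m + k) b) := by
  have h : m + (k + 1) - 1 = m + k := rfl
  unfold factorA
  rw [h, ← prod_range_mul_prod_Ico _ (Nat.le_add_right m k)]
  congr 1
  · congr 1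
    · refine prod_congr rfl fun i hi => ?_
      simp only [edgeF, fr, eps_of_lt (mem_range.1 hi), one_smul]
    · refine prod_congr rfl fun i hi => ?_
      simp only [edgeF, fr, eps_of_le (mem_Ico.1 hi).1, one_smul]
  · unfold pairProd
    refine prod_congr rfl fun a _ => prod_congr rfl fun b _ => ?_
    simp only [fusedF, Nat.add_eq_right]

theorem factorB_eq (z : Fin K → E) : factorB P m (k + 1) z =
    pairProd fun a b => zzF P m k (z a) (z b) := rfl

theorem factorC_eq (y : ℕ → Fin L → E) (z : Fin K → E) : factorC P m (k + 1) y z =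
    ∏ a, ∏ b, yzF P m k (fun i => y i a) (z b) := rfl

/-- The factor between two systems of variables `y`. -/
def yyF (y y' : ℕ → E) : E :=
  (∏ i ∈ range (m + k), edgeF P m k i (y i) (y' (i + 1)) * edgeF P m k i (y' i) (y (i + 1))) *
    fusedF P m k (y 0) (y' 0)

variable {P m k}

theorem ycoef_succ (n i : ℕ) : ycoef P m n (i + 1) = eps m i (P.sfq m n) * ycoef P m n i := by
  unfold eps
  split_ifs with h
  · exact ycoef_succ_of_lt h
  · exact ycoef_succ_of_le (not_lt.1 h)

theorem zcoef_succ (hP : P.Valid) (i : ℕ) : ζ (i + 1) = eps m i P.q3 * ζ i := by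
  unfold eps
  split_ifs with h
  · exact zcoef_succ_of_lt hP h
  · exact zcoef_succ_of_le hP (not_lt.1 h)

theorem Params.bar_d (n : ℕ) : (P.bar m n).d = P.d * P.sfq m n := rfl

theorem selfFn_smul {a : ℂ} (ha : a ≠ 0) (i : ℕ) (u v : E) :
    selfFn P m i (a • u) (a • v) = selfFn P m i u v := by
  unfold selfFn
  rw [fr_smul ha, mul_div_cancel_right₀ _ ha, mul_div_cancel_right₀ _ ha]

theorem fusedF_eq (hP : P.Valid) (hkm : k + 2 ≤ m) (u v : E) : fusedF P m k u v =
    (if m = 2 then (𝔓).d ^ 2 else 1) • P.d⁻¹ •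
    ((if k = 0 then (u - v) ^ 2 else (u - P.q2 • v) * (u - P.q2⁻¹ • v)) /
    ((u - P.q1 • v) * (u - P.q1⁻¹ • v))) := by
  unfold fusedF
  by_cases hk : k = 0
  · subst hk
    by_cases h2 : m = 2
    · subst h2
      have h3 := sfq_zpow hP (show 0 < 2 by omega)
      have h4 : P.sfq 2 (0 + 1) ^ 2 = P.q1⁻¹ := by
        rw [← h3]
        norm_cast
      simp only [if_true]
      rw [Params.bar_d, mul_pow, h4, smul_smul]
      congr 1
      have := hP.q_ne
      have := hP.d_ne
      unfold Params.q1
      field_simp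
    · simp [h2]
  · simp [hk, show m ≠ 2 by omega]

theorem fwdFn_y {i : ℕ} (hP : P.Valid) {u v : E} (h : u ≠ v) :
    fwdFn P m i (η i • u) (η (i + 1) • v) = edgeF P m k i u v * fwdFn 𝔓 m i u v := by
  have hy := ycoef_ne (m := m) hP (k + 1) i
  unfold fwdFn edgeF
  rw [fr_smul hy, ycoef_succ, ← mul_assoc, mul_div_cancel_right₀ _ hy, ← mul_assoc,
    mul_div_cancel_right₀ _ hy, one_mul, Params.bar_q1, eps_mul, mul_comm (fr 1 _ _ _), fr_mul_fr]
  rwa [one_smul]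

theorem bwdFn_y {i : ℕ} (hP : P.Valid) {u v : E} (h : u ≠ v) :
    bwdFn P m i (η (i + 1) • u) (η i • v) = edgeF P m k i v u * bwdFn 𝔓 m i u v := by
  have hy := ycoef_ne (m := m) hP (k + 1) i
  have hs : eps m i 𝔮 ≠ 0 := eps_ne (Params.Valid.sfq_ne _ _ _)
  unfold bwdFn edgeF
  have e1 : ∀ c : ℂ, c * η i / (eps m i 𝔮 * η i) =
      c * (eps m i 𝔮)⁻¹ := by grind
  rw [ycoef_succ, fr_smul (mul_ne_zero hs hy), e1, e1, fr_swap one_ne_zero hs, Params.bar_q3,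
    Params.bar_d, eps_mul, eps_mul, eps_inv, smul_mul_smul_comm, mul_comm (fr 1⁻¹ _ _ _), inv_one,
    fr_mul_fr (by rwa [one_smul]), one_mul]
  grind

theorem fused_pair (hP : P.Valid) (hkm : k + 2 ≤ m) {u v : E} (h : u ≠ v) :
    selfFn P m (m + k) u v * (fwdFn P m (m + k) u (P.q1 • v) * bwdFn P m (m + k) (P.q1 • u) v) =
    P.d⁻¹ • ((if k = 0 then (u - v) ^ 2 else (u - P.q2 • v) * (u - P.q2⁻¹ • v)) /
    ((u - P.q1 • v) * (u - P.q1⁻¹ • v))) * selfFn' P m k 0 u v := by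
  have n1 := hP.n1
  have n2 := hP.n2
  have n3 := hP.n3
  have e1 : fwdFn P m (m + k) u (P.q1 • v) = fr 1 P.q1 u v := by
    have := fr_smul (α := eps m (m + k) P.q1) (β := 1) (b := P.q1) one_ne_zero u v
    rw [one_smul] at this
    unfold fwdFn
    rw [this, eps_of_le (by omega), inv_mul_cancel₀ n1]
    simp
  have e2 : bwdFn P m (m + k) (P.q1 • u) v = P.d⁻¹ • fr P.q2 P.q1⁻¹ u v := by
    have := fr_smul (α := eps m (m + k) P.q3) (β := 1) (b := 1) n1 u v
    rw [one_smul] at this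
    unfold bwdFn
    rw [this, eps_of_le (by omega), eps_of_le (by omega)]
    congr 2
    · rw [hP.q1_eq]
      field_simp
    · simp
  rw [e1, e2]
  have h1 : u - v ≠ 0 := sub_ne_zero.2 h
  by_cases hk : k = 0
  · subst hk
    simp only [if_true, selfFn, selfFn', Nat.add_zero, or_true, ne_eq, not_true_eq_false, and_false,
      false_or, show (0 : ℕ) ≠ m by omega, if_false, eps_of_lt (show 0 < m by omega), fr,
      Algebra.smul_def, map_one, one_mul]
    rw [pow_two]
    simp only [div_eq_mul_inv, mul_inv]
    field_simp
  · simp only [hk, if_false, selfFn, selfFn', show ¬ (m + k = 0 ∨ m + k = m) by omega, ne_eq,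
      not_false_eq_true, and_true, true_or, if_true, eps_of_le (show m ≤ m + k by omega), fr,
      Algebra.smul_def, map_one, one_mul, mul_one]
    field_simp

theorem prod_selfFn' {N : ℕ} (y y' : ℕ → E) : ∏ i ∈ range (N + 1), selfFn' P m k i (y i) (y' i) =
    (∏ i ∈ range (N + 1), selfFn P m i (y i) (y' i)) * selfFn' P m k 0 (y 0) (y' 0) := by
  rw [prod_range_succ', prod_range_succ']
  congr 1
  have : selfFn P m 0 (y 0) (y' 0) = 1 := if_pos (Or.inl rfl)
  rw [this, mul_one]
  refine prod_congr rfl fun i _ => ?_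
  simp [selfFn, selfFn']

theorem yy_pair (hP : P.Valid) (hkm : k + 2 ≤ m) {y y' : ℕ → E} (hy : y (m + k) = y 0)
    (hy' : y' (m + k) = y' 0) (h : ∀ i j, y i ≠ y' j) : (𝕊).pair (fun i => η i • y i)
    (fun i => η i • y' i) = yyF P m k y y' * (𝕋).pair (fun i => y i) (fun i => y' i) := by
  unfold yyF
  rw [fusedF_eq hP hkm, mul_assoc, smul_mul_assoc, ← mul_smul_comm, sh_pair _ hkm,
    super_pair P (by omega) (by omega)]
  have c1 := prod_cycle (N := m + k)
    (fun i a b c d => selfFn P m i a b * (fwdFn P m i a d * bwdFn P m i c b))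
    (fun i => η i • y i) (fun i => η i • y' i)
  have c2 := prod_cycle' (N := m + k)
    (fun i a b c d => selfFn' 𝔓 m k i a b *
      (fwdFn 𝔓 m i a d * bwdFn 𝔓 m i c b)) hy hy'
  refine c1.trans ?_
  rw [c2, hy, hy', ycoef_last hP (by omega), ycoef_zero, one_smul, one_smul,
    fused_pair hP hkm (h 0 0)]
  simp only [selfFn_smul (ycoef_ne hP _ _), fwdFn_y hP (h _ _), bwdFn_y hP (h _ _),
    prod_mul_distrib]
  obtain ⟨N, hN⟩ : ∃ N, m + k = N + 1 := ⟨m + k - 1, by omega⟩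
  have e1 : ∀ i (u v : E), selfFn' 𝔓 m k i u v = selfFn' P m k i u v := fun _ _ _ => rfl
  simp only [e1]
  rw [hN, prod_selfFn' y y', ← hN]
  ring

end Factors

/-! ## The factors `A`, `B`, `C` and the structure functions: the variables `z` -/

section FactorsZ

variable {P : Params} {m k : ℕ} {E : Type} [Field E] [Algebra ℂ E]

theorem eps_q1_q3 (hP : P.Valid) (i : ℕ) : eps m i P.q1 * eps m i P.q3 = (eps m i P.q2)⁻¹ := by
  have n3 := hP.n3
  rw [← eps_mul, ← eps_inv, hP.q1_eq]
  grind

theorem fwdFn_z {i : ℕ} (hP : P.Valid) (u v : E) : fwdFn P m i (ζ i • u) (ζ (i + 1) • v) =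
    fr (eps m i P.q2)⁻¹ (eps m i P.q3) u v := by
  have hz := zcoef_ne (m := m) hP i
  unfold fwdFn
  rw [fr_smul hz, zcoef_succ hP, ← mul_assoc, mul_div_cancel_right₀ _ hz, ← mul_assoc,
    mul_div_cancel_right₀ _ hz, one_mul, eps_q1_q3 hP]

theorem bwdFn_z {i : ℕ} (hP : P.Valid) (u v : E) : bwdFn P m i (ζ (i + 1) • u) (ζ i • v) =
    eps m i P.d • fr 1 (eps m i P.q3)⁻¹ u v := by
  have hz := zcoef_ne (m := m) hP i
  have h3 : eps m i P.q3 ≠ 0 := eps_ne hP.n3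
  unfold bwdFn
  rw [fr_smul (zcoef_ne hP _), zcoef_succ hP]
  grind

theorem prod_selfFn (u v : E) (hm : 0 < m) : ∏ i ∈ range (m + k + 1), selfFn P m i u v =
    fr P.q2 1 u v ^ (m - 1) * fr P.q2⁻¹ 1 u v ^ k := by
  obtain ⟨m, rfl⟩ : ∃ m', m = m' + 1 := ⟨m - 1, by omega⟩
  rw [add_assoc, prod_range_add, prod_range_succ', prod_range_succ']
  have h1 : ∀ i ∈ range m, selfFn P (m + 1) (i + 1) u v = fr P.q2 1 u v := by
    intro i hi
    have := mem_range.1 hi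
    unfold selfFn
    rw [if_neg (by omega), eps_of_lt (by omega)]
  have h2 : ∀ i ∈ range k, selfFn P (m + 1) (m + 1 + (i + 1)) u v = fr P.q2⁻¹ 1 u v := by
    intro i hi
    unfold selfFn
    rw [if_neg (by omega), eps_of_le (by omega)]
  rw [prod_congr rfl h1, prod_congr rfl h2, prod_const, prod_const,
    card_range, card_range]
  have h3 : selfFn P (m + 1) 0 u v = 1 := if_pos (Or.inl rfl)
  have h4 : selfFn P (m + 1) (m + 1 + 0) u v = 1 := if_pos (Or.inr rfl)
  grind

theorem prod_edges_z (hP : P.Valid) (u v : E) : ∏ i ∈ range (m + k),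
    (fwdFn P m i (ζ i • u) (ζ (i + 1) • v) * bwdFn P m i (ζ (i + 1) • u) (ζ i • v)) =
    (fr P.q2⁻¹ P.q3 u v * P.d • fr 1 P.q3⁻¹ u v) ^ m *
    (fr P.q2 P.q3⁻¹ u v * P.d⁻¹ • fr 1 P.q3 u v) ^ k := by
  simp only [fwdFn_z hP, bwdFn_z hP]
  rw [prod_range_add]
  congr 1
  · rw [prod_congr rfl (g := fun _ => fr P.q2⁻¹ P.q3 u v * P.d • fr 1 P.q3⁻¹ u v),
      prod_const, card_range]
    intro i hi
    simp only [eps_of_lt (mem_range.1 hi)]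
  · rw [prod_congr rfl (g := fun _ => fr P.q2 P.q3⁻¹ u v * P.d⁻¹ • fr 1 P.q3 u v),
      prod_const, card_range]
    intro i hi
    simp only [eps_of_le (Nat.le_add_right m i), inv_inv]

theorem last_pair_z (hP : P.Valid) (u v : E) : fwdFn P m (m + k) (ζ (m + k) • u) (ζ 0 • v) *
    bwdFn P m (m + k) (ζ 0 • u) (ζ (m + k) • v) =
    fr (P.q1⁻¹ * P.q3 ^ (-(m : ℤ) + (k + 1 : ℕ) - 1)) (P.q3 ^ (-(m : ℤ) + (k + 1 : ℕ) - 1)) u v *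
    P.d⁻¹ • fr (P.q3 ^ ((m : ℤ) - (k + 1 : ℕ))) (P.q3 ^ ((m : ℤ) - (k + 1 : ℕ) + 1)) u v := by
  have n3 := hP.n3
  have e1 : P.q3⁻¹ / P.q3 ^ ((m : ℤ) - k - 1) = P.q3 ^ (-(m : ℤ) + (k + 1 : ℕ) - 1) := by
    rw [← zpow_neg_one, ← zpow_sub₀ n3]
    grind
  have e2 : P.q3 ^ ((m : ℤ) - k - 1) / P.q3⁻¹ = P.q3 ^ ((m : ℤ) - (k + 1 : ℕ) + 1) := by
    rw [← zpow_neg_one, ← zpow_sub₀ n3]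
    grind
  have e3 : P.q3⁻¹ * P.q3 ^ ((m : ℤ) - (k + 1 : ℕ) + 1) = P.q3 ^ ((m : ℤ) - (k + 1 : ℕ)) := by grind
  unfold fwdFn bwdFn
  rw [zcoef_last, zcoef_zero, fr_smul (zpow_ne_zero _ n3), fr_smul (inv_ne_zero n3),
    eps_of_le (by omega), eps_of_le (by omega), eps_of_le (by omega), mul_div_assoc, mul_div_assoc,
    mul_div_assoc, mul_div_assoc, e1, e2, e3, one_mul, one_mul]

theorem zz_algebra {A B X Y Z S T N₁ N₃ D : E} (hX : X ≠ 0) (hD : D ≠ 0) (hkm : k + 2 ≤ m) :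
    (A / X) ^ (m - 1) * (B / X) ^ k * ((B / Y * (D * (X / Z))) ^ m * (A / Z * (D⁻¹ * (X / Y))) ^ k *
    (N₁ / T * (D⁻¹ * (N₃ / S)))) =
    D ^ (m - (k + 1)) * ((A / Y * (B / Z)) ^ (m + (k + 1) - 2) * (X ^ 2 / (Y * Z)) *
    (X ^ 2 / (S * T))) * (N₁ * B * N₃ / X ^ 3) := by
  obtain ⟨t, rfl⟩ : ∃ t, m = k + 2 + t := ⟨m - (k + 2), by omega⟩
  rw [show k + 2 + t - 1 = k + t + 1 by omega, show k + 2 + t - (k + 1) = t + 1 by omega,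
    show k + 2 + t + (k + 1) - 2 = k + k + t + 1 by omega]
  have hX' := mul_inv_cancel₀ hX
  have hD' := mul_inv_cancel₀ hD
  simp only [div_eq_mul_inv, mul_inv, ← inv_pow]
  generalize X⁻¹ = X', Y⁻¹ = Y', Z⁻¹ = Z', S⁻¹ = S', T⁻¹ = T', D⁻¹ = D' at *
  have e1 : (A * X') ^ (k + t + 1) * (B * X') ^ k * ((B * Y' * (D * (X * Z'))) ^ (k + 2 + t) *
      (A * Z' * (D' * (X * Y'))) ^ k * (N₁ * T' * (D' * (N₃ * S')))) =
      A ^ (k + k + t + 1) * B ^ (k + k + t + 2) * (Y' * Z') ^ (k + k + t + 2) * (S' * T') *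
        (N₁ * N₃) * D ^ (t + 1) * X * (X * X') ^ (k + k + t + 1) * (D * D') ^ (k + 1) := by
    ring
  have e2 : D ^ (t + 1) * ((A * Y' * (B * Z')) ^ (k + k + t + 1) * (X ^ 2 * (Y' * Z')) *
      (X ^ 2 * (S' * T'))) * (N₁ * B * N₃ * X' ^ 3) =
      A ^ (k + k + t + 1) * B ^ (k + k + t + 2) * (Y' * Z') ^ (k + k + t + 2) * (S' * T') *
        (N₁ * N₃) * D ^ (t + 1) * X * (X * X') ^ 3 := by
    ring
  rw [e1, e2, hX', hD', one_pow, one_pow, one_pow, mul_one]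

theorem zz_pair (hP : P.Valid) (hkm : k + 2 ≤ m) {u v : E} (h : ∀ c : ℂ, u ≠ c • v) :
    (𝕊).pair (fun i => ζ i • u) (fun i => ζ i • v) =
    zzF P m k u v * (𝕆).pair (fun _ => u) (fun _ => v) := by
  rw [super_pair P (by omega) (by omega)]
  have c1 := prod_cycle (N := m + k)
    (fun i a b c d => selfFn P m i a b * (fwdFn P m i a d * bwdFn P m i c b))
    (fun i => ζ i • u) (fun i => ζ i • v)
  refine c1.trans ?_
  simp only [selfFn_smul (zcoef_ne hP _), prod_mul_distrib (f := fun i => selfFn P m i u v)]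
  rw [prod_edges_z hP, mul_mul_mul_comm, last_pair_z hP, ← prod_range_succ,
    prod_selfFn u v (by omega)]
  have h1 : (𝕆).pair (fun _ => u) (fun _ => v) =
      (u - (P.q1⁻¹ * P.q3 ^ (-(m : ℤ) + (k + 1 : ℕ) - 1)) • v) * (u - P.q2⁻¹ • v) *
        (u - P.q3 ^ ((m : ℤ) - (k + 1 : ℕ)) • v) / (u - v) ^ 3 := by
    simp [ShuffleType.pair, oneType]
  rw [h1]
  unfold zzF fr
  have hc : ∀ c : ℂ, u - c • v ≠ 0 := fun c => sub_ne_zero.2 (h c)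
  have hX : u - v ≠ 0 := by simpa using hc 1
  have := zz_algebra (A := u - P.q2 • v) (B := u - P.q2⁻¹ • v) (X := u - v) (Y := u - P.q3 • v)
    (Z := u - P.q3⁻¹ • v) (S := u - P.q3 ^ ((m : ℤ) - (k + 1 : ℕ) + 1) • v)
    (T := u - P.q3 ^ (-(m : ℤ) + (k + 1 : ℕ) - 1) • v)
    (N₁ := u - (P.q1⁻¹ * P.q3 ^ (-(m : ℤ) + (k + 1 : ℕ) - 1)) • v)
    (N₃ := u - P.q3 ^ ((m : ℤ) - (k + 1 : ℕ)) • v) (D := algebraMap ℂ E P.d) hX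
    ((map_ne_zero _).2 hP.d_ne) hkm
  simp only [one_smul, Algebra.smul_def (R := ℂ) (A := E) P.d, Algebra.smul_def (R := ℂ) (A := E) P.d⁻¹,
    Algebra.smul_def (R := ℂ) (A := E) (P.d ^ _), map_inv₀, map_pow]
  exact this

end FactorsZ

/-! ## The factors `A`, `B`, `C` and the structure functions: mixed pairs of variables -/

section FactorsYZ

variable {P : Params} {m k : ℕ} {E : Type} [Field E] [Algebra ℂ E]

variable (P m k) in
/-- The ratio of the coefficients of the specialization. -/
def theta (i : ℕ) : ℂ := ζ i / η i

theorem theta_zero (hP : P.Valid) : theta P m k 0 = P.q2 := by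
  have n2 := hP.n2
  have n3 := hP.n3
  unfold theta
  rw [zcoef_zero, ycoef_zero, hP.q1_eq]
  field_simp

theorem theta_last (hP : P.Valid) (h : k < m) : theta P m k (m + k) = ζ (m + k) := by
  unfold theta
  rw [ycoef_last hP h, div_one]

theorem selfFn_yz (hP : P.Valid) (i : ℕ) (y z : E) : selfFn P m i (η i • y) (ζ i • z) =
    if i = 0 ∨ i = m then 1 else fr (eps m i P.q2 * theta P m k i) (theta P m k i) y z := by
  unfold selfFn
  rw [fr_smul (ycoef_ne hP _ _), mul_div_assoc, mul_div_assoc, one_mul]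
  rfl

theorem fwdFn_yz (hP : P.Valid) (i : ℕ) (y z : E) : fwdFn P m i (η i • y) (ζ (i + 1) • z) =
    fr ((eps m i P.q2)⁻¹ * theta P m k i) (eps m i P.q3 * theta P m k i) y z := by
  unfold fwdFn theta
  rw [fr_smul (ycoef_ne hP _ _), zcoef_succ hP, ← eps_q1_q3 hP]
  congr 1 <;> ring

theorem bwdFn_yz (hP : P.Valid) (i : ℕ) (y z : E) : bwdFn P m i (η (i + 1) • y) (ζ i • z) =
    eps m i P.d • fr (theta P m k (i + 1)) ((eps m i P.q3)⁻¹ * theta P m k (i + 1)) y z := by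
  have h3 : eps m i P.q3 ≠ 0 := eps_ne hP.n3
  have hy := ycoef_ne (m := m) hP (k + 1) (i + 1)
  unfold bwdFn theta
  rw [fr_smul hy, zcoef_succ hP]
  grind

theorem selfFn_zy (hP : P.Valid) (i : ℕ) (y z : E) : selfFn P m i (ζ i • z) (η i • y) =
    if i = 0 ∨ i = m then 1
    else eps m i P.q2 • fr ((eps m i P.q2)⁻¹ * theta P m k i) (theta P m k i) y z := by
  have h2 : eps m i P.q2 ≠ 0 := eps_ne hP.n2
  unfold selfFn
  rw [fr_swap h2 one_ne_zero, fr_smul (ycoef_ne hP _ _), mul_div_assoc, mul_div_assoc, inv_one,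
    one_mul, div_one]
  rfl

theorem fwdFn_zy (hP : P.Valid) (i : ℕ) (y z : E) : fwdFn P m i (ζ i • z) (η (i + 1) • y) =
    eps m i P.q1 • fr (eps m i P.q2 * theta P m k (i + 1))
    ((eps m i P.q3)⁻¹ * theta P m k (i + 1)) y z := by
  have h1 : eps m i P.q1 ≠ 0 := eps_ne hP.n1
  have h2 : eps m i P.q2 ≠ 0 := eps_ne hP.n2
  have h3 : eps m i P.q3 ≠ 0 := eps_ne hP.n3
  have h4 := eps_q1_q3 (m := m) hP i
  have h5 : eps m i P.q1 = (eps m i P.q2)⁻¹ * (eps m i P.q3)⁻¹ := by grind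
  have hy := ycoef_ne (m := m) hP (k + 1) (i + 1)
  unfold fwdFn theta
  rw [fr_swap h1 one_ne_zero, fr_smul hy, zcoef_succ hP, div_one]
  grind

theorem bwdFn_zy (hP : P.Valid) (i : ℕ) (y z : E) : bwdFn P m i (ζ (i + 1) • z) (η i • y) =
    (eps m i P.d * eps m i P.q3) • fr (theta P m k i) (eps m i P.q3 * theta P m k i) y z := by
  have h3 : eps m i P.q3 ≠ 0 := eps_ne hP.n3
  have hy := ycoef_ne (m := m) hP (k + 1) i
  unfold bwdFn theta
  rw [fr_swap h3 one_ne_zero, fr_smul hy, zcoef_succ hP, div_one, smul_smul]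
  grind

variable (P m k) in
/-- The factor of `C` for a colour that is not fused. -/
def innerF (i : ℕ) (y z : E) : E :=
  if i = m then P.d • (fr (P.q2 * theta P m k i) (P.q3⁻¹ * theta P m k i) y z *
    fr (theta P m k i) (P.q3⁻¹ * theta P m k i) y z)
  else eps m i P.d • (fr (P.q2 * theta P m k i) (P.q3 * theta P m k i) y z *
    fr (P.q2⁻¹ * theta P m k i) (P.q3⁻¹ * theta P m k i) y z)

variable (P m k) in
/-- The factor of `C` for the fused colours, for `ρ = q_3^{m-n}`. -/
def outerF (w z : E) : E :=
  let ρ := ζ (m + k)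
  (if k = 0 then fr ρ (P.q3⁻¹ * ρ) w z else P.d⁻¹ ^ 2 • fr (P.q2⁻¹ * ρ) (P.q3 * ρ) w z) *
    (fr 1 P.q1⁻¹ w z * fr P.q2 P.q3⁻¹ w z * fr (P.q2 * ρ) (P.q1⁻¹ * ρ) w z)

theorem prod_range_shift {R : Type} [CommMonoid R] (p q : ℕ → R) {N : ℕ} (hN : 0 < N) :
    ∏ i ∈ range N, p i * q i = (∏ j ∈ Finset.Ico 1 N, p j * q (j - 1)) * (p 0 * q (N - 1)) := by
  obtain ⟨N, rfl⟩ : ∃ N', N = N' + 1 := ⟨N - 1, by omega⟩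
  rw [prod_Ico_eq_prod_range, prod_mul_distrib, prod_mul_distrib,
    prod_range_succ', prod_range_succ q]
  grind

theorem inner_yz (hP : P.Valid) {j : ℕ} (hj : 0 < j) {y z : E} (h : ∀ c : ℂ, y ≠ c • z) :
    selfFn P m j (η j • y) (ζ j • z) * fwdFn P m j (η j • y) (ζ (j + 1) • z) *
    bwdFn P m (j - 1) (η j • y) (ζ (j - 1) • z) = innerF P m k j y z := by
  obtain ⟨i, rfl⟩ : ∃ i, j = i + 1 := ⟨j - 1, by omega⟩
  rw [selfFn_yz hP, fwdFn_yz hP, Nat.add_sub_cancel, bwdFn_yz hP]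
  unfold innerF
  set t := theta P m k (i + 1)
  rcases lt_trichotomy (i + 1) m with h1 | h1 | h1
  · rw [if_neg (by omega), if_neg (by omega)]
    simp only [eps_of_lt h1, eps_of_lt (show i < m by omega)]
    rw [mul_smul_comm]
    congr 1
    rw [← fr_mul_fr (h t) (P.q2 * t) (P.q3 * t), ← fr_mul_fr (h t) (P.q2⁻¹ * t) (P.q3⁻¹ * t)]
    rw [← fr_mul_fr (h t) (P.q2⁻¹ * t) (P.q3 * t)]
    ring
  · rw [if_pos (Or.inr h1), if_pos h1]
    simp only [eps_of_le h1.symm.le, eps_of_lt (show i < m by omega), inv_inv]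
    rw [mul_smul_comm, one_mul]
  · rw [if_neg (by omega), if_neg (by omega)]
    simp only [eps_of_le h1.le, eps_of_le (show m ≤ i by omega), inv_inv]
    rw [mul_smul_comm]
    congr 1
    rw [← fr_mul_fr (h t) (P.q2 * t) (P.q3 * t), ← fr_mul_fr (h t) (P.q2⁻¹ * t) (P.q3⁻¹ * t)]
    rw [← fr_mul_fr (h t) (P.q2 * t) (P.q3⁻¹ * t)]
    ring

theorem inner_zy (hP : P.Valid) {j : ℕ} (hj : 0 < j) {y z : E} (h : ∀ c : ℂ, y ≠ c • z) :
    selfFn P m j (ζ j • z) (η j • y) * bwdFn P m j (ζ (j + 1) • z) (η j • y) *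
    fwdFn P m (j - 1) (ζ (j - 1) • z) (η j • y) = innerF P m k j y z := by
  have hq := hP.q_ne
  have hd := hP.d_ne
  obtain ⟨i, rfl⟩ : ∃ i, j = i + 1 := ⟨j - 1, by omega⟩
  rw [selfFn_zy hP, bwdFn_zy hP, Nat.add_sub_cancel, fwdFn_zy hP]
  unfold innerF
  set t := theta P m k (i + 1)
  rcases lt_trichotomy (i + 1) m with h1 | h1 | h1
  · rw [if_neg (by omega), if_neg (by omega)]
    simp only [eps_of_lt h1, eps_of_lt (show i < m by omega)]
    rw [smul_mul_smul_comm, smul_mul_smul_comm, fr_mul_fr (h t), mul_comm (fr _ _ _ _)]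
    congr 1
    unfold Params.q1 Params.q2 Params.q3
    field_simp
    unfold fr
    grind
  · rw [if_pos (Or.inr h1), if_pos h1]
    simp only [eps_of_le h1.symm.le, eps_of_lt (show i < m by omega)]
    rw [one_mul, smul_mul_smul_comm, mul_comm (fr _ _ _ _)]
    congr 1
    unfold Params.q1 Params.q3
    field_simp
  · rw [if_neg (by omega), if_neg (by omega)]
    simp only [eps_of_le h1.le, eps_of_le (show m ≤ i by omega), inv_inv]
    rw [smul_mul_smul_comm, smul_mul_smul_comm, fr_mul_fr (h t)]
    congr 1
    · unfold Params.q1 Params.q2 Params.q3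
      field_simp
    · unfold fr
      grind

theorem yz_cycle (hP : P.Valid) (hkm : k + 2 ≤ m) {y : ℕ → E} (hy : y (m + k) = y 0) {z : E}
    (h : ∀ i (c : ℂ), y i ≠ c • z) : (𝕊).pair (fun i => η i • y i) (fun i => ζ i • z) =
    (∏ j ∈ Finset.Ico 1 (m + k), innerF P m k j (y j) z) * outerF P m k (y 0) z := by
  have n1 := hP.n1
  have n2 := hP.n2
  have n3 := hP.n3
  have hd := hP.d_ne
  rw [super_pair P (by omega) (by omega)]
  have c1 := prod_cycle (N := m + k)
    (fun i a b c d => selfFn P m i a b * (fwdFn P m i a d * bwdFn P m i c b))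
    (fun i => η i • y i) (fun i => ζ i • z)
  refine c1.trans ?_
  simp only [← mul_assoc]
  rw [prod_range_shift (fun i => selfFn P m i (η i • y i) (ζ i • z) *
    fwdFn P m i (η i • y i) (ζ (i + 1) • z))
    (fun i => bwdFn P m i (η (i + 1) • y (i + 1)) (ζ i • z)) (by omega)]
  have hin : ∀ j ∈ Finset.Ico 1 (m + k),
      selfFn P m j (η j • y j) (ζ j • z) *
      fwdFn P m j (η j • y j) (ζ (j + 1) • z) *
      bwdFn P m (j - 1) (η (j - 1 + 1) • y (j - 1 + 1)) (ζ (j - 1) • z) =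
      innerF P m k j (y j) z := by
    intro j hj
    have h1 : 0 < j := by grind
    rw [Nat.sub_add_cancel h1]
    exact inner_yz hP h1 (h j)
  rw [prod_congr rfl hin]
  simp only [mul_assoc]
  congr 1
  set ρ := ζ (m + k) with hρ
  have e1 : selfFn P m 0 (η 0 • y 0) (ζ 0 • z) = 1 := if_pos (Or.inl rfl)
  have e2 : fwdFn P m 0 (η 0 • y 0) (ζ (0 + 1) • z) =
      fr 1 P.q1⁻¹ (y 0) z := by
    rw [fwdFn_yz hP, eps_of_lt (by omega), eps_of_lt (by omega), theta_zero hP,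
      inv_mul_cancel₀ n2, hP.q1_eq]
    congr 1
    field_simp
  have e3 : bwdFn P m (m + k - 1) (η (m + k - 1 + 1) • y (m + k - 1 + 1))
      (ζ (m + k - 1) • z) = eps m (m + k - 1) P.d •
        fr ρ ((eps m (m + k - 1) P.q3)⁻¹ * ρ) (y 0) z := by
    rw [bwdFn_yz hP, Nat.sub_add_cancel (by omega), theta_last hP (by omega), hy]
  have e4 : selfFn P m (m + k) (η (m + k) • y (m + k)) (ρ • z) =
      if m + k = 0 ∨ m + k = m then 1 else fr (eps m (m + k) P.q2 * ρ) ρ (y 0) z := by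
    rw [hρ, selfFn_yz hP, theta_last hP (by omega), hy]
  have e5 : fwdFn P m (m + k) (η (m + k) • y (m + k)) (ζ 0 • z) =
      fr P.q2 P.q3⁻¹ (y 0) z := by
    unfold fwdFn
    rw [ycoef_last hP (by omega), zcoef_zero, fr_smul one_ne_zero, eps_of_le (by omega), hy,
      hP.q1_eq]
    congr 1
    · field_simp
    · simp
  have e6 : bwdFn P m (m + k) (η 0 • y 0) (ρ • z) =
      P.d⁻¹ • fr (P.q2 * ρ) (P.q1⁻¹ * ρ) (y 0) z := by
    unfold bwdFn
    rw [ycoef_zero, fr_smul n1, eps_of_le (by omega), eps_of_le (by omega), hP.q1_eq]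
    congr 2 <;> field_simp
  rw [e1, e2, e3, e4, e5, e6]
  unfold outerF
  dsimp only
  rw [← hρ]
  by_cases hk : k = 0
  · subst hk
    rw [if_pos (show m + 0 = 0 ∨ m + 0 = m from Or.inr rfl), if_pos rfl, eps_of_lt (by omega), eps_of_lt (by omega)]
    simp only [Algebra.smul_def, map_inv₀]
    have : algebraMap ℂ E P.d ≠ 0 := (map_ne_zero _).2 hd
    field_simp
  · rw [if_neg (by omega), if_neg hk, eps_of_le (by omega), eps_of_le (by omega),
      eps_of_le (by omega), inv_inv, ← fr_mul_fr (h 0 ρ) (P.q2⁻¹ * ρ) (P.q3 * ρ)]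
    simp only [Algebra.smul_def, map_inv₀, map_pow]
    ring

theorem zy_cycle (hP : P.Valid) (hkm : k + 2 ≤ m) {y : ℕ → E} (hy : y (m + k) = y 0) {z : E}
    (h : ∀ i (c : ℂ), y i ≠ c • z) : (𝕊).pair (fun i => ζ i • z) (fun i => η i • y i) =
    (∏ j ∈ Finset.Ico 1 (m + k), innerF P m k j (y j) z) * outerF P m k (y 0) z := by
  have n1 := hP.n1
  have n2 := hP.n2
  have n3 := hP.n3
  have hd := hP.d_ne
  have hq := hP.q_ne
  rw [super_pair P (by omega) (by omega)]
  have c1 := prod_cycle (N := m + k)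
    (fun i a b c d => selfFn P m i a b * (fwdFn P m i a d * bwdFn P m i c b))
    (fun i => ζ i • z) (fun i => η i • y i)
  refine c1.trans ?_
  simp only [mul_comm (fwdFn P _ _ _ _), ← mul_assoc]
  rw [prod_range_shift (fun i => selfFn P m i (ζ i • z) (η i • y i) *
    bwdFn P m i (ζ (i + 1) • z) (η i • y i))
    (fun i => fwdFn P m i (ζ i • z) (η (i + 1) • y (i + 1))) (by omega)]
  have hin : ∀ j ∈ Finset.Ico 1 (m + k),
      selfFn P m j (ζ j • z) (η j • y j) *
      bwdFn P m j (ζ (j + 1) • z) (η j • y j) *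
      fwdFn P m (j - 1) (ζ (j - 1) • z) (η (j - 1 + 1) • y (j - 1 + 1)) =
      innerF P m k j (y j) z := by
    intro j hj
    have h1 : 0 < j := by grind
    rw [Nat.sub_add_cancel h1]
    exact inner_zy hP h1 (h j)
  rw [prod_congr rfl hin]
  simp only [mul_assoc]
  congr 1
  set ρ := ζ (m + k) with hρ
  have nρ : ρ ≠ 0 := zcoef_ne hP _
  have e1 : selfFn P m 0 (ζ 0 • z) (η 0 • y 0) = 1 := if_pos (Or.inl rfl)
  have e2 : bwdFn P m 0 (ζ (0 + 1) • z) (η 0 • y 0) =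
      (P.d * P.q3) • fr P.q2 P.q1⁻¹ (y 0) z := by
    rw [bwdFn_zy hP, eps_of_lt (by omega), eps_of_lt (by omega), theta_zero hP, hP.q1_eq]
    congr 2
    field_simp
  have e3 : fwdFn P m (m + k - 1) (ζ (m + k - 1) • z)
      (η (m + k - 1 + 1) • y (m + k - 1 + 1)) = eps m (m + k - 1) P.q1 •
        fr (eps m (m + k - 1) P.q2 * ρ) ((eps m (m + k - 1) P.q3)⁻¹ * ρ) (y 0) z := by
    rw [fwdFn_zy hP, Nat.sub_add_cancel (by omega), theta_last hP (by omega), hy]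
  have e4 : selfFn P m (m + k) (ρ • z) (η (m + k) • y (m + k)) =
      if m + k = 0 ∨ m + k = m then 1
      else eps m (m + k) P.q2 • fr ((eps m (m + k) P.q2)⁻¹ * ρ) ρ (y 0) z := by
    rw [hρ, selfFn_zy hP, theta_last hP (by omega), hy]
  have e5 : bwdFn P m (m + k) (ζ 0 • z) (η (m + k) • y (m + k)) =
      (P.d⁻¹ * P.q3⁻¹) • fr 1 P.q3⁻¹ (y 0) z := by
    unfold bwdFn
    rw [ycoef_last hP (by omega), zcoef_zero, eps_of_le (by omega), eps_of_le (by omega), hy,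
      fr_swap (inv_ne_zero n3) one_ne_zero, fr_smul one_ne_zero, smul_smul]
    grind
  have e6 : fwdFn P m (m + k) (ρ • z) (η 0 • y 0) =
      P.q1⁻¹ • fr ρ (P.q1⁻¹ * ρ) (y 0) z := by
    unfold fwdFn
    rw [ycoef_zero, eps_of_le (by omega), fr_swap (inv_ne_zero n1) one_ne_zero, fr_smul n1]
    grind
  rw [e1, e2, e3, e4, e5, e6]
  unfold outerF
  dsimp only
  rw [← hρ]
  by_cases hk : k = 0
  · subst hk
    rw [if_pos (show m + 0 = 0 ∨ m + 0 = m from Or.inr rfl), if_pos rfl, eps_of_lt (by omega), eps_of_lt (by omega),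
      eps_of_lt (by omega)]
    have hc : (P.d * P.q3) * P.q1 * (P.d⁻¹ * P.q3⁻¹) * P.q1⁻¹ = 1 := by field_simp
    have hc' := congrArg (algebraMap ℂ E) hc
    have h1 : fr P.q2 P.q1⁻¹ (y 0) z * fr (P.q2 * ρ) (P.q3⁻¹ * ρ) (y 0) z *
        fr 1 P.q3⁻¹ (y 0) z * fr ρ (P.q1⁻¹ * ρ) (y 0) z =
        fr ρ (P.q3⁻¹ * ρ) (y 0) z * (fr 1 P.q1⁻¹ (y 0) z * (fr P.q2 P.q3⁻¹ (y 0) z *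
          fr (P.q2 * ρ) (P.q1⁻¹ * ρ) (y 0) z)) := by
      unfold fr
      grind
    simp only [Algebra.smul_def, map_mul, map_one] at hc' ⊢
    grind
  · rw [if_neg (by omega), if_neg hk]
    simp only [eps_of_le (show m ≤ m + k by omega), eps_of_le (show m ≤ m + k - 1 by omega), inv_inv]
    have hc : (P.d * P.q3) * P.q1⁻¹ * P.q2⁻¹ * (P.d⁻¹ * P.q3⁻¹) * P.q1⁻¹ = P.d⁻¹ ^ 2 := by
      unfold Params.q1 Params.q2 Params.q3
      field_simp
    have h1 : fr P.q2 P.q1⁻¹ (y 0) z * fr (P.q2⁻¹ * ρ) (P.q3 * ρ) (y 0) z *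
        fr (P.q2 * ρ) ρ (y 0) z * fr 1 P.q3⁻¹ (y 0) z * fr ρ (P.q1⁻¹ * ρ) (y 0) z =
        fr (P.q2⁻¹ * ρ) (P.q3 * ρ) (y 0) z * (fr 1 P.q1⁻¹ (y 0) z * (fr P.q2 P.q3⁻¹ (y 0) z *
          fr (P.q2 * ρ) (P.q1⁻¹ * ρ) (y 0) z)) := by
      rw [mul_right_comm _ (fr (P.q2 * ρ) ρ (y 0) z), mul_assoc _ (fr (P.q2 * ρ) ρ (y 0) z),
        fr_mul_fr (h 0 ρ)]
      unfold fr
      grind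
    rw [← hc]
    simp only [Algebra.smul_def, map_mul]
    grind

end FactorsYZ

section FactorsYZ

variable {P : Params} {m k : ℕ} {E : Type} [Field E] [Algebra ℂ E]

theorem quad_fr {a : ℂ} (ha : a ≠ 0) (α β γ δ μ : ℂ) (y z : E) :
    (a • y - (α * μ) • z) * (a • y - (β * μ) • z) /
    ((a • y - (γ * μ) • z) * (a • y - (δ * μ) • z)) =
    fr (α * (μ / a)) (γ * (μ / a)) y z * fr (β * (μ / a)) (δ * (μ / a)) y z := by
  simp only [← mul_div_assoc, ← fr_smul ha]
  unfold fr
  rw [div_mul_div_comm]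
  simp only [smul_smul]

theorem inner_of_lt (hP : P.Valid) {i : ℕ} (h1 : 1 ≤ i) (h2 : i < m) (y z : E) :
    P.d • (((P.q1 * 𝔮 ^ i) • y - (P.q2 * P.q3 ^ ((i : ℤ) - 1)) • z) *
    ((P.q1 * 𝔮 ^ i) • y - (P.q2⁻¹ * P.q3 ^ ((i : ℤ) - 1)) • z) /
    (((P.q1 * 𝔮 ^ i) • y - P.q3 ^ (i : ℤ) • z) * ((P.q1 * 𝔮 ^ i) • y - P.q3 ^ ((i : ℤ) - 2) • z))) =
    innerF P m k i y z := by
  have n3 := hP.n3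
  have hη : η i = P.q1 * 𝔮 ^ i := by
    unfold ycoef
    grind
  have hζ : ζ i = P.q3 ^ ((i : ℤ) - 1) := if_pos (by omega)
  have e1 : P.q3 ^ (i : ℤ) = P.q3 * P.q3 ^ ((i : ℤ) - 1) := by
    rw [← zpow_one_add₀ n3]; congr 1; ring
  have e2 : P.q3 ^ ((i : ℤ) - 2) = P.q3⁻¹ * P.q3 ^ ((i : ℤ) - 1) := by
    rw [← zpow_neg_one, ← zpow_add₀ n3]; congr 1; ring
  unfold innerF theta
  rw [e1, e2, ← hη, ← hζ, quad_fr (ycoef_ne hP _ _), if_neg (by omega), eps_of_lt h2]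

theorem inner_of_gt (hP : P.Valid) {i : ℕ} (h2 : m < i) (y z : E) :
    P.d⁻¹ • (((P.q1 * 𝔮 ^ (2 * (m : ℤ) - i)) • y - P.q2 • P.q3 ^ (2 * (m : ℤ) - i - 1) • z) *
    ((P.q1 * 𝔮 ^ (2 * (m : ℤ) - i)) • y - P.q2⁻¹ • P.q3 ^ (2 * (m : ℤ) - i - 1) • z) /
    (((P.q1 * 𝔮 ^ (2 * (m : ℤ) - i)) • y - P.q3 • P.q3 ^ (2 * (m : ℤ) - i - 1) • z) *
    ((P.q1 * 𝔮 ^ (2 * (m : ℤ) - i)) • y - P.q3⁻¹ • P.q3 ^ (2 * (m : ℤ) - i - 1) • z))) =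
    innerF P m k i y z := by
  have hη : η i = P.q1 * 𝔮 ^ (2 * (m : ℤ) - i) := by
    unfold ycoef
    grind
  have hζ : ζ i = P.q3 ^ (2 * (m : ℤ) - i - 1) := if_neg (by omega)
  unfold innerF theta
  simp only [smul_smul]
  rw [← hη, ← hζ, quad_fr (ycoef_ne hP _ _), if_neg (by omega), eps_of_le h2.le]

theorem inner_of_eq (hP : P.Valid) (hm : 0 < m) (y z : E) :
    P.d • (((P.q1 * 𝔮 ^ m) • y - P.q3 ^ ((m : ℤ) - 1) • z) *
    ((P.q1 * 𝔮 ^ m) • y - (P.q2 * P.q3 ^ ((m : ℤ) - 1)) • z) /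
    ((P.q1 * 𝔮 ^ m) • y - P.q3 ^ ((m : ℤ) - 2) • z) ^ 2) = innerF P m k m y z := by
  have n3 := hP.n3
  have hη : η m = P.q1 * 𝔮 ^ m := by
    unfold ycoef
    grind
  have hζ : ζ m = P.q3 ^ ((m : ℤ) - 1) := by rw [zcoef, if_neg (by omega)]; congr 1; ring
  have e2 : P.q3 ^ ((m : ℤ) - 2) = P.q3⁻¹ * P.q3 ^ ((m : ℤ) - 1) := by
    rw [← zpow_neg_one, ← zpow_add₀ n3]; congr 1; ring
  have := quad_fr (ycoef_ne (m := m) hP (k + 1) m) P.q2 1 P.q3⁻¹ P.q3⁻¹ (ζ m) y z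
  unfold innerF theta
  grind

theorem yzF_eq (hP : P.Valid) (hkm : k + 2 ≤ m) {y : ℕ → E} (hy : y (m + k) = y 0) (z : E) :
    yzF P m k y z =
    (∏ j ∈ Finset.Ico 1 (m + k), innerF P m k j (y j) z) * outerF P m k (y 0) z := by
  have n3 := hP.n3
  have hd := hP.d_ne
  have hlast : (y 0 - P.q2 • z) * (y 0 - z) / ((y 0 - P.q3⁻¹ • z) * (y 0 - P.q1⁻¹ • z)) =
      fr 1 P.q1⁻¹ (y 0) z * fr P.q2 P.q3⁻¹ (y 0) z := by
    unfold fr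
    rw [div_mul_div_comm, one_smul, mul_comm (y 0 - z), mul_comm (y 0 - P.q1⁻¹ • z)]
  unfold yzF outerF
  dsimp only
  rw [hy, hlast]
  by_cases hk : k = 0
  · subst hk
    rw [if_pos (by omega), if_pos rfl]
    have hρ : ζ (m + 0) = P.q3 ^ ((m : ℤ) - 1) := by
      rw [zcoef_last]
      simp
    have e2 : P.q3 ^ ((m : ℤ) - 2) = P.q3⁻¹ * P.q3 ^ ((m : ℤ) - 1) := by
      rw [← zpow_neg_one, ← zpow_add₀ n3]; congr 1; ring
    have e3 : P.q1⁻¹ * (P.q3⁻¹ * P.q3 ^ ((m : ℤ) - 1)) = P.q2 * P.q3 ^ ((m : ℤ) - 1) := by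
      have n2 := hP.n2
      rw [hP.q1_eq]
      field_simp
    rw [prod_congr rfl fun i hi => inner_of_lt hP (mem_Ico.1 hi).1
      (mem_Ico.1 hi).2 (y i) z, hρ, e2, e3, Nat.add_zero]
    unfold fr
    simp only [one_smul, div_eq_mul_inv, mul_inv]
    ring
  · have hρ : ζ (m + k) = P.q3 ^ ((m : ℤ) - (k + 1 : ℕ)) := by
      rw [zcoef_last]
      grind
    have hin : P.d⁻¹ • (((P.q1 * 𝔮 ^ m) • y m - P.q3 ^ ((m : ℤ) - 1) • z) *
        ((P.q1 * 𝔮 ^ m) • y m - (P.q2 * P.q3 ^ ((m : ℤ) - 1)) • z) /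
        ((P.q1 * 𝔮 ^ m) • y m - P.q3 ^ ((m : ℤ) - 2) • z) ^ 2) =
        P.d⁻¹ ^ 2 • innerF P m k m (y m) z := by
      rw [← inner_of_eq hP (by omega), smul_smul]
      grind
    rw [if_neg (by omega), if_neg hk, prod_congr rfl fun i hi => inner_of_lt hP
      (mem_Ico.1 hi).1 (mem_Ico.1 hi).2 (y i) z, prod_congr rfl fun i hi =>
      inner_of_gt hP (show m < i from (mem_Ico.1 hi).1) (y i) z,
      ← prod_Ico_consecutive _ (show 1 ≤ m by omega) (show m ≤ m + k by omega),
      prod_eq_prod_Ico_succ_bot (show m < m + k by omega),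
      hin, hρ, Nat.succ_eq_add_one]
    generalize (∏ i ∈ Finset.Ico 1 m, innerF P m k i (y i) z) = A,
      (∏ i ∈ Finset.Ico (m + 1) (m + k), innerF P m k i (y i) z) = B, innerF P m k m (y m) z = C
    unfold fr
    simp only [one_smul, div_eq_mul_inv, mul_inv, smul_smul]
    simp only [Algebra.smul_def]
    ring

theorem yz_pair (hP : P.Valid) (hkm : k + 2 ≤ m) {y : ℕ → E} (hy : y (m + k) = y 0) {z : E}
    (h : ∀ i (c : ℂ), y i ≠ c • z) : (𝕊).pair (fun i => η i • y i) (fun i => ζ i • z) =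
    yzF P m k y z := by
  rw [yz_cycle hP hkm hy h, yzF_eq hP hkm hy]

theorem zy_pair (hP : P.Valid) (hkm : k + 2 ≤ m) {y : ℕ → E} (hy : y (m + k) = y 0) {z : E}
    (h : ∀ i (c : ℂ), y i ≠ c • z) : (𝕊).pair (fun i => ζ i • z) (fun i => η i • y i) =
    yzF P m k y z := by
  rw [zy_cycle hP hkm hy h, yzF_eq hP hkm hy]

end FactorsYZ

/-! ## Equality up to units -/

section UpTo

variable {E : Type} [Field E] [Algebra ℂ E]

/-- `x` is the product of `y` and an element of `U`. -/
def UpTo (U : Submonoid E) (x y : E) : Prop := ∃ u ∈ U, x = u * y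

variable {U : Submonoid E} {x y x' y' z : E}

theorem UpTo.refl (U : Submonoid E) (x : E) : UpTo U x x := ⟨1, U.one_mem, (one_mul x).symm⟩

theorem UpTo.of_eq (h : x = y) : UpTo U x y := h ▸ UpTo.refl U x

theorem UpTo.trans (h : UpTo U x y) (h' : UpTo U y z) : UpTo U x z := by
  obtain ⟨u, hu, rfl⟩ := h
  obtain ⟨v, hv, rfl⟩ := h'
  exact ⟨u * v, U.mul_mem hu hv, (mul_assoc _ _ _).symm⟩

theorem UpTo.mul (h : UpTo U x y) (h' : UpTo U x' y') : UpTo U (x * x') (y * y') := by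
  obtain ⟨u, hu, rfl⟩ := h
  obtain ⟨v, hv, rfl⟩ := h'
  exact ⟨u * v, U.mul_mem hu hv, mul_mul_mul_comm _ _ _ _⟩

theorem UpTo.prod {ι : Type} {s : Finset ι} {f g : ι → E} (h : ∀ i ∈ s, UpTo U (f i) (g i)) :
    UpTo U (∏ i ∈ s, f i) (∏ i ∈ s, g i) := by
  classical
  induction s using Finset.induction_on with
  | empty => exact UpTo.of_eq (by simp)
  | insert a s ha ih =>
    rw [prod_insert ha, prod_insert ha]
    exact (h a (mem_insert_self _ _)).mul
      (ih fun i hi => h i (mem_insert_of_mem hi))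

theorem UpTo.pairProd {N : ℕ} {f g : Fin N → Fin N → E} (h : ∀ a b, a < b → UpTo U (f a b) (g a b)) :
    UpTo U (pairProd f) (pairProd g) :=
  UpTo.prod fun a _ => UpTo.prod fun b hb => h a b (by simpa using hb)

/-- `U` contains the nonzero constants. -/
def Scalars (U : Submonoid E) : Prop := ∀ c : ℂ, c ≠ 0 → algebraMap ℂ E c ∈ U

theorem UpTo.of_mem (h : x ∈ U) : UpTo U x 1 := ⟨x, h, (mul_one x).symm⟩

theorem UpTo.smul (hU : Scalars U) {c : ℂ} (hc : c ≠ 0) (x : E) :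
    UpTo U (c • x) x := ⟨_, hU c hc, Algebra.smul_def c x⟩

theorem UpTo.smul' (hU : Scalars U) {c : ℂ} (hc : c ≠ 0) (x : E) : UpTo U x (c • x) :=
  ⟨_, hU c⁻¹ (inv_ne_zero hc), by rw [← Algebra.smul_def, smul_smul, inv_mul_cancel₀ hc, one_smul]⟩

/-- Normalization of the first coefficient of a linear form. -/
theorem UpTo.lin (hU : Scalars U) {a : ℂ} (ha : a ≠ 0) (b : ℂ) (u v : E) :
    UpTo U (a • u - b • v) (u - (b / a) • v) := by
  have : a • u - b • v = a • (u - (b / a) • v) := by rw [smul_sub, smul_smul, mul_div_cancel₀ _ ha]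
  rw [this]
  exact UpTo.smul hU ha _

theorem UpTo.lin' (hU : Scalars U) {a : ℂ} (ha : a ≠ 0) (b : ℂ) (u v : E) :
    UpTo U (u - (b / a) • v) (a • u - b • v) := by
  have : a • u - b • v = a • (u - (b / a) • v) := by rw [smul_sub, smul_smul, mul_div_cancel₀ _ ha]
  rw [this]
  exact UpTo.smul' hU ha _

/-- Normalization of the second coefficient of a linear form. -/
theorem UpTo.lin_swap (hU : Scalars U) {b : ℂ} (hb : b ≠ 0) (a : ℂ)
    (u v : E) : UpTo U (a • v - b • u) (u - (a / b) • v) := by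
  have : a • v - b • u = (-b) • (u - (a / b) • v) := by
    rw [smul_sub, smul_smul, neg_mul, mul_div_cancel₀ _ hb, neg_smul, neg_smul]
    abel
  rw [this]
  exact UpTo.smul hU (neg_ne_zero.2 hb) _

end UpTo

/-! ## The specialized poles -/

section Poles

variable {P : Params} {m k : ℕ} {E : Type} [Field E] [Algebra ℂ E] {U : Submonoid E}

theorem linF_mul_fr {β : ℂ} {u v : E} (h : u ≠ β • v) (α : ℂ) :
    (u - β • v) * fr α β u v = u - α • v :=
  mul_div_cancel₀ _ (sub_ne_zero.2 h)

theorem edge_upTo (hU : Scalars U) (hP : P.Valid) (i : ℕ) {u v : E} (h : ∀ c : ℂ, u ≠ c • v) :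
    UpTo U ((η i • u - η (i + 1) • v) * edgeF P m k i u v) (u - v) := by
  have hy := ycoef_ne (m := m) hP (k + 1) i
  refine ((UpTo.lin hU hy _ u v).mul (UpTo.refl U _)).trans (UpTo.of_eq ?_)
  rw [ycoef_succ, mul_div_cancel_right₀ _ hy]
  unfold edgeF
  rw [linF_mul_fr (h _), one_smul]

variable (P k) in
/-- The numerator of `fusedF`. -/
def wwF (u v : E) : E := if k = 0 then (u - v) ^ 2 else (u - P.q2 • v) * (u - P.q2⁻¹ • v)

theorem fused_upTo (hU : Scalars U) (hP : P.Valid) {u v : E} (h : ∀ c : ℂ, u ≠ c • v) :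
    UpTo U ((u - P.q1 • v) * (v - P.q1 • u) * fusedF P m k u v) (wwF P k u v) := by
  have n1 := hP.n1
  have e1 := UpTo.lin_swap hU n1 1 u v
  rw [one_smul, one_div] at e1
  have h1 : u - P.q1 • v ≠ 0 := sub_ne_zero.2 (h _)
  have h2 : u - P.q1⁻¹ • v ≠ 0 := sub_ne_zero.2 (h _)
  refine (((UpTo.refl U _).mul e1).mul (UpTo.refl U _)).trans ?_
  unfold fusedF wwF
  split_ifs <;> rw [mul_smul_comm, mul_div_cancel₀ _ (mul_ne_zero h1 h2)]
  · exact UpTo.smul hU hP.q_ne _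
  · exact UpTo.smul hU (inv_ne_zero hP.d_ne) _
  · exact UpTo.smul hU (inv_ne_zero hP.d_ne) _

/-- The product of the poles between two sets of variables with one element in each colour. -/
def polePair {c : ℕ} (x x' : Fin c → E) : E := ∏ i, (x i - x' (next i))

theorem polePair_y (hkm : k + 2 ≤ m) (hP : P.Valid) {y y' : ℕ → E} (hy : y (m + k) = y 0) :
    polePair (fun i : 𝕀 => η i • y i) (fun i => η i • y' i) =
    (∏ i ∈ range (m + k), (η i • y i - η (i + 1) • y' (i + 1))) * (y 0 - P.q1 • y' 0) := by
  have c1 := prod_cycle (N := m + k) (fun _ a _ _ d => a - d)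
    (fun i => η i • y i) (fun i => η i • y' i)
  refine c1.trans ?_
  rw [ycoef_last hP (by omega), ycoef_zero, one_smul, hy]

theorem zcoef_ne_succ (hP : P.Valid) (h3 : P.q3 ≠ 1) (i : ℕ) : ζ i ≠ ζ (i + 1) := by
  rw [zcoef_succ hP]
  intro h
  have h1 := mul_right_cancel₀ (zcoef_ne hP i) ((one_mul _).trans h)
  unfold eps at h1
  grind

theorem polePair_z_self (hU : Scalars U) (hP : P.Valid) (h3 : P.q3 ≠ 1)
    (hρ : ζ (m + k) ≠ P.q3⁻¹) {z : E} (hz : z ∈ U) :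
    UpTo U (polePair (fun i : 𝕀 => ζ i • z) (fun i => ζ i • z)) 1 := by
  have h : ∀ i : 𝕀, UpTo U (ζ i • z - ζ (next i) • z) 1 := by
    intro i
    have hne : ζ i - ζ (next i) ≠ 0 := by
      rw [sub_ne_zero]
      rcases next_val_cases i with ⟨-, h⟩ | ⟨h1, h⟩
      · rw [h]
        exact zcoef_ne_succ hP h3 _
      · rw [h, zcoef_zero, show i.val = m + k by omega]
        exact hρ
    rw [← sub_smul]
    exact (UpTo.smul hU hne z).trans (UpTo.of_mem hz)
  exact (UpTo.prod fun i _ => h i).trans (UpTo.of_eq prod_const_one)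

theorem zz_upTo (hU : Scalars U) (hP : P.Valid) (hkm : k + 2 ≤ m)
    {u v : E} (h : ∀ c : ℂ, u ≠ c • v) :
    UpTo U (polePair (fun i : 𝕀 => ζ i • u) (fun i => ζ i • v) *
    polePair (fun i : 𝕀 => ζ i • v) (fun i => ζ i • u) * zzF P m k u v)
    (((u - P.q2 • v) * (u - P.q2⁻¹ • v)) ^ (m + k - 1) * (u - v) ^ 2 * (u - v) ^ 2) := by
  have n3 := hP.n3
  have hc : ∀ c : ℂ, u - c • v ≠ 0 := fun c => sub_ne_zero.2 (h c)
  have c1 := prod_cycle (N := m + k) (fun _ a b c d => (a - d) * (b - c))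
    (fun i => ζ i • u) (fun i => ζ i • v)
  have hpp : polePair (fun i : 𝕀 => ζ i • u) (fun i => ζ i • v) *
        polePair (fun i : 𝕀 => ζ i • v) (fun i => ζ i • u) =
      _ := (prod_mul_distrib.symm).trans c1
  rw [hpp]
  have h1 : ∀ i ∈ range (m + k), UpTo U
      ((ζ i • u - ζ (i + 1) • v) * (ζ i • v - ζ (i + 1) • u))
      ((u - P.q3 • v) * (u - P.q3⁻¹ • v)) := by
    intro i _
    have hi := zcoef_ne (m := m) hP i
    refine ((UpTo.lin hU hi _ u v).mul
      (UpTo.lin_swap hU (zcoef_ne hP _) _ u v)).trans (UpTo.of_eq ?_)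
    rw [zcoef_succ hP, mul_div_cancel_right₀ _ hi, ← inv_div, mul_div_cancel_right₀ _ hi]
    unfold eps
    grind
  have e1 : P.q3⁻¹ / P.q3 ^ ((m : ℤ) - k - 1) = P.q3 ^ (-(m : ℤ) + (k + 1 : ℕ) - 1) := by
    rw [← zpow_neg_one, ← zpow_sub₀ n3]
    grind
  have e2 : P.q3 ^ ((m : ℤ) - k - 1) / P.q3⁻¹ = P.q3 ^ ((m : ℤ) - (k + 1 : ℕ) + 1) := by
    rw [← zpow_neg_one, ← zpow_sub₀ n3]
    grind
  have h2 : UpTo U ((ζ (m + k) • u - ζ 0 • v) *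
      (ζ (m + k) • v - ζ 0 • u))
      ((u - P.q3 ^ (-(m : ℤ) + (k + 1 : ℕ) - 1) • v) *
        (u - P.q3 ^ ((m : ℤ) - (k + 1 : ℕ) + 1) • v)) := by
    refine ((UpTo.lin hU (zcoef_ne hP _) _ u v).mul
      (UpTo.lin_swap hU (zcoef_ne hP _) _ u v)).trans (UpTo.of_eq ?_)
    rw [zcoef_last, zcoef_zero, e1, e2]
  refine (((UpTo.prod h1).mul h2).mul (UpTo.refl U _)).trans ?_
  rw [prod_const, card_range]
  unfold zzF
  rw [mul_smul_comm]
  refine (UpTo.smul hU (pow_ne_zero _ hP.d_ne) _).trans (UpTo.of_eq ?_)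
  obtain ⟨t, ht⟩ : ∃ t, m + k = t + 1 := ⟨m + k - 1, by omega⟩
  rw [show m + (k + 1) - 2 = t by omega, show m + k - 1 = t by omega, ht]
  have a1 := hc P.q3
  have a2 := hc P.q3⁻¹
  have a3 := hc (P.q3 ^ ((m : ℤ) - (k + 1 : ℕ) + 1))
  have a4 := hc (P.q3 ^ (-(m : ℤ) + (k + 1 : ℕ) - 1))
  generalize u - P.q3 • v = x₁, u - P.q3⁻¹ • v = x₂, u - P.q3 ^ ((m : ℤ) - (k + 1 : ℕ) + 1) • v = x₃,
    u - P.q3 ^ (-(m : ℤ) + (k + 1 : ℕ) - 1) • v = x₄, u - P.q2 • v = x₅, u - P.q2⁻¹ • v = x₆,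
    u - v = x₇ at *
  rw [div_mul_div_comm, div_pow]
  field_simp
  ring

theorem inner_upTo (hU : Scalars U) (hP : P.Valid) {j : ℕ} (hj : 0 < j)
    {y z : E} (h : ∀ c : ℂ, y ≠ c • z) : UpTo U ((η j • y - ζ (j + 1) • z) *
    (ζ (j - 1) • z - η j • y) * innerF P m k j y z) ((η j • y - (ratA P j * ζ j) • z) *
    (η j • y - (ratB P m j * ζ j) • z)) := by
  obtain ⟨i, rfl⟩ : ∃ i, j = i + 1 := ⟨j - 1, by omega⟩
  have n3 := hP.n3
  have hd := hP.d_ne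
  have hy := ycoef_ne (m := m) hP (k + 1) (i + 1)
  have hs := zcoef_succ (m := m) hP i
  have h3 : eps m i P.q3 ≠ 0 := eps_ne n3
  refine UpTo.trans ?_ ((UpTo.lin' hU hy _ y z).mul (UpTo.lin' hU hy _ y z))
  refine (((UpTo.lin hU hy _ y z).mul (UpTo.lin_swap hU hy _ y z)).mul (UpTo.refl U _)).trans ?_
  rw [Nat.add_sub_cancel, zcoef_succ hP (i + 1)]
  have e1 : ζ i = (eps m i P.q3)⁻¹ * ζ (i + 1) := by grind
  rw [e1]
  simp only [mul_div_assoc]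
  change UpTo U ((y - (_ * theta P m k (i + 1)) • z) * (y - (_ * theta P m k (i + 1)) • z) * _)
    ((y - (_ * theta P m k (i + 1)) • z) * (y - (_ * theta P m k (i + 1)) • z))
  unfold innerF ratA ratB
  rw [if_neg (show i + 1 ≠ 0 by omega)]
  set t := theta P m k (i + 1)
  rcases lt_trichotomy (i + 1) m with h1 | h1 | h1
  · rw [if_neg (by omega), if_neg (by omega)]
    simp only [eps_of_lt h1, eps_of_lt (show i < m by omega)]
    rw [mul_smul_comm]
    refine (UpTo.smul hU hd _).trans (UpTo.of_eq ?_)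
    rw [mul_mul_mul_comm, linF_mul_fr (h _), linF_mul_fr (h _)]
  · rw [if_pos h1, if_pos h1]
    simp only [eps_of_le h1.symm.le, eps_of_lt (show i < m by omega)]
    rw [mul_smul_comm]
    refine (UpTo.smul hU hd _).trans (UpTo.of_eq ?_)
    rw [mul_mul_mul_comm, linF_mul_fr (h _), linF_mul_fr (h _), one_mul]
  · rw [if_neg (by omega), if_neg (by omega)]
    simp only [eps_of_le h1.le, eps_of_le (show m ≤ i by omega), inv_inv]
    rw [mul_smul_comm]
    refine (UpTo.smul hU (inv_ne_zero hd) _).trans (UpTo.of_eq ?_)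
    rw [mul_comm (y - (P.q3⁻¹ * t) • z), mul_mul_mul_comm, linF_mul_fr (h _), linF_mul_fr (h _)]

theorem outer_upTo (hU : Scalars U) (hP : P.Valid) (hkm : k + 2 ≤ m)
    {w z : E} (h : ∀ c : ℂ, w ≠ c • z) : UpTo U ((P.q1 • w - z) * (ζ (m + k - 1) • z - w) *
    ((w - P.q3⁻¹ • z) * (ζ (m + k) • z - P.q1 • w)) * outerF P m k w z)
    ((P.q1 • w - (ratA P 0 * ζ 0) • z) * (P.q1 • w - (ratB P m 0 * ζ 0) • z) *
    ((w - (ratA P (m + k) * ζ (m + k)) • z) * (w - (ratB P m (m + k) * ζ (m + k)) • z))) := by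
  have n1 := hP.n1
  have n2 := hP.n2
  have n3 := hP.n3
  have hd := hP.d_ne
  have hs := zcoef_succ (m := m) hP (m + k - 1)
  have h3 : eps m (m + k - 1) P.q3 ≠ 0 := eps_ne n3
  rw [Nat.sub_add_cancel (by omega)] at hs
  set ρ := ζ (m + k) with hρ
  have e1 : ζ (m + k - 1) = (eps m (m + k - 1) P.q3)⁻¹ * ρ := by grind
  have e2 : ratA P 0 * ζ 0 / P.q1 = P.q2 := by
    rw [zcoef_zero, hP.q1_eq, ratA, if_pos rfl]
    field_simp
  have e3 : ratB P m 0 * ζ 0 / P.q1 = 1 := by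
    rw [zcoef_zero, hP.q1_eq, ratB, if_neg (show 0 ≠ m by omega)]
    field_simp
  have e4 : ratA P (m + k) = P.q2 := if_neg (by omega)
  have t1 := UpTo.lin hU n1 1 w z
  have t2 := UpTo.lin_swap hU one_ne_zero (ζ (m + k - 1)) w z
  have t3 := UpTo.lin_swap hU n1 ρ w z
  have s1 := UpTo.lin' hU n1 (ratA P 0 * ζ 0) w z
  have s2 := UpTo.lin' hU n1 (ratB P m 0 * ζ 0) w z
  rw [e2] at s1
  rw [e3, one_smul] at s2
  rw [one_smul, one_div] at t1
  rw [one_smul, div_one] at t2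
  rw [div_eq_inv_mul] at t3
  refine UpTo.trans ?_ ((s1.mul s2).mul (UpTo.refl U _))
  refine (((t1.mul t2).mul ((UpTo.refl U _).mul t3)).mul (UpTo.refl U _)).trans ?_
  have a1 := linF_mul_fr (h P.q1⁻¹) 1
  have a2 := linF_mul_fr (h P.q3⁻¹) P.q2
  have a3 := linF_mul_fr (h (P.q1⁻¹ * ρ)) (P.q2 * ρ)
  rw [one_smul] at a1
  unfold outerF
  dsimp only
  rw [← hρ, e1, e4]
  by_cases hk : k = 0
  · have a4 := linF_mul_fr (h (P.q3⁻¹ * ρ)) ρ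
    have e5 : ratB P m (m + k) = 1 := if_pos (by omega)
    rw [if_pos hk, e5, one_mul, eps_of_lt (by omega), ← a1, ← a2, ← a3, ← a4]
    exact UpTo.of_eq (by ring)
  · have a4 := linF_mul_fr (h (P.q3 * ρ)) (P.q2⁻¹ * ρ)
    have e5 : ratB P m (m + k) = P.q2⁻¹ := if_neg (by omega)
    rw [if_neg hk, e5, eps_of_le (by omega), inv_inv, smul_mul_assoc, mul_smul_comm, ← a1, ← a2,
      ← a3, ← a4]
    exact (UpTo.smul hU (pow_ne_zero _ (inv_ne_zero hd)) _).trans (UpTo.of_eq (by ring))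

theorem yz_upTo (hU : Scalars U) (hP : P.Valid) (hkm : k + 2 ≤ m)
    {y : ℕ → E} (hy : y (m + k) = y 0) {z : E} (h : ∀ i (c : ℂ), y i ≠ c • z) :
    UpTo U (polePair (fun i : 𝕀 => η i • y i) (fun i => ζ i • z) * polePair (fun i : 𝕀 => ζ i • z)
    (fun i => η i • y i) * yzF P m k y z) (∏ i : 𝕀, (η i • y i - (ratA P i * ζ i) • z) *
    (η i • y i - (ratB P m i * ζ i) • z)) := by
  have c1 := prod_cycle (N := m + k) (fun _ a b c d => (a - d) * (b - c))
    (fun i => η i • y i) (fun i => ζ i • z)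
  have hpp : polePair (fun i : 𝕀 => η i • y i)
        (fun i => ζ i • z) * polePair (fun i : 𝕀 => ζ i • z)
          (fun i => η i • y i) = _ := (prod_mul_distrib.symm).trans c1
  have hz1 : ζ 1 = 1 := by
    rw [← zero_add 1, zcoef_succ hP, zcoef_zero, eps_of_lt (by omega), mul_inv_cancel₀ hP.n3]
  rw [hpp, yzF_eq hP hkm hy, prod_range_shift
    (fun i => η i • y i - ζ (i + 1) • z)
    (fun i => ζ i • z - η (i + 1) • y (i + 1)) (by omega),
    Fin.prod_univ_eq_prod_range (fun i => (η i • y i - (ratA P i * ζ i) • z) *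
        (η i • y i - (ratB P m i * ζ i) • z)), ← Nat.add_assoc,
    prod_range_succ, prod_range_eq_mul_Ico _ (show 0 < m + k by omega)]
  have e1 : m + k - 1 + 1 = m + k := by omega
  simp only [e1, ycoef_last hP (show k < m by omega), zero_add, hz1, ycoef_zero, hy, one_smul,
    zcoef_zero]
  have ho := outer_upTo (U := U) hU hP hkm (h 0)
  rw [zcoef_zero] at ho
  refine UpTo.trans (UpTo.of_eq ?_) (((UpTo.prod (s := Finset.Ico 1 (m + k)) fun j hj =>
    inner_upTo (m := m) (k := k) hU hP (show 0 < j from (mem_Ico.1 hj).1)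
      (h j)).mul ho).trans (UpTo.of_eq ?_))
  · rw [prod_mul_distrib (g := fun i => innerF P m k i (y i) z)]
    have : ∀ j ∈ Finset.Ico 1 (m + k), (η j • y j - ζ (j + 1) • z) *
        (ζ (j - 1) • z - η (j - 1 + 1) • y (j - 1 + 1)) =
        (η j • y j - ζ (j + 1) • z) *
        (ζ (j - 1) • z - η j • y j) := by grind
    rw [prod_congr rfl this]
    ring
  · ring

end Poles

section Total

variable {P : Params} {m k : ℕ} {E : Type} [Field E] [Algebra ℂ E] {U : Submonoid E} {L K : ℕ}

theorem prod_prod_eq_diag_mul_pairProd {R : Type} [CommRing R] {N : ℕ} (f : Fin N → Fin N → R) :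
    ∏ a, ∏ b, f a b = (∏ a, f a a) * pairProd fun a b => f a b * f b a := by
  have key : ∀ g : Fin N → Fin N → R, pairProd g = ∏ a, ∏ b, if a < b then g a b else 1 := by
    intro g
    unfold pairProd
    refine prod_congr rfl fun a _ => ?_
    rw [← prod_filter]
    refine prod_congr ?_ fun _ _ => rfl
    ext b
    simp
  have h1 : ∀ a b, f a b = (if a = b then f a b else 1) *
      ((if a < b then f a b else 1) * if b < a then f a b else 1) := by grind
  rw [key]
  calc ∏ a, ∏ b, f a b = ∏ a, ∏ b, (if a = b then f a b else 1) *
      ((if a < b then f a b else 1) * if b < a then f a b else 1) :=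
        prod_congr rfl fun a _ => prod_congr rfl fun b _ => h1 a b
    _ = (∏ a, ∏ b, if a = b then f a b else 1) * ((∏ a, ∏ b, if a < b then f a b else 1) *
        ∏ a, ∏ b, if b < a then f a b else 1) := by simp only [prod_mul_distrib]
    _ = _ := by
      congr 1
      · simp
      · rw [prod_comm (f := fun a b => if b < a then f a b else 1)]
        simp only [← prod_mul_distrib]
        refine prod_congr rfl fun a _ => prod_congr rfl fun b _ => ?_
        split_ifs <;> simp

theorem yy_total (hU : Scalars U) (hP : P.Valid) (hkm : k + 2 ≤ m)
    {y : ℕ → Fin L → E} (hy : y (m + k) = y 0) (hw : ∀ a, y 0 a ∈ U)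
    (h0 : ∀ a b, a ≠ b → ∀ c : ℂ, y 0 a ≠ c • y 0 b)
    (h1 : ∀ i < m + k, ∀ a b, ∀ c : ℂ, y i a ≠ c • y (i + 1) b) :
    UpTo U ((∏ a, ∏ b, polePair (fun i : 𝕀 => η i • y i a)
    (fun i => η i • y i b)) * factorA P m (k + 1) y)
    ((pairProd fun a b => wwF P k (y 0 a) (y 0 b)) *
    ∏ i ∈ range (m + k), ∏ a, ∏ b, (y i a - y (i + 1) b)) := by
  have hq1 : (1 : ℂ) - P.q1 ≠ 0 := by
    intro h
    have := hP.generic 1 0 0 (by simp [← sub_eq_zero.1 h])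
    omega
  have e1 : ∀ a b, polePair (fun i : 𝕀 => η i • y i a)
      (fun i => η i • y i b) = _ :=
    fun a b => polePair_y (y := fun i => y i a) (y' := fun i => y i b) hkm hP (by simp only [hy])
  simp only [e1, prod_mul_distrib]
  rw [factorA_eq, prod_prod_eq_diag_mul_pairProd (fun a b => y 0 a - P.q1 • y 0 b), hy]
  have e2 : ∏ a : Fin L, ∏ b : Fin L, ∏ i ∈ range (m + k), (η i • y i a -
      η (i + 1) • y (i + 1) b) = ∏ i ∈ range (m + k), ∏ a, ∏ b,
      (η i • y i a - η (i + 1) • y (i + 1) b) :=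
    (prod_congr rfl fun a _ => prod_comm).trans prod_comm
  rw [e2]
  have u1 : UpTo U ((∏ i ∈ range (m + k), ∏ a, ∏ b, (η i • y i a -
      η (i + 1) • y (i + 1) b)) *
      ∏ i ∈ range (m + k), ∏ a, ∏ b, edgeF P m k i (y i a) (y (i + 1) b))
      (∏ i ∈ range (m + k), ∏ a, ∏ b, (y i a - y (i + 1) b)) := by
    simp only [← prod_mul_distrib]
    exact UpTo.prod fun i hi => UpTo.prod fun a _ => UpTo.prod fun b _ =>
      edge_upTo hU hP i (h1 i (mem_range.1 hi) a b)
  have u2 : UpTo U (∏ a, (y 0 a - P.q1 • y 0 a)) 1 := by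
    refine (UpTo.prod (g := fun _ => 1) fun a _ => ?_).trans (UpTo.of_eq prod_const_one)
    have : y 0 a - P.q1 • y 0 a = (1 - P.q1) • y 0 a := by rw [sub_smul, one_smul]
    rw [this]
    exact (UpTo.smul hU hq1 _).trans (UpTo.of_mem (hw a))
  have u3 : UpTo U ((pairProd fun a b => (y 0 a - P.q1 • y 0 b) * (y 0 b - P.q1 • y 0 a)) *
      pairProd fun a b => fusedF P m k (y 0 a) (y 0 b))
      (pairProd fun a b => wwF P k (y 0 a) (y 0 b)) := by
    rw [← pairProd_mul]
    exact UpTo.pairProd fun a b hab => fused_upTo hU hP (h0 a b hab.ne)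
  refine (UpTo.of_eq ?_).trans ((u1.mul (u2.mul u3)).trans (UpTo.of_eq ?_))
  · ring
  · ring

theorem zz_total (hU : Scalars U) (hP : P.Valid) (hkm : k + 2 ≤ m)
    {z : Fin K → E} (hz : ∀ b, z b ∈ U) (h : ∀ a b, a ≠ b → ∀ c : ℂ, z a ≠ c • z b) :
    UpTo U ((∏ a, ∏ b, polePair (fun i : 𝕀 => ζ i • z a)
    (fun i => ζ i • z b)) * factorB P m (k + 1) z)
    ((pairProd fun a b => ((z a - P.q2 • z b) * (z a - P.q2⁻¹ • z b)) ^ (m + k - 1) *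
    (z a - z b) ^ 2) * pairProd fun a b => (z a - z b) ^ 2) := by
  have h3 : P.q3 ≠ 1 := by
    intro h
    have := hP.generic 0 0 1 (by simp [h])
    omega
  have hρ : ζ (m + k) ≠ P.q3⁻¹ := by
    rw [zcoef_last]
    intro h
    have := hP.zpow_inj (a := 0) (b := (m : ℤ) - k - 1) (a' := 0) (b' := -1) (by simp [h])
    omega
  rw [factorB_eq, prod_prod_eq_diag_mul_pairProd]
  have u1 : UpTo U (∏ a, polePair (fun i : 𝕀 => ζ i • z a)
      (fun i => ζ i • z a)) 1 :=
    (UpTo.prod (g := fun _ => 1) fun a _ => polePair_z_self hU hP h3 hρ (hz a)).trans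
      (UpTo.of_eq prod_const_one)
  rw [mul_assoc, ← pairProd_mul, ← pairProd_mul]
  refine (u1.mul (UpTo.pairProd fun a b hab => zz_upTo hU hP hkm (h a b hab.ne))).trans
    (UpTo.of_eq (one_mul _))

theorem yz_total (hU : Scalars U) (hP : P.Valid) (hkm : k + 2 ≤ m)
    {y : ℕ → Fin L → E} (hy : y (m + k) = y 0) {z : Fin K → E}
    (h : ∀ i a b, ∀ c : ℂ, y i a ≠ c • z b) : UpTo U ((∏ a, ∏ b, polePair (fun i : 𝕀 => η i • y i a)
    (fun i => ζ i • z b)) * (∏ b, ∏ a, polePair (fun i : 𝕀 => ζ i • z b)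
    (fun i => η i • y i a)) * factorC P m (k + 1) y z) (∏ i : 𝕀, ∏ a, ∏ b,
    (η i • y i a - (ratA P i * ζ i) • z b) * (η i • y i a - (ratB P m i * ζ i) • z b)) := by
  rw [factorC_eq, prod_comm (s := (Finset.univ : Finset (Fin K)))]
  simp only [← prod_mul_distrib]
  refine (UpTo.prod fun a _ => UpTo.prod fun b _ =>
    yz_upTo hU hP hkm (y := fun i => y i a) (by simp only [hy]) fun i => h i a b).trans
    (UpTo.of_eq ?_)
  rw [prod_congr rfl fun a _ => prod_comm]
  exact prod_comm

/-- The product of the poles at a point. -/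
def polesAt {c : ℕ} {α : Type} [Fintype α] (x : Fin c → α → E) : E :=
  ∏ i, ∏ a, ∏ b, (x i a - x (next i) b)

theorem polesAt_eq {c : ℕ} {α : Type} [Fintype α] (x : Fin c → α → E) :
    polesAt x = ∏ a, ∏ b, polePair (fun i => x i a) fun i => x i b := by
  unfold polesAt polePair
  rw [prod_comm]
  exact prod_congr rfl fun a _ => prod_comm

variable (P m k) in
/-- The specialized point. -/
def specPt (y : ℕ → Fin L → E) (z : Fin K → E) (i : 𝕀) (s : Fin L ⊕ Fin K) : E :=
  Sum.elim (fun a => η i • y i a) (fun b => ζ i • z b) s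

theorem total_upTo (hU : Scalars U) (hP : P.Valid) (hkm : k + 2 ≤ m)
    {y : ℕ → Fin L → E} (hy : y (m + k) = y 0) (hw : ∀ a, y 0 a ∈ U)
    (h0 : ∀ a b, a ≠ b → ∀ c : ℂ, y 0 a ≠ c • y 0 b)
    (h1 : ∀ i < m + k, ∀ a b, ∀ c : ℂ, y i a ≠ c • y (i + 1) b)
    {z : Fin K → E} (hz : ∀ b, z b ∈ U) (h2 : ∀ a b, a ≠ b → ∀ c : ℂ, z a ≠ c • z b)
    (h3 : ∀ i a b, ∀ c : ℂ, y i a ≠ c • z b) :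
    UpTo U (polesAt (specPt P m k y z) * (factorA P m (k + 1) y * factorB P m (k + 1) z *
    factorC P m (k + 1) y z)) ((pairProd fun a b => wwF P k (y 0 a) (y 0 b)) *
    (pairProd fun a b => ((z a - P.q2 • z b) * (z a - P.q2⁻¹ • z b)) ^ (m + k - 1) *
    (z a - z b) ^ 2) * (∏ i : 𝕀, ∏ a, ∏ b, (η i • y i a - (ratA P i * ζ i) • z b) *
    (η i • y i a - (ratB P m i * ζ i) • z b)) *
    ((∏ i ∈ range (m + k), ∏ a, ∏ b, (y i a - y (i + 1) b)) *
    pairProd fun a b => (z a - z b) ^ 2)) := by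
  have e : polesAt (specPt P m k y z) = (∏ a, ∏ b, polePair
      (fun i : 𝕀 => η i • y i a)
        (fun i => η i • y i b)) *
      (∏ a, ∏ b, polePair (fun i : 𝕀 => η i • y i a)
        (fun i => ζ i • z b)) *
      ((∏ b, ∏ a, polePair (fun i : 𝕀 => ζ i • z b)
        (fun i => η i • y i a)) *
      (∏ a, ∏ b, polePair (fun i : 𝕀 => ζ i • z a)
        (fun i => ζ i • z b))) := by
    rw [polesAt_eq]
    simp only [Fintype.prod_sum_type, prod_mul_distrib, specPt, Sum.elim_inl, Sum.elim_inr]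
    grind
  rw [e]
  refine (UpTo.of_eq ?_).trans ((((yy_total hU hP hkm hy hw h0 h1).mul
    (zz_total hU hP hkm hz h2)).mul (yz_total hU hP hkm hy h3)).trans (UpTo.of_eq ?_))
  · ring
  · ring

end Total

/-! ## The specialized poles in the field of rational functions -/

section Monomials

variable {τ : Type} [Fintype τ]

/-- The divisors of powers of the product of all variables. -/
def monU (τ : Type) [Fintype τ] : Submonoid (RatField τ) where
  carrier := {u | ∃ (p : MvPolynomial τ ℂ) (n : ℕ), p ∣ (∏ s, X s) ^ n ∧ u = algebraMap _ _ p}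
  one_mem' := ⟨1, 0, by simp, by simp⟩
  mul_mem' := by
    rintro _ _ ⟨p, n, h, rfl⟩ ⟨p', n', h', rfl⟩
    exact ⟨p * p', n + n', by rw [pow_add]; exact mul_dvd_mul h h', by rw [map_mul]⟩

theorem algebraMap_mem_monU (c : ℂ) (hc : c ≠ 0) : algebraMap ℂ (RatField τ) c ∈ monU τ :=
  ⟨C c, 0, ((isUnit_iff_ne_zero.2 hc).map C).dvd, rfl⟩

theorem var_mem_monU (s : τ) : var s ∈ monU τ :=
  ⟨X s, 1, by rw [pow_one]; exact Finset.dvd_prod_of_mem _ (mem_univ s), rfl⟩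

theorem ne_zero_of_mem_monU {u : RatField τ} (h : u ∈ monU τ) : u ≠ 0 := by
  obtain ⟨p, n, hp, rfl⟩ := h
  apply algebraMap_rat_ne_zero
  rintro rfl
  exact pow_ne_zero n (prod_ne_zero_iff.2 fun s _ => X_ne_zero s) (zero_dvd_iff.1 hp)

theorem var_ne_smul {s t : τ} (h : s ≠ t) (c : ℂ) : (var s : RatField τ) ≠ c • var t := by
  intro h0
  have h1 : algebraMap (MvPolynomial τ ℂ) (RatField τ) (lin 1 s c t) = 0 := by
    rw [lin, map_one, one_mul, map_sub, map_mul]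
    exact sub_eq_zero.2 (h0.trans (Algebra.smul_def c _))
  exact lin_ne_zero (Or.inl h) one_ne_zero (algebraMap_rat_injective (h1.trans (map_zero _).symm))

theorem algebraMap_lin (α : ℂ) (u : τ) (β : ℂ) (v : τ) :
    algebraMap (MvPolynomial τ ℂ) (RatField τ) (lin α u β v) = α • var u - β • var v := by
  rw [lin, map_sub, map_mul, map_mul, Algebra.smul_def, Algebra.smul_def]
  rfl

end Monomials

section Concrete

variable {P : Params} {m k : ℕ} (hm : 0 < m) {L K : ℕ}

/-- The variables `y_{i,a}`, the index `i` being read modulo `m + k`. -/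
def yv (K : ℕ) (i : ℕ) (a : Fin L) : RatField 𝕍 := var (inl (col hm i, a))

/-- The variables `z_b`. -/
def zw (m k L : ℕ) (b : Fin K) : RatField 𝕍 := var (inr (0, b))

theorem yv_last : yv (L := L) (m := m) (k := k) hm K (m + k) = yv hm K 0 := by
  funext a
  unfold yv
  rw [col_last]

theorem yv_zero_ne {a b : Fin L} (h : a ≠ b) (c : ℂ) :
    yv (m := m) (k := k) hm K 0 a ≠ c • yv hm K 0 b :=
  var_ne_smul (fun h' => h (Prod.mk.inj (Sum.inl_injective h')).2) c

theorem yv_ne_next (hm2 : 2 ≤ m) {i : ℕ} (hi : i < m + k) (a b : Fin L) (c : ℂ) :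
    yv (m := m) (k := k) hm K i a ≠ c • yv hm K (i + 1) b := by
  refine var_ne_smul (fun h' => ?_) c
  have := col_eq_col (hm := hm) hi.le hi (Prod.mk.inj (Sum.inl_injective h')).1
  omega

theorem zw_ne {a b : Fin K} (h : a ≠ b) (c : ℂ) : zw m k L a ≠ c • zw m k L b :=
  var_ne_smul (fun h' => h (Prod.mk.inj (Sum.inr_injective h')).2) c

theorem yv_ne_zw (i : ℕ) (a : Fin L) (b : Fin K) (c : ℂ) :
    yv (m := m) (k := k) hm K i a ≠ c • zw m k L b := var_ne_smul (by simp) c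

theorem map_pairProd {R S : Type} [CommRing R] [CommRing S] (θ : R →+* S) {N : ℕ}
    (f : Fin N → Fin N → R) : θ (pairProd f) = pairProd fun a b => θ (f a b) := by
  simp [pairProd, map_prod]

theorem smul_sub_smul_eq {E : Type} [Field E] [Algebra ℂ E] (a b : ℂ) (u v : E) :
    a • u - (b * a) • v = a • (u - b • v) := by
  rw [smul_sub, smul_smul, mul_comm]

theorem smul_sub_upTo {ι E : Type} [Field E] [Algebra ℂ E] {U : Submonoid E}
    (hU : Scalars U) (s : Finset ι) {c : ι → ℂ} (hc : ∀ i, c i ≠ 0)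
    (x : E) : UpTo U (x ^ s.card) (∏ i ∈ s, c i • x) := by
  rw [← prod_const]
  exact UpTo.prod fun i _ => UpTo.smul' hU (hc i) x

theorem ww_upTo (hP : P.Valid) (a b : Fin L) : UpTo (monU 𝕍) (wwF P k (yv hm K 0 a) (yv hm K 0 b))
    (algebraMap _ _ (pairWW P hm L K a b : MvPolynomial 𝕍 ℂ)) := by
  unfold wwF pairWW
  split_ifs with h
  · rw [map_prod]
    have hcard : ({0, Fin.last (m + k)} : Finset (Fin (m + k + 1))).card = 2 := card_pair (by grind)
    rw [← hcard]
    refine (smul_sub_upTo (c := fun i => η (i : 𝕀)) algebraMap_mem_monU _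
      (fun i => ycoef_ne hP _ _) _).trans (UpTo.of_eq (prod_congr rfl fun i _ => ?_))
    rw [algebraMap_lin, smul_sub]
    rfl
  · rw [map_mul, algebraMap_lin, algebraMap_lin, one_smul]
    exact UpTo.refl _ _

theorem card_filter_ne_and_ne {c r : ℕ} (hr : r ≠ 0) (hrc : r < c) :
    (Finset.univ.filter fun i : Fin c => i.val ≠ 0 ∧ i.val ≠ r).card = c - 2 ∧
    (Finset.univ.filter fun i : Fin c => i.val = 0 ∨ i.val = r).card = 2 := by
  have h1 : (Finset.univ.filter fun i : Fin c => i.val = 0 ∨ i.val = r) =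
      {⟨0, by omega⟩, ⟨r, hrc⟩} := by grind
  have h2 : (Finset.univ.filter fun i : Fin c => i.val = 0 ∨ i.val = r).card = 2 := by grind
  have h3 : (Finset.univ.filter fun i : Fin c => i.val ≠ 0 ∧ i.val ≠ r) =
      (Finset.univ.filter fun i : Fin c => i.val = 0 ∨ i.val = r)ᶜ := by
    ext i
    simp
  exact ⟨by rw [h3, card_compl, h2, Fintype.card_fin], h2⟩

theorem zz_upTo' (hP : P.Valid) (hkm : k + 2 ≤ m) (a b : Fin K) : UpTo (monU 𝕍)
    (((zw m k L a - P.q2 • zw m k L b) * (zw m k L a - P.q2⁻¹ • zw m k L b)) ^ (m + k - 1) *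
    (zw m k L a - zw m k L b) ^ 2) (algebraMap _ _ (pairZZ P L K m k a b)) := by
  have e : ∀ (i : ℕ) (r : ℂ),
      algebraMap (MvPolynomial 𝕍 ℂ) (RatField 𝕍)
        (lin (ζ i) (zv m k L a) (r * ζ i) (zv m k L b)) =
      ζ i • (zw m k L a - r • zw m k L b) := by
    intro i r
    rw [algebraMap_lin, ← smul_sub_smul_eq]
    rfl
  have e' : ∀ i : ℕ,
      algebraMap (MvPolynomial 𝕍 ℂ) (RatField 𝕍)
        (lin (ζ i) (zv m k L a) (ζ i) (zv m k L b)) =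
      ζ i • (zw m k L a - zw m k L b) := by
    intro i
    have := e i 1
    rwa [one_mul, one_smul] at this
  obtain ⟨c1, -⟩ := card_filter_ne_and_ne (c := m + (k + 1)) (r := m + k) (by omega) (by omega)
  obtain ⟨c2, c3⟩ := card_filter_ne_and_ne (c := m + (k + 1)) (r := m) (by omega) (by omega)
  unfold pairZZ
  simp only [map_mul, map_prod, e, e']
  rw [mul_pow]
  have hz : ∀ i : 𝕀, ζ i ≠ 0 := fun i => zcoef_ne hP _
  have s1 := smul_sub_upTo algebraMap_mem_monU (Finset.univ.filter
    fun i : 𝕀 => i.val ≠ 0 ∧ i.val ≠ m + k) hz (zw m k L a - P.q2 • zw m k L b)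
  have s2 := smul_sub_upTo algebraMap_mem_monU (Finset.univ.filter
    fun i : 𝕀 => i.val ≠ 0 ∧ i.val ≠ m) hz (zw m k L a - P.q2⁻¹ • zw m k L b)
  have s3 := smul_sub_upTo algebraMap_mem_monU (Finset.univ.filter
    fun i : 𝕀 => i.val = 0 ∨ i.val = m) hz (zw m k L a - zw m k L b)
  rw [c1, show m + (k + 1) - 2 = m + k - 1 by omega] at s1
  rw [c2, show m + (k + 1) - 2 = m + k - 1 by omega] at s2
  rw [c3] at s3
  exact (s1.mul s2).mul s3

theorem algebraMap_numYZ : algebraMap (MvPolynomial 𝕍 ℂ) (RatField 𝕍)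
    (numYZ P hm L K) = ∏ i : 𝕀, ∏ a, ∏ b, (η i • yv hm K i a - (ratA P i * ζ i) • zw m k L b) *
    (η i • yv hm K i a - (ratB P m i * ζ i) • zw m k L b) := by
  unfold numYZ
  rw [map_prod]
  simp only [Fintype.prod_prod_type, Fintype.prod_bool, algebraMap_lin, if_true,
    Bool.false_eq_true, if_false]
  rfl

theorem shType_pole (P : Params) (hm2 : 2 ≤ m) : (shType P m k).pole L = cyclicPole (m + k) L := by
  cases k with
  | zero =>
    have h1 : shType P m 0 = evenType' P (m + 0) := evenType_eq _ (by omega)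
    rw [h1]
    rfl
  | succ k => rfl

theorem algebraMap_poles (hm2 : 2 ≤ m) (p₁ p₂ p₃ : ℂ) : algebraMap (MvPolynomial 𝕍 ℂ) (RatField 𝕍)
    (polyMul ((shType P m k).pole L) ((oneType p₁ p₂ p₃).pole K)) =
    (∏ i ∈ range (m + k), ∏ a, ∏ b, (yv hm K i a - yv hm K (i + 1) b)) *
    pairProd fun a b => (zw m k L a - zw m k L b) ^ 2 := by
  rw [shType_pole P hm2, polyMul_apply, map_mul]
  congr 1
  · unfold cyclicPole
    simp only [map_prod, map_sub, rename_X]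
    rw [← Fin.prod_univ_eq_prod_range
      (fun i => ∏ a : Fin L, ∏ b : Fin L, (yv (k := k) hm K i a - yv hm K (i + 1) b))]
    refine prod_congr rfl fun i _ => prod_congr rfl fun a _ => prod_congr rfl fun b _ => ?_
    rw [next_eq_col (hm := hm)]
    conv_lhs => rw [eq_col (hm := hm) i]
    unfold yv var
    congr 4
    unfold col
    simp
  · simp only [oneType, map_prod, map_pow, map_sub, rename_X]
    rfl

theorem poles_upTo (hP : P.Valid) (hkm : k + 2 ≤ m) (p₁ p₂ p₃ : ℂ) : UpTo (monU 𝕍)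
    (polesAt (specPt P m k (yv hm K) (zw m k L)) * (factorA P m (k + 1) (yv hm K) *
    factorB P m (k + 1) (zw m k L) * factorC P m (k + 1) (yv hm K) (zw m k L))) (algebraMap _ _ 𝔑 *
    algebraMap _ _ (polyMul ((𝕋).pole L) ((oneType p₁ p₂ p₃).pole K))) := by
  refine (total_upTo algebraMap_mem_monU hP hkm (yv_last hm) (fun a => var_mem_monU _)
    (fun a b h => yv_zero_ne hm h) (fun i hi => yv_ne_next hm (by omega) hi)
    (fun b => var_mem_monU _) (fun a b h => zw_ne h) (yv_ne_zw hm)).trans ?_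
  rw [map_mul, map_mul, algebraMap_poles hm (by omega), algebraMap_numYZ]
  refine UpTo.mul (UpTo.mul (UpTo.mul ?_ ?_) (UpTo.refl _ _)) (UpTo.refl _ _)
  · unfold numWW
    rw [map_pairProd]
    exact UpTo.pairProd fun a b _ => ww_upTo hm hP a b
  · unfold numZZ
    rw [map_pairProd]
    exact UpTo.pairProd fun a b _ => zz_upTo' hP hkm a b

end Concrete

/-! ## Symmetry of the factors -/

section Symmetry

variable {P : Params} {m k : ℕ} {E : Type} [Field E] [Algebra ℂ E] {L K : ℕ}

theorem lin_pair_symm {c c' : ℂ} (h : c * c' = 1) (u v : E) :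
    (u - c • v) * (u - c' • v) = (v - c • u) * (v - c' • u) := by
  have h' := congrArg (algebraMap ℂ E) h
  rw [map_mul, map_one] at h'
  simp only [Algebra.smul_def]
  grind

theorem fusedF_symm (hP : P.Valid) (u v : E) : fusedF P m k u v = fusedF P m k v u := by
  unfold fusedF
  rw [lin_pair_symm (mul_inv_cancel₀ hP.n1), lin_pair_symm (mul_inv_cancel₀ hP.n2),
    show (u - v) ^ 2 = (v - u) ^ 2 by ring]

theorem zzF_symm (hP : P.Valid) (u v : E) : zzF P m k u v = zzF P m k v u := by
  have h : P.q3 ^ ((m : ℤ) - (k + 1 : ℕ) + 1) * P.q3 ^ (-(m : ℤ) + (k + 1 : ℕ) - 1) = 1 := by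
    rw [← zpow_add₀ hP.n3, ← zpow_zero P.q3]
    congr 1
    ring
  unfold zzF
  rw [div_mul_div_comm, div_mul_div_comm, lin_pair_symm (mul_inv_cancel₀ hP.n2),
    lin_pair_symm (mul_inv_cancel₀ hP.n3), lin_pair_symm h, show (u - v) ^ 2 = (v - u) ^ 2 by ring]

theorem factorC_prod (hP : P.Valid) (hkm : k + 2 ≤ m) {y : ℕ → Fin L → E} (hy : y (m + k) = y 0)
    (z : Fin K → E) : factorC P m (k + 1) y z =
    (∏ j ∈ Finset.Ico 1 (m + k), ∏ a, ∏ b, innerF P m k j (y j a) (z b)) *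
    ∏ a, ∏ b, outerF P m k (y 0 a) (z b) := by
  rw [factorC_eq]
  have h : ∀ a b, yzF P m k (fun i => y i a) (z b) = _ :=
    fun a b => yzF_eq hP hkm (y := fun i => y i a) (by simp only [hy]) (z b)
  simp only [h, prod_mul_distrib]
  congr 1
  exact (prod_congr rfl fun a _ => prod_comm).trans prod_comm

theorem prod_prod_perm {R : Type} [CommMonoid R] (s : Perm (Fin L)) (t : Perm (Fin K))
    (f : Fin L → Fin K → R) : ∏ a, ∏ b, f (s a) (t b) = ∏ a, ∏ b, f a b := by
  rw [Equiv.prod_comp s fun a => ∏ b, f a (t b)]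
  exact prod_congr rfl fun a _ => Equiv.prod_comp t _

/-- The product of the factors `A`, `B`, `C`. -/
def facs (P : Params) (m n : ℕ) (y : ℕ → Fin L → E) (z : Fin K → E) : E :=
  factorA P m n y * factorB P m n z * factorC P m n y z

theorem facs_perm (hP : P.Valid) (hkm : k + 2 ≤ m) {y : ℕ → Fin L → E} (hy : y (m + k) = y 0)
    (z : Fin K → E) {s : ℕ → Perm (Fin L)} (hs : s (m + k) = s 0) (t : Perm (Fin K)) :
    facs P m (k + 1) (fun i a => y i (s i a)) (fun b => z (t b)) = facs P m (k + 1) y z := by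
  have hy' : (fun i a => y i (s i a)) (m + k) = (fun i a => y i (s i a)) 0 := by simp only [hy, hs]
  unfold facs
  rw [factorA_eq, factorA_eq, factorB_eq, factorB_eq, factorC_prod hP hkm hy',
    factorC_prod hP hkm hy, pairProd_perm
    (f := fun a b => fusedF P m k (y (m + k) a) (y (m + k) b)) (fun a b => fusedF_symm hP _ _)
    (s (m + k)),
    pairProd_perm (f := fun a b => zzF P m k (z a) (z b)) (fun a b => zzF_symm hP _ _) t]
  congr 1
  · congr 2
    exact prod_congr rfl fun i _ =>
      prod_prod_perm (s i) (s (i + 1)) fun a b => edgeF P m k i (y i a) (y (i + 1) b)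
  · congr 1
    · exact prod_congr rfl fun i _ => prod_prod_perm (s i) t fun a b => innerF P m k i (y i a) (z b)
    · exact prod_prod_perm (s 0) t fun a b => outerF P m k (y 0 a) (z b)

theorem map_facs {E' : Type} [Field E'] [Algebra ℂ E'] (θ : E →ₐ[ℂ] E') (n : ℕ)
    (y : ℕ → Fin L → E) (z : Fin K → E) :
    θ (facs P m n y z) = facs P m n (fun i a => θ (y i a)) (fun b => θ (z b)) := by
  unfold facs factorA factorB factorC
  dsimp only
  split_ifs <;> simp only [map_mul, map_prod, map_div₀, map_sub, map_smul, map_pow]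

end Symmetry

/-! ## The components of the fusion map -/

section Membership

variable {P : Params} {m k : ℕ} (hm : 0 < m) {L K : ℕ}

/-- The specialized point, in the field of rational functions. -/
def spec (P : Params) (m k : ℕ) (hm : 0 < m) (L K : ℕ) : 𝕀 → Fin L ⊕ Fin K → RatField 𝕍 :=
  specPt P m k (yv hm K) (zw m k L)

theorem spec_eq (i : 𝕀) (s : Fin L ⊕ Fin K) :
    spec P m k hm L K i s = sc P L K m k (i, s) • var (sv hm L K (i, s)) := by
  rcases s with a | b <;> rfl

theorem rho_eq (F : Rat (m + (k + 1)) (L + K)) : (rho P hm L K F : RatField 𝕍) =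
    ratSubst (fun p => spec P m k hm L K p.1 (finSumFinEquiv.symm p.2)) F := by
  have h : (fun p : 𝕀 × Fin (L + K) => (Fin.addCases
      (fun a => η p.1 • (yvar hm L K p.1 a : YZ m (k + 1) L K))
      (fun b => ζ p.1 • zvar m (k + 1) L K b) p.2 : YZ m (k + 1) L K)) =
      fun p => spec P m k hm L K p.1 (finSumFinEquiv.symm p.2) := by
    funext p
    obtain ⟨i, s⟩ := p
    refine Fin.addCases (fun a => ?_) (fun b => ?_) s
    · rw [finSumFinEquiv_symm_apply_castAdd]
      dsimp only
      rw [Fin.addCases_left]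
      rfl
    · rw [finSumFinEquiv_symm_apply_natAdd]
      dsimp only
      rw [Fin.addCases_right]
      rfl
  exact congrArg (fun φ => ratSubst φ F) h

theorem polesAt_facs_ne (hP : P.Valid) (hkm : k + 2 ≤ m) :
    polesAt (spec P m k hm L K) * facs P m (k + 1) (yv hm K) (zw m k L) ≠ 0 := by
  have h := total_upTo (z := zw m k L) algebraMap_mem_monU hP hkm (yv_last (L := L) (K := K) (k := k) hm)
    (fun a => var_mem_monU _)
    (fun a b h => yv_zero_ne hm h) (fun i hi => yv_ne_next hm (by omega) hi)
    (fun b => var_mem_monU _) (fun a b h => zw_ne h) (yv_ne_zw hm)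
  obtain ⟨u, hu, h⟩ := h
  have hy := @yv_zero_ne m k hm L K
  have hz := @zw_ne m k L K
  refine ne_of_eq_of_ne h (mul_ne_zero (ne_zero_of_mem_monU hu) (mul_ne_zero
    (mul_ne_zero (mul_ne_zero ?_ ?_) ?_) (mul_ne_zero ?_ ?_)))
  · refine prod_ne_zero_iff.2 fun a _ => prod_ne_zero_iff.2 fun b hb => ?_
    have hab : a ≠ b := (mem_Ioi.1 hb).ne
    unfold wwF
    have h1 := hy hab 1
    rw [one_smul] at h1
    grind
  · refine prod_ne_zero_iff.2 fun a _ => prod_ne_zero_iff.2 fun b hb => ?_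
    have hab : a ≠ b := (mem_Ioi.1 hb).ne
    have h1 := hz hab 1
    rw [one_smul] at h1
    exact mul_ne_zero (pow_ne_zero _ (mul_ne_zero (sub_ne_zero.2 (hz hab _))
      (sub_ne_zero.2 (hz hab _)))) (pow_ne_zero _ (sub_ne_zero.2 h1))
  · refine prod_ne_zero_iff.2 fun i _ => prod_ne_zero_iff.2 fun a _ =>
      prod_ne_zero_iff.2 fun b _ => ?_
    have key : ∀ r : ℂ, η i • yv hm K i a - r • zw m k L b ≠ 0 := by
      intro r h0
      apply yv_ne_zw hm i a b (r / η i)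
      rw [div_eq_inv_mul, ← smul_smul, ← sub_eq_zero.1 h0, smul_smul,
        inv_mul_cancel₀ (ycoef_ne hP _ _), one_smul]
    grind
  · refine prod_ne_zero_iff.2 fun i hi => prod_ne_zero_iff.2 fun a _ =>
      prod_ne_zero_iff.2 fun b _ => ?_
    have h1 := yv_ne_next (K := K) hm (by omega) (mem_range.1 hi) a b 1
    rw [one_smul] at h1
    grind
  · refine prod_ne_zero_iff.2 fun a _ => prod_ne_zero_iff.2 fun b hb => ?_
    have h1 := hz (mem_Ioi.1 hb).ne 1
    rw [one_smul] at h1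
    grind

theorem facs_ne (hP : P.Valid) (hkm : k + 2 ≤ m) :
    facs P m (k + 1) (yv (L := L) hm K) (zw m k L) ≠ 0 :=
  right_ne_zero_of_mul (polesAt_facs_ne hm hP hkm)

theorem spec_sub_ne (hP : P.Valid) (hkm : k + 2 ≤ m) (i : 𝕀) (s t : Fin L ⊕ Fin K) :
    spec P m k hm L K i s - spec P m k hm L K (next i) t ≠ 0 := by
  have h := left_ne_zero_of_mul (polesAt_facs_ne (L := L) (K := K) hm hP hkm)
  exact prod_ne_zero_iff.1 (prod_ne_zero_iff.1 (prod_ne_zero_iff.1 h i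
    (mem_univ _)) s (mem_univ _)) t (mem_univ _)

theorem spec_ne (hP : P.Valid) (i : 𝕀) (s : Fin L ⊕ Fin K) : spec P m k hm L K i s ≠ 0 := by
  rw [spec_eq]
  exact smul_ne_zero (sc_ne hP _) (ne_zero_of_mem_monU (var_mem_monU _))

theorem comp_mem_regSub {E : Type} [Field E] [Algebra ℂ E] {n N : ℕ} {F : Rat (m + n) N}
    (hF : F ∈ (superType P m n).comp N) {φ : Fin (m + n) × Fin N → E} (h0 : ∀ p, φ p ≠ 0)
    (h1 : ∀ i a b, φ (i, a) - φ (next i, b) ≠ 0) : F ∈ regSub φ := by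
  obtain ⟨⟨l, f, hf, -⟩, -⟩ := hF
  refine ⟨f, _, hf, ?_⟩
  rw [map_mul, map_pow]
  refine mul_ne_zero ?_ (pow_ne_zero _ ?_)
  · have : (superType P m n).pole N = cyclicPole (m + n) N := rfl
    rw [this, aeval_cyclicPole]
    exact prod_ne_zero_iff.2 fun i _ => prod_ne_zero_iff.2 fun a _ =>
      prod_ne_zero_iff.2 fun b _ => h1 i a b
  · unfold allVars
    rw [map_prod]
    refine prod_ne_zero_iff.2 fun p _ => ?_
    rw [aeval_X]
    exact h0 p

/-- The component of bidegree `(L, K)` of the image of `F` under the fusion map. -/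
def fbar (P : Params) (m k : ℕ) (hm : 0 < m) (L K : ℕ) (F : Rat (m + (k + 1)) (L + K)) :
    RatField 𝕍 :=
  ratSubst (fun p => spec P m k hm L K p.1 (finSumFinEquiv.symm p.2)) F /
    facs P m (k + 1) (yv hm K) (zw m k L)

theorem spec_regSub (hP : P.Valid) (hkm : k + 2 ≤ m) {F : Rat (m + (k + 1)) (L + K)}
    (hF : F ∈ (𝕊).comp (L + K)) :
    F ∈ regSub (fun p => spec P m k hm L K p.1 (finSumFinEquiv.symm p.2)) :=
  comp_mem_regSub hF (fun _ => spec_ne hm hP _ _) fun _ _ _ => spec_sub_ne hm hP hkm _ _ _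

theorem polesAt_reindex {E : Type} [Field E] {c N : ℕ} {α : Type} [Fintype α] (σ : Fin N ≃ α)
    (x : Fin c → α → E) : poleAt (fun p : Fin c × Fin N => x p.1 (σ p.2)) = polesAt x := by
  refine prod_congr rfl fun i _ => ?_
  refine Eq.trans (prod_congr rfl fun a _ => ?_)
    (Equiv.prod_comp σ fun a => ∏ b, (x i a - x (next i) b))
  exact Equiv.prod_comp σ fun b => (x i (σ a) - x (next i) b)

theorem fbar_numerator (hP : P.Valid) (hkm : k + 2 ≤ m) {F : Rat (m + (k + 1)) (L + K)}
    (hF : F ∈ (𝕊).comp (L + K)) (p₁ p₂ p₃ : ℂ) :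
    ∃ (f : MvPolynomial (𝕀 × (Fin L ⊕ Fin K)) ℂ) (h r : MvPolynomial 𝕍 ℂ)
    (n : ℕ), RatioVanish P m (k + 1) f ∧ 𝔈 ∧ fbar P m k hm L K F * algebraMap _ _
    (polyMul ((𝕋).pole L * allVars (m + k) L ^ n)
    ((oneType p₁ p₂ p₃).pole K * allVars 1 K ^ n)) = algebraMap _ _ (h * r) := by
  obtain ⟨l, f, hf, hv⟩ := exists_ratioVanish hm hP hF
  have hv' := hv.rename finSumFinEquiv.symm
  obtain ⟨h, hh⟩ := num_dvd (hm := hm) hP hkm hv'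
  set ψ : 𝕀 × Fin (L + K) → RatField 𝕍 :=
    fun p => spec P m k hm L K p.1 (finSumFinEquiv.symm p.2) with hψ
  have hden : aeval ψ (cyclicPole (m + (k + 1)) (L + K) * allVars (m + (k + 1)) (L + K) ^ l) =
      polesAt (spec P m k hm L K) * (∏ p, ψ p) ^ l := by
    rw [map_mul, map_pow, aeval_cyclicPole, polesAt_reindex]
    congr 2
    unfold allVars
    rw [map_prod]
    exact prod_congr rfl fun p _ => aeval_X _ _
  have hu' : (∏ p, ψ p) ^ l ∈ monU 𝕍 := by
    refine pow_mem (prod_mem fun p _ => ?_) l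
    rw [hψ]
    dsimp only
    rw [spec_eq, Algebra.smul_def]
    exact mul_mem (algebraMap_mem_monU _ (sc_ne hP _)) (var_mem_monU _)
  have hp := left_ne_zero_of_mul (polesAt_facs_ne (L := L) (K := K) hm hP hkm)
  have hfac := facs_ne (L := L) (K := K) hm hP hkm
  have hnum : aeval ψ f = algebraMap _ (RatField 𝕍)
      (𝔐 (rename (fun p => (p.1, finSumFinEquiv.symm p.2)) f)) := by
    rw [aeval_rename, ← aeval_algebraMap_apply]
    congr 2
    funext p
    simp only [hψ, spec_eq, Function.comp, mpt, map_mul]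
    rw [Algebra.smul_def]
    rfl
  have hF' := ratSubst_eq ψ F f _ hf (by rw [hden]; exact mul_ne_zero hp (ne_zero_of_mem_monU hu'))
  obtain ⟨u, hu, hu1⟩ := poles_upTo (L := L) (K := K) hm hP hkm p₁ p₂ p₃
  obtain ⟨p, n, ⟨r, hr⟩, hpu⟩ := mul_mem hu hu'
  refine ⟨_, h, r, n, hv', hh, ?_⟩
  have hM : polyMul ((𝕋).pole L * allVars (m + k) L ^ n)
      ((oneType p₁ p₂ p₃).pole K * allVars 1 K ^ n) =
      polyMul ((𝕋).pole L) ((oneType p₁ p₂ p₃).pole K) * (p * r) := by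
    rw [← hr, Fintype.prod_sum_type, polyMul_apply, polyMul_apply]
    simp only [allVars, map_mul, map_pow, map_prod, rename_X]
    ring
  have hfb : fbar P m k hm L K F = ratSubst ψ F / facs P m (k + 1) (yv hm K) (zw m k L) := rfl
  have hu1' : polesAt (spec P m k hm L K) * facs P m (k + 1) (yv hm K) (zw m k L) = _ := hu1
  rw [hM, hfb, hF', hden, hnum, hh]
  generalize numWW P hm L K * numZZ P L K m k * numYZ P hm L K = A at hu1'
  simp only [map_mul]
  rw [← hpu]
  have hu'0 := ne_zero_of_mem_monU hu'
  have hu0 := ne_zero_of_mem_monU hu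
  field_simp
  grind

end Membership

section FbarSymmetry

variable {P : Params} {m k : ℕ} (hm : 0 < m) {L K : ℕ}

theorem permL_var_inl {c : ℕ} (s : Fin c → Perm (Fin L)) (i : Fin c) (a : Fin L) :
    permL (K := K) s (var (inl (i, a))) = var (inl (i, s i a)) := ratRename_var _ _ _

theorem permL_var_inr {c : ℕ} (s : Fin c → Perm (Fin L)) (b : Fin 1 × Fin K) :
    permL (K := K) s (var (inr b)) = var (inr b) := ratRename_var _ _ _

theorem permR_var_inl {c : ℕ} (s : Perm (Fin K)) (a : Fin c × Fin L) :
    permR (K := K) s (var (inl a)) = var (inl a) := ratRename_var _ _ _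

theorem permR_var_inr {c : ℕ} (s : Perm (Fin K)) (b : Fin 1 × Fin K) :
    permR (c := c) (L := L) s (var (inr b)) = var (inr (b.1, s b.2)) := ratRename_var _ _ _

theorem super_odd : (𝕊).odd = {⟨0, by omega⟩, ⟨m, by omega⟩} := by
  ext i
  simp only [superType, mem_filter, mem_univ, true_and, mem_insert,
    mem_singleton, Fin.ext_iff]

/-- A product over the fermionic colours. -/
theorem prod_super_odd {R : Type} [CommMonoid R] (hm : 0 < m) (f : ℕ → R) :
    ∏ i ∈ (𝕊).odd, f i = f 0 * f m := by
  rw [super_odd hm, prod_pair fun h => hm.ne (congrArg Fin.val h)]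

theorem sign_mul_self {α : Type} [Fintype α] [DecidableEq α] (s : Perm α) :
    (((Perm.sign s : ℤ) : ℂ)) * ((Perm.sign s : ℤ) : ℂ) = 1 := by
  rw [← Int.cast_mul, ← Units.val_mul, Int.units_mul_self]
  simp

/-- A product over the fermionic colours of the target. -/
theorem prod_sh_odd (P' : Params) (hm2 : 2 ≤ m) (f : ℕ → ℂ) (hf : k = 0 → f 0 * f m = 1) :
    ∏ i ∈ (shType P' m k).odd, f i = f 0 * f m := by
  cases k with
  | zero =>
    have h1 : shType P' m 0 = evenType' P' (m + 0) := evenType_eq _ (by omega)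
    rw [h1, hf rfl]
    rfl
  | succ k => exact prod_super_odd (by omega) f

/-- A permutation of the indices induced by permutations of the two blocks. -/
def blockPerm (s : Perm (Fin L)) (t : Perm (Fin K)) : Perm (Fin (L + K)) :=
  (finSumFinEquiv.symm.trans (Equiv.sumCongr s t)).trans finSumFinEquiv

theorem sign_blockPerm (s : Perm (Fin L)) (t : Perm (Fin K)) :
    Perm.sign (blockPerm s t) = Perm.sign s * Perm.sign t := by
  unfold blockPerm
  rw [← Perm.sign_sumCongr]
  exact Perm.sign_symm_trans_trans (Perm.sumCongr s t) finSumFinEquiv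

theorem fbar_perm (hP : P.Valid) (hkm : k + 2 ≤ m) {F : Rat (m + (k + 1)) (L + K)}
    (hF : F ∈ (𝕊).comp (L + K)) (θ : RatField 𝕍 →ₐ[ℂ] RatField 𝕍)
    (s : ℕ → Perm (Fin L)) (hs : s (m + k) = s 0) (t : Perm (Fin K))
    (hy : ∀ i a, θ (yv hm K i a) = yv hm K i (s i a)) (hz : ∀ b, θ (zw m k L b) = zw m k L (t b)) :
    θ (fbar P m k hm L K F) = (((Perm.sign (s 0) : ℤ) : ℂ) * ((Perm.sign (s m) : ℤ) : ℂ)) •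
    fbar P m k hm L K F := by
  unfold fbar
  rw [map_div₀, map_facs]
  simp only [hy, hz]
  rw [facs_perm hP hkm (yv_last hm) _ hs, map_ratSubst]
  have h1 : (fun p : 𝕀 × Fin (L + K) =>
      θ (spec P m k hm L K p.1 (finSumFinEquiv.symm p.2))) =
      fun p => spec P m k hm L K p.1 (finSumFinEquiv.symm (blockPerm (s p.1) t p.2)) := by
    funext p
    unfold blockPerm
    simp only [Equiv.trans_apply, Equiv.symm_apply_apply]
    rcases finSumFinEquiv.symm p.2 with a | b
    · simp only [spec, specPt, Sum.elim_inl, Equiv.sumCongr_apply, Sum.map_inl, map_smul, hy]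
    · simp only [spec, specPt, Sum.elim_inr, Equiv.sumCongr_apply, Sum.map_inr, map_smul, hz]
  rw [h1, ratSubst_perm (T := 𝕊) hF.2
    (φ := fun p => spec P m k hm L K p.1 (finSumFinEquiv.symm p.2)) (spec_regSub hm hP hkm hF)
    (fun i => blockPerm (s i) t),
    prod_super_odd hm (fun i => ((Perm.sign (blockPerm (s i) t) : ℤ) : ℂ)), smul_div_assoc]
  congr 1
  simp only [sign_blockPerm, Units.val_mul, Int.cast_mul]
  rw [mul_mul_mul_comm, sign_mul_self, mul_one]

/-- The components of the fusion map take values in the tensor products of the components. -/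
theorem fbar_mem (hP : P.Valid) (hkm : k + 2 ≤ m) {F : Rat (m + (k + 1)) (L + K)}
    (hF : F ∈ (𝕊).comp (L + K)) (p₁ : ℂ) : ∃ t : (𝕋).comp L ⊗[ℂ]
    (oneType p₁ P.q2⁻¹ (P.q3 ^ ((m : ℤ) - (k + 1 : ℕ)))).comp K,
    TensorProduct.lift ratMul (mapIncl _ _ t) = fbar P m k hm L K F := by
  obtain ⟨f, h, r, n, hf, hg, hh⟩ :=
    fbar_numerator hm hP hkm hF p₁ P.q2⁻¹ (P.q3 ^ ((m : ℤ) - (k + 1 : ℕ)))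
  refine exists_sum_ratMul _ _ _ ?_ ?_ n _ hh ?_ ?_ ?_ ?_
  · rw [shType_pole _ (by omega)]
    refine prod_ne_zero_iff.2 fun i _ => prod_ne_zero_iff.2 fun a _ =>
      prod_ne_zero_iff.2 fun b _ => ?_
    rw [sub_lin]
    refine lin_ne_zero (Or.inl fun h0 => ?_) one_ne_zero
    exact next_ne (c := m + k) (by omega) i (Prod.mk.inj h0).1.symm
  · change (∏ a : Fin K, ∏ b ∈ Finset.Ioi a,
      (X (0, a) - X (0, b)) ^ 2 : MvPolynomial (Fin 1 × Fin K) ℂ) ≠ 0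
    refine prod_ne_zero_iff.2 fun a _ => prod_ne_zero_iff.2 fun b hb => pow_ne_zero _ ?_
    rw [sub_lin]
    refine lin_ne_zero (Or.inl fun h0 => ?_) one_ne_zero
    grind
  · intro y hy hw z hz
    rw [map_mul, eval_eq_zero_of_y_wheel hP hkm hf hg (p₀ := Sum.elim (fun p => y p.1 p.2) z)
      (by grind) hw, zero_mul]
  · intro z hz hw y hy
    rw [map_mul, eval_eq_zero_of_z_wheel hP hkm hf hg (p₀ := Sum.elim y fun p => z p.1 p.2)
      (by grind) hw, zero_mul]
  · intro s
    have h1 := fbar_perm hm hP hkm hF (permL s) (fun i => s (col hm i)) (by rw [col_last]) 1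
      (fun i a => permL_var_inl s _ a) (fun b => permL_var_inr s _)
    rw [h1]
    congr 1
    have h2 := prod_sh_odd (m := m) (k := k) 𝔓 (by omega)
      (fun i => ((Perm.sign (s (col hm i)) : ℤ) : ℂ)) (by
        rintro rfl
        have : (col hm m : Fin (m + 0)) = col hm 0 := col_last (k := 0)
        rw [this, sign_mul_self])
    rw [← h2]
    refine prod_congr rfl fun i _ => ?_
    rw [← eq_col]
  · intro s
    have h1 := fbar_perm hm hP hkm hF (permR (s 0)) (fun _ => 1) rfl (s 0)
      (fun i a => permR_var_inl (s 0) _) (fun b => permR_var_inr (s 0) _)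
    rw [h1]
    congr 1
    rw [sign_mul_self]
    rfl

end FbarSymmetry

/-! ## The product of the tensor product of two shuffle algebras, on functions -/

section SetSums

variable {ι α K : Type} [Fintype ι] [DecidableEq ι] [Fintype α] [DecidableEq α] [Field K] {M N : ℕ}

theorem setSum_add (Φ Ψ : (ι → (Fin M ⊕ Fin N ≃ α)) → K) :
    setSum (fun e => Φ e + Ψ e) = setSum Φ + setSum Ψ := by
  unfold setSum
  rw [← sum_add_distrib]
  refine sum_congr rfl fun S _ => ?_
  unfold setTerm
  split_ifs <;> simp

theorem setTerm_zero (S : ι → Finset α) :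
    setTerm (fun _ : ι → (Fin M ⊕ Fin N ≃ α) => (0 : K)) S = 0 := by
  unfold setTerm
  split_ifs <;> rfl

theorem setSum_zero : setSum (fun _ : ι → (Fin M ⊕ Fin N ≃ α) => (0 : K)) = 0 :=
  sum_eq_zero fun S _ => setTerm_zero S

theorem setSum_mul_left (c : K) (Φ : (ι → (Fin M ⊕ Fin N ≃ α)) → K) :
    setSum (fun e => c * Φ e) = c * setSum Φ := by
  unfold setSum
  rw [mul_sum]
  refine sum_congr rfl fun S _ => ?_
  unfold setTerm
  split_ifs <;> simp

theorem setSum_mul_right (c : K) (Φ : (ι → (Fin M ⊕ Fin N ≃ α)) → K) :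
    setSum (fun e => Φ e * c) = setSum Φ * c := by
  simp only [mul_comm _ c]
  exact setSum_mul_left c Φ

theorem setSum_of_isEmpty [Nonempty ι] (h : IsEmpty (Fin M ⊕ Fin N ≃ α))
    (Φ : (ι → (Fin M ⊕ Fin N ≃ α)) → K) : setSum Φ = 0 := by
  refine sum_eq_zero fun S _ => ?_
  unfold setTerm
  rw [dif_neg]
  intro h1
  obtain ⟨e, -⟩ := h1 (Classical.arbitrary ι)
  exact h.elim e

end SetSums

section Signs

variable {c M N : ℕ} {α : Type} [Fintype α] [DecidableEq α]

theorem ShuffleType.signAt_eq (T : ShuffleType c) (hT : Even T.odd.card)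
    (b b' : Fin M ⊕ Fin N ≃ α) (e : Fin c → (Fin M ⊕ Fin N ≃ α)) :
    T.signAt b e = T.signAt b' e := by
  unfold ShuffleType.signAt
  have h : ∀ i, ((Perm.sign (b.symm.trans (e i)) : ℤ) : ℂ) =
      ((Perm.sign (b.symm.trans b') : ℤ) : ℂ) *
        ((Perm.sign (b'.symm.trans (e i)) : ℤ) : ℂ) := by
    intro i
    have h1 : b.symm.trans (e i) = (b.symm.trans b').trans (b'.symm.trans (e i)) := by
      ext x
      simp
    rw [h1, Perm.sign_trans, Units.val_mul, Int.cast_mul, mul_comm]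
  simp only [h, prod_mul_distrib, prod_const]
  obtain ⟨r, hr⟩ := hT
  rw [hr, pow_add, ← mul_pow, sign_mul_self, one_pow, one_mul]

theorem ShuffleType.termAt_eq (T : ShuffleType c) (hT : Even T.odd.card) {K : Type} [Field K]
    [Algebra ℂ K] (b b' : Fin M ⊕ Fin N ≃ α) (F : Rat c M) (G : Rat c N) (x : Fin c → α → K)
    (e : Fin c → (Fin M ⊕ Fin N ≃ α)) : T.termAt b F G x e = T.termAt b' F G x e := by
  unfold ShuffleType.termAt
  rw [T.signAt_eq hT b b']

end Signs

theorem colour_injective {ι A B : Type} {f : ι → A → B} (hf : ∀ i, Injective (f i)) :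
    Injective (fun p : ι × A => (p.1, f p.1 p.2)) := by
  rintro ⟨i, a⟩ ⟨j, b⟩ h
  grind

theorem inl_colour_injective {c L₁ L₂ : ℕ} {α : Type} (e : Fin c → (Fin L₁ ⊕ Fin L₂ ≃ α)) :
    Injective (fun p : Fin c × Fin L₁ => (p.1, e p.1 (inl p.2))) :=
  colour_injective fun i => (e i).injective.comp Sum.inl_injective

theorem inr_colour_injective {c L₁ L₂ : ℕ} {α : Type} (e : Fin c → (Fin L₁ ⊕ Fin L₂ ≃ α)) :
    Injective (fun p : Fin c × Fin L₂ => (p.1, e p.1 (inr p.2))) :=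
  colour_injective fun i => (e i).injective.comp Sum.inr_injective

section GenStar

variable {c L₁ L₂ K₁ K₂ L K : ℕ}

/-- The renaming of `y`, `z` given by injective maps in every colour. -/
def blockRename {L' K' : ℕ} (f : Fin c → Fin L' → Fin L) (g : Fin 1 → Fin K' → Fin K)
    (hf : ∀ i, Injective (f i)) (hg : ∀ i, Injective (g i)) :
    RatField ((Fin c × Fin L') ⊕ (Fin 1 × Fin K')) →ₐ[ℂ]
    RatField ((Fin c × Fin L) ⊕ (Fin 1 × Fin K)) :=
  ratRename (Sum.map (fun p => (p.1, f p.1 p.2)) (fun p => (p.1, g p.1 p.2)))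
    ((colour_injective hf).sumMap (colour_injective hg))

/-- `H(y_I | z_I)`. -/
def onLeft (e : Fin c → (Fin L₁ ⊕ Fin L₂ ≃ Fin L)) (e' : Fin 1 → (Fin K₁ ⊕ Fin K₂ ≃ Fin K)) :
    RatField ((Fin c × Fin L₁) ⊕ (Fin 1 × Fin K₁)) →ₐ[ℂ]
    RatField ((Fin c × Fin L) ⊕ (Fin 1 × Fin K)) :=
  blockRename (fun i a => e i (inl a)) (fun i a => e' i (inl a))
    (fun i => (e i).injective.comp Sum.inl_injective)
    (fun i => (e' i).injective.comp Sum.inl_injective)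

/-- `H(y_J | z_J)`. -/
def onRight (e : Fin c → (Fin L₁ ⊕ Fin L₂ ≃ Fin L)) (e' : Fin 1 → (Fin K₁ ⊕ Fin K₂ ≃ Fin K)) :
    RatField ((Fin c × Fin L₂) ⊕ (Fin 1 × Fin K₂)) →ₐ[ℂ]
    RatField ((Fin c × Fin L) ⊕ (Fin 1 × Fin K)) :=
  blockRename (fun i a => e i (inr a)) (fun i a => e' i (inr a))
    (fun i => (e i).injective.comp Sum.inr_injective)
    (fun i => (e' i).injective.comp Sum.inr_injective)

/-- The variables `y`. -/
def yAll (c L K : ℕ) (i : Fin c) (a : Fin L) : RatField ((Fin c × Fin L) ⊕ (Fin 1 × Fin K)) :=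
  var (inl (i, a))

/-- The variables `z`. -/
def zAll (c L K : ℕ) (i : Fin 1) (b : Fin K) : RatField ((Fin c × Fin L) ⊕ (Fin 1 × Fin K)) :=
  var (inr (i, b))

/-- A summand of the product. -/
def genTerm (T : ShuffleType c) (T₁ : ShuffleType 1) (i₀ : Fin c)
    (H₁ : RatField ((Fin c × Fin L₁) ⊕ (Fin 1 × Fin K₁)))
    (H₂ : RatField ((Fin c × Fin L₂) ⊕ (Fin 1 × Fin K₂)))
    (e : Fin c → (Fin L₁ ⊕ Fin L₂ ≃ Fin L)) (e' : Fin 1 → (Fin K₁ ⊕ Fin K₂ ≃ Fin K)) :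
    RatField ((Fin c × Fin L) ⊕ (Fin 1 × Fin K)) :=
  (T.signAt (e i₀) e * T₁.signAt (e' 0) e') • (onLeft e e' H₁ * onRight e e' H₂ *
    (T.omegaAt (ptL (yAll c L K) e) (ptR (yAll c L K) e) *
      T₁.omegaAt (ptL (zAll c L K) e') (ptR (zAll c L K) e')))

/-- The product of functions of `y` and `z`. -/
def genStar (T : ShuffleType c) (T₁ : ShuffleType 1) (i₀ : Fin c) (L K : ℕ)
    (H₁ : RatField ((Fin c × Fin L₁) ⊕ (Fin 1 × Fin K₁)))
    (H₂ : RatField ((Fin c × Fin L₂) ⊕ (Fin 1 × Fin K₂))) :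
    RatField ((Fin c × Fin L) ⊕ (Fin 1 × Fin K)) :=
  setSum fun e => setSum fun e' => genTerm T T₁ i₀ H₁ H₂ e e'

variable (T : ShuffleType c) (T₁ : ShuffleType 1) (i₀ : Fin c)

theorem genTerm_add_left (H₁ H₁' : RatField ((Fin c × Fin L₁) ⊕ (Fin 1 × Fin K₁)))
    (H₂ : RatField ((Fin c × Fin L₂) ⊕ (Fin 1 × Fin K₂)))
    (e : Fin c → (Fin L₁ ⊕ Fin L₂ ≃ Fin L)) (e' : Fin 1 → (Fin K₁ ⊕ Fin K₂ ≃ Fin K)) :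
    genTerm T T₁ i₀ (H₁ + H₁') H₂ e e' = genTerm T T₁ i₀ H₁ H₂ e e' +
    genTerm T T₁ i₀ H₁' H₂ e e' := by
  unfold genTerm
  rw [map_add, add_mul, add_mul, smul_add]

theorem genTerm_add_right (H₁ : RatField ((Fin c × Fin L₁) ⊕ (Fin 1 × Fin K₁)))
    (H₂ H₂' : RatField ((Fin c × Fin L₂) ⊕ (Fin 1 × Fin K₂)))
    (e : Fin c → (Fin L₁ ⊕ Fin L₂ ≃ Fin L)) (e' : Fin 1 → (Fin K₁ ⊕ Fin K₂ ≃ Fin K)) :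
    genTerm T T₁ i₀ H₁ (H₂ + H₂') e e' = genTerm T T₁ i₀ H₁ H₂ e e' +
    genTerm T T₁ i₀ H₁ H₂' e e' := by
  unfold genTerm
  rw [map_add, mul_add, add_mul, smul_add]

theorem genTerm_zero_left (H₂ : RatField ((Fin c × Fin L₂) ⊕ (Fin 1 × Fin K₂)))
    (e : Fin c → (Fin L₁ ⊕ Fin L₂ ≃ Fin L)) (e' : Fin 1 → (Fin K₁ ⊕ Fin K₂ ≃ Fin K)) :
    genTerm T T₁ i₀ 0 H₂ e e' = 0 := by
  unfold genTerm
  rw [map_zero, zero_mul, zero_mul, smul_zero]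

theorem genTerm_zero_right (H₁ : RatField ((Fin c × Fin L₁) ⊕ (Fin 1 × Fin K₁)))
    (e : Fin c → (Fin L₁ ⊕ Fin L₂ ≃ Fin L)) (e' : Fin 1 → (Fin K₁ ⊕ Fin K₂ ≃ Fin K)) :
    genTerm T T₁ i₀ H₁ 0 e e' = 0 := by
  unfold genTerm
  rw [map_zero, mul_zero, zero_mul, smul_zero]

variable {T T₁}

theorem genTerm_ratMul (hT : Even T.odd.card) (hT₁ : Even T₁.odd.card) (a : Rat c L₁) (a' : Rat c L₂)
    (b : Rat 1 K₁) (b' : Rat 1 K₂) (e₀ : Fin L₁ ⊕ Fin L₂ ≃ Fin L) (e₀' : Fin K₁ ⊕ Fin K₂ ≃ Fin K)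
    (e : Fin c → (Fin L₁ ⊕ Fin L₂ ≃ Fin L)) (e' : Fin 1 → (Fin K₁ ⊕ Fin K₂ ≃ Fin K)) :
    genTerm T T₁ i₀ (ratMul a b) (ratMul a' b') e e' =
    T.termAt e₀ a a' (yAll c L K) e * T₁.termAt e₀' b b' (zAll c L K) e' := by
  rw [T.termAt_eq hT e₀ (e i₀), T₁.termAt_eq hT₁ e₀' (e' 0)]
  unfold genTerm ShuffleType.termAt onLeft onRight blockRename
  have e1 : ratSubst (ptL (yAll c L K) e) a = _ :=
    ratSubst_var_eq (Sum.inl_injective.comp (inl_colour_injective e)) a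
  have e2 : ratSubst (ptR (yAll c L K) e) a' = _ :=
    ratSubst_var_eq (Sum.inl_injective.comp (inr_colour_injective e)) a'
  have e3 : ratSubst (ptL (zAll c L K) e') b = _ :=
    ratSubst_var_eq (Sum.inr_injective.comp (inl_colour_injective e')) b
  have e4 : ratSubst (ptR (zAll c L K) e') b' = _ :=
    ratSubst_var_eq (Sum.inr_injective.comp (inr_colour_injective e')) b'
  rw [e1, e2, e3, e4, ratMul_apply, ratMul_apply, map_mul, map_mul, ratRename_ratRename,
    ratRename_ratRename, ratRename_ratRename, ratRename_ratRename, smul_mul_smul_comm]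
  refine congrArg _ (Eq.trans ?_ (mul_mul_mul_comm _ _ _ _))
  exact congrArg (· * _) (mul_mul_mul_comm _ _ _ _)

theorem ShuffleType.setInv_yAll (T : ShuffleType c) {a : Rat c L₁} {a' : Rat c L₂}
    (e₀ : Fin L₁ ⊕ Fin L₂ ≃ Fin L) (ha : T.Sym a) (ha' : T.Sym a') :
    SetInv (T.termAt e₀ a a' (yAll c L K)) :=
  T.setInv_termAt e₀ (yAll c L K) ha ha'
    (fun e => mem_regSub_var (Sum.inl_injective.comp (inl_colour_injective e)) _)
    (fun e => mem_regSub_var (Sum.inl_injective.comp (inr_colour_injective e)) _)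

theorem ShuffleType.setInv_zAll (T : ShuffleType 1) {b : Rat 1 K₁} {b' : Rat 1 K₂}
    (e₀ : Fin K₁ ⊕ Fin K₂ ≃ Fin K) (hb : T.Sym b) (hb' : T.Sym b') :
    SetInv (T.termAt e₀ b b' (zAll c L K)) :=
  T.setInv_termAt e₀ (zAll c L K) hb hb'
    (fun e => mem_regSub_var (Sum.inr_injective.comp (inl_colour_injective e)) _)
    (fun e => mem_regSub_var (Sum.inr_injective.comp (inr_colour_injective e)) _)

/-- The summands of the product depend on the subsets only. -/
theorem genTerm_congr (hT : Even T.odd.card) (hT₁ : Even T₁.odd.card)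
    (t : T.comp L₁ ⊗[ℂ] T₁.comp K₁) (t' : T.comp L₂ ⊗[ℂ] T₁.comp K₂)
    {e₁ e₂ : Fin c → (Fin L₁ ⊕ Fin L₂ ≃ Fin L)} {e₁' e₂' : Fin 1 → (Fin K₁ ⊕ Fin K₂ ≃ Fin K)}
    (h : ∀ i, leftSet (e₁ i) = leftSet (e₂ i)) (h' : ∀ i, leftSet (e₁' i) = leftSet (e₂' i)) :
    genTerm T T₁ i₀ (TensorProduct.lift ratMul (mapIncl _ _ t))
    (TensorProduct.lift ratMul (mapIncl _ _ t')) e₁ e₁' =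
    genTerm T T₁ i₀ (TensorProduct.lift ratMul (mapIncl _ _ t))
    (TensorProduct.lift ratMul (mapIncl _ _ t')) e₂ e₂' := by
  induction t with
  | zero => simp only [map_zero, genTerm_zero_left]
  | add x y hx hy => simp only [map_add, genTerm_add_left, hx, hy]
  | tmul a b =>
    induction t' with
    | zero => simp only [map_zero, genTerm_zero_right]
    | add x y hx hy => simp only [map_add, genTerm_add_right, hx, hy]
    | tmul a' b' =>
      simp only [mapIncl, TensorProduct.map_tmul, TensorProduct.lift.tmul,
        Submodule.subtype_apply]
      rw [genTerm_ratMul i₀ hT hT₁ _ _ _ _ (e₁ i₀) (e₁' 0),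
        genTerm_ratMul i₀ hT hT₁ _ _ _ _ (e₁ i₀) (e₁' 0)]
      rw [T.setInv_yAll (e₁ i₀) a.2.2 a'.2.2 e₁ e₂ h, T₁.setInv_zAll (e₁' 0) b.2.2 b'.2.2 e₁' e₂' h']

theorem ratMul_star (hT : Even T.odd.card) (hT₁ : Even T₁.odd.card) (hN : T.Natural)
    (hN₁ : T₁.Natural) {a : Rat c L₁} {a' : Rat c L₂} {b : Rat 1 K₁} {b' : Rat 1 K₂}
    (ha : T.Sym a) (ha' : T.Sym a') (hb : T₁.Sym b) (hb' : T₁.Sym b') :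
    ratMul (T.star L₁ L₂ a a') (T₁.star K₁ K₂ b b') =
    genStar T T₁ i₀ (L₁ + L₂) (K₁ + K₂) (ratMul a b) (ratMul a' b') := by
  have e1 : ratRename inl Sum.inl_injective (T.star L₁ L₂ a a') =
      setSum (T.termAt finSumFinEquiv a a' (yAll c (L₁ + L₂) (K₁ + K₂))) := by
    rw [T.map_star hN, ← sum_Sub_eq_setSum (T.setInv_yAll finSumFinEquiv ha ha')]
    simp only [ratRename_var]
    rfl
  have e2 : ratRename inr Sum.inr_injective (T₁.star K₁ K₂ b b') =
      setSum (T₁.termAt finSumFinEquiv b b' (zAll c (L₁ + L₂) (K₁ + K₂))) := by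
    rw [T₁.map_star hN₁, ← sum_Sub_eq_setSum (T₁.setInv_zAll finSumFinEquiv hb hb')]
    simp only [ratRename_var]
    rfl
  rw [ratMul_apply, e1, e2]
  unfold genStar
  simp only [genTerm_ratMul i₀ hT hT₁ _ _ _ _ finSumFinEquiv finSumFinEquiv, setSum_mul_left]
  rw [setSum_mul_right]

/-- The embedding of a homogeneous component of a tensor product of shuffle algebras. -/
def inclComp (T : ShuffleType c) (T₁ : ShuffleType 1) (L K : ℕ) :
    T.comp L ⊗[ℂ] T₁.comp K →ₗ[ℂ] Space c ⊗[ℂ] Space 1 :=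
  TensorProduct.map (single c L ∘ₗ (T.comp L).subtype) (single 1 K ∘ₗ (T₁.comp K).subtype)

theorem ShuffleType.alg_mul_single (T : ShuffleType c) (a : Rat c L₁) (a' : Rat c L₂) :
    T.alg.mul (single c L₁ a) (single c L₂ a') = single c (L₁ + L₂) (T.star L₁ L₂ a a') := by
  simp [ShuffleType.alg, single]

theorem toFun_single (a : Rat c L) (b : Rat 1 K) :
    toFun c L K (single c L a ⊗ₜ[ℂ] single 1 K b) = ratMul a b := by
  rw [toFun_tmul]
  congr 1
  · exact congrArg _ (DirectSum.lof_apply ..)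
  · exact DirectSum.lof_apply ..

theorem toFun_single_of_ne (a : Rat c L₁) (b : Rat 1 K₁) (h : ¬ (L₁ = L ∧ K₁ = K)) :
    toFun c L K (single c L₁ a ⊗ₜ[ℂ] single 1 K₁ b) = 0 := by
  rw [toFun_tmul]
  by_cases h1 : L₁ = L
  · have : (single 1 K₁ b) K = 0 := DFinsupp.single_eq_of_ne fun h2 => h ⟨h1, h2.symm⟩
    grind
  · have : (single c L₁ a) L = 0 := DFinsupp.single_eq_of_ne fun h2 => h1 h2.symm
    rw [this, map_zero, LinearMap.zero_apply]

theorem toFun_inclComp (t : T.comp L ⊗[ℂ] T₁.comp K) :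
    toFun c L K (inclComp T T₁ L K t) = TensorProduct.lift ratMul (mapIncl _ _ t) := by
  induction t with
  | zero => simp
  | add x y hx hy => simp only [map_add, hx, hy]
  | tmul a b => exact toFun_single _ _

theorem toFun_inclComp_of_ne (t : T.comp L₁ ⊗[ℂ] T₁.comp K₁) (h : ¬ (L₁ = L ∧ K₁ = K)) :
    toFun c L K (inclComp T T₁ L₁ K₁ t) = 0 := by
  induction t with
  | zero => simp
  | add x y hx hy => simp only [map_add, hx, hy, add_zero]
  | tmul a b => exact toFun_single_of_ne _ _ h

theorem toFun_mul_inclComp (hT : Even T.odd.card) (hT₁ : Even T₁.odd.card) (hN : T.Natural)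
    (hN₁ : T₁.Natural) (L K : ℕ) (t : T.comp L₁ ⊗[ℂ] T₁.comp K₁) (t' : T.comp L₂ ⊗[ℂ] T₁.comp K₂) :
    toFun c L K ((T.alg.tensor T₁.alg).mul (inclComp T T₁ L₁ K₁ t) (inclComp T T₁ L₂ K₂ t')) =
    genStar T T₁ i₀ L K (TensorProduct.lift ratMul (mapIncl _ _ t))
    (TensorProduct.lift ratMul (mapIncl _ _ t')) := by
  induction t with
  | zero => simp only [map_zero, LinearMap.zero_apply, genStar, genTerm_zero_left, setSum_zero]
  | add x y hx hy =>
    simp only [map_add, LinearMap.add_apply, hx, hy, genStar, genTerm_add_left, setSum_add]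
  | tmul a b =>
    induction t' with
    | zero => simp only [map_zero, genStar, genTerm_zero_right, setSum_zero]
    | add x y hx hy => simp only [map_add, hx, hy, genStar, genTerm_add_right, setSum_add]
    | tmul a' b' =>
      have e1 : (T.alg.tensor T₁.alg).mul (inclComp T T₁ L₁ K₁ (a ⊗ₜ b))
          (inclComp T T₁ L₂ K₂ (a' ⊗ₜ b')) = single c (L₁ + L₂) (T.star L₁ L₂ a a') ⊗ₜ[ℂ]
            single 1 (K₁ + K₂) (T₁.star K₁ K₂ b b') := by
        rw [← T.alg_mul_single, ← T₁.alg_mul_single]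
        rfl
      have e2 : TensorProduct.lift ratMul (mapIncl (T.comp L₁) (T₁.comp K₁)
        (a ⊗ₜ b)) = ratMul a.1 b.1 := rfl
      have e3 : TensorProduct.lift ratMul (mapIncl (T.comp L₂) (T₁.comp K₂)
        (a' ⊗ₜ b')) = ratMul a'.1 b'.1 := rfl
      rw [e1, e2, e3]
      by_cases h : L₁ + L₂ = L ∧ K₁ + K₂ = K
      · obtain ⟨rfl, rfl⟩ := h
        rw [toFun_single, ratMul_star i₀ hT hT₁ hN hN₁ a.2.2 a'.2.2 b.2.2 b'.2.2]
      · rw [toFun_single_of_ne _ _ h]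
        have : Nonempty (Fin c) := ⟨i₀⟩
        symm
        unfold genStar
        by_cases h1 : L₁ + L₂ = L
        · have h2 : IsEmpty (Fin K₁ ⊕ Fin K₂ ≃ Fin K) :=
            ⟨fun e => h ⟨h1, by simpa using Fintype.card_congr e⟩⟩
          simp only [setSum_of_isEmpty h2, setSum_zero]
        · exact setSum_of_isEmpty ⟨fun e => h1 (by simpa using Fintype.card_congr e)⟩ _

end GenStar

section FacsSplit

variable {P : Params} {m k : ℕ} {E : Type} [Field E] [Algebra ℂ E] {L₁ L₂ K₁ K₂ : ℕ}

theorem factorA_split (hP : P.Valid) {y : ℕ → Fin (L₁ + L₂) → E} (hy : y (m + k) = y 0)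
    {e : ℕ → (Fin L₁ ⊕ Fin L₂ ≃ Fin (L₁ + L₂))} (he : e (m + k) = e 0) :
    factorA P m (k + 1) y = factorA P m (k + 1) (fun i a => y i (e i (inl a))) *
    factorA P m (k + 1) (fun i a => y i (e i (inr a))) *
    ∏ a, ∏ b, yyF P m k (fun i => y i (e i (inl a))) (fun i => y i (e i (inr b))) := by
  have h1 : ∀ i, ∏ a, ∏ b, edgeF P m k i (y i a) (y (i + 1) b) = _ := fun i =>
    prod_prod_split (e i) (e (i + 1)) (fun a b => edgeF P m k i (y i a) (y (i + 1) b))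
  have h2 : ∀ i, ∏ a, ∏ b, edgeF P m k i (y i (e i (inr a))) (y (i + 1) (e (i + 1) (inl b))) =
    ∏ b, ∏ a, edgeF P m k i (y i (e i (inr a))) (y (i + 1) (e (i + 1) (inl b))) := fun i =>
    prod_comm
  have h3 : ∀ g : ℕ → Fin L₁ → Fin L₂ → E, ∏ a, ∏ b, ∏ i ∈ range (m + k), g i a b =
      ∏ i ∈ range (m + k), ∏ a, ∏ b, g i a b := by
    intro g
    rw [prod_comm' (s := range (m + k)) (t' := Finset.univ)
      (s' := fun _ => range (m + k)) (t := fun _ => Finset.univ) (by simp)]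
    exact prod_congr rfl fun a _ => prod_comm
  unfold yyF
  simp only [prod_mul_distrib, h3]
  rw [factorA_eq, factorA_eq, factorA_eq, hy, he,
    pairProd_split (f := fun a b => fusedF P m k (y 0 a) (y 0 b)) (fun a b => fusedF_symm hP _ _) (e 0)]
  simp only [h1, h2, prod_mul_distrib]
  ring

theorem factorC_split (hP : P.Valid) (hkm : k + 2 ≤ m) {y : ℕ → Fin (L₁ + L₂) → E}
    (hy : y (m + k) = y 0) {e : ℕ → (Fin L₁ ⊕ Fin L₂ ≃ Fin (L₁ + L₂))} (he : e (m + k) = e 0)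
    (z : Fin (K₁ + K₂) → E) (e' : Fin K₁ ⊕ Fin K₂ ≃ Fin (K₁ + K₂)) : factorC P m (k + 1) y z =
    (factorC P m (k + 1) (fun i a => y i (e i (inl a))) (fun b => z (e' (inl b))) *
    factorC P m (k + 1) (fun i a => y i (e i (inl a))) (fun b => z (e' (inr b)))) *
    (factorC P m (k + 1) (fun i a => y i (e i (inr a))) (fun b => z (e' (inl b))) *
    factorC P m (k + 1) (fun i a => y i (e i (inr a))) (fun b => z (e' (inr b)))) := by
  have h : ∀ (j : ℕ) (f : E → E → E), ∏ a, ∏ b, f (y j a) (z b) =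
      ((∏ a, ∏ b, f (y j (e j (inl a))) (z (e' (inl b)))) *
        ∏ a, ∏ b, f (y j (e j (inl a))) (z (e' (inr b)))) *
      ((∏ a, ∏ b, f (y j (e j (inr a))) (z (e' (inl b)))) *
        ∏ a, ∏ b, f (y j (e j (inr a))) (z (e' (inr b)))) := by
    intro j f
    rw [prod_split (e j)]
    simp only [prod_split e' (fun b => f _ (z b)), prod_mul_distrib]
  have hl : (fun (i : ℕ) (a : Fin L₁) => y i (e i (inl a))) (m + k) =
      (fun i a => y i (e i (inl a))) 0 := by simp only [hy, he]
  have hr : (fun (i : ℕ) (a : Fin L₂) => y i (e i (inr a))) (m + k) =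
      (fun i a => y i (e i (inr a))) 0 := by simp only [hy, he]
  rw [factorC_prod hP hkm hy, factorC_prod hP hkm hl, factorC_prod hP hkm hl,
    factorC_prod hP hkm hr, factorC_prod hP hkm hr]
  simp only [h, prod_mul_distrib]
  ring

theorem facs_split (hP : P.Valid) (hkm : k + 2 ≤ m) {y : ℕ → Fin (L₁ + L₂) → E}
    (hy : y (m + k) = y 0) {e : ℕ → (Fin L₁ ⊕ Fin L₂ ≃ Fin (L₁ + L₂))} (he : e (m + k) = e 0)
    (z : Fin (K₁ + K₂) → E) (e' : Fin K₁ ⊕ Fin K₂ ≃ Fin (K₁ + K₂)) : facs P m (k + 1) y z =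
    facs P m (k + 1) (fun i a => y i (e i (inl a))) (fun b => z (e' (inl b))) *
    facs P m (k + 1) (fun i a => y i (e i (inr a))) (fun b => z (e' (inr b))) *
    (((∏ a, ∏ b, yyF P m k (fun i => y i (e i (inl a))) (fun i => y i (e i (inr b)))) *
    ∏ a, ∏ b, yzF P m k (fun i => y i (e i (inl a))) (z (e' (inr b)))) *
    ((∏ b, ∏ a, yzF P m k (fun i => y i (e i (inr a))) (z (e' (inl b)))) *
    ∏ a, ∏ b, zzF P m k (z (e' (inl a))) (z (e' (inr b))))) := by
  have h1 := factorC_eq (P := P) (m := m) (k := k) (fun i a => y i (e i (inl a)))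
    (fun b => z (e' (inr b)))
  have h2 := factorC_eq (P := P) (m := m) (k := k) (fun i a => y i (e i (inr a)))
    (fun b => z (e' (inl b)))
  rw [prod_comm] at h2
  rw [← h1, ← h2]
  unfold facs
  rw [factorA_split hP hy he, factorC_split hP hkm hy he z e', factorB_eq, factorB_eq, factorB_eq,
    pairProd_split (f := fun a b => zzF P m k (z a) (z b)) (fun a b => zzF_symm hP _ _) e']
  ring

theorem pairs_split (hP : P.Valid) (hkm : k + 2 ≤ m) {yL : Fin L₁ → ℕ → E} {yR : Fin L₂ → ℕ → E}
    {zL : Fin K₁ → E} {zR : Fin K₂ → E} (hyL : ∀ a, yL a (m + k) = yL a 0)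
    (hyR : ∀ a, yR a (m + k) = yR a 0) (hyy : ∀ a b i j, yL a i ≠ yR b j)
    (hyz : ∀ a b i (c : ℂ), yL a i ≠ c • zR b) (hzy : ∀ a b i (c : ℂ), yR a i ≠ c • zL b)
    (hzz : ∀ a b (c : ℂ), zL a ≠ c • zR b) : ∏ s : Fin L₁ ⊕ Fin K₁, ∏ t : Fin L₂ ⊕ Fin K₂, (𝕊).pair
    (fun i => Sum.elim (fun a => η i • yL a i) (fun b => ζ i • zL b) s)
    (fun i => Sum.elim (fun a => η i • yR a i) (fun b => ζ i • zR b) t) =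
    (((∏ a, ∏ b, yyF P m k (yL a) (yR b)) * ∏ a, ∏ b, yzF P m k (yL a) (zR b)) *
    ((∏ b, ∏ a, yzF P m k (yR a) (zL b)) * ∏ a, ∏ b, zzF P m k (zL a) (zR b))) *
    ((∏ a, ∏ b, (𝕋).pair (fun i => yL a i) (fun i => yR b i)) *
    ∏ a, ∏ b, (𝕆).pair (fun _ => zL a) (fun _ => zR b)) := by
  simp only [Fintype.prod_sum_type, Sum.elim_inl, Sum.elim_inr,
    fun a b => yy_pair hP hkm (hyL a) (hyR b) (hyy a b), fun a b => yz_pair hP hkm (hyL a) (hyz a b),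
    fun a b => zy_pair hP hkm (hyR a) (hzy a b), fun a b => zz_pair hP hkm (hzz a b),
    prod_mul_distrib]
  ring

end FacsSplit

section Blocks

variable {L₁ L₂ K₁ K₂ L K : ℕ}

/-- The enumeration of a union of two blocks by enumerations of the blocks. -/
def blk (e : Fin L₁ ⊕ Fin L₂ ≃ Fin L) (e' : Fin K₁ ⊕ Fin K₂ ≃ Fin K) :
    Fin (L₁ + K₁) ⊕ Fin (L₂ + K₂) ≃ Fin L ⊕ Fin K :=
  ((finSumFinEquiv.symm.sumCongr finSumFinEquiv.symm).trans
    (Equiv.sumSumSumComm _ _ _ _)).trans (e.sumCongr e')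

theorem blk_inl (e : Fin L₁ ⊕ Fin L₂ ≃ Fin L) (e' : Fin K₁ ⊕ Fin K₂ ≃ Fin K) (s : Fin (L₁ + K₁)) :
    blk e e' (inl s) =
    Sum.map (fun a => e (inl a)) (fun a => e' (inl a)) (finSumFinEquiv.symm s) := by
  obtain ⟨s, rfl⟩ := finSumFinEquiv.surjective s
  rcases s with s | s <;> simp [blk]

theorem blk_inr (e : Fin L₁ ⊕ Fin L₂ ≃ Fin L) (e' : Fin K₁ ⊕ Fin K₂ ≃ Fin K) (s : Fin (L₂ + K₂)) :
    blk e e' (inr s) =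
    Sum.map (fun a => e (inr a)) (fun a => e' (inr a)) (finSumFinEquiv.symm s) := by
  obtain ⟨s, rfl⟩ := finSumFinEquiv.surjective s
  rcases s with s | s <;> simp [blk]

theorem sign_blk (e₀ e : Fin L₁ ⊕ Fin L₂ ≃ Fin L) (e' : Fin K₁ ⊕ Fin K₂ ≃ Fin K) :
    Perm.sign ((blk e₀ e').symm.trans (blk e e')) = Perm.sign (e₀.symm.trans e) := by
  have h : (blk e₀ e').symm.trans (blk e e') =
      Perm.sumCongr (e₀.symm.trans e) (Equiv.refl (Fin K)) := by
    ext s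
    rcases s with s | s
    · simp [blk]
    · obtain ⟨s, rfl⟩ := e'.surjective s
      rcases s with s | s <;> simp [blk]
  rw [h, Perm.sign_sumCongr]
  simp

end Blocks

section Value

variable {P : Params} {m k : ℕ} (hm : 0 < m) {L₁ L₂ K₁ K₂ L K : ℕ}
    (e : Fin (m + k) → (Fin L₁ ⊕ Fin L₂ ≃ Fin L)) (e' : Fin 1 → (Fin K₁ ⊕ Fin K₂ ≃ Fin K))

theorem onLeft_yv (i : ℕ) (a : Fin L₁) :
    onLeft e e' (yv hm K₁ i a) = yv hm K i (e (col hm i) (inl a)) := by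
  rw [yv, onLeft, blockRename, ratRename_var]
  rfl

theorem onRight_yv (i : ℕ) (a : Fin L₂) :
    onRight e e' (yv hm K₂ i a) = yv hm K i (e (col hm i) (inr a)) := by
  rw [yv, onRight, blockRename, ratRename_var]
  rfl

theorem onLeft_zw (b : Fin K₁) : onLeft e e' (zw m k L₁ b) = zw m k L (e' 0 (inl b)) := by
  rw [zw, onLeft, blockRename, ratRename_var]
  rfl

theorem onRight_zw (b : Fin K₂) : onRight e e' (zw m k L₂ b) = zw m k L (e' 0 (inr b)) := by
  rw [zw, onRight, blockRename, ratRename_var]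
  rfl

theorem ptL_blk : ptL (spec P m k hm L K) (fun i => blk (e (col hm i)) (e' 0)) =
    fun p => onLeft e e' (spec P m k hm L₁ K₁ p.1 (finSumFinEquiv.symm p.2)) := by
  funext p
  unfold ptL
  rw [blk_inl]
  rcases finSumFinEquiv.symm p.2 with a | b
  · simp only [spec, specPt, Sum.elim_inl, Sum.map_inl, map_smul, onLeft_yv]
  · simp only [spec, specPt, Sum.elim_inr, Sum.map_inr, map_smul, onLeft_zw]

theorem ptR_blk : ptR (spec P m k hm L K) (fun i => blk (e (col hm i)) (e' 0)) =
    fun p => onRight e e' (spec P m k hm L₂ K₂ p.1 (finSumFinEquiv.symm p.2)) := by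
  funext p
  unfold ptR
  rw [blk_inr]
  rcases finSumFinEquiv.symm p.2 with a | b
  · simp only [spec, specPt, Sum.elim_inl, Sum.map_inl, map_smul, onRight_yv]
  · simp only [spec, specPt, Sum.elim_inr, Sum.map_inr, map_smul, onRight_zw]

theorem signAt_blk (P' : Params) (p₁ p₂ p₃ : ℂ) (hm2 : 2 ≤ m) :
    (𝕊).signAt (blk (e (col hm 0)) (e' 0)) (fun i => blk (e (col hm i)) (e' 0)) =
    (shType P' m k).signAt (e (col hm 0)) e * (oneType p₁ p₂ p₃).signAt (e' 0) e' := by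
  unfold ShuffleType.signAt
  have h1 : ∏ i ∈ (oneType p₁ p₂ p₃).odd,
    ((Perm.sign ((e' 0).symm.trans (e' i)) : ℤ) : ℂ) = 1 := rfl
  have h2 := prod_sh_odd (m := m) (k := k) P' hm2
    (fun i => ((Perm.sign ((e (col hm 0)).symm.trans (e (col hm i))) : ℤ) : ℂ)) (by
      rintro rfl
      have : (col hm m : Fin (m + 0)) = col hm 0 := col_last (k := 0)
      rw [this, sign_mul_self])
  simp only [sign_blk]
  rw [h1, mul_one, prod_super_odd hm fun i =>
    ((Perm.sign ((e (col hm 0)).symm.trans (e (col hm i))) : ℤ) : ℂ), ← h2]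
  refine prod_congr rfl fun i _ => ?_
  rw [← eq_col]

theorem omegaAt_blk (hP : P.Valid) (hkm : k + 2 ≤ m) : (𝕊).omegaAt
    (ptL (spec P m k hm L K) (fun i => blk (e (col hm i)) (e' 0)))
    (ptR (spec P m k hm L K) (fun i => blk (e (col hm i)) (e' 0))) =
    (((∏ a, ∏ b, yyF P m k (fun i => yv hm K i (e (col hm i) (inl a)))
    (fun i => yv hm K i (e (col hm i) (inr b)))) *
    ∏ a, ∏ b, yzF P m k (fun i => yv hm K i (e (col hm i) (inl a))) (zw m k L (e' 0 (inr b)))) *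
    ((∏ b, ∏ a, yzF P m k (fun i => yv hm K i (e (col hm i) (inr a))) (zw m k L (e' 0 (inl b)))) *
    ∏ a, ∏ b, zzF P m k (zw m k L (e' 0 (inl a))) (zw m k L (e' 0 (inr b))))) *
    ((𝕋).omegaAt (ptL (yAll (m + k) L K) e) (ptR (yAll (m + k) L K) e) * (𝕆).omegaAt
    (ptL (zAll (m + k) L K) e') (ptR (zAll (m + k) L K) e')) := by
  have hyy : ∀ a b i j, yv (k := k) hm K i (e (col hm i) (inl a)) ≠
      yv hm K j (e (col hm j) (inr b)) := by
    intro a b i j h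
    have h1 := var_ne_smul (s := (inl (col hm i, e (col hm i) (inl a)) : 𝕍))
      (t := inl (col hm j, e (col hm j) (inr b))) (by
        intro h2
        obtain ⟨h3, h4⟩ := Prod.mk.inj (Sum.inl_injective h2)
        rw [h3] at h4
        simpa using (e _).injective h4) 1
    rw [one_smul] at h1
    exact h1 h
  have hzz : ∀ a b (c : ℂ), zw m k L (e' 0 (inl a)) ≠ c • zw m k L (e' 0 (inr b)) :=
    fun a b c => var_ne_smul (fun h => by
      simpa using (e' 0).injective (Prod.mk.inj (Sum.inr_injective h)).2) c
  have hy : ∀ s, yv (k := k) hm K (m + k) (e (col hm (m + k)) s) = yv hm K 0 (e (col hm 0) s) :=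
    fun s => by rw [yv_last, col_last]
  have h := pairs_split hP hkm (yL := fun a i => yv (k := k) hm K i (e (col hm i) (inl a)))
    (yR := fun a i => yv (k := k) hm K i (e (col hm i) (inr a)))
    (zL := fun b => zw m k L (e' 0 (inl b))) (zR := fun b => zw m k L (e' 0 (inr b)))
    (fun a => hy _) (fun a => hy _) hyy (fun _ _ _ c => yv_ne_zw hm _ _ _ c)
    (fun _ _ _ c => yv_ne_zw hm _ _ _ c) hzz
  have e1 : ∀ s, (fun i : Fin (m + k) => yv hm K i (e (col hm i) s)) =
      fun i => yAll (m + k) L K i (e i s) := by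
    intro s
    funext i
    rw [← eq_col]
    exact congrArg (fun j => var (inl (j, e i s))) (eq_col i).symm
  have e2 : ∀ s, (fun _ : Fin 1 => zw m k L (e' 0 s)) = fun i => zAll (m + k) L K i (e' i s) := by
    intro s
    funext i
    obtain rfl := Subsingleton.elim i 0
    rfl
  simp only [e1, e2] at h
  rw [ptL_blk, ptR_blk, ShuffleType.omegaAt_eq_pair, ShuffleType.omegaAt_eq_pair,
    ShuffleType.omegaAt_eq_pair]
  refine Eq.trans ?_ h
  refine Eq.trans (prod_congr rfl fun s _ => ?_) (Equiv.prod_comp finSumFinEquiv.symm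
    fun s => ∏ t, (𝕊).pair (fun i => Sum.elim _ _ s) (fun i => Sum.elim _ _ t))
  refine Eq.trans (prod_congr rfl fun t _ => ?_) (Equiv.prod_comp finSumFinEquiv.symm
    fun t => (𝕊).pair (fun i => Sum.elim _ _ (finSumFinEquiv.symm s))
      (fun i => Sum.elim _ _ t))
  congr 1
  · funext i
    rcases finSumFinEquiv.symm s with a | b
    · simp only [spec, specPt, Sum.elim_inl, map_smul, onLeft_yv]
    · simp only [spec, specPt, Sum.elim_inr, map_smul, onLeft_zw]
  · funext i
    rcases finSumFinEquiv.symm t with a | b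
    · simp only [spec, specPt, Sum.elim_inl, map_smul, onRight_yv]
    · simp only [spec, specPt, Sum.elim_inr, map_smul, onRight_zw]

/-- The summands of a specialized shuffle product indexed by unions of blocks. -/
theorem termAt_blk (hP : P.Valid) (hkm : k + 2 ≤ m) {F : Rat (m + (k + 1)) (L₁ + K₁)}
    {G : Rat (m + (k + 1)) (L₂ + K₂)} (b : Fin (L₁ + K₁) ⊕ Fin (L₂ + K₂) ≃ Fin L ⊕ Fin K) :
    (𝕊).termAt b F G (spec P m k hm L K) (fun i => blk (e (col hm i)) (e' 0)) = genTerm 𝕋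
    𝕆 (col hm 0) (fbar P m k hm L₁ K₁ F) (fbar P m k hm L₂ K₂ G) e e' *
    facs P m (k + 1) (yv hm K) (zw m k L) := by
  obtain rfl : L₁ + L₂ = L := by simpa using Fintype.card_congr (e (col hm 0))
  obtain rfl : K₁ + K₂ = K := by simpa using Fintype.card_congr (e' 0)
  have hodd : Even (𝕊).odd.card := by
    rw [super_odd hm, card_pair fun h => hm.ne (congrArg Fin.val h)]
    exact even_two
  have hF : ratSubst (fun p => onLeft e e' (spec P m k hm L₁ K₁ p.1 (finSumFinEquiv.symm p.2))) F =
      onLeft e e' (fbar P m k hm L₁ K₁ F) * onLeft e e' (facs P m (k + 1) (yv hm K₁) (zw m k L₁)) := by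
    rw [← map_mul, fbar, div_mul_cancel₀ _ (facs_ne hm hP hkm), map_ratSubst]
  have hG : ratSubst (fun p => onRight e e' (spec P m k hm L₂ K₂ p.1 (finSumFinEquiv.symm p.2))) G =
      onRight e e' (fbar P m k hm L₂ K₂ G) * onRight e e' (facs P m (k + 1) (yv hm K₂) (zw m k L₂)) := by
    rw [← map_mul, fbar, div_mul_cancel₀ _ (facs_ne hm hP hkm), map_ratSubst]
  rw [ShuffleType.termAt_eq _ hodd b (blk (e (col hm 0)) (e' 0))]
  unfold ShuffleType.termAt genTerm
  rw [signAt_blk hm e e' 𝔓 _ _ _ (by omega), smul_mul_assoc, omegaAt_blk hm e e' hP hkm,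
    ptL_blk, ptR_blk, hF, hG, map_facs, map_facs, facs_split hP hkm (yv_last hm)
      (e := fun i => e (col hm i)) (by rw [col_last]) _ (e' 0)]
  simp only [onLeft_yv, onRight_yv, onLeft_zw, onRight_zw]
  congr 1
  ring

end Value

section Sets

theorem exists_leftSet_eq {α : Type} [LinearOrder α] [Fintype α] {M N : ℕ} {S : Finset α}
    (h : S.card = M) (h' : Sᶜ.card = N) : ∃ e : Fin M ⊕ Fin N ≃ α, leftSet e = S := by
  refine ⟨finSumEquivOfFinset h h', Finset.eq_of_subset_of_card_le (fun x hx => ?_) ?_⟩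
  · obtain ⟨a, rfl⟩ := (mem_leftSet _ _).1 hx
    rw [finSumEquivOfFinset_inl]
    exact Finset.orderEmbOfFin_mem _ _ _
  · rw [h, card_leftSet]

theorem leftSet_blk {L₁ L₂ K₁ K₂ L K : ℕ} (e : Fin L₁ ⊕ Fin L₂ ≃ Fin L)
    (e' : Fin K₁ ⊕ Fin K₂ ≃ Fin K) : leftSet (blk e e') = (leftSet e).disjSum (leftSet e') := by
  symm
  refine Finset.eq_of_subset_of_card_le (fun s hs => ?_) ?_
  · rw [mem_leftSet]
    rcases s with s | s
    · obtain ⟨a, rfl⟩ := (mem_leftSet _ _).1 (Finset.inl_mem_disjSum.1 hs)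
      exact ⟨finSumFinEquiv (inl a), by rw [blk_inl, Equiv.symm_apply_apply, Sum.map_inl]⟩
    · obtain ⟨a, rfl⟩ := (mem_leftSet _ _).1 (Finset.inr_mem_disjSum.1 hs)
      exact ⟨finSumFinEquiv (inr a), by rw [blk_inl, Equiv.symm_apply_apply, Sum.map_inr]⟩
  · rw [card_disjSum, card_leftSet, card_leftSet, card_leftSet]

theorem setTerm_setSum {ι ι' α α' K : Type} [Fintype ι] [Fintype ι'] [DecidableEq ι'] [Fintype α]
    [DecidableEq α] [Fintype α'] [DecidableEq α'] [Field K] {M N M' N' : ℕ}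
    (Ψ : (ι → (Fin M ⊕ Fin N ≃ α)) → (ι' → (Fin M' ⊕ Fin N' ≃ α')) → K) (A : ι → Finset α) :
    setTerm (fun e => setSum (Ψ e)) A = ∑ B, setTerm (fun e => setTerm (Ψ e) B) A := by
  unfold setTerm
  split_ifs with h
  · rfl
  · exact sum_const_zero.symm

end Sets

section Vanishing

variable {P : Params} {m k : ℕ} (hm : 0 < m) {M N L K : ℕ}

theorem super_omega_bwd {E : Type} [Field E] [Algebra ℂ E] (hm2 : 2 ≤ m) {i : 𝕀}
    (hi : i.val < m + k) {x y : E} (h : x = eps m i P.q3 • y) : (𝕊).ω E (next i) i x y = 0 := by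
  have h1 := next_ne (by omega) i
  have h2 := next_next_ne (by omega) i
  have h3 := next_val_cases i
  have h4 : (1 ≤ (next i).val ∧ (next i).val ≤ m) ↔ i.val < m := by omega
  simp only [superType, h1, h2.symm, if_false, if_true, h4]
  split_ifs with h5
  · rw [h, eps_of_lt h5, sub_self, zero_div, smul_zero]
  · rw [h, eps_of_le (not_lt.1 h5), sub_self, zero_div, smul_zero]

theorem super_omega_fwd {E : Type} [Field E] [Algebra ℂ E] (hm2 : 2 ≤ m) {i : 𝕀}
    (hi : i.val = m + k) {x y : E} (h : x = P.q1⁻¹ • y) : (𝕊).ω E i (next i) x y = 0 := by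
  have h1 := next_ne (by omega) i
  have h3 := next_val_cases i
  have h4 : ¬ (1 ≤ (next i).val ∧ (next i).val ≤ m) := by omega
  simp only [superType, h1.symm, if_false, if_true, h4]
  grind

theorem omegaAt_eq_zero {E : Type} [Field E] [Algebra ℂ E] {c : ℕ} {α : Type} (T : ShuffleType c)
    {x : Fin c → α → E} {e : Fin c → (Fin M ⊕ Fin N ≃ α)} {i j : Fin c} {s t : α}
    [Fintype α] [DecidableEq α] (hs : s ∈ leftSet (e i)) (ht : t ∉ leftSet (e j))
    (h : T.ω E i j (x i s) (x j t) = 0) : T.omegaAt (ptL x e) (ptR x e) = 0 := by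
  obtain ⟨a, rfl⟩ := (mem_leftSet _ _).1 hs
  obtain ⟨b, rfl⟩ := (e j).surjective t
  rcases b with b | b
  · exact absurd ((mem_leftSet _ _).2 ⟨b, rfl⟩) ht
  · exact prod_eq_zero (mem_univ i) (prod_eq_zero (mem_univ j)
      (prod_eq_zero (mem_univ a) (prod_eq_zero (mem_univ b) h)))

/-- Families of subsets with the same variables `z` in all colours. -/
def comb (p : (Fin (m + k) → Finset (Fin L)) × (Fin 1 → Finset (Fin K))) (i : 𝕀) :
    Finset (Fin L ⊕ Fin K) := (p.1 (col hm i)).disjSum (p.2 0)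

theorem comb_injective : Injective (comb (m := m) (k := k) (L := L) (K := K) hm) := by
  rintro ⟨A, B⟩ ⟨A', B'⟩ h
  have h1 := fun i => Finset.disjSum_inj.1 (congrFun h i)
  refine Prod.ext (funext fun i => ?_) (funext fun i => ?_)
  · have := (h1 ⟨i, by omega⟩).1
    rwa [← eq_col] at this
  · obtain rfl := Subsingleton.elim i 0
    exact (h1 0).2

/-- The summands of a specialized product vanish unless the variables `z` are distributed in the
same way in all colours. -/
theorem exists_comb (hP : P.Valid) (hkm : k + 2 ≤ m) {E : 𝕀 → (Fin M ⊕ Fin N ≃ Fin L ⊕ Fin K)}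
    (h : (𝕊).omegaAt (ptL (spec P m k hm L K) E) (ptR (spec P m k hm L K) E) ≠ 0) :
    ∃ p, comb hm p = fun i => leftSet (E i) := by
  have hz : ∀ (i : ℕ) (hi : i < m + k), (leftSet (E ⟨i + 1, by omega⟩)).toRight ⊆
      (leftSet (E ⟨i, by omega⟩)).toRight := by
    intro i hi b hb
    rw [mem_toRight] at hb ⊢
    by_contra hb'
    have hn : next (⟨i, by omega⟩ : 𝕀) = ⟨i + 1, by omega⟩ :=
      Fin.ext (Nat.mod_eq_of_lt (show i + 1 < m + (k + 1) by omega))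
    rw [← hn] at hb
    refine h (omegaAt_eq_zero _ hb hb' (super_omega_bwd (by omega) hi ?_))
    rw [hn]
    simp only [spec, specPt, Sum.elim_inr, zcoef_succ hP, mul_smul]
  have hw : (leftSet (E ⟨m + k, by omega⟩)).toLeft ⊆ (leftSet (E ⟨0, by omega⟩)).toLeft := by
    intro a ha
    rw [mem_toLeft] at ha ⊢
    by_contra ha'
    have hn : next (⟨m + k, by omega⟩ : 𝕀) = ⟨0, by omega⟩ := Fin.ext (Nat.mod_self _)
    rw [← hn] at ha'
    refine h (omegaAt_eq_zero _ ha ha' (super_omega_fwd (by omega) rfl ?_))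
    rw [hn]
    simp only [spec, specPt, Sum.elim_inl, ycoef_zero, ycoef_last hP (show k < m by omega), yv_last,
      smul_smul, inv_mul_cancel₀ hP.n1]
  have hz' : ∀ (j : ℕ) (hj : j ≤ m + k) (i : ℕ) (hi : i ≤ j), (leftSet (E ⟨j, by omega⟩)).toRight ⊆
      (leftSet (E ⟨i, by omega⟩)).toRight := by
    intro j
    induction j with
    | zero =>
      grind
    | succ j ih =>
      grind
  have hc : ∀ i, (leftSet (E i)).toLeft.card + (leftSet (E i)).toRight.card = M := fun i => by
    rw [card_toLeft_add_card_toRight, card_leftSet]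
  have c1 := hc ⟨0, by omega⟩
  have c2 := hc ⟨m + k, by omega⟩
  have c3 := card_le_card hw
  have c4 := card_le_card (hz' (m + k) le_rfl 0 (by omega))
  have hw' := Finset.eq_of_subset_of_card_le hw (by omega)
  have h0 := Finset.eq_of_subset_of_card_le (hz' (m + k) le_rfl 0 (by omega)) (by omega)
  refine ⟨(fun j => (leftSet (E ⟨j, by omega⟩)).toLeft, fun _ => (leftSet (E ⟨0, by omega⟩)).toRight),
    funext fun i => ?_⟩
  have e1 : (leftSet (E i)).toRight = (leftSet (E ⟨0, by omega⟩)).toRight :=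
    (hz' i (by omega) 0 (by omega)).antisymm (by grind)
  have e2 : (leftSet (E ⟨(col (k := k) hm i).val, by omega⟩)).toLeft = (leftSet (E i)).toLeft := by
    rcases (show i.val < m + k ∨ i.val = m + k by omega) with hi | hi
    · congr 3
      exact Fin.ext (Nat.mod_eq_of_lt hi)
    · have h1 : (⟨(col (k := k) hm i).val, by omega⟩ : 𝕀) = ⟨0, by omega⟩ :=
        Fin.ext (by simp [col, hi])
      rw [h1, ← hw']
      congr 3
      grind
  unfold comb
  dsimp only
  rw [e2, ← e1, Finset.toLeft_disjSum_toRight]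

end Vanishing

section Product

variable {P : Params} {m k : ℕ} (hm : 0 < m) {M N L K : ℕ}

/-- The component of bidegree `(L, K)` of the image of a function of degree `N`. -/
def gbar (P : Params) (m k : ℕ) (hm : 0 < m) (L K : ℕ) {N : ℕ} (F : Rat (m + (k + 1)) N) :
    RatField 𝕍 :=
  if h : L + K = N then fbar P m k hm L K (h ▸ F) else 0

theorem gbar_eq (F : Rat (m + (k + 1)) (L + K)) : gbar P m k hm L K F = fbar P m k hm L K F :=
  dif_pos rfl

theorem gbar_of_ne (h : L + K ≠ N) (F : Rat (m + (k + 1)) N) : gbar P m k hm L K F = 0 := dif_neg h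

theorem gbar_mem (hP : P.Valid) (hkm : k + 2 ≤ m) {F : Rat (m + (k + 1)) N}
    (hF : F ∈ (𝕊).comp N) (p₁ : ℂ) (L K : ℕ) : ∃ t : (𝕋).comp L ⊗[ℂ]
    (oneType p₁ P.q2⁻¹ (P.q3 ^ ((m : ℤ) - (k + 1 : ℕ)))).comp K,
    TensorProduct.lift ratMul (mapIncl _ _ t) = gbar P m k hm L K F := by
  by_cases h : L + K = N
  · subst h
    rw [gbar_eq]
    exact fbar_mem hm hP hkm hF p₁
  · exact ⟨0, by rw [gbar_of_ne hm h, map_zero, map_zero]⟩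

theorem sh_odd_even (P' : Params) (hm2 : 2 ≤ m) : Even (shType P' m k).odd.card := by
  cases k with
  | zero =>
    have h1 : shType P' m 0 = evenType' P' (m + 0) := evenType_eq _ (by omega)
    rw [h1]
    exact Even.zero
  | succ k =>
    change Even (superType P' m (k + 1)).odd.card
    rw [super_odd (by omega), card_pair fun h => absurd (congrArg Fin.val h) (by dsimp only; omega)]
    exact even_two

theorem super_spec_regular (hP : P.Valid) (hkm : k + 2 ≤ m) {α : Type} (σ : α ≃ Fin L ⊕ Fin K)
    (i j : 𝕀) (a b : α) (h : (i, a) ≠ (j, b)) :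
    (𝕊).ω (RatField (𝕀 × α)) i j (var (i, a)) (var (j, b)) ∈
    regSub (fun p => spec P m k hm L K p.1 (σ p.2)) ∧
    ratSubst (fun p => spec P m k hm L K p.1 (σ p.2)) ((𝕊).ω
    (RatField (𝕀 × α)) i j (var (i, a)) (var (j, b))) =
    (𝕊).ω _ i j (spec P m k hm L K i (σ a)) (spec P m k hm L K j (σ b)) := by
  refine super_omega_regular P m (k + 1) (fun p : 𝕀 × α => spec P m k hm L K p.1 (σ p.2)) i j
    (i, a) (j, b) ?_
  unfold sden
  dsimp only
  split_ifs with h1 h2 h3 h4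
  · exact one_ne_zero
  · subst h1
    have hs : ∀ s t : Fin L ⊕ Fin K, s ≠ t → spec P m k hm L K i s ≠ spec P m k hm L K i t := by
      intro s t hst h5
      rw [spec_eq, spec_eq] at h5
      have h6 := sc_ne (m := m) (k := k) hP (i, s)
      refine var_ne_smul (s := sv hm L K (i, s)) (t := sv hm L K (i, t)) ?_
        ((sc P L K m k (i, s))⁻¹ * sc P L K m k (i, t)) ?_
      · rcases s with s | s <;> rcases t with t | t <;> simp [sv] at hst ⊢ <;> exact hst
      · rw [mul_smul, ← h5, smul_smul, inv_mul_cancel₀ h6, one_smul]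
    exact sub_ne_zero.2 (hs _ _ fun h5 => h (by rw [σ.injective h5]))
  · subst h3
    exact spec_sub_ne hm hP hkm i _ _
  · subst h4
    exact spec_sub_ne hm hP hkm j _ _
  · exact one_ne_zero

/-- The fusion map is multiplicative, in terms of functions of `y` and `z`. -/
theorem gbar_star (hP : P.Valid) (hkm : k + 2 ≤ m) {F : Rat (m + (k + 1)) M} {G : Rat (m + (k + 1)) N}
    (hF : F ∈ (𝕊).comp M) (hG : G ∈ (𝕊).comp N) (L K : ℕ) : gbar P m k hm L K ((𝕊).star M N F G) =
    ∑ p ∈ Finset.HasAntidiagonal.antidiagonal M, ∑ p' ∈ Finset.HasAntidiagonal.antidiagonal N,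
    genStar 𝕋 𝕆 (col hm 0) L K (gbar P m k hm p.1 p.2 F) (gbar P m k hm p'.1 p'.2 G) := by
  set T := 𝕋 with hT
  set T₁ := 𝕆 with hT₁
  by_cases h : L + K = M + N
  swap
  · rw [gbar_of_ne hm h]
    symm
    refine sum_eq_zero fun p hp => sum_eq_zero fun p' hp' => ?_
    rw [Finset.HasAntidiagonal.mem_antidiagonal] at hp hp'
    unfold genStar
    have : Nonempty (Fin (m + k)) := ⟨col hm 0⟩
    by_cases h1 : p.1 + p'.1 = L
    · have h2 : IsEmpty (Fin p.2 ⊕ Fin p'.2 ≃ Fin K) :=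
        ⟨fun e => by have := Fintype.card_congr e; simp at this; omega⟩
      simp only [setSum_of_isEmpty h2, setSum_zero]
    · exact setSum_of_isEmpty ⟨fun e => h1 (by simpa using Fintype.card_congr e)⟩ _
  have hN := facs_ne (L := L) (K := K) hm hP hkm
  let σ : Fin (M + N) ≃ Fin L ⊕ Fin K := (finCongr h.symm).trans finSumFinEquiv.symm
  have h0 : ∀ H : Rat (m + (k + 1)) (M + N), gbar P m k hm L K H =
      ratSubst (fun p => spec P m k hm L K p.1 (σ p.2)) H / facs P m (k + 1) (yv hm K) (zw m k L) := by
    have : ∀ {n : ℕ} (h : L + K = n) (H : Rat (m + (k + 1)) n), gbar P m k hm L K H =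
        ratSubst (fun p => spec P m k hm L K p.1 (finSumFinEquiv.symm (finCongr h.symm p.2))) H /
          facs P m (k + 1) (yv hm K) (zw m k L) := by
      rintro n rfl H
      exact gbar_eq hm H
    exact this h
  have rF : ∀ e : 𝕀 → (Fin M ⊕ Fin N ≃ Fin L ⊕ Fin K),
      F ∈ regSub (ptL (spec P m k hm L K) e) := fun e =>
    comp_mem_regSub hF (fun _ => spec_ne hm hP _ _) fun _ _ _ => spec_sub_ne hm hP hkm _ _ _
  have rG : ∀ e : 𝕀 → (Fin M ⊕ Fin N ≃ Fin L ⊕ Fin K),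
      G ∈ regSub (ptR (spec P m k hm L K) e) := fun e =>
    comp_mem_regSub hG (fun _ => spec_ne hm hP _ _) fun _ _ _ => spec_sub_ne hm hP hkm _ _ _
  rw [h0, (𝕊).ratSubst_star hF.2 hG.2 σ (spec P m k hm L K) rF rG
    (super_spec_regular hm hP hkm σ), div_eq_iff hN]
  have hinv := (𝕊).setInv_termAt (finSumFinEquiv.trans σ) (spec P m k hm L K)
    hF.2 hG.2 rF rG
  set Φ := (𝕊).termAt (finSumFinEquiv.trans σ) F G (spec P m k hm L K) with hΦ
  let V : (Fin (m + k) → Finset (Fin L)) → (Fin 1 → Finset (Fin K)) → RatField 𝕍 :=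
    fun A B => ∑ p ∈ Finset.HasAntidiagonal.antidiagonal M, ∑ p' ∈ Finset.HasAntidiagonal.antidiagonal N,
      setTerm (fun e => setTerm (genTerm T T₁ (col hm 0) (gbar P m k hm p.1 p.2 F)
        (gbar P m k hm p'.1 p'.2 G) e) B) A
  have hR : ∑ p ∈ Finset.HasAntidiagonal.antidiagonal M, ∑ p' ∈ Finset.HasAntidiagonal.antidiagonal N,
      genStar T T₁ (col hm 0) L K (gbar P m k hm p.1 p.2 F) (gbar P m k hm p'.1 p'.2 G) =
      ∑ q : (Fin (m + k) → Finset (Fin L)) × (Fin 1 → Finset (Fin K)), V q.1 q.2 := by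
    refine Eq.trans (sum_congr rfl fun p _ => sum_congr rfl fun p' _ => ?_)
      ((sum_congr rfl fun p _ => sum_comm).trans sum_comm)
    rw [Fintype.sum_prod_type]
    exact sum_congr rfl fun A _ => setTerm_setSum _ A
  have hne : ∀ (p p' : ℕ × ℕ) A B, setTerm (fun e => setTerm (genTerm T T₁ (col hm 0)
      (gbar P m k hm p.1 p.2 F) (gbar P m k hm p'.1 p'.2 G) e) B) A ≠ 0 →
      ∃ (e : Fin (m + k) → (Fin p.1 ⊕ Fin p'.1 ≃ Fin L)) (e' : Fin 1 → (Fin p.2 ⊕ Fin p'.2 ≃ Fin K)),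
        (∀ i, leftSet (e i) = A i) ∧ ∀ i, leftSet (e' i) = B i := by
    intro p p' A B h1
    obtain ⟨e, he, h2⟩ := setTerm_eq_of h1
    rw [h2] at h1
    obtain ⟨e', he', -⟩ := setTerm_eq_of h1
    exact ⟨e, e', he, he'⟩
  have key : ∀ q, V q.1 q.2 * facs P m (k + 1) (yv hm K) (zw m k L) = setTerm Φ (comb hm q) := by
    rintro ⟨A, B⟩
    by_cases hex : ∃ (p p' : ℕ × ℕ) (e : Fin (m + k) → (Fin p.1 ⊕ Fin p'.1 ≃ Fin L))
        (e' : Fin 1 → (Fin p.2 ⊕ Fin p'.2 ≃ Fin K)), p.1 + p.2 = M ∧ p'.1 + p'.2 = N ∧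
        (∀ i, leftSet (e i) = A i) ∧ ∀ i, leftSet (e' i) = B i
    · obtain ⟨⟨L₁, K₁⟩, ⟨L₂, K₂⟩, e, e', hM, hN', hA, hB⟩ := hex
      dsimp only at e e' hM hN'
      subst hM hN'
      obtain rfl := funext hA
      obtain rfl := funext hB
      have hcomb : comb hm (fun i => leftSet (e i), fun i => leftSet (e' i)) =
          fun i : 𝕀 => leftSet (blk (e (col hm i)) (e' 0)) := funext fun i => (leftSet_blk _ _).symm
      rw [hcomb, setTerm_leftSet hinv, hΦ, termAt_blk hm e e' hP hkm, ← gbar_eq, ← gbar_eq]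
      congr 1
      have hc := Fintype.card_congr (e (col hm 0))
      have hc' := Fintype.card_congr (e' 0)
      simp only [Fintype.card_sum, Fintype.card_fin] at hc hc'
      have hz : ∀ p p' : ℕ × ℕ, (p, p') ≠ ((L₁, K₁), (L₂, K₂)) → setTerm (fun f => setTerm (genTerm T
          T₁ (col hm 0) (gbar P m k hm p.1 p.2 F) (gbar P m k hm p'.1 p'.2 G) f)
          (fun i => leftSet (e' i))) (fun i => leftSet (e i)) = 0 := by
        intro p p' hp
        by_contra h1
        obtain ⟨f, f', hf, hf'⟩ := hne p p' _ _ h1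
        have c1 := Fintype.card_congr (f (col hm 0))
        have c2 := Fintype.card_congr (f' 0)
        have c3 := congrArg Finset.card (hf (col hm 0))
        have c4 := congrArg Finset.card (hf' 0)
        simp only [Fintype.card_sum, Fintype.card_fin, card_leftSet] at c1 c2 c3 c4
        exact hp (Prod.ext (Prod.ext c3 c4) (Prod.ext (by dsimp only; omega) (by dsimp only; omega)))
      dsimp only [V]
      rw [sum_eq_single (L₁, K₁), sum_eq_single (L₂, K₂)]
      · obtain ⟨t, ht⟩ := gbar_mem hm hP hkm hF (P.q1⁻¹ * P.q3 ^ (-(m : ℤ) + (k + 1 : ℕ) - 1)) L₁ K₁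
        obtain ⟨t', ht'⟩ := gbar_mem hm hP hkm hG (P.q1⁻¹ * P.q3 ^ (-(m : ℤ) + (k + 1 : ℕ) - 1)) L₂ K₂
        have o := sh_odd_even (m := m) (k := k) 𝔓 (by omega)
        dsimp only
        rw [← ht, ← ht']
        have h1 : ∀ f, setTerm (genTerm T T₁ (col hm 0) _ _ f) (fun i => leftSet (e' i)) = _ :=
          fun f : Fin (m + k) → (Fin L₁ ⊕ Fin L₂ ≃ Fin L) =>
          setTerm_leftSet (fun f₁ f₂ hf => genTerm_congr (col hm 0) o Even.zero t t'
            (fun _ => rfl) hf) e'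
        simp only [h1]
        exact setTerm_leftSet (fun f₁ f₂ hf => genTerm_congr (col hm 0) o Even.zero t t'
            hf (fun _ => rfl)) e
      · exact fun p' _ hp' => hz _ _ fun h1 => hp' (Prod.mk.inj h1).2
      · exact fun h1 => (h1 (Finset.HasAntidiagonal.mem_antidiagonal.2 rfl)).elim
      · exact fun p _ hp => sum_eq_zero fun p' _ => hz _ _ fun h1 => hp (Prod.mk.inj h1).1
      · exact fun h1 => (h1 (Finset.HasAntidiagonal.mem_antidiagonal.2 rfl)).elim
    · have h1 : V A B = 0 := by
        refine sum_eq_zero fun p hp => sum_eq_zero fun p' hp' => ?_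
        by_contra h1
        obtain ⟨e, e', he, he'⟩ := hne p p' _ _ h1
        exact hex ⟨p, p', e, e', Finset.HasAntidiagonal.mem_antidiagonal.1 hp,
          Finset.HasAntidiagonal.mem_antidiagonal.1 hp', he, he'⟩
      dsimp only
      rw [h1, zero_mul]
      by_contra h2
      obtain ⟨E, hE, -⟩ := setTerm_eq_of (Ne.symm h2)
      have hc : ∀ i, (A (col hm i)).card + (B 0).card = M := fun i => by
        have := congrArg Finset.card (hE ⟨i % (m + k), (Nat.mod_lt _ (by omega)).trans (by omega)⟩)
        rw [card_leftSet, comb, card_disjSum] at this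
        rw [this]
        congr 3
        exact Fin.ext (Nat.mod_mod _ _).symm
      have hA : ∀ j, (A j).card = (A (col hm 0)).card := fun j => by
        have h3 := hc j
        have h4 := hc 0
        rw [← eq_col] at h3
        omega
      have c1 : (A (col hm 0)).card ≤ L := by simpa using card_le_univ (A (col hm 0))
      have c2 : (B 0).card ≤ K := by simpa using card_le_univ (B 0)
      have c3 := hc 0
      choose e he using fun j => exists_leftSet_eq (hA j)
        (N := L - (A (col hm 0)).card) (by rw [card_compl, Fintype.card_fin, hA])
      have hB : ∀ j, (B j).card = (B 0).card := fun j => by rw [Subsingleton.elim j 0]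
      choose e' he' using fun j => exists_leftSet_eq (hB j)
        (N := K - (B 0).card) (by rw [card_compl, Fintype.card_fin, hB])
      exact hex ⟨(_, _), (_, _), e, e', c3, by dsimp only; omega, he, he'⟩
  rw [hR, sum_mul]
  symm
  refine Fintype.sum_of_injective (comb hm) (comb_injective hm) _ _ (fun S hS => ?_) key
  by_contra hne
  obtain ⟨E, hE, hE'⟩ := setTerm_eq_of hne
  rw [hE'] at hne
  obtain ⟨p, hp⟩ := exists_comb hm hP hkm (right_ne_zero_of_mul (right_ne_zero_of_smul hne))
  exact hS ⟨p, hp.trans (funext hE)⟩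

end Product

/-! ## Homomorphisms of graded algebras -/

section Graded

variable {V W X : Type} [AddCommGroup V] [Module ℂ V] [AddCommGroup W] [Module ℂ W]
    [AddCommGroup X] [Module ℂ X]

theorem mem_carrier_of_deg {A : GradedAlg V} {N : ℕ} {x : V} (hx : x ∈ A.deg N) : x ∈ A.carrier :=
  Submodule.mem_iSup_of_mem N hx

theorem mul_of_homogeneous {A : GradedAlg V} {B : GradedAlg W} {φ : A.carrier →ₗ[ℂ] W}
    (h : ∀ (M N : ℕ) (F G : V) (hF : F ∈ A.deg M) (hG : G ∈ A.deg N),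
    ∃ h : A.mul F G ∈ A.carrier, φ ⟨A.mul F G, h⟩ =
    B.mul (φ ⟨F, mem_carrier_of_deg hF⟩) (φ ⟨G, mem_carrier_of_deg hG⟩)) (F G : A.carrier) :
    ∃ h : A.mul F G ∈ A.carrier, φ ⟨A.mul F G, h⟩ = B.mul (φ F) (φ G) := by
  obtain ⟨Ψ, hΨ⟩ := LinearMap.exists_extend φ
  have hΨ' : ∀ x (hx : x ∈ A.carrier), φ ⟨x, hx⟩ = Ψ x :=
    fun x hx => (LinearMap.congr_fun hΨ ⟨x, hx⟩).symm
  obtain ⟨F, hF⟩ := F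
  obtain ⟨G, hG⟩ := G
  suffices h' : A.mul F G ∈ A.carrier ∧ Ψ (A.mul F G) = B.mul (Ψ F) (Ψ G) from
    ⟨h'.1, by grind⟩
  unfold GradedAlg.carrier at hF hG
  induction hF using Submodule.iSup_induction' with
  | zero => simp only [map_zero, LinearMap.zero_apply, zero_mem, and_self]
  | add x y hx hy ihx ihy =>
    simp only [map_add, LinearMap.add_apply, ihx.2, ihy.2, add_mem ihx.1 ihy.1, and_self]
  | mem M F hF =>
    induction hG using Submodule.iSup_induction' with
    | zero => simp only [map_zero, zero_mem, and_self]
    | add x y hx hy ihx ihy => simp only [map_add, ihx.2, ihy.2, add_mem ihx.1 ihy.1, and_self]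
    | mem N G hG =>
      obtain ⟨h1, h2⟩ := h M N F G hF hG
      grind

theorem mapIncl_injective (p : Submodule ℂ V) (q : Submodule ℂ W) : Injective (mapIncl p q) :=
  TensorProduct.map_injective_of_flat_flat _ _ (Submodule.subtype_injective _)
    (Submodule.subtype_injective _)

/-- Composition of a homomorphism to a tensor product with `φ ⊗ id`. -/
theorem IsGradedHom.comp_map {V' : Type} [AddCommGroup V'] [Module ℂ V'] {A : GradedAlg V'}
    {B : GradedAlg V} {C : GradedAlg W} {D : GradedAlg X}
    {π : A.carrier →ₗ[ℂ] B.carrier ⊗[ℂ] C.carrier} {φ : B.carrier →ₗ[ℂ] X}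
    (hπ : IsGradedHom A (B.tensor C) (mapIncl B.carrier C.carrier ∘ₗ π)) (hφ : IsGradedHom B D φ) :
    IsGradedHom A (D.tensor C) (TensorProduct.map φ C.carrier.subtype ∘ₗ π) := by
  obtain ⟨Ψ, hΨ⟩ := LinearMap.exists_extend φ
  have hΨ' : ∀ x : B.carrier, Ψ x = φ x := fun x => LinearMap.congr_fun hΨ x
  have e : ∀ u : B.carrier ⊗[ℂ] C.carrier, TensorProduct.map φ C.carrier.subtype u =
      TensorProduct.map Ψ LinearMap.id (mapIncl B.carrier C.carrier u) := by
    intro u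
    rw [mapIncl, ← LinearMap.comp_apply, ← TensorProduct.map_comp, hΨ,
      LinearMap.id_comp]
  obtain ⟨h1, ⟨h2, h3⟩, h4⟩ := hπ
  obtain ⟨g1, ⟨g2, g3⟩, g4⟩ := hφ
  refine ⟨fun N F hF => ?_, ⟨h2, ?_⟩, fun F G => ?_⟩
  · rw [LinearMap.comp_apply, e]
    have h5 := h1 N F hF
    have h6 : (B.tensor C).deg N ≤ ((D.tensor C).deg N).comap (TensorProduct.map Ψ LinearMap.id) := by
      refine iSup₂_le fun p hp => LinearMap.range_le_iff_comap.2 (eq_top_iff.2 fun t _ => ?_)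
      rw [Submodule.mem_comap, Submodule.mem_comap]
      refine Submodule.mem_iSup_of_mem p (Submodule.mem_iSup_of_mem hp ?_)
      induction t with
      | zero => simp only [map_zero, zero_mem]
      | add x y hx hy => simp only [map_add]; exact add_mem (hx trivial) (hy trivial)
      | tmul x y =>
        exact ⟨⟨Ψ x, by
          rw [hΨ' ⟨x, mem_carrier_of_deg x.2⟩]
          grind⟩ ⊗ₜ y, rfl⟩
    exact h6 h5
  · rw [LinearMap.comp_apply, e]
    rw [LinearMap.comp_apply] at h3
    rw [h3]
    change Ψ B.one ⊗ₜ[ℂ] C.one = D.one ⊗ₜ C.one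
    grind
  · obtain ⟨h5, h6⟩ := h4 F G
    refine ⟨h5, ?_⟩
    simp only [LinearMap.comp_apply] at h6 ⊢
    rw [e, e, e, h6]
    generalize π F = u
    generalize π G = v
    induction u with
    | zero => simp only [map_zero, LinearMap.zero_apply]
    | add x y hx hy => simp only [map_add, LinearMap.add_apply, hx, hy]
    | tmul b c =>
      induction v with
      | zero => simp only [map_zero]
      | add x y hx hy => simp only [map_add, hx, hy]
      | tmul b' c' =>
        obtain ⟨g5, g6⟩ := g4 b b'
        change Ψ (B.mul b b') ⊗ₜ[ℂ] C.mul c c' = D.mul (Ψ b) (Ψ b') ⊗ₜ[ℂ] C.mul c c'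
        rw [hΨ' ⟨_, g5⟩, g6, hΨ', hΨ']

end Graded

section Components

variable {c : ℕ} (T : ShuffleType c) (T₁ : ShuffleType 1)

theorem ShuffleType.mem_carrier {x : Space c} (hx : x ∈ T.alg.carrier) (N : ℕ) : x N ∈ T.comp N := by
  unfold GradedAlg.carrier at hx
  induction hx using Submodule.iSup_induction' with
  | zero => exact zero_mem _
  | add x y _ _ hx hy => exact add_mem hx hy
  | mem M x hx =>
    obtain ⟨F, hF, rfl⟩ := hx
    by_cases h : M = N
    · subst h
      have : (single c M F) M = F := DirectSum.lof_apply ..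
      rwa [this]
    · have : (single c M F) N = 0 := DFinsupp.single_eq_of_ne fun h2 => h h2.symm
      rw [this]
      exact zero_mem _

theorem ShuffleType.single_mem_carrier {N : ℕ} {F : Rat c N} (hF : F ∈ T.comp N) :
    single c N F ∈ T.alg.carrier := mem_carrier_of_deg ⟨F, hF, rfl⟩

theorem ShuffleType.one_mem (h : ∀ x, ¬ T.wheel 0 x) (hp : T.pole 0 = 1) :
    (1 : Rat c 0) ∈ T.comp 0 := by
  refine ⟨⟨0, 1, by rw [hp]; simp, fun x _ hx => absurd hx (h x)⟩, fun s => ?_⟩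
  have : ∀ i, s i = 1 := fun i => Subsingleton.elim _ _
  simp [this]

/-- The embedding of a homogeneous component into the tensor product of the algebras. -/
def toCarrier (L K : ℕ) : T.comp L ⊗[ℂ] T₁.comp K →ₗ[ℂ] T.alg.carrier ⊗[ℂ] T₁.alg.carrier :=
  TensorProduct.map ((single c L ∘ₗ (T.comp L).subtype).codRestrict _
      fun F => T.single_mem_carrier F.2)
    ((single 1 K ∘ₗ (T₁.comp K).subtype).codRestrict _ fun F => T₁.single_mem_carrier F.2)

theorem mapIncl_toCarrier (L K : ℕ) (t : T.comp L ⊗[ℂ] T₁.comp K) :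
    mapIncl _ _ (toCarrier T T₁ L K t) = inclComp T T₁ L K t := by
  unfold mapIncl toCarrier inclComp
  rw [← LinearMap.comp_apply, ← TensorProduct.map_comp]
  rfl

theorem inclComp_mem (L K : ℕ) (t : T.comp L ⊗[ℂ] T₁.comp K) :
    inclComp T T₁ L K t ∈ LinearMap.range (mapIncl (T.alg.deg L) (T₁.alg.deg K)) := by
  induction t with
  | zero => rw [map_zero]; exact zero_mem _
  | add x y hx hy => rw [map_add]; exact add_mem hx hy
  | tmul a b => exact ⟨⟨single c L a, a, a.2, rfl⟩ ⊗ₜ ⟨single 1 K b, b, b.2, rfl⟩, rfl⟩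

/-- A linear map to a tensor product of shuffle algebras, given by its components. -/
theorem exists_map_of_components {V : Type} [AddCommGroup V] [Module ℂ V] {A : GradedAlg V}
    (Γ : ∀ L K : ℕ, A.carrier →ₗ[ℂ] RatField ((Fin c × Fin L) ⊕ (Fin 1 × Fin K)))
    (h : ∀ N x (hx : x ∈ A.deg N), ∃ u : T.alg.carrier ⊗[ℂ] T₁.alg.carrier, ∀ L K,
    toFun c L K (mapIncl _ _ u) = Γ L K ⟨x, mem_carrier_of_deg hx⟩) :
    ∃ π : A.carrier →ₗ[ℂ] T.alg.carrier ⊗[ℂ] T₁.alg.carrier, ∀ L K x,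
    toFun c L K (mapIncl _ _ (π x)) = Γ L K x := by
  choose Ψ hΨ using fun L K => LinearMap.exists_extend (Γ L K)
  have hΨ' : ∀ L K x, Γ L K x = Ψ L K x := fun L K x => (LinearMap.congr_fun (hΨ L K) x).symm
  have h' : ∀ x : A.carrier, ∃ u : T.alg.carrier ⊗[ℂ] T₁.alg.carrier, ∀ L K,
      toFun c L K (mapIncl _ _ u) = Ψ L K x := fun x => by
    refine Submodule.iSup_induction A.deg (motive := fun x => ∃ u : T.alg.carrier ⊗[ℂ]
      T₁.alg.carrier, ∀ L K, toFun c L K (mapIncl _ _ u) = Ψ L K x) x.2 ?_ ?_ ?_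
    · intro N x hx
      obtain ⟨u, hu⟩ := h N x hx
      exact ⟨u, fun L K => (hu L K).trans (hΨ' L K _)⟩
    · exact ⟨0, fun L K => by rw [map_zero, map_zero, map_zero]⟩
    · rintro x y ⟨u, hu⟩ ⟨v, hv⟩
      exact ⟨u + v, fun L K => by rw [map_add, map_add, map_add, hu, hv]⟩
  choose u hu using h'
  have inj := mapIncl_injective T.alg.carrier T₁.alg.carrier
  refine ⟨⟨⟨u, fun x y => inj (eq_of_toFun c fun L K => ?_)⟩, fun r x =>
    inj (eq_of_toFun c fun L K => ?_)⟩, fun L K x => (hu x L K).trans (hΨ' L K x).symm⟩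
  · rw [map_add, map_add, hu, hu, hu, ← map_add]
    rfl
  · rw [map_smul, map_smul, hu]
    exact (map_smul (Ψ L K) r (x : V)).trans (congrArg _ (hu x L K).symm)

end Components

/-! ## The fusion map -/

section Fusion

variable {P : Params} {m k : ℕ}

theorem sh_natural (P' : Params) (hm2 : 2 ≤ m) : (shType P' m k).Natural := by
  cases k with
  | zero =>
    have h1 : shType P' m 0 = evenType' P' (m + 0) := evenType_eq _ (by omega)
    rw [h1]
    intro K K' _ _ _ _ θ i j x y
    simp only [evenType']
    split_ifs <;> simp
  | succ k => exact super_natural P' m (k + 1)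

theorem one_natural (p₁ p₂ p₃ : ℂ) : (oneType p₁ p₂ p₃).Natural := by
  intro K K' _ _ _ _ θ i j x y
  simp [oneType]

theorem gbar_one (hm : 0 < m) : gbar P m k hm 0 0 (1 : Rat (m + (k + 1)) 0) = 1 := by
  have h : gbar P m k hm 0 0 (1 : Rat (m + (k + 1)) 0) = fbar P m k hm 0 0 1 := gbar_eq hm (L := 0) 1
  rw [h, fbar, ratSubst_one]
  simp [facs, factorA, factorB, factorC]

/-- The fusion map. -/
theorem exists_fusion (hm : 0 < m) (hP : P.Valid) (hkm : k + 2 ≤ m) :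
    ∃ π : (Sh0 P m (k + 1)).carrier →ₗ[ℂ] FusionTarget P m (k + 1), IsFusionMap P m (k + 1) hm π ∧
    IsGradedHom (Sh0 P m (k + 1)) (fusionTarget P m (k + 1)) (fusionIncl P m (k + 1) ∘ₗ π) := by
  let S := 𝕊
  let T := 𝕋
  let T₁ := 𝕆
  let Γ : ∀ L K : ℕ, S.alg.carrier →ₗ[ℂ] RatField ((Fin (m + k) × Fin L) ⊕ (Fin 1 × Fin K)) :=
    fun L K =>
    { toFun := fun x => fbar P m k hm L K (x.1 (L + K))
      map_add' := fun x y => by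
        unfold fbar
        rw [← add_div, ← ratSubst_add (spec_regSub hm hP hkm (S.mem_carrier x.2 _))
          (spec_regSub hm hP hkm (S.mem_carrier y.2 _))]
        rfl
      map_smul' := fun r x => by
        unfold fbar
        rw [RingHom.id_apply, ← smul_div_assoc,
          ← ratSubst_smul (spec_regSub hm hP hkm (S.mem_carrier x.2 _))]
        rfl }
  have hΓ : ∀ (L K N : ℕ) (F : Rat (m + (k + 1)) N) (hF : single _ N F ∈ S.alg.carrier),
      Γ L K ⟨single _ N F, hF⟩ = gbar P m k hm L K F := by
    intro L K N F hF
    change fbar P m k hm L K ((single (m + (k + 1)) N F) (L + K)) = _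
    by_cases h : L + K = N
    · subst h
      rw [gbar_eq]
      exact congrArg _ (DirectSum.lof_apply ..)
    · have h1 : (single (m + (k + 1)) N F) (L + K) = 0 := DFinsupp.single_eq_of_ne h
      rw [gbar_of_ne hm h, h1, fbar, ratSubst_zero, zero_div]
  have hdec : ∀ (N : ℕ) (F : Rat (m + (k + 1)) N), F ∈ S.comp N →
      ∃ t : ∀ p : ℕ × ℕ, T.comp p.1 ⊗[ℂ] T₁.comp p.2,
        (∀ p, TensorProduct.lift ratMul (mapIncl _ _ (t p)) = gbar P m k hm p.1 p.2 F) ∧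
        ∀ L K, toFun (m + k) L K (∑ p ∈ Finset.HasAntidiagonal.antidiagonal N,
          inclComp T T₁ p.1 p.2 (t p)) = gbar P m k hm L K F := by
    intro N F hF
    choose t ht using fun p : ℕ × ℕ => gbar_mem hm hP hkm hF
      (P.q1⁻¹ * P.q3 ^ (-(m : ℤ) + (k + 1 : ℕ) - 1)) p.1 p.2
    refine ⟨t, ht, fun L K => ?_⟩
    rw [map_sum]
    by_cases h : L + K = N
    · rw [sum_eq_single (L, K)]
      · rw [← ht (L, K)]
        exact toFun_inclComp _
      · exact fun p _ hp => toFun_inclComp_of_ne _ fun h1 => hp (Prod.ext h1.1 h1.2)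
      · exact fun h1 => (h1 (Finset.HasAntidiagonal.mem_antidiagonal.2 h)).elim
    · rw [gbar_of_ne hm h]
      refine sum_eq_zero fun p hp => toFun_inclComp_of_ne _ fun h1 => h ?_
      rw [← h1.1, ← h1.2]
      exact Finset.HasAntidiagonal.mem_antidiagonal.1 hp
  obtain ⟨π, hπ⟩ := exists_map_of_components (A := S.alg) T T₁ Γ (by
    rintro N _ ⟨F, hF, rfl⟩
    obtain ⟨t, -, ht⟩ := hdec N F hF
    refine ⟨∑ p ∈ Finset.HasAntidiagonal.antidiagonal N, toCarrier T T₁ p.1 p.2 (t p), fun L K => ?_⟩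
    rw [map_sum]
    simp only [mapIncl_toCarrier]
    rw [ht, hΓ])
  have hval : ∀ (N : ℕ) (F : Rat (m + (k + 1)) N) (hF : single _ N F ∈ S.alg.carrier) (L K : ℕ),
      toFun (m + k) L K (mapIncl _ _ (π ⟨single _ N F, hF⟩)) =
        gbar P m k hm L K F := fun N F hF L K => by rw [hπ, hΓ]
  have hsum : ∀ (N : ℕ) (F : Rat (m + (k + 1)) N) (hF : F ∈ S.comp N),
      ∃ t : ∀ p : ℕ × ℕ, T.comp p.1 ⊗[ℂ] T₁.comp p.2,
        (∀ p, TensorProduct.lift ratMul (mapIncl _ _ (t p)) = gbar P m k hm p.1 p.2 F) ∧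
        mapIncl _ _ (π ⟨single _ N F, S.single_mem_carrier hF⟩) =
          ∑ p ∈ Finset.HasAntidiagonal.antidiagonal N, inclComp T T₁ p.1 p.2 (t p) := by
    intro N F hF
    obtain ⟨t, ht, ht'⟩ := hdec N F hF
    exact ⟨t, ht, eq_of_toFun _ fun L K => (hval _ _ _ L K).trans (ht' L K).symm⟩
  refine ⟨π, ⟨fun L K F hF => ?_, fun N F hF L K h => ?_⟩, fun N F hF => ?_, ⟨?_, ?_⟩,
    mul_of_homogeneous (A := Sh0 P m (k + 1)) (B := fusionTarget P m (k + 1))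
      (φ := fusionIncl P m (k + 1) ∘ₗ π) ?_⟩
  · refine (rho_eq hm F).trans (Eq.trans ?_ (congrArg (· * facs P m (k + 1) (yv hm K) (zw m k L))
      (hval (L + K) F hF L K).symm))
    rw [gbar_eq]
    exact (div_mul_cancel₀ _ (facs_ne hm hP hkm)).symm
  · exact (hval N F hF L K).trans (gbar_of_ne hm h F)
  · obtain ⟨F, hF'⟩ := F
    obtain ⟨F, hF1, rfl⟩ := hF
    obtain ⟨t, -, ht⟩ := hsum N F hF1
    change mapIncl _ _ (π ⟨single _ N F, S.single_mem_carrier hF1⟩) ∈ _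
    rw [ht]
    exact sum_mem fun p hp => Submodule.mem_iSup_of_mem p
      (Submodule.mem_iSup_of_mem hp (inclComp_mem T T₁ p.1 p.2 (t p)))
  · refine S.single_mem_carrier (S.one_mem ?_ ?_)
    · rintro x ⟨i, h | h | h | h | h | h⟩
      · exact h.2.2.elim fun a _ => a.elim0
      · exact h.2.2.elim fun a _ => a.elim0
      · exact h.2.elim fun a _ => a.elim0
      · exact h.2.elim fun a _ => a.elim0
      · exact h.2.elim fun a _ => a.elim0
      · exact h.2.elim fun a _ => a.elim0
    · change cyclicPole (m + (k + 1)) 0 = 1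
      simp [cyclicPole]
  · refine eq_of_toFun _ fun L K => ?_
    refine (hval 0 1 _ L K).trans ?_
    change _ = toFun (m + k) L K (single (m + k) 0 1 ⊗ₜ[ℂ] single 1 0 1)
    by_cases h : 0 = L ∧ 0 = K
    · obtain ⟨rfl, rfl⟩ := h
      rw [toFun_single, gbar_one, ratMul_apply, map_one, map_one, one_mul]
    · rw [toFun_single_of_ne _ _ h, gbar_of_ne hm (by omega)]
  · rintro M N _ _ ⟨F, hF, rfl⟩ ⟨G, hG, rfl⟩
    have hs : S.star M N F G ∈ S.comp (M + N) :=
      super_star_mem (by omega) (by omega) hP.q_ne hP.d_ne hP.q2_ne_one hF hG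
    have hmul : (Sh0 P m (k + 1)).mul (single _ M F) (single _ N G) =
      single _ (M + N) (S.star M N F G) := S.alg_mul_single F G
    refine ⟨by rw [hmul]; exact S.single_mem_carrier hs, ?_⟩
    simp only [hmul]
    obtain ⟨t, ht, h1⟩ := hsum M F hF
    obtain ⟨t', ht', h2⟩ := hsum N G hG
    refine eq_of_toFun _ fun L K => (hval _ _ (S.single_mem_carrier hs) L K).trans ?_
    change _ = toFun (m + k) L K ((T.alg.tensor T₁.alg).mul
      (mapIncl _ _ (π ⟨single _ M F, S.single_mem_carrier hF⟩))
      (mapIncl _ _ (π ⟨single _ N G, S.single_mem_carrier hG⟩)))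
    rw [h1, h2, gbar_star hm hP hkm hF hG]
    simp only [map_sum, LinearMap.sum_apply]
    rw [sum_comm]
    refine sum_congr rfl fun p _ => sum_congr rfl fun p' _ => ?_
    rw [toFun_mul_inclComp (col hm 0) (sh_odd_even _ (by omega)) Even.zero (sh_natural _ (by omega))
      (one_natural _ _ _), ht, ht']

end Fusion

section Iteration

variable {P : Params} {m k : ℕ}

theorem Params.Valid.bar (hP : P.Valid) (hkm : k + 2 ≤ m) : (𝔓).Valid := by
  have h0 : ∀ r, P.q1pow r ≠ 0 := fun r => Complex.exp_ne_zero _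
  refine ⟨hP.q_ne, mul_ne_zero hP.d_ne (h0 _), ?_, fun n₁ n₂ n₃ h => ?_⟩
  · rw [Params.bar_q1]
    change Complex.exp (P.logq1 + _) = _
    rw [Complex.exp_add, hP.exp_logq1]
    rfl
  · rw [Params.bar_q1, Params.bar_q2, Params.bar_q3] at h
    have h1 := congrArg (· ^ ((m : ℤ) - k)) h
    have hs := sfq_zpow hP (show k < m by omega)
    have hs0 : 𝔮 ≠ 0 := h0 _
    have e1 : 𝔮 ^ (n₁ * ((m : ℤ) - k)) = P.q1 ^ (-n₁) := by rw [mul_comm, zpow_mul, hs, inv_zpow']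
    have e3 : 𝔮⁻¹ ^ (n₃ * ((m : ℤ) - k)) = P.q1 ^ n₃ := by
      rw [mul_comm, zpow_mul, inv_zpow, hs, inv_inv]
    simp only [mul_zpow, one_zpow, ← zpow_mul, e1, e3] at h1
    have h2 := hP.generic (n₁ * (m - k) - n₁ + n₃) (n₂ * (m - k)) (n₃ * (m - k)) (by
      rw [← h1, zpow_add₀ hP.n1, sub_eq_add_neg, zpow_add₀ hP.n1]
      ring)
    have hr : (m : ℤ) - k ≠ 0 := by omega
    have hr' : (m : ℤ) - k - 1 ≠ 0 := by omega
    have h3 : n₂ = n₃ := mul_right_cancel₀ hr h2.2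
    refine ⟨?_, h3⟩
    refine mul_right_cancel₀ hr' ?_
    rw [h3] at h2 ⊢
    linear_combination h2.1

theorem Params.bar_shift (hkm : k + 2 ≤ m) :
    (𝔓).shift (-(k : ℂ) / m) = P.shift (-((k + 1 : ℕ) : ℂ) / m) := by
  have hm : (m : ℂ) ≠ 0 := by exact_mod_cast (show m ≠ 0 by omega)
  have hr : (m : ℂ) - k ≠ 0 := sub_ne_zero.2 (by exact_mod_cast (show m ≠ k by omega))
  have hr' : (m : ℂ) - (k + 1 : ℕ) + 1 ≠ 0 := by
    push_cast
    rwa [show (m : ℂ) - (k + 1) + 1 = m - k by ring]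
  have e : -1 / ((m : ℂ) - (k + 1 : ℕ) + 1) + -(k : ℂ) / m * (1 + -1 / ((m : ℂ) - (k + 1 : ℕ) + 1)) =
      -((k + 1 : ℕ) : ℂ) / m := by
    field_simp
    push_cast
    ring
  unfold Params.bar Params.shift Params.q1pow
  dsimp only
  rw [← e, mul_assoc, ← Complex.exp_add]
  congr 1
  · ring_nf
  · ring

theorem fullTarget_succ (hP : P.Valid) (hkm : k + 2 ≤ m) :
    fullTarget P m (k + 1) = (fullTarget 𝔓 m k).tensor (fusionSh1 P m (k + 1)) := by
  have n2 := hP.n2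
  have n3 := hP.n3
  have hb : (𝔓).q3 ^ ((m : ℤ) - k) = P.q2⁻¹ * P.q3 ^ ((m : ℤ) - (k + 1 : ℕ)) := by
    have e : (m : ℤ) - k = ((m : ℤ) - (k + 1 : ℕ)) + 1 := by push_cast; ring
    rw [Params.bar_q3, mul_zpow, inv_zpow, sfq_zpow hP (by omega), inv_inv, hP.q1_eq, e,
      zpow_add₀ n3, zpow_one]
    field_simp
  have hneg : ∀ a b : ℤ, -a + b = -(a - b) := fun a b => by ring
  have h0 : Sh1 (P.q2 ^ (0 + 1) * P.q3 ^ (-(m : ℤ) + (k + 1 : ℕ))) P.q2⁻¹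
      (P.q2 ^ (-((0 : ℕ) : ℤ)) * P.q3 ^ ((m : ℤ) - (k + 1 : ℕ))) = fusionSh1 P m (k + 1) := by
    unfold fusionSh1
    congr 1
    · rw [hP.q1_eq, zpow_sub₀ n3, zpow_one]
      field_simp
      ring
    · simp
  have h1 : (fun j : ℕ => (P.q2 ^ (j + 1 + 1) * P.q3 ^ (-(m : ℤ) + (k + 1 : ℕ)), P.q2⁻¹,
      P.q2 ^ (-((j + 1 : ℕ) : ℤ)) * P.q3 ^ ((m : ℤ) - (k + 1 : ℕ)))) =
      fun j : ℕ => ((𝔓).q2 ^ (j + 1) * (𝔓).q3 ^ (-(m : ℤ) + k),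
        (𝔓).q2⁻¹, (𝔓).q2 ^ (-(j : ℤ)) *
          (𝔓).q3 ^ ((m : ℤ) - k)) := by
    funext j
    refine Prod.ext ?_ (Prod.ext rfl ?_)
    · dsimp only
      rw [hneg, hneg, zpow_neg, zpow_neg, hb, Params.bar_q2, mul_inv, inv_inv, pow_succ, mul_assoc]
    · dsimp only
      rw [hb, Params.bar_q2, Nat.cast_succ, neg_add, zpow_add₀ n2, zpow_neg_one, mul_assoc]
  change (iterTarget _ k _).tensor (Sh1 _ _ _) = (iterTarget _ k _).tensor _
  rw [Params.bar_shift hkm, ← h1, ← h0]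

theorem exists_iterated_fusion (hm : 0 < m) (hP : P.Valid) (hkm : k + 2 ≤ m) :
    ∃ Φ : (Sh0 P m (k + 1)).carrier →ₗ[ℂ] iterSpace m (k + 1), IsIteratedFusion m hm (k + 1) P Φ ∧
    IsGradedHom (Sh0 P m (k + 1)) (fullTarget P m (k + 1)) Φ := by
  induction k generalizing P with
  | zero =>
    obtain ⟨π, hπ, hg⟩ := exists_fusion hm hP hkm
    refine ⟨_, ⟨π, _, hπ, rfl, rfl⟩, ?_⟩
    rw [fullTarget_succ hP hkm]
    have h : fullTarget (P.bar m (0 + 1)) m 0 = Sh0 (P.bar m (0 + 1)) m 0 := by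
      have h1 : (P.bar m (0 + 1)).shift (-((0 : ℕ) : ℂ) / m) = P.bar m (0 + 1) := by
        simp [Params.shift, Params.q1pow]
      unfold fullTarget
      rw [h1]
      rfl
    rw [h]
    exact hg
  | succ k ih =>
    obtain ⟨π, hπ, hg⟩ := exists_fusion hm hP hkm
    obtain ⟨Φ, hΦ, hg'⟩ := ih (hP.bar hkm) (by omega)
    refine ⟨_, ⟨π, Φ, hπ, hΦ, rfl⟩, ?_⟩
    rw [fullTarget_succ hP hkm]
    exact hg.comp_map hg'

end Iteration

end Shuffle

end

theorem mainTheorem3 (m n : ℕ) (hn : 1 ≤ n) (hmn : n + 1 ≤ m)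
    (P : Shuffle.Params) (hP : P.Valid) :
    (∃ π : (Shuffle.Sh0 P m n).carrier →ₗ[ℂ] Shuffle.FusionTarget P m n,
      Shuffle.IsFusionMap P m n (Nat.zero_lt_of_lt hmn) π ∧
      Shuffle.IsGradedHom (Shuffle.Sh0 P m n) (Shuffle.fusionTarget P m n)
        (Shuffle.fusionIncl P m n ∘ₗ π)) ∧
    (∃ Φ : (Shuffle.Sh0 P m n).carrier →ₗ[ℂ] Shuffle.iterSpace m n,
      Shuffle.IsIteratedFusion m (Nat.zero_lt_of_lt hmn) n P Φ ∧
      Shuffle.IsGradedHom (Shuffle.Sh0 P m n) (Shuffle.fullTarget P m n) Φ) := by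
  obtain ⟨k, rfl⟩ : ∃ k, n = k + 1 := ⟨n - 1, by omega⟩
  exact ⟨Shuffle.exists_fusion _ hP (by omega), Shuffle.exists_iterated_fusion _ hP (by omega)⟩
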